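/- For a subgroup $G\le S_n$ let $P(G)\subset\mathrm{Mat}_n(\mathbb R)$ be the convex hull of the permutation matrices of the elements of $G$ (the permutation polytope of $G$); $B_n:=P(S_n)$ is the $n$-th Birkhoff polytope. A face of a polytope is a subset on which some linear functional is maximized (the empty set is also counted), and two polytopes have the same combinatorial type if their face lattices are isomorphic as posets. The combinatorial types of $d$-dimensional faces of permutation polytopes, $2\le d\le 4$, are described as follows. **$d=2$.** Every two-dimensional face of a permutation polytope has exactly one of the following $2$ combinatorial types: triangle, square. Both occur as faces of Birkhoff polytopes. **$d=3$.** Every three-dimensional face of a permutation polytope has exactly one of the following $5$ combinatorial types: tetrahedron, square pyramid, triangular prism, cube, octahedron. All five occur as faces of permutation polytopes; exactly the first four occur as faces of Birkhoff polytopes. **$d=4$.** Every four-dimensional face of a permutation polytope has exactly one of the following $21$ combinatorial types, which are pairwise different and are all types of four-dimensional $0/1$-polytopes: (a) the following $11$ types, which are exactly the types of four-dimensional faces of Birkhoff polytopes: $4$-simplex; pyramid over the square pyramid; Birkhoff polytope $B_3$ (which is combinatorially the free sum of two triangles); pyramid over the triangular prism; wedge $W$ over a base edge of the square pyramid; pyramid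 over the cube; prism over the tetrahedron; product of two triangles; prism over the square pyramid; product of triangle and square; $4$-cube; (b) the following $8$ types, each of which also occurs as a face of some permutation polytope: $4$-crosspolytope; prism over the octahedron; pyramid over the octahedron; bipyramid over the cube; wedge over a facet of the octahedron; the dual of $W$; the hypersimplex $\{x\in[0,1]^5:\sum_{i=1}^5 x_i=2\}$; and the special polytope $P$ below; (c) the $2$ types $Q_1$, $Q_2$ below (for these, no claim is made on whether they occur as faces of permutation polytopes). Here the wedge over a face $F'$ of a polytope $X$ is $\{(x,t): x\in X,\ 0\le t\le \ell(x)\}$, where $\ell$ is an affine function, nonnegative on $X$, whose zero set on $X$ is $F'$. The types of $P,Q_1,Q_2$ are given by their facets, each written as the list of the vertices it contains (the vertex sets of the faces are the intersections of these sets, together with the set of all vertices): $P$ (vertices $0,\dots,7$): $0256,\ 0246,\ 01234,\ 01235,\ 1347,\ 1357,\ 23467,\ 23567,\ 014567$. $Q_1$ (vertices $0,\dots,6$): $01234,\ 12345,\ 0125,\ 1356,\ 0136,\ 0156,\ 0256,\ 2456,\ 0246,\ 3456,\ 0346$. $Q_2$ (vertices $0,\dots,7$): $012345,\ 2456,\ 1356,\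 1256,\ 0126,\ 0137,\ 0167,\ 0267,\ 0247,\ 0347,\ 2467,\ 1367,\ 3567,\ 4567,\ 3457$. -/

import Mathlib

namespace PermutationPolytope

/-! ### Faces, dimension, combinatorial equivalence -/

section Polytopes

variable {E : Type*} [AddCommGroup E] [Module ℝ E]

/-- The dimension of (the affine hull of) a nonempty set. -/
noncomputable def dim (X : Set E) : ℕ := Module.finrank ℝ (vectorSpan ℝ X)

variable [TopologicalSpace E]

/-- The face lattice of `X`, ordered by inclusion. A face is a subset on which some linear
functional is maximized over `X`; as usual the empty set is also counted as a face. -/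
abbrev Faces (X : Set E) : Type _ := {F : Set E // IsExposed ℝ X F}

/-- Combinatorial equivalence: the face lattices are isomorphic as posets. -/
def CombEquiv {E' : Type*} [AddCommGroup E'] [Module ℝ E'] [TopologicalSpace E']
    (X : Set E) (Y : Set E') : Prop := Nonempty (Faces X ≃o Faces Y)

/-- `X` has the combinatorial type of the dual of `Y`: the face lattice of `X` is isomorphic to
the face lattice of `Y` with the order reversed. -/
def CombDual {E' : Type*} [AddCommGroup E'] [Module ℝ E'] [TopologicalSpace E']
    (X : Set E) (Y : Set E') : Prop := Nonempty (Faces X ≃o (Faces Y)ᵒᵈ)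

/-- A list `T` of subsets of `{0, …, n - 1}` (the vertex sets of the facets of a polytope with
vertices `0, …, n - 1`) determines the face lattice: the vertex sets of the faces are exactly the
intersections of members of `T` (the empty intersection being the whole polytope). -/
abbrev IncidenceLattice {n : ℕ} (T : Finset (Finset (Fin n))) : Type :=
  {S : Finset (Fin n) // ∃ U ⊆ T, S = U.inf id}

/-- `X` has the combinatorial type described by the vertex-facet incidences `T`. -/
def HasIncidences {n : ℕ} (X : Set E) (T : Finset (Finset (Fin n))) : Prop :=
  Nonempty (Faces X ≃o IncidenceLattice T)

end Polytopes

/-! ### Permutation polytopes -/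

/-- The permutation polytope `P(G)`: the convex hull of the permutation matrices of the elements
of the permutation group `G ≤ S_n`. -/
def permPolytope {n : ℕ} (G : Subgroup (Equiv.Perm (Fin n))) : Set (Matrix (Fin n) (Fin n) ℝ) :=
  convexHull ℝ ((fun σ : Equiv.Perm (Fin n) => σ.permMatrix ℝ) '' (G : Set (Equiv.Perm (Fin n))))

/-- The Birkhoff polytope `B_n = P(S_n)`. -/
def birkhoff (n : ℕ) : Set (Matrix (Fin n) (Fin n) ℝ) :=
  permPolytope (⊤ : Subgroup (Equiv.Perm (Fin n)))

/-! ### Standard polytopes and constructions -/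

/-- The `d`-simplex. -/
def simplex (d : ℕ) : Set (Fin (d + 1) → ℝ) := stdSimplex ℝ (Fin (d + 1))

/-- The `d`-cube `[0,1]^d`. -/
def cube (d : ℕ) : Set (Fin d → ℝ) := Set.Icc 0 1

/-- The `d`-crosspolytope, the convex hull of plus and minus the standard basis vectors. -/
def crossPolytope (d : ℕ) : Set (Fin d → ℝ) :=
  convexHull ℝ {x | ∃ i, x = Pi.single i 1 ∨ x = -Pi.single i 1}

/-- The hypersimplex `{x ∈ [0,1]^5 : x_1 + ⋯ + x_5 = 2}`. -/
def hypersimplex : Set (Fin 5 → ℝ) := {x | (∀ i, 0 ≤ x i ∧ x i ≤ 1) ∧ ∑ i, x i = 2}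

section Constructions

variable {E E' : Type*} [AddCommGroup E] [Module ℝ E] [AddCommGroup E'] [Module ℝ E']

/-- The prism over `X`. (The product of `X` and `Y` is the set `X ×ˢ Y`.) -/
def prism (X : Set E) : Set (E × ℝ) := X ×ˢ Set.Icc (0 : ℝ) 1

/-- The pyramid over `X`, with apex `(0, 1)`. -/
def pyramid (X : Set E) : Set (E × ℝ) := convexHull ℝ (X ×ˢ {(0 : ℝ)} ∪ {((0 : E), (1 : ℝ))})

/-- The free sum of `X` and `Y`; to be used for polytopes with the origin in their relative
interior. -/
def freeSum (X : Set E) (Y : Set E') : Set (E × E') :=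
  convexHull ℝ (X ×ˢ {(0 : E')} ∪ {(0 : E)} ×ˢ Y)

/-- The bipyramid over `X`, with apexes `(0, 1)` and `(0, -1)`; to be used for polytopes with the
origin in their relative interior. -/
def bipyramid (X : Set E) : Set (E × ℝ) :=
  convexHull ℝ (X ×ˢ {(0 : ℝ)} ∪ {((0 : E), (1 : ℝ)), ((0 : E), (-1 : ℝ))})

/-- The wedge over the face `{x ∈ X : l x = 0}` of `X`, where `l` is an affine function that is
nonnegative on `X`: the part of `X × [0, ∞)` below the graph of `l`. -/
def wedge (X : Set E) (l : E → ℝ) : Set (E × ℝ) := {p | p.1 ∈ X ∧ 0 ≤ p.2 ∧ p.2 ≤ l p.1}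

end Constructions

/-- A triangle with the origin in its interior. -/
def centeredTriangle : Set (Fin 2 → ℝ) := convexHull ℝ {![1, 0], ![0, 1], ![-1, -1]}

/-- The cube `[-1,1]^3`. -/
def centeredCube : Set (Fin 3 → ℝ) := Set.Icc (-1) 1

/-- The square pyramid. -/
def squarePyramid : Set ((Fin 2 → ℝ) × ℝ) := pyramid (cube 2)

/-- The wedge `W` over a base edge of the square pyramid. The base edge is the set of the points
`((x_0, x_1), z)` with `x_0 = 0` and `z = 0`, i.e. with `x_0 + z = 0`. -/
def wedgeW : Set (((Fin 2 → ℝ) × ℝ) × ℝ) := wedge squarePyramid fun p => p.1 0 + p.2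

/-- The wedge over a facet of the octahedron, the facet being given by `x_0 + x_1 + x_2 = 1`. -/
def wedgeOctahedron : Set ((Fin 3 → ℝ) × ℝ) := wedge (crossPolytope 3) fun x => 1 - ∑ i, x i

/-- The vertex-facet incidences of the special polytope `P`, with `f`-vector `(8,21,22,9)`. -/
def incidencesP : Finset (Finset (Fin 8)) :=
  {{0, 2, 5, 6}, {0, 2, 4, 6}, {0, 1, 2, 3, 4}, {0, 1, 2, 3, 5}, {1, 3, 4, 7}, {1, 3, 5, 7},
   {2, 3, 4, 6, 7}, {2, 3, 5, 6, 7}, {0, 1, 4, 5, 6, 7}}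

/-- The vertex-facet incidences of the special polytope `Q₁`, with `f`-vector `(7,19,23,11)`. -/
def incidencesQ1 : Finset (Finset (Fin 7)) :=
  {{0, 1, 2, 3, 4}, {1, 2, 3, 4, 5}, {0, 1, 2, 5}, {1, 3, 5, 6}, {0, 1, 3, 6}, {0, 1, 5, 6},
   {0, 2, 5, 6}, {2, 4, 5, 6}, {0, 2, 4, 6}, {3, 4, 5, 6}, {0, 3, 4, 6}}

/-- The vertex-facet incidences of the special polytope `Q₂`, with `f`-vector `(8,25,32,15)`. -/
def incidencesQ2 : Finset (Finset (Fin 8)) :=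
  {{0, 1, 2, 3, 4, 5}, {2, 4, 5, 6}, {1, 3, 5, 6}, {1, 2, 5, 6}, {0, 1, 2, 6}, {0, 1, 3, 7},
   {0, 1, 6, 7}, {0, 2, 6, 7}, {0, 2, 4, 7}, {0, 3, 4, 7}, {2, 4, 6, 7}, {1, 3, 6, 7},
   {3, 5, 6, 7}, {4, 5, 6, 7}, {3, 4, 5, 7}}

/-! ### The lists of combinatorial types -/

/-- The names of the types in dimension two. -/
inductive FaceType2 : Type
  | triangle
  | square

/-- The names of the types in dimension three. -/
inductive FaceType3 : Type
  | tetrahedron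
  | squarePyramid
  | triangularPrism
  | cube
  | octahedron

/-- The names of the candidate types in dimension four. -/
inductive FaceType4 : Type
  | simplex
  | pyramidSquarePyramid
  | birkhoff3
  | pyramidTriangularPrism
  | wedgeW
  | pyramidCube
  | prismTetrahedron
  | productTriangles
  | prismSquarePyramid
  | productTriangleSquare
  | cube
  | crossPolytope
  | prismOctahedron
  | pyramidOctahedron
  | bipyramidCube
  | wedgeOctahedron
  | dualW
  | hypersimplex
  | specialP
  | specialQ1
  | specialQ2

section Types

variable {E : Type*} [AddCommGroup E] [Module ℝ E] [TopologicalSpace E]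

/-- `X` has the combinatorial type with the given name. -/
def FaceType2.IsTypeOf : FaceType2 → Set E → Prop
  | .triangle, X => CombEquiv X (PermutationPolytope.simplex 2)
  | .square, X => CombEquiv X (PermutationPolytope.cube 2)

/-- `X` has the combinatorial type with the given name. -/
def FaceType3.IsTypeOf : FaceType3 → Set E → Prop
  | .tetrahedron, X => CombEquiv X (PermutationPolytope.simplex 3)
  | .squarePyramid, X => CombEquiv X PermutationPolytope.squarePyramid
  | .triangularPrism, X => CombEquiv X (prism (PermutationPolytope.simplex 2))
  | .cube, X => CombEquiv X (PermutationPolytope.cube 3)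
  | .octahedron, X => CombEquiv X (PermutationPolytope.crossPolytope 3)

/-- `X` has the combinatorial type with the given name. -/
def FaceType4.IsTypeOf : FaceType4 → Set E → Prop
  | .simplex, X => CombEquiv X (PermutationPolytope.simplex 4)
  | .pyramidSquarePyramid, X => CombEquiv X (pyramid PermutationPolytope.squarePyramid)
  | .birkhoff3, X => CombEquiv X (birkhoff 3)
  | .pyramidTriangularPrism, X => CombEquiv X (pyramid (prism (PermutationPolytope.simplex 2)))
  | .wedgeW, X => CombEquiv X PermutationPolytope.wedgeW
  | .pyramidCube, X => CombEquiv X (pyramid (PermutationPolytope.cube 3))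
  | .prismTetrahedron, X => CombEquiv X (prism (PermutationPolytope.simplex 3))
  | .productTriangles, X =>
      CombEquiv X (PermutationPolytope.simplex 2 ×ˢ PermutationPolytope.simplex 2)
  | .prismSquarePyramid, X => CombEquiv X (prism PermutationPolytope.squarePyramid)
  | .productTriangleSquare, X =>
      CombEquiv X (PermutationPolytope.simplex 2 ×ˢ PermutationPolytope.cube 2)
  | .cube, X => CombEquiv X (PermutationPolytope.cube 4)
  | .crossPolytope, X => CombEquiv X (PermutationPolytope.crossPolytope 4)
  | .prismOctahedron, X => CombEquiv X (prism (PermutationPolytope.crossPolytope 3))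
  | .pyramidOctahedron, X => CombEquiv X (pyramid (PermutationPolytope.crossPolytope 3))
  | .bipyramidCube, X => CombEquiv X (bipyramid centeredCube)
  | .wedgeOctahedron, X => CombEquiv X PermutationPolytope.wedgeOctahedron
  | .dualW, X => CombDual X PermutationPolytope.wedgeW
  | .hypersimplex, X => CombEquiv X PermutationPolytope.hypersimplex
  | .specialP, X => HasIncidences X incidencesP
  | .specialQ1, X => HasIncidences X incidencesQ1
  | .specialQ2, X => HasIncidences X incidencesQ2

end Types

/-- The eleven four-dimensional types that occur as faces of Birkhoff polytopes. -/
def birkhoffTypes4 : Set FaceType4 :=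
  {.simplex, .pyramidSquarePyramid, .birkhoff3, .pyramidTriangularPrism, .wedgeW, .pyramidCube,
   .prismTetrahedron, .productTriangles, .prismSquarePyramid, .productTriangleSquare, .cube}

/-- The eight further four-dimensional types that occur as faces of permutation polytopes. -/
def furtherTypes4 : Set FaceType4 :=
  {.crossPolytope, .prismOctahedron, .pyramidOctahedron, .bipyramidCube, .wedgeOctahedron,
   .dualW, .hypersimplex, .specialP}

/-- The two four-dimensional types for which the realization problem is left open. -/
def openTypes4 : Set FaceType4 := {.specialQ1, .specialQ2}

end PermutationPolytope

/-! The vertices of a face of `P(G)` are the matrices of those elements of `G` at which a functional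
is maximal. Suppose that some of these vertices add up to a combination, with natural coefficients,
of two vertices `v` and `w`, the matrices of `σ` and `π`. Since all entries are nonnegative, the
permutation `τ` of each summand `u` agrees in every row with `σ` or with `π`. Then `v + w - u` is
the matrix of `π τ⁻¹ σ`, which lies in `G` and in the same face. This closure property, `Star`,
involves affine relations only.

A `d`-dimensional face projects affinely, and injectively on its affine hull, to `d` suitable matrix
entries. Its vertex set thus becomes a spanning subset of `{0,1}^d` that still satisfies `Star`. For
`d ≤ 4` there are at most `2^16` subsets, encoded as binary numbers. The least number in an affine
equivalence class cannot be lowered by a change of coordinates, cannot violate `Star` and cannot lie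
in a hyperplane. An inspection of all numbers leaves a short list (`Enumeration.classify`), and each
entry is described by integral barycentric coordinates, a `Model`.

The face lattice of a model is certified from two sides (`Model.Fits.nonempty_faces`). Intersections
of zero sets of nonnegative functionals are faces. Conversely, the vertex set of a face is closed
under affine relations `∑ A = ∑ B`: a nonnegative functional that vanishes on `A` vanishes on `B`.
The closed sets turn out to be exactly the intersections. The polytopes named in the theorem have
the same lattices as the models, and the types are told apart by their numbers of vertices and
facets.

Existence: the Birkhoff types arise by prescribing the support of the matrices. The other types
arise from groups of translations of copies of `ZMod 4`, where the vertices of a suitable face are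
the 0/1 vectors in the image of a linear map.

Non-existence in Birkhoff polytopes rests on three facts special to the full symmetric group. Three
vertices that never take three different values have a majority permutation in the face. If a vertex
is supported in the sum of three others, then the remainder is a sum of two vertices, by the
Birkhoff-von Neumann theorem. The dimension is at least the cyclomatic number of a digraph attached
to the face. The first fact excludes all types that contain a suitable octahedral relation, the
second excludes `Q₁`, and the third, combined with the first, excludes the dual of `W`. -/

namespace PermutationPolytope

open Finset

/-! ### Affine equivalence and integral barycentric models -/

section AffineEquivalence

variable {E E' E'' : Type*} [AddCommGroup E] [Module ℝ E] [AddCommGroup E'] [Module ℝ E']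
  [AddCommGroup E''] [Module ℝ E'']

/-- Two point sets are affinely equivalent: affine maps carry them to each other bijectively. -/
def AffEq (W : Set E) (V : Set E') : Prop :=
  ∃ (f : E →ᵃ[ℝ] E') (g : E' →ᵃ[ℝ] E), f '' W = V ∧ ∀ x ∈ W, g (f x) = x

theorem AffEq.symm {W : Set E} {V : Set E'} (h : AffEq W V) : AffEq V W := by
  obtain ⟨f, g, rfl, hg⟩ := h
  refine ⟨g, f, ?_, ?_⟩
  · ext x
    constructor
    · rintro ⟨_, ⟨y, hy, rfl⟩, rfl⟩
      rwa [hg y hy]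
    · intro hx
      exact ⟨f x, ⟨x, hx, rfl⟩, hg x hx⟩
  · rintro _ ⟨x, hx, rfl⟩
    rw [hg x hx]

theorem AffEq.trans {W : Set E} {V : Set E'} {U : Set E''} (h : AffEq W V) (h' : AffEq V U) :
    AffEq W U := by
  obtain ⟨f, g, rfl, hg⟩ := h
  obtain ⟨f', g', rfl, hg'⟩ := h'
  refine ⟨f'.comp f, g.comp g', ?_, ?_⟩
  · rw [AffineMap.coe_comp, Set.image_comp]
  · intro x hx
    simp only [AffineMap.coe_comp, Function.comp_apply]
    rw [hg' _ ⟨x, hx, rfl⟩, hg x hx]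

/-- The linear combination of the points `b 0, …, b (k - 1)` with integer coefficients `r`. -/
noncomputable def comb (k : ℕ) (b : ℕ → E) (r : List ℤ) : E :=
  ∑ j ∈ range k, ((r.getD j 0 : ℤ) : ℝ) • b j

/-- The sum of the first `k` entries. -/
def rowSum (k : ℕ) (r : List ℤ) : ℤ := ((List.range k).map fun j => r.getD j 0).sum

theorem rowSum_eq (k : ℕ) (r : List ℤ) : rowSum k r = ∑ j ∈ range k, r.getD j 0 := by
  unfold rowSum
  rfl

/-- Coefficients with sum one absorb the constant term of an affine map. This is why the rows of a
balanced model keep their meaning under every affine map. -/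
theorem map_comb (k : ℕ) (b : ℕ → E) (r : List ℤ) (hr : rowSum k r = 1) (a : E →ᵃ[ℝ] E') :
    a (comb k b r) = comb k (fun j => a (b j)) r := by
  have hd : ∀ x, a x = a.linear x + a 0 := fun x => congrFun a.decomp x
  have h1 : ∑ j ∈ range k, ((r.getD j 0 : ℤ) : ℝ) = 1 := by
    rw [← Int.cast_sum, ← rowSum_eq, hr, Int.cast_one]
  have h2 : a 0 = ∑ j ∈ range k, ((r.getD j 0 : ℤ) : ℝ) • a 0 := by
    rw [← Finset.sum_smul, h1, one_smul]
  rw [hd, comb, comb, map_sum]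
  nth_rewrite 1 [h2]
  rw [← Finset.sum_add_distrib]
  refine Finset.sum_congr rfl fun j _ => ?_
  rw [hd (b j), map_smul, smul_add]

/-- A point configuration given by integral barycentric coordinates with respect to `k` affinely
independent points. -/
structure Model where
  k : ℕ
  rows : List (List ℤ)

/-- All rows have coordinate sum one. -/
def Model.Balanced (M : Model) : Bool := M.rows.all fun r => rowSum M.k r == 1

theorem Model.rowSum_eq_one {M : Model} (h : M.Balanced = true) {r : List ℤ} (hr : r ∈ M.rows) :
    rowSum M.k r = 1 := by
  have := List.all_eq_true.1 h r hr
  simpa using this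

/-- The functionals `a i` are dual to the points `b j`. -/
def IsDual (k : ℕ) (b : ℕ → E) (a : ℕ → E →ᵃ[ℝ] ℝ) : Prop :=
  ∀ i < k, ∀ j < k, a i (b j) = if i = j then 1 else 0

/-- The set of points given by the rows of the model, with respect to the base points `b`. -/
def Model.points (M : Model) (b : ℕ → E) : Set E := {x | ∃ r ∈ M.rows, comb M.k b r = x}

/-- `W` is an affine realization of the model. -/
def Model.Fits (M : Model) (W : Set E) : Prop :=
  ∃ (b : ℕ → E) (a : ℕ → E →ᵃ[ℝ] ℝ), IsDual M.k b a ∧ W = M.points b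

theorem IsDual.apply_comb {k : ℕ} {b : ℕ → E} {a : ℕ → E →ᵃ[ℝ] ℝ} (h : IsDual k b a)
    {r : List ℤ} (hr : rowSum k r = 1) {i : ℕ} (hi : i < k) :
    a i (comb k b r) = r.getD i 0 := by
  rw [map_comb k b r hr, comb]
  rw [Finset.sum_eq_single i]
  · rw [h i hi i hi]; simp
  · intro j hj hji
    rw [h i hi j (Finset.mem_range.1 hj), if_neg (Ne.symm hji)]; simp
  · intro hi'
    exact absurd (Finset.mem_range.2 hi) hi'

/-- The base points belong to `W`, where `g` inverts `f`, so the functionals `a i ∘ g` are dual to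
the points `f (b j)`. The lemma carries a model from a set of 0/1 points back to the face it came
from. -/
theorem Model.Fits.congr {M : Model} (hM : M.Balanced = true) {W : Set E} {V : Set E'}
    (h : M.Fits W) (hb : ∀ j < M.k, ∃ r ∈ M.rows, ∀ i < M.k, r.getD i 0 = if i = j then 1 else 0)
    (hWV : AffEq W V) : M.Fits V := by
  obtain ⟨b, a, hd, rfl⟩ := h
  obtain ⟨f, g, rfl, hg⟩ := hWV
  have hbW : ∀ j < M.k, b j ∈ M.points b := by
    intro j hj
    obtain ⟨r, hr, hr'⟩ := hb j hj
    refine ⟨r, hr, ?_⟩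
    rw [comb, Finset.sum_eq_single j]
    · rw [hr' j hj]; simp
    · intro i hi hij
      rw [hr' i (Finset.mem_range.1 hi), if_neg hij]; simp
    · intro h; exact absurd (Finset.mem_range.2 hj) h
  refine ⟨fun j => f (b j), fun i => (a i).comp g, ?_, ?_⟩
  · intro i hi j hj
    simp only [AffineMap.coe_comp, Function.comp_apply]
    rw [hg _ (hbW j hj), hd i hi j hj]
  · ext x
    constructor
    · rintro ⟨_, ⟨r, hr, rfl⟩, rfl⟩
      exact ⟨r, hr, (map_comb _ _ _ (Model.rowSum_eq_one hM hr) f).symm⟩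
    · rintro ⟨r, hr, rfl⟩
      exact ⟨_, ⟨r, hr, rfl⟩, map_comb _ _ _ (Model.rowSum_eq_one hM hr) f⟩

/-- Each base point occurs among the points of the model. -/
def Model.HasUnits (M : Model) : Bool :=
  (List.range M.k).all fun j => M.rows.any fun r =>
    (List.range M.k).all fun i => r.getD i 0 == if i = j then 1 else 0

theorem Model.exists_unit {M : Model} (h : M.HasUnits = true) :
    ∀ j < M.k, ∃ r ∈ M.rows, ∀ i < M.k, r.getD i 0 = if i = j then 1 else 0 := by
  intro j hj
  have := List.all_eq_true.1 h j (List.mem_range.2 hj)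
  obtain ⟨r, hr, hr'⟩ := List.any_eq_true.1 this
  refine ⟨r, hr, fun i hi => ?_⟩
  simpa using List.all_eq_true.1 hr' i (List.mem_range.2 hi)

theorem comb_unit {k : ℕ} {b : ℕ → E} {r : List ℤ} {j : ℕ} (hj : j < k)
    (hr : ∀ i < k, r.getD i 0 = if i = j then 1 else 0) : comb k b r = b j := by
  rw [comb, Finset.sum_eq_single j]
  · rw [hr j hj]; simp
  · intro i hi hij
    rw [hr i (Finset.mem_range.1 hi), if_neg hij]; simp
  · intro h; exact absurd (Finset.mem_range.2 hj) h

/-- Applied to an affine dependence, the functional `a i` singles out its `i`-th coefficient, which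
must vanish. -/
theorem IsDual.affineIndependent {k : ℕ} {b : ℕ → E} {a : ℕ → E →ᵃ[ℝ] ℝ} (h : IsDual k b a) :
    AffineIndependent ℝ fun j : Fin k => b j := by
  rw [affineIndependent_iff]
  intro s w hw hs i hi
  have hlin : ∀ x, (a i).linear x = a i x - a i 0 := fun x => by
    have := congrFun (a i).decomp x
    simp only [Pi.add_apply] at this
    rw [this]; ring
  have h1 := congrArg (a i).linear hs
  rw [map_sum, map_zero] at h1
  have h2 : ∀ j ∈ s, (a i).linear (w j • b j) = w j * (if i = j then 1 else 0) - w j * a i 0 := by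
    intro j _
    rw [map_smul, hlin, h i i.2 j j.2, smul_eq_mul]
    have : ((i : ℕ) = (j : ℕ)) ↔ i = j := Fin.ext_iff.symm
    simp only [this]; ring
  rw [Finset.sum_congr rfl h2, Finset.sum_sub_distrib, ← Finset.sum_mul, hw] at h1
  simpa [hi] using h1

theorem Model.points_subset_affineSpan (M : Model) (hM : M.Balanced = true) (b : ℕ → E) :
    M.points b ⊆ affineSpan ℝ (Set.range fun j : Fin M.k => b j) := by
  rintro _ ⟨r, hr, rfl⟩
  have h1 : ∑ j : Fin M.k, ((r.getD j 0 : ℤ) : ℝ) = 1 := by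
    rw [← Finset.sum_range fun j => ((r.getD j 0 : ℤ) : ℝ), ← Int.cast_sum, ← rowSum_eq,
      Model.rowSum_eq_one hM hr, Int.cast_one]
  have := affineCombination_mem_affineSpan (k := ℝ) (s := Finset.univ)
    (w := fun j : Fin M.k => ((r.getD j 0 : ℤ) : ℝ)) h1 (fun j : Fin M.k => b j)
  rw [Finset.affineCombination_eq_linear_combination _ _ _ h1] at this
  rw [comb, Finset.sum_range]
  exact this

theorem Model.Fits.dim_eq {M : Model} (hM : M.Balanced = true) (hu : M.HasUnits = true)
    {W : Set E} (h : M.Fits W) : PermutationPolytope.dim (convexHull ℝ W) = M.k - 1 := by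
  obtain ⟨b, a, hd, rfl⟩ := h
  have hspan : vectorSpan ℝ (convexHull ℝ (M.points b)) =
      vectorSpan ℝ (Set.range fun j : Fin M.k => b j) := by
    rw [← direction_affineSpan, affineSpan_convexHull, ← direction_affineSpan ℝ (Set.range _)]
    congr 1
    apply le_antisymm
    · exact affineSpan_le.2 (M.points_subset_affineSpan hM b)
    · apply affineSpan_mono
      rintro _ ⟨j, rfl⟩
      obtain ⟨r, hr, hr'⟩ := Model.exists_unit hu j j.2
      exact ⟨r, hr, comb_unit j.2 hr'⟩
  rw [PermutationPolytope.dim, hspan]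
  rcases Nat.eq_zero_or_pos M.k with hk | hk
  · have : IsEmpty (Fin M.k) := by rw [hk]; infer_instance
    rw [Set.range_eq_empty, vectorSpan_empty, finrank_bot, hk]
  · obtain ⟨n, hn⟩ : ∃ n, M.k = n + 1 := ⟨M.k - 1, by omega⟩
    rw [hd.affineIndependent.finrank_vectorSpan (n := n) (by simp [hn]), hn]
    rfl

end AffineEquivalence

/-! ### Finite sets as binary numbers: intersection closures and closure rules -/

section Masks

/-- The bit mask of a list of positions. -/
def maskOf (l : List ℕ) : ℕ := l.foldr (fun i m => Nat.lor (Nat.pow 2 i) m) 0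

theorem testBit_maskOf (l : List ℕ) (i : ℕ) : (maskOf l).testBit i = true ↔ i ∈ l := by
  induction l with
  | nil => simp [maskOf]
  | cons j l ih =>
    have : maskOf (j :: l) = 2 ^ j ||| maskOf l := rfl
    rw [this, Nat.testBit_or, Bool.or_eq_true, ih, Nat.testBit_two_pow]
    simp [eq_comm]

theorem maskOf_lt {l : List ℕ} {n : ℕ} (h : ∀ i ∈ l, i < n) : maskOf l < 2 ^ n := by
  induction l with
  | nil => simp [maskOf]
  | cons j l ih =>
    have : maskOf (j :: l) = 2 ^ j ||| maskOf l := rfl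
    rw [this]
    exact Nat.or_lt_two_pow (Nat.pow_lt_pow_right (by norm_num) (h j (by simp)))
      (ih fun i hi => h i (by simp [hi]))

/-- The poset of the sets encoded by the bit masks in a list, ordered by inclusion. -/
def MaskPoset (L : List ℕ) : Type := {s : ℕ // s ∈ L}

instance (L : List ℕ) : PartialOrder (MaskPoset L) where
  le s t := ∀ i, s.1.testBit i = true → t.1.testBit i = true
  le_refl _ _ h := h
  le_trans _ _ _ h h' i hi := h' i (h i hi)
  le_antisymm s t h h' := Subtype.ext <| Nat.eq_of_testBit_eq fun i => by
    rw [Bool.eq_iff_iff]; exact ⟨h i, h' i⟩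

theorem MaskPoset.le_def {L : List ℕ} {s t : MaskPoset L} :
    s ≤ t ↔ ∀ i, s.1.testBit i = true → t.1.testBit i = true := Iff.rfl

/-- Inclusion of masks. -/
def subMask (s t : ℕ) : Bool := Nat.beq (Nat.land s t) s

theorem subMask_iff {s t : ℕ} :
    subMask s t = true ↔ ∀ i, s.testBit i = true → t.testBit i = true := by
  have h0 : subMask s t = true ↔ s &&& t = s := by
    unfold subMask; exact Nat.beq_eq ▸ Iff.rfl
  rw [h0]
  constructor
  · intro h i hi
    rw [← h, Nat.testBit_and, Bool.and_eq_true] at hi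
    exact hi.2
  · intro h
    apply Nat.eq_of_testBit_eq
    intro i
    rw [Nat.testBit_and]
    cases hs : s.testBit i with
    | false => rfl
    | true => rw [h i hs]; rfl

/-- Apply `f` to `n` after the evaluation of `n` to a numeral. -/
def force {α : Type*} (n : ℕ) (f : ℕ → α) : α :=
  match n with
  | 0 => f 0
  | k + 1 => f (k + 1)

theorem force_eq {α : Type*} (n : ℕ) (f : ℕ → α) : force n f = f n := by
  cases n <;> rfl

/-- Apply `f` to a list after the evaluation of its entries to numerals. -/
def forceList {α : Type*} : List ℕ → (List ℕ → α) → α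
  | [], f => f []
  | x :: l, f => force x fun x => forceList l fun l => f (x :: l)

theorem forceList_eq {α : Type*} (l : List ℕ) (f : List ℕ → α) : forceList l f = f l := by
  induction l generalizing f with
  | nil => rfl
  | cons x l ih => rw [forceList, force_eq, ih]

/-- Apply `f` to a list of pairs after the evaluation of its entries to numerals. -/
def forcePairs {α : Type*} : List (ℕ × ℕ) → (List (ℕ × ℕ) → α) → α
  | [], f => f []
  | x :: l, f => force x.1 fun a => force x.2 fun b => forcePairs l fun l => f ((a, b) :: l)

theorem forcePairs_eq {α : Type*} (l : List (ℕ × ℕ)) (f : List (ℕ × ℕ) → α) :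
    forcePairs l f = f l := by
  induction l generalizing f with
  | nil => rfl
  | cons x l ih => rw [forcePairs, force_eq, force_eq, ih]

def memMask (s : ℕ) : List ℕ → Bool
  | [] => false
  | x :: l => bif Nat.beq x s then true else memMask s l

theorem memMask_iff {s : ℕ} {l : List ℕ} : memMask s l = true ↔ s ∈ l := by
  induction l with
  | nil => simp [memMask]
  | cons x l ih =>
    rw [memMask, List.mem_cons]
    cases h : Nat.beq x s with
    | false =>
      have : s ≠ x := fun e => Nat.ne_of_beq_eq_false h e.symm
      simp [ih, this]
    | true => simp [Nat.eq_of_beq_eq_true h]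

/-- Insert the intersections of `t` with the members of `l` into `L`. -/
def insertInters (t : ℕ) : List ℕ → List ℕ → List ℕ
  | [], L => L
  | u :: l, L => force (Nat.land t u) fun x =>
      bif memMask x L then insertInters t l L else insertInters t l (x :: L)

theorem mem_insertInters {t s : ℕ} {l L : List ℕ} :
    s ∈ insertInters t l L ↔ (∃ u ∈ l, t &&& u = s) ∨ s ∈ L := by
  induction l generalizing L with
  | nil => simp [insertInters]
  | cons u l ih =>
    rw [insertInters, force_eq]
    have hx : Nat.land t u = t &&& u := rfl
    cases h : memMask (Nat.land t u) L with
    | false =>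
      rw [cond_false, ih, List.mem_cons, hx]
      simp only [List.mem_cons, exists_eq_or_imp]
      rw [eq_comm (a := s), or_left_comm, or_assoc]
    | true =>
      rw [memMask_iff] at h
      rw [cond_true, ih]
      simp only [List.mem_cons, exists_eq_or_imp]
      constructor
      · rintro (h' | h')
        · exact Or.inl (Or.inr h')
        · exact Or.inr h'
      · rintro ((rfl | h') | h')
        · exact Or.inr h
        · exact Or.inl h'
        · exact Or.inr h'

theorem nodup_insertInters {t : ℕ} {l L : List ℕ} (hL : L.Nodup) :
    (insertInters t l L).Nodup := by
  induction l generalizing L with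
  | nil => exact hL
  | cons u l ih =>
    rw [insertInters, force_eq]
    cases h : memMask (Nat.land t u) L with
    | false =>
      refine ih (List.nodup_cons.2 ⟨fun h' => ?_, hL⟩)
      rw [memMask_iff.2 h'] at h
      exact absurd h (by simp)
    | true => exact ih hL

/-- All intersections of the masks in `ts`, the empty intersection being `full`. -/
def interClosure (full : ℕ) : List ℕ → List ℕ
  | [] => [full]
  | t :: ts => forceList (interClosure full ts) fun L => insertInters t L L

theorem mem_interClosure_cons {full t s : ℕ} {ts : List ℕ} :
    s ∈ interClosure full (t :: ts) ↔
      (∃ u ∈ interClosure full ts, t &&& u = s) ∨ s ∈ interClosure full ts := by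
  rw [interClosure, forceList_eq, mem_insertInters]

/-- Needed when atoms and coatoms are counted by running through the list. -/
theorem nodup_interClosure (full : ℕ) (ts : List ℕ) : (interClosure full ts).Nodup := by
  induction ts with
  | nil => simp [interClosure]
  | cons t ts ih =>
    rw [interClosure, forceList_eq]
    exact nodup_insertInters ih

/-- One round of application of closure rules, a rule being a pair of masks. -/
def closePass : List (ℕ × ℕ) → ℕ → ℕ
  | [], s => s
  | r :: R, s => bif subMask r.1 s then force (Nat.lor s r.2) (closePass R) else closePass R s

theorem closePass_le {R : List (ℕ × ℕ)} {s t : ℕ}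
    (ht : ∀ r ∈ R, subMask r.1 t = true → subMask r.2 t = true) (hs : subMask s t = true) :
    subMask (closePass R s) t = true := by
  induction R generalizing s with
  | nil => exact hs
  | cons r R ih =>
    have ih' := fun s => @ih s fun r' hr' => ht r' (List.mem_cons_of_mem _ hr')
    cases h : subMask r.1 s with
    | false =>
      rw [closePass, h, cond_false]
      exact ih' s hs
    | true =>
      rw [closePass, h, cond_true, force_eq]
      apply ih' (Nat.lor s r.2)
      have h1 := ht r (by simp)
      rw [subMask_iff] at *
      rw [subMask_iff] at h1
      intro i hi
      have hi' : (s ||| r.2).testBit i = true := hi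
      rw [Nat.testBit_or, Bool.or_eq_true] at hi'
      rcases hi' with hi' | hi'
      · exact hs i hi'
      · exact h1 (fun j hj => hs j (h j hj)) i hi'

theorem le_closePass (R : List (ℕ × ℕ)) (s : ℕ) : subMask s (closePass R s) = true := by
  induction R generalizing s with
  | nil => exact subMask_iff.2 fun _ h => h
  | cons r R ih =>
    rw [subMask_iff]
    intro i hi
    cases h : subMask r.1 s with
    | false =>
      rw [closePass, h, cond_false]
      exact subMask_iff.1 (ih _) i hi
    | true =>
      rw [closePass, h, cond_true, force_eq]
      refine subMask_iff.1 (ih _) i ?_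
      change (s ||| r.2).testBit i = true
      rw [Nat.testBit_or, hi]; rfl

/-- At most `fuel` rounds of closure lead from `s` to a member of `L`. -/
def closesInto (R : List (ℕ × ℕ)) (L : List ℕ) : ℕ → ℕ → Bool
  | 0, s => memMask s L
  | fuel + 1, s => memMask s L || force (closePass R s) (closesInto R L fuel)

/-- A closed set `t` containing `s` contains every stage of the closure of `s`. It therefore
suffices that some stage, not necessarily the last one, is a member of `L`. -/
theorem exists_of_closesInto {R : List (ℕ × ℕ)} {L : List ℕ} {fuel s t : ℕ}
    (h : closesInto R L fuel s = true)
    (ht : ∀ r ∈ R, subMask r.1 t = true → subMask r.2 t = true) (hs : subMask s t = true) :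
    ∃ s' ∈ L, subMask s s' = true ∧ subMask s' t = true := by
  have hrefl : subMask s s = true := subMask_iff.2 fun _ h => h
  induction fuel generalizing s with
  | zero => exact ⟨s, memMask_iff.1 h, hrefl, hs⟩
  | succ fuel ih =>
    rw [closesInto, force_eq, Bool.or_eq_true] at h
    rcases h with h | h
    · exact ⟨s, memMask_iff.1 h, hrefl, hs⟩
    · obtain ⟨s', hs', h1, h2⟩ := ih h (closePass_le ht hs) (subMask_iff.2 fun _ h => h)
      exact ⟨s', hs', subMask_iff.2 fun i hi =>
        subMask_iff.1 h1 i (subMask_iff.1 (le_closePass R s) i hi), h2⟩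

/-- Every set obtained by closing a member of `L` together with one more element is in `L`. -/
def closedCheck (R : List (ℕ × ℕ)) (n : ℕ) (L : List ℕ) : Bool :=
  forceList L fun L => forcePairs R fun R => L.all fun s => (List.range n).all fun w =>
    Nat.testBit s w || force (Nat.lor s (Nat.pow 2 w)) (closesInto R L 3)

/-- Let `s` be the largest member of `L` inside the closed set `t`. If `t` had a further element
`w`, then closing `s ∪ {w}` would lead, without leaving `t`, to a larger member of `L`. The bound of
three rounds in `closedCheck` does not affect soundness: too few rounds could only make the check
fail. -/
theorem mem_of_closedCheck {R : List (ℕ × ℕ)} {n : ℕ} {L : List ℕ} (h0 : 0 ∈ L)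
    (h : closedCheck R n L = true) {t : ℕ} (htn : t < 2 ^ n)
    (ht : ∀ r ∈ R, subMask r.1 t = true → subMask r.2 t = true) : t ∈ L := by
  classical
  rw [closedCheck, forceList_eq, forcePairs_eq] at h
  let A : Finset ℕ := L.toFinset.filter fun s => subMask s t = true
  have hA : A.Nonempty := ⟨0, by simp [A, h0, subMask_iff]⟩
  obtain ⟨s, hsA, hmax⟩ := A.exists_max_image id hA
  simp only [A, Finset.mem_filter, List.mem_toFinset] at hsA
  obtain ⟨hsL, hst⟩ := hsA
  by_cases hEq : s = t
  · rwa [← hEq]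
  exfalso
  obtain ⟨w, hwt, hws⟩ : ∃ w, t.testBit w = true ∧ s.testBit w = false := by
    by_contra hcon
    push Not at hcon
    apply hEq
    apply Nat.eq_of_testBit_eq
    intro i
    rw [Bool.eq_iff_iff]
    refine ⟨subMask_iff.1 hst i, fun hi => ?_⟩
    simpa using hcon i hi
  have hwn : w < n := by
    by_contra hcon
    have : t.testBit w = false := Nat.testBit_lt_two_pow
      (lt_of_lt_of_le htn (Nat.pow_le_pow_right (by norm_num) (not_lt.1 hcon)))
    simp [this] at hwt
  have h1 := List.all_eq_true.1 (List.all_eq_true.1 h s hsL) w (List.mem_range.2 hwn)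
  rw [hws, Bool.false_or, force_eq] at h1
  have hbit : ∀ i, (Nat.lor s (Nat.pow 2 w)).testBit i = true ↔ s.testBit i = true ∨ w = i := by
    intro i
    change (s ||| 2 ^ w).testBit i = true ↔ _
    rw [Nat.testBit_or, Bool.or_eq_true, Nat.testBit_two_pow]
    simp
  obtain ⟨s', hs'L, hle, hs't⟩ := exists_of_closesInto h1 ht <| subMask_iff.2 fun i hi => by
    rcases (hbit i).1 hi with hi | rfl
    · exact subMask_iff.1 hst i hi
    · exact hwt
  rw [subMask_iff] at hle
  have hge := hmax s' (by simp [A, hs'L, hs't])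
  simp only [id] at hge
  have hsub : subMask s s' = true := subMask_iff.2 fun i hi => hle i ((hbit i).2 (Or.inl hi))
  -- Maximality refers to the masks as numbers. Inclusion implies `≤`, so `s'` would have to equal
  -- `s` although it contains `w`.
  have hand : s &&& s' = s := by
    unfold subMask at hsub; exact Nat.eq_of_beq_eq_true hsub
  have hle' : s ≤ s' := by rw [← hand]; exact Nat.and_le_right
  have : s = s' := le_antisymm hle' hge
  have hw' : s.testBit w = true := by
    rw [this]; exact hle w ((hbit w).2 (Or.inr rfl))
  rw [hws] at hw'
  exact absurd hw' (by simp)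

end Masks

/-! ### Certificates for face lattices -/

section Lattice

/-- A certificate for the face lattice of a model: affine functionals (by their values at the base
points), and affine relations `∑ A = ∑ B` between points of the model. -/
structure LatticeData where
  facets : List (List ℤ)
  rules : List (List ℕ × List ℕ)

def Model.row (M : Model) (i : ℕ) : List ℤ := M.rows.getD i []

/-- The value of a functional at a row. -/
def dot (k : ℕ) (y r : List ℤ) : ℤ := ((List.range k).map fun j => r.getD j 0 * y.getD j 0).sum

theorem dot_eq (k : ℕ) (y r : List ℤ) :
    (dot k y r : ℝ) = comb k (fun j => ((y.getD j 0 : ℤ) : ℝ)) r := by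
  have : dot k y r = ∑ j ∈ range k, r.getD j 0 * y.getD j 0 := rfl
  rw [this, comb]
  push_cast
  rfl

/-- The vertices of the model at which the functional vanishes. -/
def Model.zeroMask (M : Model) (y : List ℤ) : ℕ :=
  maskOf ((List.range M.rows.length).filter fun i => dot M.k y (M.row i) == 0)

/-- The mask of the set of all vertices. -/
def Model.full (M : Model) : ℕ := maskOf (List.range M.rows.length)

/-- The vertex sets of the faces. -/
def Model.lattice (M : Model) (D : LatticeData) : List ℕ :=
  interClosure M.full (D.facets.map M.zeroMask)

/-- The relation is valid in the model. -/
def Model.ruleCheck (M : Model) (r : List ℕ × List ℕ) : Bool :=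
  ((List.range M.k).all fun j => (r.1.map fun i => (M.row i).getD j 0).sum ==
    (r.2.map fun i => (M.row i).getD j 0).sum) && (r.1 ++ r.2).all fun i => Nat.blt i M.rows.length

/-- Nonnegativity of the functionals makes every listed intersection a face; the rules, together
with `closedCheck`, show that no face is missing. It need not be known in advance that the
functionals define facets. The mask `0` is required because the empty face counts, and because the
search for closed sets starts there. -/
def Model.latticeCheck (M : Model) (D : LatticeData) : Bool :=
  (D.facets.all fun y => M.rows.all fun r => decide (0 ≤ dot M.k y r)) &&
  (D.rules.all M.ruleCheck && (memMask 0 (M.lattice D) &&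
    closedCheck (D.rules.map fun r => (maskOf r.1, maskOf r.2)) M.rows.length (M.lattice D)))

theorem Model.row_mem (M : Model) {i : ℕ} (hi : i < M.rows.length) : M.row i ∈ M.rows := by
  unfold Model.row
  rw [List.getD_eq_getElem _ _ hi]
  exact List.getElem_mem hi

theorem Model.exists_row (M : Model) {r : List ℤ} (hr : r ∈ M.rows) :
    ∃ i < M.rows.length, M.row i = r := by
  obtain ⟨i, hi, rfl⟩ := List.getElem_of_mem hr
  exact ⟨i, hi, List.getD_eq_getElem _ _ hi⟩

theorem comb_add_fun (k : ℕ) (y z : ℕ → ℝ) (r : List ℤ) :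
    comb k (fun j => y j + z j) r = comb k y r + comb k z r := by
  simp only [comb, smul_add, Finset.sum_add_distrib]

theorem Model.testBit_full (M : Model) (i : ℕ) :
    M.full.testBit i = true ↔ i < M.rows.length := by
  rw [Model.full, testBit_maskOf, List.mem_range]

/-- Every member of the intersection closure is the zero set of a nonnegative functional. -/
theorem Model.exists_functional (M : Model) {ys : List (List ℤ)}
    (hys : ∀ y ∈ ys, ∀ r ∈ M.rows, 0 ≤ dot M.k y r) {s : ℕ}
    (hs : s ∈ interClosure M.full (ys.map M.zeroMask)) :
    (∀ i, s.testBit i = true → i < M.rows.length) ∧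
    ∃ y : ℕ → ℝ, ∀ i < M.rows.length, 0 ≤ comb M.k y (M.row i) ∧
      (s.testBit i = true ↔ comb M.k y (M.row i) = 0) := by
  induction ys generalizing s with
  | nil =>
    have : s = M.full := by simpa [interClosure] using hs
    subst this
    refine ⟨fun i hi => (M.testBit_full i).1 hi, fun _ => 0, fun i hi => ?_⟩
    have h0 : comb M.k (fun _ => (0 : ℝ)) (M.row i) = 0 := by simp [comb]
    rw [h0]
    simp [M.testBit_full, hi]
  | cons y ys ih =>
    rw [List.map_cons, mem_interClosure_cons] at hs
    have ih' := fun s hs => ih (s := s) (fun y' hy' => hys y' (List.mem_cons_of_mem _ hy')) hs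
    rcases hs with ⟨u, hu, rfl⟩ | hs
    · obtain ⟨h1, z, hz⟩ := ih' u hu
      -- Both summands are nonnegative at all points, so the sum vanishes exactly where both do:
      -- intersections of zero sets correspond to sums of functionals.
      refine ⟨fun i hi => ?_, fun j => ((y.getD j 0 : ℤ) : ℝ) + z j, fun i hi => ?_⟩
      · rw [Nat.testBit_and, Bool.and_eq_true] at hi
        exact h1 i hi.2
      · rw [comb_add_fun, ← dot_eq]
        have hy0 : (0 : ℝ) ≤ (dot M.k y (M.row i) : ℝ) := by
          exact_mod_cast hys y (by simp) _ (M.row_mem hi)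
        obtain ⟨hz0, hz1⟩ := hz i hi
        refine ⟨add_nonneg hy0 hz0, ?_⟩
        rw [Nat.testBit_and, Bool.and_eq_true, hz1, add_eq_zero_iff_of_nonneg hy0 hz0,
          Model.zeroMask, testBit_maskOf]
        simp [hi]
    · exact ih' s hs

end Lattice

/-! ### Faces as hulls of level sets, and the face lattice of a model -/

section Faces

variable {E : Type*} [AddCommGroup E] [Module ℝ E]

/-- The open half-space `l < M` together with the hull of the points at level `M` is a convex set,
and it contains `W`. -/
theorem mem_convexHull_level {W : Set E} {l : E →ₗ[ℝ] ℝ} {M : ℝ} (hM : ∀ x ∈ W, l x ≤ M) {x : E}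
    (hx : x ∈ convexHull ℝ W) : l x < M ∨ x ∈ convexHull ℝ {w ∈ W | l w = M} := by
  have hA : ∀ z ∈ convexHull ℝ {w ∈ W | l w = M}, l z = M := by
    intro z hz
    have : convexHull ℝ {w ∈ W | l w = M} ⊆ {z | l z = M} :=
      convexHull_min (fun w hw => hw.2) (convex_hyperplane l.isLinear M)
    exact this hz
  have hconv : Convex ℝ ({z | l z < M} ∪ convexHull ℝ {w ∈ W | l w = M}) := by
    intro a ha b hb s t hs ht hst
    have hle : ∀ z ∈ ({z | l z < M} ∪ convexHull ℝ {w ∈ W | l w = M}), l z ≤ M := by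
      rintro z (hz | hz)
      · exact le_of_lt hz
      · exact (hA z hz).le
    rcases eq_or_lt_of_le hs with rfl | hs'
    · have : t = 1 := by linarith
      subst this; simpa using hb
    rcases eq_or_lt_of_le ht with rfl | ht'
    · have : s = 1 := by linarith
      subst this; simpa using ha
    have hla := hle a ha
    have hlb := hle b hb
    have hM' : M = s * M + t * M := by rw [← add_mul, hst, one_mul]
    rcases ha with ha | ha
    · left
      change l _ < M
      rw [map_add, map_smul, map_smul, smul_eq_mul, smul_eq_mul, hM']
      have h1 : s * l a < s * M := mul_lt_mul_of_pos_left ha hs'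
      have h2 : t * l b ≤ t * M := mul_le_mul_of_nonneg_left hlb ht
      linarith
    · rcases hb with hb | hb
      · left
        change l _ < M
        rw [map_add, map_smul, map_smul, smul_eq_mul, smul_eq_mul, hM']
        have h1 : s * l a ≤ s * M := mul_le_mul_of_nonneg_left hla hs
        have h2 : t * l b < t * M := mul_lt_mul_of_pos_left hb ht'
        linarith
      · right
        exact convex_convexHull ℝ _ ha hb hs ht hst
  have hsub : convexHull ℝ W ⊆ ({z | l z < M} ∪ convexHull ℝ {w ∈ W | l w = M}) := by
    apply convexHull_min _ hconv
    intro w hw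
    rcases lt_or_eq_of_le (hM w hw) with h | h
    · exact Or.inl h
    · exact Or.inr (subset_convexHull ℝ _ ⟨hw, h⟩)
  exact hsub hx

variable [TopologicalSpace E]

/-- A nonempty face of the convex hull of `W` is the convex hull of the points of `W` at which some
functional is maximal. -/
theorem exists_level_of_isExposed {W F : Set E} (hF : IsExposed ℝ (convexHull ℝ W) F)
    (hne : F.Nonempty) : ∃ (l : E →L[ℝ] ℝ) (M : ℝ), (∀ x ∈ W, l x ≤ M) ∧
      F = convexHull ℝ {w ∈ W | l w = M} := by
  obtain ⟨l, hl⟩ := hF hne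
  obtain ⟨x₀, hx₀⟩ := hne
  have hx₀' := hx₀
  rw [hl] at hx₀'
  have hmax : ∀ x ∈ convexHull ℝ W, l x ≤ l x₀ := hx₀'.2
  refine ⟨l, l x₀, fun x hx => hmax x (subset_convexHull ℝ _ hx), ?_⟩
  ext x
  constructor
  · intro hx
    rw [hl] at hx
    rcases mem_convexHull_level (l := (l : E →ₗ[ℝ] ℝ)) (M := l x₀)
      (fun x hx => hmax x (subset_convexHull ℝ _ hx)) hx.1 with h | h
    · exact absurd (hx.2 x₀ hx₀'.1) (not_le.2 h)
    · exact h
  · intro hx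
    have hxW : x ∈ convexHull ℝ W := convexHull_mono (fun w hw => hw.1) hx
    have hlx : l x = l x₀ := by
      have : convexHull ℝ {w ∈ W | l w = l x₀} ⊆ {z | l z = l x₀} :=
        convexHull_min (fun w hw => hw.2) (convex_hyperplane (l : E →ₗ[ℝ] ℝ).isLinear _)
      exact this hx
    rw [hl]
    exact ⟨hxW, fun y hy => hlx ▸ hmax y hy⟩

/-- The level `M` need not be attained: otherwise the set is empty, and `IsExposed` demands nothing.
-/
theorem isExposed_level {W : Set E} (l : E →L[ℝ] ℝ) (M : ℝ) (hM : ∀ x ∈ W, l x ≤ M) :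
    IsExposed ℝ (convexHull ℝ W) (convexHull ℝ {w ∈ W | l w = M}) := by
  intro hne
  have hne' : {w ∈ W | l w = M}.Nonempty := convexHull_nonempty_iff.1 hne
  obtain ⟨w₀, hw₀, hlw₀⟩ := hne'
  have hle : ∀ x ∈ convexHull ℝ W, l x ≤ M := by
    intro x hx
    have : convexHull ℝ W ⊆ {z | l z ≤ M} :=
      convexHull_min hM (convex_halfSpace_le (l : E →ₗ[ℝ] ℝ).isLinear _)
    exact this hx
  refine ⟨l, ?_⟩
  ext x
  constructor
  · intro hx
    have hlx : l x = M := by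
      have : convexHull ℝ {w ∈ W | l w = M} ⊆ {z | l z = M} :=
        convexHull_min (fun w hw => hw.2) (convex_hyperplane (l : E →ₗ[ℝ] ℝ).isLinear _)
      exact this hx
    exact ⟨convexHull_mono (fun w hw => hw.1) hx, fun y hy => hlx ▸ hle y hy⟩
  · rintro ⟨hx, hx'⟩
    rcases mem_convexHull_level (l := (l : E →ₗ[ℝ] ℝ)) hM hx with h | h
    · have := hx' w₀ (subset_convexHull ℝ _ hw₀)
      rw [hlw₀] at this
      exact absurd this (not_le.2 h)
    · exact h

variable [IsTopologicalAddGroup E] [ContinuousSMul ℝ E] [T2Space E] [FiniteDimensional ℝ E]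

/-- The faces of a polytope that fits a model with a checked certificate. -/
theorem Model.Fits.nonempty_faces {M : Model} (hM : M.Balanced = true) {D : LatticeData}
    (hD : M.latticeCheck D = true) {W : Set E} (hW : M.Fits W) :
    Nonempty (Faces (convexHull ℝ W) ≃o MaskPoset (M.lattice D)) := by
  obtain ⟨b, a, hd, rfl⟩ := hW
  simp only [Model.latticeCheck, Bool.and_eq_true] at hD
  obtain ⟨hfac, hrul, h0, hcl⟩ := hD
  have h0 : 0 ∈ M.lattice D := memMask_iff.1 h0
  have hys : ∀ y ∈ D.facets, ∀ r ∈ M.rows, 0 ≤ dot M.k y r := fun y hy r hr => by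
    simpa using List.all_eq_true.1 (List.all_eq_true.1 hfac y hy) r hr
  let p : ℕ → E := fun i => comb M.k b (M.row i)
  let V : ℕ → Set E := fun s => {x | ∃ i < M.rows.length, s.testBit i = true ∧ p i = x}
  have hpW : ∀ i < M.rows.length, p i ∈ M.points b := fun i hi => ⟨_, M.row_mem hi, rfl⟩
  -- a functional for each member of the lattice
  have hlev : ∀ s ∈ M.lattice D, ∃ (l : E →L[ℝ] ℝ) (c : ℝ), (∀ x ∈ M.points b, l x ≤ c) ∧
      ∀ i < M.rows.length, (s.testBit i = true ↔ l (p i) = c) := by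
    intro s hs
    obtain ⟨-, y, hy⟩ := M.exists_functional hys hs
    -- The dual functionals produce an affine function on `E` with the prescribed values `y j` at
    -- the base points.
    let g : E →ᵃ[ℝ] ℝ := ∑ j ∈ range M.k, y j • a j
    have hg : ∀ i < M.rows.length, g (p i) = comb M.k y (M.row i) := by
      intro i hi
      have : g (p i) = ∑ j ∈ range M.k, y j * a j (p i) := by
        simp only [g]
        have hsum : ∀ (S : Finset ℕ), (∑ j ∈ S, y j • a j : E →ᵃ[ℝ] ℝ) (p i) =
            ∑ j ∈ S, y j * a j (p i) := by
          intro S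
          induction S using Finset.induction_on with
          | empty => simp
          | insert j S hj ih => rw [Finset.sum_insert hj, Finset.sum_insert hj, ← ih]; simp
        exact hsum _
      rw [this, comb]
      refine Finset.sum_congr rfl fun j hj => ?_
      rw [hd.apply_comb (Model.rowSum_eq_one hM (M.row_mem hi)) (Finset.mem_range.1 hj), smul_eq_mul,
        mul_comm]
    have hgd : ∀ x, g x = g.linear x + g 0 := fun x => congrFun g.decomp x
    -- Faces are defined by maximization, hence the sign: `g ≥ 0` with equality on the face means
    -- that `-g.linear` is at most `g 0`, with equality on the face.
    refine ⟨-(LinearMap.toContinuousLinearMap g.linear), g 0, ?_, ?_⟩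
    · rintro _ ⟨r, hr, rfl⟩
      obtain ⟨i, hi, rfl⟩ := M.exists_row hr
      have h1 := hgd (p i)
      rw [hg i hi] at h1
      have h2 := (hy i hi).1
      change -(g.linear (p i)) ≤ g 0
      linarith
    · intro i hi
      rw [(hy i hi).2, ← hg i hi, hgd]
      change _ ↔ -(g.linear (p i)) = g 0
      constructor <;> intro h <;> linarith
  have hV : ∀ s ∈ M.lattice D, IsExposed ℝ (convexHull ℝ (M.points b)) (convexHull ℝ (V s)) ∧
      ∀ i < M.rows.length, p i ∈ convexHull ℝ (V s) → s.testBit i = true := by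
    intro s hs
    obtain ⟨l, c, hl, hl'⟩ := hlev s hs
    have hVs : V s = {w ∈ M.points b | l w = c} := by
      ext x
      constructor
      · rintro ⟨i, hi, his, rfl⟩
        exact ⟨hpW i hi, (hl' i hi).1 his⟩
      · rintro ⟨⟨r, hr, rfl⟩, hx⟩
        obtain ⟨i, hi, rfl⟩ := M.exists_row hr
        exact ⟨i, hi, (hl' i hi).2 hx, rfl⟩
    refine ⟨hVs ▸ isExposed_level l c hl, fun i hi hp => (hl' i hi).2 ?_⟩
    have : convexHull ℝ (V s) ⊆ {z | l z = c} := by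
      rw [hVs]
      exact convexHull_min (fun w hw => hw.2) (convex_hyperplane (l : E →ₗ[ℝ] ℝ).isLinear _)
    exact this hp
  have hlt : ∀ s ∈ M.lattice D, ∀ i, s.testBit i = true → i < M.rows.length := fun s hs =>
    (M.exists_functional hys hs).1
  let φ : MaskPoset (M.lattice D) → Faces (convexHull ℝ (M.points b)) :=
    fun s => ⟨convexHull ℝ (V s.1), (hV s.1 s.2).1⟩
  have hφ : ∀ s t, φ s ≤ φ t ↔ s ≤ t := by
    intro s t
    constructor
    · intro h i hi
      have hin := hlt s.1 s.2 i hi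
      exact (hV t.1 t.2).2 i hin (h (subset_convexHull ℝ _ ⟨i, hin, hi, rfl⟩))
    · intro h
      refine convexHull_mono ?_
      rintro _ ⟨i, hi, his, rfl⟩
      exact ⟨i, hi, h i his, rfl⟩
  have hsurj : Function.Surjective φ := by
    rintro ⟨F, hF⟩
    rcases Set.eq_empty_or_nonempty F with rfl | hne
    · refine ⟨⟨0, h0⟩, Subtype.ext ?_⟩
      change convexHull ℝ (V 0) = ∅
      have : V 0 = ∅ := by ext x; simp [V]
      rw [this, convexHull_empty]
    · obtain ⟨l, c, hl, hFeq⟩ := exists_level_of_isExposed hF hne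
      -- The slack `c - l`, recorded by its values at the base points. It is nonnegative at all
      -- points of the model and vanishes exactly at those on the face.
      let y : ℕ → ℝ := fun j => c - l (b j)
      have hy : ∀ i < M.rows.length, comb M.k y (M.row i) = c - l (p i) := by
        intro i hi
        have hr := Model.rowSum_eq_one hM (M.row_mem hi)
        let g : E →ᵃ[ℝ] ℝ := AffineMap.const ℝ E c - (l : E →ₗ[ℝ] ℝ).toAffineMap
        have := map_comb M.k b (M.row i) hr g
        simpa [g] using this.symm
      classical
      let z : ℕ := maskOf ((List.range M.rows.length).filter fun i => decide (l (p i) = c))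
      have hz : ∀ i, z.testBit i = true ↔ i < M.rows.length ∧ l (p i) = c := by
        intro i
        simp only [z, testBit_maskOf]
        simp
      have hzL : z ∈ M.lattice D := by
        refine mem_of_closedCheck h0 hcl (maskOf_lt fun i hi => ?_) ?_
        · simp only [List.mem_filter, List.mem_range] at hi
          exact hi.1
        · rintro _ hr'
          obtain ⟨r, hr, rfl⟩ := List.mem_map.1 hr'
          have hrc := List.all_eq_true.1 hrul r hr
          simp only [Model.ruleCheck, Bool.and_eq_true] at hrc
          obtain ⟨hrc1, hrc2⟩ := hrc
          have hlen : ∀ i ∈ r.1 ++ r.2, i < M.rows.length := fun i hi => by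
            have := List.all_eq_true.1 hrc2 i hi
            simpa [Nat.blt_eq] using this
          have hsum : ∀ S : List ℕ, (S.map fun i => comb M.k y (M.row i)).sum =
              ∑ j ∈ range M.k, (((S.map fun i => (M.row i).getD j 0).sum : ℤ) : ℝ) * y j := by
            intro S
            induction S with
            | nil => simp
            | cons i S ih =>
              simp only [List.map_cons, List.sum_cons, Int.cast_add, add_mul,
                Finset.sum_add_distrib, ih]
              rfl
          -- The slack respects relations between points. If all terms on the left vanish, then the
          -- nonnegative terms on the right have sum zero and vanish as well, so the zero set is
          -- closed under the rules.
          have hrel : (r.1.map fun i => comb M.k y (M.row i)).sum =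
              (r.2.map fun i => comb M.k y (M.row i)).sum := by
            rw [hsum, hsum]
            refine Finset.sum_congr rfl fun j hj => ?_
            have := List.all_eq_true.1 hrc1 j (List.mem_range.2 (Finset.mem_range.1 hj))
            rw [eq_of_beq this]
          intro hA
          rw [subMask_iff] at hA ⊢
          have hzero : (r.1.map fun i => comb M.k y (M.row i)).sum = 0 := by
            apply List.sum_eq_zero
            intro x hx
            obtain ⟨i, hi, rfl⟩ := List.mem_map.1 hx
            have := (hz i).1 (hA i ((testBit_maskOf _ _).2 hi))
            rw [hy i this.1, this.2, sub_self]
          rw [hzero] at hrel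
          intro i hi
          have hiB := (testBit_maskOf _ _).1 hi
          have hin := hlen i (by simp [hiB])
          refine (hz i).2 ⟨hin, ?_⟩
          have hnn : ∀ x ∈ r.2.map fun i => comb M.k y (M.row i), 0 ≤ x := by
            intro x hx
            obtain ⟨i', hi', rfl⟩ := List.mem_map.1 hx
            have hin' := hlen i' (by simp [hi'])
            rw [hy i' hin']
            linarith [hl _ (hpW i' hin')]
          have hle := List.single_le_sum hnn _ (List.mem_map.2 ⟨i, hiB, rfl⟩)
          rw [← hrel, hy i hin] at hle
          linarith [hl _ (hpW i hin)]
      refine ⟨⟨z, hzL⟩, Subtype.ext ?_⟩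
      change convexHull ℝ (V z) = F
      rw [hFeq]
      congr 1
      ext x
      constructor
      · rintro ⟨i, hi, hiz, rfl⟩
        exact ⟨hpW i hi, ((hz i).1 hiz).2⟩
      · rintro ⟨⟨r, hr, rfl⟩, hx⟩
        obtain ⟨i, hi, rfl⟩ := M.exists_row hr
        exact ⟨i, hi, (hz i).2 ⟨hi, hx⟩, rfl⟩
  exact ⟨(RelIso.ofSurjective (OrderEmbedding.ofMapLEIff φ hφ) hsurj).symm⟩

end Faces

/-! ### Dimension, and dual functionals of affinely independent points -/

section Dimension

variable {E E' : Type*} [AddCommGroup E] [Module ℝ E] [AddCommGroup E'] [Module ℝ E']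

theorem dim_convexHull (W : Set E) :
    dim (convexHull ℝ W) = Module.finrank ℝ (vectorSpan ℝ W) := by
  rw [dim, ← direction_affineSpan, affineSpan_convexHull, direction_affineSpan]

theorem AffEq.finrank_le [FiniteDimensional ℝ E] {W : Set E} {V : Set E'} (h : AffEq W V) :
    Module.finrank ℝ (vectorSpan ℝ V) ≤ Module.finrank ℝ (vectorSpan ℝ W) := by
  obtain ⟨f, g, rfl, -⟩ := h
  rw [← AffineMap.map_vectorSpan]
  exact Submodule.finrank_map_le _ _

theorem AffEq.finrank_eq [FiniteDimensional ℝ E] [FiniteDimensional ℝ E'] {W : Set E} {V : Set E'}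
    (h : AffEq W V) : Module.finrank ℝ (vectorSpan ℝ V) = Module.finrank ℝ (vectorSpan ℝ W) :=
  le_antisymm h.finrank_le h.symm.finrank_le

/-- The differences `b j - b 0` are linearly independent, and their coordinate functionals extend
from their span to the whole space. -/
theorem exists_isDual {k : ℕ} {b : ℕ → E} (h : AffineIndependent ℝ fun j : Fin k => b j) :
    ∃ a : ℕ → E →ᵃ[ℝ] ℝ, IsDual k b a := by
  rcases Nat.eq_zero_or_pos k with rfl | hk
  · exact ⟨fun _ => 0, fun i hi => absurd hi (Nat.not_lt_zero i)⟩
  let j₀ : Fin k := ⟨0, hk⟩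
  have hli := (affineIndependent_iff_linearIndependent_vsub ℝ _ j₀).1 h
  obtain ⟨φ, hφ⟩ := (hli.repr).exists_extend
  have hφ' : ∀ j : {x : Fin k // x ≠ j₀}, φ (b j - b 0) = Finsupp.single j 1 := by
    intro j
    have hmem : b j - b 0 ∈ Submodule.span ℝ
        (Set.range fun i : {x : Fin k // x ≠ j₀} => (b i -ᵥ b j₀ : E)) :=
      Submodule.subset_span ⟨j, rfl⟩
    have h1 := LinearMap.congr_fun hφ ⟨_, hmem⟩
    have h2 := hli.repr_eq_single j ⟨_, hmem⟩ rfl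
    rw [← h2, ← h1]
    rfl
  let ψ : ℕ → E →ₗ[ℝ] ℝ := fun i =>
    if hi : i < k ∧ i ≠ 0 then (Finsupp.lapply ⟨⟨i, hi.1⟩, fun h => hi.2 (Fin.ext_iff.1 h)⟩).comp φ
    else 0
  have hψ : ∀ i < k, i ≠ 0 → ∀ j < k, ψ i (b j - b 0) = if i = j then 1 else 0 := by
    intro i hi hi0 j hj
    simp only [ψ, dif_pos (And.intro hi hi0)]
    by_cases hj0 : j = 0
    · subst hj0; simp [hi0]
    · have := hφ' ⟨⟨j, hj⟩, fun h => hj0 (Fin.ext_iff.1 h)⟩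
      simp only at this
      rw [LinearMap.comp_apply, this]
      simp [Finsupp.single_apply, Fin.ext_iff, eq_comm]
  let β : ℕ → E →ᵃ[ℝ] ℝ := fun i => (ψ i).toAffineMap - AffineMap.const ℝ E (ψ i (b 0))
  have hβ : ∀ i x, β i x = ψ i (x - b 0) := fun i x => by simp [β]
  have hsum : ∀ (S : Finset ℕ) x, (∑ i ∈ S, β i : E →ᵃ[ℝ] ℝ) x = ∑ i ∈ S, β i x := by
    intro S x
    induction S using Finset.induction_on with
    | empty => simp
    | insert j S hj ih => rw [Finset.sum_insert hj, Finset.sum_insert hj, ← ih]; rfl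
  -- For `i ≥ 1` the functional `β i` vanishes at `b 0`. The functional belonging to `b 0` is then
  -- one minus the sum of these, as barycentric coordinates have sum one.
  refine ⟨fun i => if i = 0 then AffineMap.const ℝ E 1 - ∑ i ∈ (range k).erase 0, β i else β i, ?_⟩
  intro i hi j hj
  by_cases hi0 : i = 0
  · subst hi0
    beta_reduce
    rw [if_pos rfl]
    have : (AffineMap.const ℝ E 1 - ∑ i ∈ (range k).erase 0, β i : E →ᵃ[ℝ] ℝ) (b j) =
        1 - ∑ i ∈ (range k).erase 0, β i (b j) := by
      rw [← hsum]; rfl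
    rw [this]
    have h2 : ∑ i ∈ (range k).erase 0, β i (b j) =
        ∑ i ∈ (range k).erase 0, if i = j then 1 else 0 := by
      refine Finset.sum_congr rfl fun i hi => ?_
      rw [Finset.mem_erase, Finset.mem_range] at hi
      rw [hβ, hψ i hi.2 hi.1 j hj]
    rw [h2, Finset.sum_ite_eq']
    by_cases hj0 : j = 0
    · simp [hj0]
    · simp [hj0, hj, Ne.symm hj0]
  · beta_reduce
    rw [if_neg hi0, hβ, hψ i hi hi0 j hj]

end Dimension

/-! ### The reflection property -/

section Star

variable {E E' : Type*} [AddCommGroup E] [Module ℝ E] [AddCommGroup E'] [Module ℝ E']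

/-- If points of `W` add up to a combination of `v` and `w`, then their reflections in the midpoint
of `v` and `w` belong to `W` as well. -/
def Star (W : Set E) : Prop :=
  ∀ v ∈ W, ∀ w ∈ W, ∀ l : List E, (∀ u ∈ l, u ∈ W) → ∀ a b : ℕ, a + b = l.length →
    l.sum = a • v + b • w → ∀ u ∈ l, v + w - u ∈ W

theorem affineMap_list_sum (f : E →ᵃ[ℝ] E') (l : List E) :
    (l.map f).sum = f.linear l.sum + l.length • f 0 := by
  induction l with
  | nil => simp
  | cons x l ih =>
    have : f x = f.linear x + f 0 := congrFun f.decomp x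
    rw [List.map_cons, List.sum_cons, List.sum_cons, ih, this, map_add, List.length_cons,
      succ_nsmul]
    abel

theorem affineMap_reflect (f : E →ᵃ[ℝ] E') (v w u : E) : f (v + w - u) = f v + f w - f u := by
  have : ∀ x, f x = f.linear x + f 0 := fun x => congrFun f.decomp x
  rw [this (v + w - u), this v, this w, this u, map_sub, map_add]
  abel

/-- With `a + b` equal to the number of summands, the constant terms of the affine map balance. This
is the reason for the length condition in `Star`. -/
theorem affineMap_relation (f : E →ᵃ[ℝ] E') {l : List E} {a b : ℕ} (hab : a + b = l.length)
    {v w : E} (h : l.sum = a • v + b • w) : (l.map f).sum = a • f v + b • f w := by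
  have : ∀ x, f x = f.linear x + f 0 := fun x => congrFun f.decomp x
  rw [affineMap_list_sum, h, ← hab, this v, this w, map_add, map_nsmul, map_nsmul, add_nsmul,
    nsmul_add, nsmul_add]
  abel

/-- Both the relation and the reflection are affine with equal weights on the two sides. A relation
in `V` is pulled back to `W`, and the reflected point is pushed forward. This allows the property to
be tested on 0/1 points instead of permutation matrices. -/
theorem Star.congr {W : Set E} {V : Set E'} (hW : Star W) (h : AffEq W V) : Star V := by
  obtain ⟨g, f, hgV, hfW⟩ := h.symm
  have hg : ∀ x ∈ V, g x ∈ W := fun x hx => hgV ▸ Set.mem_image_of_mem g hx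
  have hf : ∀ x ∈ W, f x ∈ V := by
    intro x hx
    rw [← hgV] at hx
    obtain ⟨y, hy, rfl⟩ := hx
    rwa [hfW y hy]
  intro v hv w hw l hl a b hab hsum u hu
  have h1 := hW (g v) (hg v hv) (g w) (hg w hw) (l.map g)
    (by intro x hx; obtain ⟨y, hy, rfl⟩ := List.mem_map.1 hx; exact hg y (hl y hy)) a b
    (by simpa using hab) (affineMap_relation g hab hsum) (g u) (List.mem_map_of_mem hu)
  have h2 := hf _ h1
  rwa [affineMap_reflect, hfW v hv, hfW w hw, hfW u (hl u hu)] at h2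

end Star

/-! ### Sets of 0/1 points and their changes of coordinates -/

section ZeroOne

/-- The `i`-th binary digit. -/
def bit (v i : ℕ) : ℤ := bif v.testBit i then 1 else 0

/-- The 0/1 point with the given code. -/
def pt (d v : ℕ) : Fin d → ℝ := fun i => (bit v i : ℝ)

/-- The set of the 0/1 points with codes in the mask `m`. -/
def ptSet (d m : ℕ) : Set (Fin d → ℝ) := {x | ∃ v, m.testBit v = true ∧ pt d v = x}

theorem bit_inj {v w i : ℕ} (h : (bit v i : ℝ) = bit w i) : v.testBit i = w.testBit i := by
  have h' : bit v i = bit w i := by exact_mod_cast h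
  unfold bit at h'
  cases hv : v.testBit i <;> cases hw : w.testBit i <;> simp_all

theorem pt_inj {d v w : ℕ} (hv : v < 2 ^ d) (hw : w < 2 ^ d) (h : pt d v = pt d w) : v = w := by
  apply Nat.eq_of_testBit_eq
  intro i
  by_cases hi : i < d
  · exact bit_inj (congrFun h ⟨i, hi⟩)
  · have hle : 2 ^ d ≤ 2 ^ i := Nat.pow_le_pow_right (by norm_num) (not_lt.1 hi)
    rw [Nat.testBit_lt_two_pow (lt_of_lt_of_le hv hle),
      Nat.testBit_lt_two_pow (lt_of_lt_of_le hw hle)]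

theorem lt_of_testBit_mask {m N v : ℕ} (hm : m < 2 ^ N) (hv : m.testBit v = true) : v < N := by
  by_contra h
  rw [Nat.testBit_lt_two_pow (lt_of_lt_of_le hm (Nat.pow_le_pow_right (by norm_num) (not_lt.1 h)))]
    at hv
  exact absurd hv (by simp)

/-- The affine map with integer matrix `F`, the column `0` being the constant term. -/
noncomputable def affOf (d : ℕ) (F : ℕ → ℕ → ℤ) : (Fin d → ℝ) →ᵃ[ℝ] (Fin d → ℝ) where
  toFun x i := (F i 0 : ℝ) + ∑ j : Fin d, (F i (j + 1) : ℝ) * x j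
  linear := LinearMap.pi fun i => ∑ j : Fin d, (F i (j + 1) : ℝ) • LinearMap.proj j
  map_vadd' p v := by
    ext i
    simp only [vadd_eq_add, Pi.add_apply, LinearMap.pi_apply, LinearMap.sum_apply,
      LinearMap.smul_apply, LinearMap.proj_apply, smul_eq_mul, mul_add, Finset.sum_add_distrib]
    ring

/-- The value of row `i` of the integer matrix at the 0/1 point with code `v`. -/
def affVal (d : ℕ) (F : ℕ → ℕ → ℤ) (v i : ℕ) : ℤ :=
  F i 0 + ((List.range d).map fun j => F i (j + 1) * bit v j).sum

theorem affOf_pt {d : ℕ} {F : ℕ → ℕ → ℤ} {v w : ℕ} (h : ∀ i < d, affVal d F v i = bit w i) :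
    affOf d F (pt d v) = pt d w := by
  ext i
  have hs : ((List.range d).map fun j => F i (j + 1) * bit v j).sum =
      ∑ j ∈ range d, F i (j + 1) * bit v j := rfl
  change (F i 0 : ℝ) + ∑ j : Fin d, (F i (j + 1) : ℝ) * (bit v j : ℝ) = (bit w i : ℝ)
  rw [← h i i.2, affVal, hs, Finset.sum_range]
  push_cast
  rfl

/-- A change of coordinates: a partial permutation of the codes of 0/1 points, given by the masks of
the codes that are excluded, kept, increased by `s`, and decreased by `s`, together with the integer
matrices of the corresponding affine map and of its inverse. -/
structure Gen where
  bad : ℕ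
  keep : ℕ
  up : ℕ
  s : ℕ
  down : ℕ
  F : ℕ → ℕ → ℤ
  G : ℕ → ℕ → ℤ

/-- The action of a change of coordinates on masks. -/
def Gen.app (g : Gen) (m : ℕ) : ℕ :=
  Nat.lor (Nat.lor (Nat.land m g.keep) (Nat.shiftLeft (Nat.land m g.up) g.s))
    (Nat.shiftRight (Nat.land m g.down) g.s)

/-- The action of a change of coordinates on codes. -/
def Gen.code (g : Gen) (v : ℕ) : ℕ :=
  bif g.keep.testBit v then v else bif g.up.testBit v then v + g.s else v - g.s

/-- The three classes are disjoint so that `Gen.app`, which shifts whole masks, moves each code in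
the same way as `Gen.code`. Injectivity needs no separate test, since `G` inverts `F` on the points
concerned. The excluded codes are those whose images may fail to be 0/1 points. -/
def Gen.check (d : ℕ) (g : Gen) : Bool :=
  (List.range (2 ^ d)).all fun v =>
    (g.bad.testBit v && !g.keep.testBit v && !g.up.testBit v && !g.down.testBit v) ||
    (((g.keep.testBit v && !g.up.testBit v && !g.down.testBit v) ||
      (!g.keep.testBit v && g.up.testBit v && !g.down.testBit v) ||
      (!g.keep.testBit v && !g.up.testBit v && g.down.testBit v && Nat.ble g.s v)) &&
    (Nat.blt (g.code v) (2 ^ d) && (List.range d).all fun i =>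
      affVal d g.F v i == bit (g.code v) i && affVal d g.G (g.code v) i == bit v i))

theorem Gen.testBit_app (g : Gen) (m w : ℕ) : (g.app m).testBit w = true ↔
    (m.testBit w = true ∧ g.keep.testBit w = true) ∨
    (g.s ≤ w ∧ m.testBit (w - g.s) = true ∧ g.up.testBit (w - g.s) = true) ∨
    (m.testBit (w + g.s) = true ∧ g.down.testBit (w + g.s) = true) := by
  have : g.app m = ((m &&& g.keep) ||| ((m &&& g.up) <<< g.s)) ||| ((m &&& g.down) >>> g.s) := rfl
  rw [this]
  simp only [Nat.testBit_or, Nat.testBit_and, Nat.testBit_shiftLeft, Nat.testBit_shiftRight,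
    Bool.or_eq_true, Bool.and_eq_true, decide_eq_true_eq, ge_iff_le, add_comm g.s w]
  tauto

/-- A shear does not preserve the whole cube, but it acts on every set that avoids the excluded
codes. Each bit of `m` moves to its image, and each bit of `g.app m` arises in this way. -/
theorem Gen.affEq {d : ℕ} {g : Gen} (hg : g.check d = true) {m : ℕ} (hm : m < 2 ^ 2 ^ d)
    (hbad : Nat.land m g.bad = 0) :
    AffEq (ptSet d m) (ptSet d (g.app m)) ∧ g.app m < 2 ^ 2 ^ d := by
  have hcase : ∀ v, m.testBit v = true → g.code v < 2 ^ d ∧ (g.app m).testBit (g.code v) = true ∧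
      affOf d g.F (pt d v) = pt d (g.code v) ∧ affOf d g.G (pt d (g.code v)) = pt d v := by
    intro v hv
    have hvd := lt_of_testBit_mask hm hv
    have hnb : g.bad.testBit v = false := by
      have h0 : (m &&& g.bad).testBit v = false := by
        have : m &&& g.bad = 0 := hbad
        rw [this]; simp
      rw [Nat.testBit_and, hv] at h0
      simpa using h0
    have h1 := List.all_eq_true.1 hg v (List.mem_range.2 hvd)
    rw [hnb] at h1
    simp only [Bool.false_and, Bool.false_or, Bool.and_eq_true, List.all_eq_true, List.mem_range,
      beq_iff_eq] at h1
    obtain ⟨h1, hlt, h2⟩ := h1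
    refine ⟨by simpa [Nat.blt_eq] using hlt, ?_, affOf_pt fun i hi => (h2 i hi).1,
      affOf_pt fun i hi => (h2 i hi).2⟩
    rw [g.testBit_app]
    simp only [Bool.or_eq_true, Bool.and_eq_true, Bool.not_eq_true', Nat.ble_eq] at h1
    rcases h1 with (⟨⟨h3, -⟩, -⟩ | ⟨⟨h3, h4⟩, -⟩) | ⟨⟨⟨h3, h4⟩, h5⟩, h6⟩
    · left; simp [Gen.code, h3, hv]
    · right; left; simp [Gen.code, h3, h4, hv]
    · right; right
      simp only [Gen.code, h3, h4, cond_false]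
      rw [Nat.sub_add_cancel h6]
      exact ⟨hv, h5⟩
  have hback : ∀ w, (g.app m).testBit w = true → ∃ v, m.testBit v = true ∧ g.code v = w := by
    intro w hw
    have key : ∀ v, m.testBit v = true → (g.keep.testBit v = true ∨ g.up.testBit v = true ∨
        g.down.testBit v = true) →
        (g.keep.testBit v = true ∧ g.up.testBit v = false ∧ g.down.testBit v = false) ∨
        (g.keep.testBit v = false ∧ g.up.testBit v = true ∧ g.down.testBit v = false) ∨
        (g.keep.testBit v = false ∧ g.up.testBit v = false ∧ g.down.testBit v = true) := by
      intro v hv _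
      have hvd := lt_of_testBit_mask hm hv
      have h1 := List.all_eq_true.1 hg v (List.mem_range.2 hvd)
      have hnb : g.bad.testBit v = false := by
        have h0 : (m &&& g.bad).testBit v = false := by
          have : m &&& g.bad = 0 := hbad
          rw [this]; simp
        rw [Nat.testBit_and, hv] at h0
        simpa using h0
      rw [hnb] at h1
      simp only [Bool.false_and, Bool.false_or, Bool.and_eq_true, Bool.or_eq_true,
        Bool.not_eq_true'] at h1
      rcases h1.1 with (⟨⟨h3, h4⟩, h5⟩ | ⟨⟨h3, h4⟩, h5⟩) | ⟨⟨⟨h3, h4⟩, h5⟩, -⟩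
      · exact Or.inl ⟨h3, h4, h5⟩
      · exact Or.inr (Or.inl ⟨h3, h4, h5⟩)
      · exact Or.inr (Or.inr ⟨h3, h4, h5⟩)
    rcases (g.testBit_app m w).1 hw with ⟨h1, h2⟩ | ⟨h1, h2, h3⟩ | ⟨h1, h2⟩
    · exact ⟨w, h1, by simp [Gen.code, h2]⟩
    · rcases key _ h2 (Or.inr (Or.inl h3)) with h | h | h
      · rw [h.2.1] at h3; exact absurd h3 (by simp)
      · refine ⟨w - g.s, h2, ?_⟩
        simp only [Gen.code, h.1, h.2.1, cond_false, cond_true]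
        omega
      · rw [h.2.1] at h3; exact absurd h3 (by simp)
    · rcases key _ h1 (Or.inr (Or.inr h2)) with h | h | h
      · rw [h.2.2] at h2; exact absurd h2 (by simp)
      · rw [h.2.2] at h2; exact absurd h2 (by simp)
      · refine ⟨w + g.s, h1, ?_⟩
        simp only [Gen.code, h.1, h.2.1, cond_false]
        omega
  refine ⟨⟨affOf d g.F, affOf d g.G, ?_, ?_⟩, ?_⟩
  · ext x
    constructor
    · rintro ⟨_, ⟨v, hv, rfl⟩, rfl⟩
      obtain ⟨-, h2, h3, -⟩ := hcase v hv
      exact ⟨_, h2, h3.symm⟩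
    · rintro ⟨w, hw, rfl⟩
      obtain ⟨v, hv, rfl⟩ := hback w hw
      exact ⟨_, ⟨v, hv, rfl⟩, (hcase v hv).2.2.1⟩
  · rintro _ ⟨v, hv, rfl⟩
    rw [(hcase v hv).2.2.1, (hcase v hv).2.2.2]
  · apply Nat.lt_pow_two_of_testBit
    intro w hw
    by_contra hcon
    obtain ⟨v, hv, rfl⟩ := hback w (by simpa using hcon)
    exact absurd (hcase v hv).1 (not_lt.2 hw)

end ZeroOne

/-! ### The tests applied to sets of 0/1 points, and the classification -/

/-- A relation that tests the property `Star`: the codes `v ^^^ h`, for `h` in `pts`, add up to a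
combination of the codes `v` (with multiplicity `pts.length - mult`) and `v ^^^ dir`. -/
structure StarRule where
  dir : ℕ
  pts : List ℕ
  mult : ℕ

def StarRule.premise (r : StarRule) (v : ℕ) : ℕ :=
  maskOf (v :: Nat.xor v r.dir :: r.pts.map (Nat.xor v))

def StarRule.conclusion (r : StarRule) (v : ℕ) : ℕ :=
  maskOf (r.pts.map (Nat.xor (Nat.xor v r.dir)))

/-- Since the codes are `v ^^^ h`, one rule is used at every vertex `v` of the cube. The final
condition says that reflection in the midpoint of `v` and `v ^^^ dir` turns the code `v ^^^ h` into
`v ^^^ dir ^^^ h`; in particular it stays within the cube. -/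
def StarRule.check (d : ℕ) (r : StarRule) : Bool :=
  Nat.ble r.mult r.pts.length && Nat.blt r.dir (2 ^ d) && (r.pts.all fun h => Nat.blt h (2 ^ d)) &&
  (List.range (2 ^ d)).all fun v => (List.range d).all fun i =>
    (r.pts.map fun h => bit (Nat.xor v h) i).sum ==
      (r.pts.length - r.mult : ℕ) * bit v i + r.mult * bit (Nat.xor v r.dir) i &&
    r.pts.all fun h =>
      bit v i + bit (Nat.xor v r.dir) i - bit (Nat.xor v h) i == bit (Nat.xor (Nat.xor v r.dir) h) i

/-- The rule supplies a relation of the form required by `Star`, and injectivity of the encoding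
translates the reflected points back into bits of `m`. -/
theorem Star.subMask_conclusion {d m : ℕ} (hm : m < 2 ^ 2 ^ d) (hS : Star (ptSet d m))
    {r : StarRule} (hr : r.check d = true) {v : ℕ} (hv : v < 2 ^ d)
    (hp : subMask (r.premise v) m = true) : subMask (r.conclusion v) m = true := by
  simp only [StarRule.check, Bool.and_eq_true, List.all_eq_true, List.mem_range, beq_iff_eq,
    Nat.ble_eq, Nat.blt_eq] at hr
  obtain ⟨⟨⟨hmult, hdir⟩, hpts⟩, hr⟩ := hr
  rw [subMask_iff] at hp
  have hmem : ∀ u ∈ v :: Nat.xor v r.dir :: r.pts.map (Nat.xor v), pt d u ∈ ptSet d m :=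
    fun u hu => ⟨u, hp u ((testBit_maskOf _ _).2 hu), rfl⟩
  have hsum : ((r.pts.map (Nat.xor v)).map (pt d)).sum =
      (r.pts.length - r.mult) • pt d v + r.mult • pt d (Nat.xor v r.dir) := by
    have hgen : ∀ (l : List (Fin d → ℝ)) i, l.sum i = (l.map fun x => x i).sum := by
      intro l i
      induction l with
      | nil => rfl
      | cons x l ih => simp [ih]
    ext i
    rw [hgen, List.map_map, List.map_map]
    have h1 := (hr v hv i i.2).1
    have h2 : ∀ l : List ℕ, (l.map (((fun x : Fin d → ℝ => x i) ∘ pt d) ∘ Nat.xor v)).sum =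
        (((l.map fun h => bit (Nat.xor v h) i).sum : ℤ) : ℝ) := by
      intro l
      induction l with
      | nil => simp
      | cons h l ih => simp only [List.map_cons, List.sum_cons, Int.cast_add, ih]; rfl
    rw [h2, h1]
    simp only [Int.cast_add, Int.cast_mul, Int.cast_natCast, Pi.add_apply, nsmul_eq_mul]
    rfl
  have hconc := hS (pt d v) (hmem v (by simp)) (pt d (Nat.xor v r.dir)) (hmem _ (by simp))
    ((r.pts.map (Nat.xor v)).map (pt d))
    (by
      intro u hu
      obtain ⟨c, hc, rfl⟩ := List.mem_map.1 hu
      exact hmem c (by simp [hc]))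
    (r.pts.length - r.mult) r.mult (by simp [Nat.sub_add_cancel hmult]) hsum
  rw [subMask_iff]
  intro c hc
  obtain ⟨h, hh, rfl⟩ := List.mem_map.1 ((testBit_maskOf _ _).1 hc)
  obtain ⟨c', hc', hcc⟩ := hconc (pt d (Nat.xor v h))
    (List.mem_map_of_mem (List.mem_map_of_mem hh))
  have hEq : pt d v + pt d (Nat.xor v r.dir) - pt d (Nat.xor v h) =
      pt d (Nat.xor (Nat.xor v r.dir) h) := by
    ext i
    have := (hr v hv i i.2).2 h hh
    change (bit v i : ℝ) + (bit (Nat.xor v r.dir) i : ℝ) - (bit (Nat.xor v h) i : ℝ) =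
      (bit (Nat.xor (Nat.xor v r.dir) h) i : ℝ)
    exact_mod_cast this
  rw [hEq] at hcc
  have hlt : Nat.xor (Nat.xor v r.dir) h < 2 ^ d :=
    Nat.xor_lt_two_pow (Nat.xor_lt_two_pow hv hdir) (hpts h hh)
  rw [← pt_inj (lt_of_testBit_mask hm hc') hlt hcc]
  exact hc'

/-- A mask together with the coefficients of an affine function that vanishes on it. -/
def flatCheck (d : ℕ) (f : ℕ × List ℤ) : Bool :=
  ((List.range d).any fun i => f.2.getD (i + 1) 0 != 0) &&
  (List.range (2 ^ d)).all fun v => !f.1.testBit v ||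
    f.2.getD 0 0 + ((List.range d).map fun i => f.2.getD (i + 1) 0 * bit v i).sum == 0

/-- A nonconstant affine function is constant on the set, so all directions lie in the kernel of a
nonzero linear form. -/
theorem finrank_lt_of_flat {d m : ℕ} (hm : m < 2 ^ 2 ^ d) {f : ℕ × List ℤ}
    (hf : flatCheck d f = true) (hmf : subMask m f.1 = true) :
    Module.finrank ℝ (vectorSpan ℝ (ptSet d m)) < d := by
  simp only [flatCheck, Bool.and_eq_true, List.any_eq_true, List.mem_range, bne_iff_ne, ne_eq,
    List.all_eq_true, Bool.or_eq_true, Bool.not_eq_true', beq_iff_eq] at hf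
  obtain ⟨⟨i₀, hi₀, hne⟩, hf⟩ := hf
  rw [subMask_iff] at hmf
  let φ : (Fin d → ℝ) →ₗ[ℝ] ℝ :=
    ∑ i : Fin d, ((f.2.getD (i + 1) 0 : ℤ) : ℝ) • LinearMap.proj i
  have hφ : ∀ x, φ x = ∑ i : Fin d, ((f.2.getD (i + 1) 0 : ℤ) : ℝ) * x i := fun x => by
    simp [φ]
  have hval : ∀ x ∈ ptSet d m, φ x = -((f.2.getD 0 0 : ℤ) : ℝ) := by
    rintro _ ⟨v, hv, rfl⟩
    have h1 := (hf v (lt_of_testBit_mask hm hv)).resolve_left (by rw [hmf v hv]; simp)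
    have hs : ((List.range d).map fun i => f.2.getD (i + 1) 0 * bit v i).sum =
      ∑ i ∈ range d, f.2.getD (i + 1) 0 * bit v i := rfl
    rw [hs, Finset.sum_range] at h1
    rw [hφ, eq_neg_iff_add_eq_zero, add_comm]
    have h2 : (((f.2.getD 0 0 : ℤ) + ∑ i : Fin d, f.2.getD (i + 1) 0 * bit v i : ℤ) : ℝ) = 0 := by
      rw [h1]; simp
    push_cast at h2
    exact h2
  have hle : vectorSpan ℝ (ptSet d m) ≤ LinearMap.ker φ := by
    rw [vectorSpan_def, Submodule.span_le]
    rintro _ ⟨x, hx, y, hy, rfl⟩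
    simp [hval x hx, hval y hy]
  have hlt : LinearMap.ker φ < ⊤ := by
    rw [lt_top_iff_ne_top]
    intro htop
    have : φ = 0 := LinearMap.ker_eq_top.1 htop
    have h1 := LinearMap.congr_fun this (Pi.single ⟨i₀, hi₀⟩ 1)
    rw [hφ, Finset.sum_eq_single ⟨i₀, hi₀⟩ (by
      intro j _ hj; simp [hj]) (by simp)] at h1
    simp at h1
    exact hne h1
  calc Module.finrank ℝ (vectorSpan ℝ (ptSet d m)) ≤ Module.finrank ℝ (LinearMap.ker φ) :=
        Submodule.finrank_mono hle
    _ < Module.finrank ℝ (Fin d → ℝ) := Submodule.finrank_lt hlt.ne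
    _ = d := by simp

/-- The position of the `j`-th base point among the rows. -/
def Model.basePos (M : Model) (j : ℕ) : ℕ :=
  M.rows.idxOf ((List.range M.k).map fun i => if i = j then 1 else 0)

/-- The 0/1 points with codes `p` realize the model, provided that they span. -/
def repCheck (d : ℕ) (r : Model × List ℕ) : Bool :=
  r.1.k == d + 1 && r.1.Balanced && r.2.length == r.1.rows.length &&
  (List.range r.1.rows.length).all fun i => (List.range d).all fun t =>
    bit (r.2.getD i 0) t == ((List.range r.1.k).map fun j =>
      (r.1.row i).getD j 0 * bit (r.2.getD (r.1.basePos j) 0) t).sum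

/-- The `d + 1` base points affinely generate all points, whose affine hull has dimension at least
`d`. Hence the base points are affinely independent and possess dual functionals, without any
computation of determinants. -/
theorem fits_of_repCheck {d : ℕ} {r : Model × List ℕ} (h : repCheck d r = true)
    (hdim : d ≤ Module.finrank ℝ (vectorSpan ℝ (ptSet d (maskOf r.2)))) :
    r.1.Fits (ptSet d (maskOf r.2)) := by
  simp only [repCheck, Bool.and_eq_true, List.all_eq_true, List.mem_range, beq_iff_eq] at h
  obtain ⟨⟨⟨hk, hbal⟩, hlen⟩, hrel⟩ := h
  let b : ℕ → Fin d → ℝ := fun j => pt d (r.2.getD (r.1.basePos j) 0)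
  have hcomb : ∀ i < r.1.rows.length, comb r.1.k b (r.1.row i) = pt d (r.2.getD i 0) := by
    intro i hi
    ext t
    have hs : ((List.range r.1.k).map fun j =>
      (r.1.row i).getD j 0 * bit (r.2.getD (r.1.basePos j) 0) t).sum =
      ∑ j ∈ range r.1.k, (r.1.row i).getD j 0 * bit (r.2.getD (r.1.basePos j) 0) t := rfl
    have h1 := hrel i hi t t.2
    rw [hs] at h1
    change comb r.1.k b (r.1.row i) t = (bit (r.2.getD i 0) t : ℝ)
    rw [h1, comb, Finset.sum_apply]
    push_cast
    rfl
  have hpts : ptSet d (maskOf r.2) = r.1.points b := by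
    ext x
    constructor
    · rintro ⟨v, hv, rfl⟩
      obtain ⟨i, hi, rfl⟩ := List.getElem_of_mem ((testBit_maskOf _ _).1 hv)
      have hi' : i < r.1.rows.length := hlen ▸ hi
      exact ⟨_, r.1.row_mem hi', by rw [hcomb i hi', List.getD_eq_getElem _ _ hi]⟩
    · rintro ⟨s, hs, rfl⟩
      obtain ⟨i, hi, rfl⟩ := r.1.exists_row hs
      rw [hcomb i hi]
      have hi' : i < r.2.length := hlen.symm ▸ hi
      refine ⟨r.2.getD i 0, (testBit_maskOf _ _).2 ?_, rfl⟩
      rw [List.getD_eq_getElem _ _ hi']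
      exact List.getElem_mem hi'
  have hind : AffineIndependent ℝ fun j : Fin r.1.k => b j := by
    rw [affineIndependent_iff_le_finrank_vectorSpan ℝ _ (n := d) (by simp [hk])]
    refine hdim.trans (Submodule.finrank_mono ?_)
    rw [← direction_affineSpan, ← direction_affineSpan]
    apply AffineSubspace.direction_le
    rw [hpts]
    exact affineSpan_le.2 (r.1.points_subset_affineSpan hbal b)
  obtain ⟨a, ha⟩ := exists_isDual hind
  exact ⟨b, a, ha, hpts⟩

/-- The data for the classification of the sets of 0/1 points in dimension `d` that satisfy
`Star`. -/
structure Enumeration where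
  d : ℕ
  gens : List Gen
  comps : List (Gen × Gen)
  rules : List StarRule
  flats : List (ℕ × List ℤ)
  reps : List (Model × List ℕ)

def Gen.reduces (g : Gen) (m : ℕ) : Bool :=
  bif Nat.beq (Nat.land m g.bad) 0 then Nat.blt (g.app m) m else false

def reducesComp (g : Gen × Gen) (m : ℕ) : Bool :=
  bif Nat.beq (Nat.land m g.1.bad) 0 then
    bif Nat.beq (Nat.land (g.1.app m) g.2.bad) 0 then Nat.blt (g.2.app (g.1.app m)) m else false
  else false

/-- Every mask must be disposed of in one of five ways: it becomes smaller under a change of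
coordinates, it violates `Star`, it becomes smaller under a composition of two changes (the first of
which may enlarge it), it lies in a hyperplane, or it is a listed representative. -/
def Enumeration.maskCheck (e : Enumeration) (m : ℕ) : Bool :=
  (e.gens.any fun g => g.reduces m) || ((e.rules.any fun r => (List.range (2 ^ e.d)).any fun v =>
    bif subMask (r.premise v) m then !(subMask (r.conclusion v) m) else false) ||
  ((e.comps.any fun g => reducesComp g m) || ((e.flats.any fun f => subMask m f.1) ||
    e.reps.any fun r => Nat.beq (maskOf r.2) m)))

def Enumeration.valid (e : Enumeration) : Bool :=
  (e.gens.all fun g => g.check e.d) && (e.comps.all fun g => g.1.check e.d && g.2.check e.d) &&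
  (e.rules.all fun r => r.check e.d) && (e.flats.all fun f => flatCheck e.d f) &&
  (e.reps.all fun r => repCheck e.d r && r.1.HasUnits)

/-- Test all numbers whose binary digits above the last `k` are those of `b`. -/
def allBits : ℕ → ℕ → (ℕ → Bool) → Bool
  | 0, b, f => f b
  | k + 1, b, f => allBits k (Nat.mul 2 b) f && allBits k (Nat.succ (Nat.mul 2 b)) f

/-- The numbers with given leading digits split into two halves by the next digit. The depth of the
recursion is thus the number of digits, not the number of masks. -/
theorem of_allBits {k b : ℕ} {f : ℕ → Bool} (h : allBits k b f = true) {m : ℕ}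
    (h1 : 2 ^ k * b ≤ m) (h2 : m < 2 ^ k * (b + 1)) : f m = true := by
  induction k generalizing b with
  | zero =>
    have : m = b := by omega
    subst this; exact h
  | succ k ih =>
    have h' : allBits k (2 * b) f = true ∧ allBits k (2 * b + 1) f = true := by
      simpa [allBits] using h
    rw [pow_succ] at h1 h2
    by_cases hm : m < 2 ^ k * (2 * b + 1)
    · exact ih h'.1 (by nlinarith) hm
    · exact ih h'.2 (not_lt.1 hm) (by nlinarith)

/-- Take the least mask `m` whose point set is affinely equivalent to `W`. A change of coordinates
leading to a smaller mask contradicts minimality, a violated rule contradicts `Star`, and a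
hyperplane contradicts the dimension. Only the representatives remain, and their models are
transported back to `W`. -/
theorem Enumeration.classify {e : Enumeration} (hv : e.valid = true)
    (hall : allBits (2 ^ e.d) 0 e.maskCheck = true) {E : Type*} [AddCommGroup E] [Module ℝ E]
    [FiniteDimensional ℝ E] {W : Set E} (hW : ∃ m < 2 ^ 2 ^ e.d, AffEq W (ptSet e.d m))
    (hS : Star W) (hdim : Module.finrank ℝ (vectorSpan ℝ W) = e.d) :
    ∃ r ∈ e.reps, r.1.Fits W := by
  classical
  obtain ⟨⟨hm, hWm⟩, hmin⟩ := Nat.find_spec hW, fun k => Nat.find_min' (m := k) hW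
  set m := Nat.find hW
  simp only [Enumeration.valid, Bool.and_eq_true, List.all_eq_true] at hv
  obtain ⟨⟨⟨⟨hgens, hcomps⟩, hrules⟩, hflats⟩, hreps⟩ := hv
  have hdm : Module.finrank ℝ (vectorSpan ℝ (ptSet e.d m)) = e.d := hWm.finrank_eq.trans hdim
  have h := of_allBits hall (m := m) (by simp) (by simpa using hm)
  simp only [Enumeration.maskCheck, Bool.or_eq_true, List.any_eq_true, List.mem_range] at h
  rcases h with ⟨g, hg, h⟩ | ⟨r, hr, v, hv, h⟩ | ⟨g, hg, h⟩ | ⟨f, hf, h⟩ | ⟨r, hr, h⟩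
  · unfold Gen.reduces at h
    cases h0 : Nat.beq (Nat.land m g.bad) 0 with
    | false => rw [h0, cond_false] at h; exact absurd h (by simp)
    | true =>
      rw [h0, cond_true, Nat.blt_eq] at h
      obtain ⟨h1, h2⟩ := Gen.affEq (hgens g hg) hm (Nat.eq_of_beq_eq_true h0)
      exact absurd (hmin _ ⟨h2, hWm.trans h1⟩) (not_le.2 h)
  · cases h0 : subMask (r.premise v) m with
    | false => rw [h0, cond_false] at h; exact absurd h (by simp)
    | true =>
      rw [h0, cond_true, (hS.congr hWm).subMask_conclusion hm (hrules r hr) hv h0] at h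
      exact absurd h (by simp)
  · unfold reducesComp at h
    cases h0 : Nat.beq (Nat.land m g.1.bad) 0 with
    | false => rw [h0, cond_false] at h; exact absurd h (by simp)
    | true =>
      rw [h0, cond_true] at h
      obtain ⟨h1, h2⟩ := Gen.affEq (hcomps g hg).1 hm (Nat.eq_of_beq_eq_true h0)
      cases h0' : Nat.beq (Nat.land (g.1.app m) g.2.bad) 0 with
      | false => rw [h0', cond_false] at h; exact absurd h (by simp)
      | true =>
        rw [h0', cond_true, Nat.blt_eq] at h
        obtain ⟨h3, h4⟩ := Gen.affEq (hcomps g hg).2 h2 (Nat.eq_of_beq_eq_true h0')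
        exact absurd (hmin _ ⟨h4, (hWm.trans h1).trans h3⟩) (not_le.2 h)
  · exact absurd hdm (finrank_lt_of_flat hm (hflats f hf) h).ne
  · have hmr := Nat.eq_of_beq_eq_true h
    obtain ⟨hrc, hru⟩ := hreps r hr
    have hbal : r.1.Balanced = true := by
      simp only [repCheck, Bool.and_eq_true] at hrc
      exact hrc.1.1.2
    refine ⟨r, hr, Model.Fits.congr hbal ?_ (Model.exists_unit hru) hWm.symm⟩
    rw [← hmr]
    apply fits_of_repCheck hrc
    rw [hmr, hdm]

/-! ### Models of the types, with certificates for their face lattices -/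

def modelSimplex4 : Model where
  k := 5
  rows :=
    [[1, 0, 0, 0, 0], [0, 1, 0, 0, 0], [0, 0, 1, 0, 0], [0, 0, 0, 1, 0], [0, 0, 0, 0, 1]]

def dataSimplex4 : LatticeData where
  facets :=
    [[0, 0, 0, 0, 1], [0, 0, 0, 1, 0], [0, 0, 1, 0, 0], [0, 1, 0, 0, 0], [1, 0, 0, 0, 0]]
  rules :=
    []

def modelPyramidSquarePyramid : Model where
  k := 5
  rows :=
    [[1, 0, 0, 0, 0], [0, 1, 0, 0, 0], [0, 0, 1, 0, 0], [-1, 1, 1, 0, 0], [0, 0, 0, 1, 0], [0, 0,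
    0, 0, 1]]

def dataPyramidSquarePyramid : LatticeData where
  facets :=
    [[0, 0, 0, 0, 1], [0, 0, 0, 1, 0], [0, 0, 1, 0, 0], [0, 1, 0, 0, 0], [1, 0, 1, 0, 0], [1, 1,
    0, 0, 0]]
  rules :=
    [([0, 3], [1, 2]), ([1, 2], [0, 3])]

def modelBirkhoff3 : Model where
  k := 5
  rows :=
    [[1, 0, 0, 0, 0], [0, 1, 0, 0, 0], [0, 0, 1, 0, 0], [0, 0, 0, 1, 0], [0, 0, 0, 0, 1], [1, -1,
    -1, 1, 1]]

def dataBirkhoff3 : LatticeData where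
  facets :=
    [[0, 0, 0, 0, 1], [0, 0, 0, 1, 0], [1, 0, 0, 0, 0], [0, 0, 1, 0, 1], [0, 1, 0, 0, 1], [0, 0,
    1, 1, 0], [0, 1, 0, 1, 0], [1, 0, 1, 0, 0], [1, 1, 0, 0, 0]]
  rules :=
    [([1, 2, 5], [0, 3, 4]), ([0, 3, 4], [1, 2, 5])]

/-- Six points spanning dimension four have a single affine dependence, and only its signs matter
for the face lattice. `modelBirkhoff3`, this model and `modelFreeSumC` all have three coefficients
of either sign, so they are free sums of two triangles combinatorially. The coefficients differ,
however, and both additional models occur among the representatives. -/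
def modelFreeSumB : Model where
  k := 5
  rows :=
    [[1, 0, 0, 0, 0], [0, 1, 0, 0, 0], [0, 0, 1, 0, 0], [-1, 1, 1, 2, -2], [0, 0, 0, 0, 1], [0, 0,
    0, 1, 0]]

def dataFreeSumB : LatticeData where
  facets :=
    [[0, 0, 0, 1, 1], [0, 0, 0, 1, 0], [2, 0, 0, 1, 0], [0, 0, 2, 0, 1], [0, 2, 0, 0, 1], [0, 0,
    1, 0, 0], [0, 1, 0, 0, 0], [1, 0, 1, 0, 0], [1, 1, 0, 0, 0]]
  rules :=
    [([0, 3, 4, 4], [1, 2, 5, 5]), ([1, 2, 5, 5], [0, 3, 4, 4])]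

def modelFreeSumC : Model where
  k := 5
  rows :=
    [[1, 0, 0, 0, 0], [0, 1, 0, 0, 0], [0, 0, 0, 0, 1], [0, 0, 1, 0, 0], [0, 0, 0, 1, 0], [2, -3,
    1, 2, -1]]

def dataFreeSumC : LatticeData where
  facets :=
    [[0, 0, 0, 1, 0], [0, 0, 1, 0, 0], [1, 0, 0, 0, 0], [0, 0, 0, 1, 2], [0, 2, 0, 3, 0], [0, 0,
    1, 0, 1], [0, 1, 3, 0, 0], [1, 0, 0, 0, 2], [3, 2, 0, 0, 0]]
  rules :=
    [([1, 1, 1, 2, 5], [0, 0, 3, 4, 4]), ([0, 0, 3, 4, 4], [1, 1, 1, 2, 5])]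

def modelPyramidTriangularPrism : Model where
  k := 5
  rows :=
    [[1, 0, 0, 0, 0], [0, 1, 0, 0, 0], [0, 0, 1, 0, 0], [-1, 1, 1, 0, 0], [0, 0, 0, 1, 0], [-1, 1,
    0, 1, 0], [0, 0, 0, 0, 1]]

def dataPyramidTriangularPrism : LatticeData where
  facets :=
    [[0, 0, 0, 0, 1], [0, 0, 0, 1, 0], [0, 1, 0, 0, 0], [1, 0, 1, 1, 0], [0, 0, 1, 0, 0], [1, 1,
    0, 0, 0]]
  rules :=
    [([0, 3], [1, 2]), ([0, 5], [1, 4]), ([1, 2], [0, 3]), ([2, 5], [3, 4]), ([1, 4], [0, 5]),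
    ([3, 4], [2, 5])]

def modelWedgeW : Model where
  k := 5
  rows :=
    [[1, 0, 0, 0, 0], [0, 1, 0, 0, 0], [0, 0, 1, 0, 0], [-1, 1, 1, 0, 0], [0, 0, 0, 1, 0], [-1, 0,
    1, 1, 0], [0, 0, 0, 0, 1], [-1, 1, 0, 0, 1]]

def dataWedgeW : LatticeData where
  facets :=
    [[0, 0, 0, 0, 1], [0, 1, 0, 0, 0], [1, 0, 1, 0, 1], [0, 0, 0, 1, 0], [0, 0, 1, 0, 0], [1, 1,
    0, 1, 0], [1, 1, 1, 0, 0]]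
  rules :=
    [([0, 3], [1, 2]), ([0, 5], [2, 4]), ([0, 7], [1, 6]), ([1, 2], [0, 3]), ([2, 4], [0, 5]),
    ([2, 7], [3, 6]), ([1, 5], [3, 4]), ([1, 6], [0, 7]), ([3, 4], [1, 5]), ([3, 6], [2, 7])]

def modelPyramidCube : Model where
  k := 5
  rows :=
    [[1, 0, 0, 0, 0], [0, 1, 0, 0, 0], [0, 0, 1, 0, 0], [-1, 1, 1, 0, 0], [1, -1, 0, 1, 0], [0, 0,
    0, 1, 0], [0, -1, 1, 1, 0], [-1, 0, 1, 1, 0], [0, 0, 0, 0, 1]]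

def dataPyramidCube : LatticeData where
  facets :=
    [[0, 0, 0, 0, 1], [0, 0, 0, 1, 0], [0, 0, 1, 0, 0], [0, 1, 0, 1, 0], [1, 0, 1, 0, 0], [1, 1,
    0, 1, 0], [1, 1, 1, 0, 0]]
  rules :=
    [([0, 3], [1, 2]), ([0, 5], [1, 4]), ([0, 6], [2, 4]), ([0, 7], [1, 6]), ([2, 7], [3, 6]),
    ([3, 4], [2, 5]), ([1, 2], [0, 3]), ([1, 4], [0, 5]), ([1, 6], [2, 5]), ([2, 5], [0, 7]), ([1,
    7], [3, 5]), ([2, 4], [0, 6]), ([3, 5], [1, 7]), ([3, 6], [2, 7]), ([4, 7], [5, 6]), ([5, 6],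
    [4, 7])]

def modelPrismTetrahedron : Model where
  k := 5
  rows :=
    [[1, 0, 0, 0, 0], [0, 1, 0, 0, 0], [0, 0, 1, 0, 0], [-1, 1, 1, 0, 0], [0, 0, 0, 1, 0], [-1, 1,
    0, 1, 0], [0, 0, 0, 0, 1], [-1, 1, 0, 0, 1]]

def dataPrismTetrahedron : LatticeData where
  facets :=
    [[0, 0, 0, 0, 1], [0, 1, 0, 0, 0], [1, 0, 1, 1, 1], [0, 0, 0, 1, 0], [0, 0, 1, 0, 0], [1, 1,
    0, 0, 0]]
  rules :=
    [([0, 3], [1, 2]), ([0, 5], [1, 4]), ([0, 7], [1, 6]), ([1, 2], [0, 3]), ([2, 5], [3, 4]),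
    ([2, 7], [3, 6]), ([1, 4], [0, 5]), ([3, 4], [2, 5]), ([4, 7], [5, 6]), ([1, 6], [0, 7]), ([3,
    6], [2, 7]), ([5, 6], [4, 7])]

def modelProductTriangles : Model where
  k := 5
  rows :=
    [[1, 0, 0, 0, 0], [0, 1, 0, 0, 0], [0, 0, 1, 0, 0], [0, 0, 0, 1, 0], [-1, 1, 0, 1, 0], [-1, 0,
    1, 1, 0], [0, 0, 0, 0, 1], [-1, 1, 0, 0, 1], [-1, 0, 1, 0, 1]]

def dataProductTriangles : LatticeData where
  facets :=
    [[0, 0, 0, 0, 1], [0, 0, 1, 0, 0], [0, 1, 0, 0, 0], [1, 0, 0, 1, 1], [0, 0, 0, 1, 0], [1, 1,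
    1, 0, 0]]
  rules :=
    [([0, 4], [1, 3]), ([0, 5], [2, 3]), ([0, 7], [1, 6]), ([0, 8], [2, 6]), ([1, 3], [0, 4]),
    ([2, 3], [0, 5]), ([3, 7], [4, 6]), ([3, 8], [5, 6]), ([1, 5], [2, 4]), ([1, 6], [0, 7]), ([1,
    8], [2, 7]), ([2, 4], [1, 5]), ([4, 6], [3, 7]), ([4, 8], [5, 7]), ([2, 6], [0, 8]), ([2, 7],
    [1, 8]), ([5, 6], [3, 8]), ([5, 7], [4, 8])]

def modelPrismSquarePyramid : Model where
  k := 5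
  rows :=
    [[1, 0, 0, 0, 0], [0, 1, 0, 0, 0], [0, 0, 1, 0, 0], [-1, 1, 1, 0, 0], [1, -1, 0, 1, 0], [0, 0,
    0, 1, 0], [0, -1, 1, 1, 0], [-1, 0, 1, 1, 0], [0, 0, 0, 0, 1], [-1, 1, 0, 0, 1]]

def dataPrismSquarePyramid : LatticeData where
  facets :=
    [[0, 0, 0, 0, 1], [0, 1, 0, 1, 0], [1, 0, 1, 0, 1], [0, 0, 0, 1, 0], [0, 0, 1, 0, 0], [1, 1,
    0, 1, 0], [1, 1, 1, 0, 0]]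
  rules :=
    [([0, 3], [1, 2]), ([0, 5], [1, 4]), ([0, 6], [2, 4]), ([0, 7], [1, 6]), ([2, 7], [3, 6]),
    ([3, 4], [2, 5]), ([0, 9], [1, 8]), ([1, 2], [0, 3]), ([2, 4], [0, 6]), ([2, 5], [0, 7]), ([2,
    9], [3, 8]), ([1, 4], [0, 5]), ([4, 7], [5, 6]), ([4, 9], [5, 8]), ([1, 6], [3, 4]), ([3, 6],
    [2, 7]), ([5, 6], [4, 7]), ([6, 9], [7, 8]), ([1, 7], [3, 5]), ([1, 8], [0, 9]), ([3, 5], [1,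
    7]), ([3, 8], [2, 9]), ([5, 8], [4, 9]), ([7, 8], [6, 9])]

def modelProductTriangleSquare : Model where
  k := 5
  rows :=
    [[1, 0, 0, 0, 0], [0, 1, 0, 0, 0], [0, 0, 1, 0, 0], [-1, 1, 1, 0, 0], [1, -1, 0, 1, 0], [0, 0,
    0, 1, 0], [0, -1, 1, 1, 0], [-1, 0, 1, 1, 0], [1, -1, 0, 0, 1], [0, 0, 0, 0, 1], [0, -1, 1, 0,
    1], [-1, 0, 1, 0, 1]]

def dataProductTriangleSquare : LatticeData where
  facets :=
    [[0, 0, 0, 0, 1], [0, 0, 1, 0, 0], [0, 1, 0, 1, 1], [1, 0, 1, 0, 0], [1, 1, 0, 1, 1], [0, 0,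
    0, 1, 0], [1, 1, 1, 0, 0]]
  rules :=
    [([0, 3], [1, 2]), ([0, 5], [1, 4]), ([0, 6], [2, 4]), ([0, 7], [1, 6]), ([1, 7], [3, 5]),
    ([0, 9], [1, 8]), ([0, 10], [2, 8]), ([0, 11], [2, 9]), ([2, 9], [3, 8]), ([3, 8], [1, 10]),
    ([1, 4], [0, 5]), ([2, 4], [0, 6]), ([3, 4], [0, 7]), ([4, 7], [5, 6]), ([4, 9], [5, 8]), ([4,
    10], [6, 8]), ([4, 11], [5, 10]), ([5, 11], [7, 9]), ([1, 2], [0, 3]), ([1, 6], [0, 7]), ([1,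
    8], [0, 9]), ([1, 10], [2, 9]), ([3, 10], [2, 11]), ([1, 11], [3, 9]), ([2, 5], [1, 6]), ([3,
    5], [1, 7]), ([5, 6], [4, 7]), ([5, 8], [4, 9]), ([5, 10], [4, 11]), ([2, 7], [3, 6]), ([2,
    8], [0, 10]), ([2, 11], [3, 10]), ([3, 6], [2, 7]), ([6, 8], [4, 10]), ([6, 9], [5, 10]), ([6,
    11], [7, 10]), ([3, 9], [1, 11]), ([7, 8], [6, 9]), ([7, 9], [5, 11]), ([7, 10], [6, 11]),
    ([8, 11], [9, 10]), ([9, 10], [8, 11])]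

def modelCube4 : Model where
  k := 5
  rows :=
    [[1, 0, 0, 0, 0], [0, 1, 0, 0, 0], [0, 0, 1, 0, 0], [-1, 1, 1, 0, 0], [1, -1, 0, 1, 0], [0, 0,
    0, 1, 0], [0, -1, 1, 1, 0], [-1, 0, 1, 1, 0], [1, 0, -1, 0, 1], [0, 1, -1, 0, 1], [0, 0, 0, 0,
    1], [-1, 1, 0, 0, 1], [1, -1, -1, 1, 1], [0, 0, -1, 1, 1], [0, -1, 0, 1, 1], [-1, 0, 0, 1, 1]]

def dataCube4 : LatticeData where
  facets :=
    [[0, 0, 0, 0, 1], [0, 0, 0, 1, 0], [0, 0, 1, 0, 1], [0, 1, 0, 1, 0], [1, 0, 1, 0, 1], [1, 1,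
    0, 1, 0], [1, 1, 1, 0, 1], [1, 1, 1, 1, 0]]
  rules :=
    [([0, 3], [1, 2]), ([0, 5], [1, 4]), ([0, 6], [2, 4]), ([0, 7], [1, 6]), ([1, 7], [3, 5]),
    ([0, 9], [1, 8]), ([0, 10], [2, 8]), ([0, 11], [2, 9]), ([2, 9], [3, 8]), ([3, 8], [1, 10]),
    ([0, 12], [4, 8]), ([0, 13], [4, 9]), ([4, 8], [0, 12]), ([1, 13], [5, 9]), ([0, 14], [6, 8]),
    ([2, 14], [6, 10]), ([0, 15], [7, 8]), ([8, 15], [9, 14]), ([1, 12], [0, 13]), ([9, 14], [11,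
    12]), ([1, 2], [0, 3]), ([1, 4], [0, 5]), ([1, 6], [3, 4]), ([3, 6], [2, 7]), ([1, 8], [0,
    9]), ([1, 10], [0, 11]), ([1, 11], [3, 9]), ([1, 14], [4, 11]), ([1, 15], [3, 13]), ([5, 15],
    [7, 13]), ([9, 15], [11, 13]), ([2, 4], [0, 6]), ([2, 5], [1, 6]), ([2, 7], [3, 6]), ([2, 8],
    [0, 10]), ([2, 11], [3, 10]), ([2, 12], [0, 14]), ([2, 13], [1, 14]), ([2, 15], [7, 10]), ([3,
    10], [2, 11]), ([7, 10], [3, 14]), ([3, 4], [1, 6]), ([3, 5], [1, 7]), ([3, 9], [1, 11]), ([3,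
    12], [5, 10]), ([0, 10], [2, 8]), ([3, 13], [7, 9]), ([7, 11], [3, 15]), ([3, 14], [2, 15]),
    ([3, 15], [7, 11]), ([4, 7], [5, 6]), ([4, 9], [1, 12]), ([4, 10], [6, 8]), ([4, 11], [7, 8]),
    ([4, 13], [5, 12]), ([4, 14], [6, 12]), ([4, 15], [7, 12]), ([12, 15], [13, 14]), ([5, 6], [4,
    7]), ([5, 8], [1, 12]), ([5, 9], [1, 13]), ([5, 10], [1, 14]), ([5, 11], [1, 15]), ([5, 12],
    [4, 13]), ([5, 14], [4, 15]), ([6, 8], [0, 14]), ([6, 9], [2, 13]), ([6, 10], [2, 14]), ([6,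
    11], [3, 14]), ([6, 12], [4, 14]), ([6, 13], [4, 15]), ([6, 15], [7, 14]), ([7, 8], [2, 13]),
    ([7, 9], [3, 13]), ([7, 12], [6, 13]), ([7, 13], [5, 15]), ([7, 14], [6, 15]), ([8, 11], [9,
    10]), ([8, 13], [9, 12]), ([8, 14], [10, 12]), ([9, 10], [8, 11]), ([9, 12], [8, 13]), ([10,
    13], [8, 15]), ([10, 12], [8, 14]), ([10, 15], [11, 14]), ([11, 12], [10, 13]), ([11, 13], [9,
    15]), ([11, 14], [10, 15]), ([13, 14], [12, 15])]

def modelCrossPolytope4 : Model where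
  k := 5
  rows :=
    [[1, 0, 0, 0, 0], [0, 1, 0, 0, 0], [0, 0, 1, 0, 0], [0, 0, 0, 1, 0], [0, 0, 0, 0, 1], [0, 0,
    -1, 1, 1], [0, -1, 0, 1, 1], [-1, 0, 0, 1, 1]]

def dataCrossPolytope4 : LatticeData where
  facets :=
    [[0, 0, 0, 0, 1], [0, 0, 0, 1, 0], [0, 0, 1, 0, 1], [0, 0, 1, 1, 0], [0, 1, 0, 0, 1], [0, 1,
    0, 1, 0], [0, 1, 1, 0, 1], [0, 1, 1, 1, 0], [1, 0, 0, 0, 1], [1, 0, 0, 1, 0], [1, 0, 1, 0, 1],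
    [1, 0, 1, 1, 0], [1, 1, 0, 0, 1], [1, 1, 0, 1, 0], [1, 1, 1, 0, 1], [1, 1, 1, 1, 0]]
  rules :=
    [([0, 7], [1, 6]), ([2, 5], [3, 4]), ([1, 6], [2, 5]), ([3, 4], [0, 7])]

def modelPrismOctahedron : Model where
  k := 5
  rows :=
    [[1, 0, 0, 0, 0], [0, 1, 0, 0, 0], [0, 0, 1, 0, 0], [-1, 1, 1, 0, 0], [0, 0, 0, 1, 0], [-1, 1,
    0, 1, 0], [1, 0, 0, -1, 1], [0, 1, 0, -1, 1], [1, 0, -1, 0, 1], [0, 1, -1, 0, 1], [0, 0, 0, 0,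
    1], [-1, 1, 0, 0, 1]]

def dataPrismOctahedron : LatticeData where
  facets :=
    [[0, 0, 0, 0, 1], [0, 0, 0, 1, 1], [0, 0, 1, 0, 1], [0, 0, 1, 1, 1], [0, 1, 0, 0, 0], [1, 0,
    1, 1, 1], [1, 1, 0, 0, 0], [1, 1, 0, 1, 0], [1, 1, 1, 0, 0], [1, 1, 1, 1, 0]]
  rules :=
    [([1, 2], [0, 3]), ([0, 3], [1, 2]), ([2, 5], [3, 4]), ([2, 7], [3, 6]), ([2, 8], [4, 6]),
    ([2, 8], [0, 10]), ([5, 6], [1, 10]), ([2, 9], [0, 11]), ([0, 10], [2, 8]), ([1, 10], [4, 7]),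
    ([0, 11], [2, 9]), ([3, 4], [2, 5]), ([1, 6], [0, 7]), ([3, 8], [2, 9]), ([3, 9], [1, 11]),
    ([1, 11], [5, 7]), ([1, 4], [0, 5]), ([0, 5], [1, 4]), ([4, 6], [2, 8]), ([4, 7], [1, 10]),
    ([4, 9], [5, 8]), ([5, 7], [3, 9]), ([5, 8], [4, 9]), ([2, 11], [3, 10]), ([5, 10], [4, 11]),
    ([0, 7], [1, 6]), ([0, 9], [1, 8]), ([1, 8], [0, 9]), ([3, 6], [2, 7]), ([3, 10], [2, 11]),
    ([4, 11], [5, 10]), ([6, 9], [7, 8]), ([6, 11], [7, 10]), ([7, 8], [6, 9]), ([8, 11], [9,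
    10]), ([7, 10], [6, 11]), ([9, 10], [8, 11])]

def modelPyramidOctahedron : Model where
  k := 5
  rows :=
    [[1, 0, 0, 0, 0], [0, 1, 0, 0, 0], [0, 0, 1, 0, 0], [0, 0, 0, 1, 0], [0, -1, 1, 1, 0], [-1, 0,
    1, 1, 0], [0, 0, 0, 0, 1]]

def dataPyramidOctahedron : LatticeData where
  facets :=
    [[0, 0, 0, 0, 1], [0, 0, 0, 1, 0], [0, 0, 1, 0, 0], [0, 1, 0, 1, 0], [0, 1, 1, 0, 0], [1, 0,
    0, 1, 0], [1, 0, 1, 0, 0], [1, 1, 0, 1, 0], [1, 1, 1, 0, 0]]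
  rules :=
    [([1, 4], [0, 5]), ([0, 5], [2, 3]), ([2, 3], [1, 4])]

def modelBipyramidCube : Model where
  k := 5
  rows :=
    [[1, 0, 0, 0, 0], [0, 1, 0, 0, 0], [0, 0, 1, 0, 0], [0, 0, 0, 1, 0], [0, -1, 1, 1, 0], [0, 1,
    -1, 0, 1], [0, 0, 0, 0, 1], [0, 0, -1, 1, 1], [0, -1, 0, 1, 1], [-1, 0, 0, 1, 1]]

def dataBipyramidCube : LatticeData where
  facets :=
    [[0, 0, 0, 0, 1], [0, 0, 0, 1, 0], [0, 0, 1, 0, 1], [0, 1, 0, 1, 0], [0, 1, 1, 0, 1], [0, 1,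
    1, 1, 0], [1, 0, 0, 0, 1], [1, 0, 0, 1, 0], [1, 0, 1, 0, 1], [1, 1, 0, 1, 0], [1, 1, 1, 0, 1],
    [1, 1, 1, 1, 0]]
  rules :=
    [([1, 4], [2, 3]), ([1, 6], [2, 5]), ([1, 7], [3, 5]), ([1, 8], [0, 9]), ([2, 7], [4, 5]),
    ([0, 9], [2, 7]), ([4, 5], [1, 8]), ([2, 3], [1, 4]), ([2, 5], [1, 6]), ([2, 8], [4, 6]), ([3,
    5], [1, 7]), ([3, 6], [1, 8]), ([3, 8], [4, 7]), ([4, 6], [2, 8]), ([4, 7], [3, 8]), ([5, 8],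
    [6, 7]), ([6, 7], [5, 8])]

def modelWedgeOctahedron : Model where
  k := 5
  rows :=
    [[1, 0, 0, 0, 0], [0, 1, 0, 0, 0], [0, 0, 1, 0, 0], [0, 0, 0, 1, 0], [0, -1, 1, 1, 0], [-1, 0,
    1, 1, 0], [0, 0, 0, 0, 1], [0, -1, 1, 0, 1], [-1, 0, 1, 0, 1]]

def dataWedgeOctahedron : LatticeData where
  facets :=
    [[0, 0, 0, 0, 1], [0, 0, 1, 0, 0], [0, 1, 0, 1, 1], [0, 1, 1, 0, 0], [1, 0, 0, 1, 1], [1, 0,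
    1, 0, 0], [1, 1, 0, 1, 1], [0, 0, 0, 1, 0], [1, 1, 1, 0, 0]]
  rules :=
    [([2, 3], [1, 4]), ([0, 5], [2, 3]), ([3, 7], [4, 6]), ([3, 8], [5, 6]), ([1, 4], [0, 5]),
    ([5, 7], [4, 8]), ([1, 7], [0, 8]), ([0, 8], [2, 6]), ([4, 6], [3, 7]), ([4, 8], [5, 7]), ([2,
    6], [1, 7]), ([5, 6], [3, 8])]

def modelDualW : Model where
  k := 5
  rows :=
    [[1, 0, 0, 0, 0], [0, 1, 0, 0, 0], [0, 0, 1, 0, 0], [0, 0, 0, 1, 0], [-1, 0, 1, 1, 0], [0, 0,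
    0, 0, 1], [-1, 1, 0, 0, 1]]

def dataDualW : LatticeData where
  facets :=
    [[0, 0, 0, 0, 1], [0, 1, 0, 0, 0], [1, 0, 0, 1, 1], [1, 0, 1, 0, 1], [0, 0, 0, 1, 0], [0, 0,
    1, 0, 0], [1, 1, 0, 1, 0], [1, 1, 1, 0, 0]]
  rules :=
    [([0, 4], [2, 3]), ([0, 6], [1, 5]), ([2, 3], [0, 4]), ([1, 5], [0, 6])]

def modelHypersimplex : Model where
  k := 5
  rows :=
    [[1, 0, 0, 0, 0], [0, 1, 0, 0, 0], [0, 0, 1, 0, 0], [0, 0, 0, 1, 0], [0, -1, 1, 1, 0], [-1, 0,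
    1, 1, 0], [0, 1, -1, 0, 1], [0, 0, 0, 0, 1], [-1, 1, 0, 0, 1], [-1, 0, 0, 1, 1]]

def dataHypersimplex : LatticeData where
  facets :=
    [[0, 0, 0, 0, 1], [0, 0, 1, 0, 1], [0, 1, 0, 1, 0], [1, 0, 0, 1, 1], [0, 0, 0, 1, 0], [1, 1,
    1, 0, 1], [0, 1, 1, 0, 0], [1, 0, 1, 0, 1], [1, 1, 0, 1, 0], [1, 1, 1, 1, 0]]
  rules :=
    [([1, 4], [2, 3]), ([0, 5], [1, 4]), ([1, 7], [2, 6]), ([2, 6], [0, 8]), ([0, 8], [1, 7]),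
    ([1, 9], [5, 6]), ([2, 3], [0, 5]), ([3, 7], [4, 6]), ([4, 6], [0, 9]), ([0, 9], [3, 7]), ([3,
    8], [5, 6]), ([5, 6], [1, 9]), ([5, 6], [3, 8]), ([4, 8], [2, 9]), ([2, 9], [5, 7]), ([5, 7],
    [4, 8])]

def modelSpecialP : Model where
  k := 5
  rows :=
    [[1, 0, 0, 0, 0], [0, 1, 0, 0, 0], [0, 0, 1, 0, 0], [-1, 1, 1, 0, 0], [0, 0, 0, 1, 0], [0, 0,
    0, 0, 1], [0, -1, 0, 1, 1], [-1, 0, 0, 1, 1]]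

def dataSpecialP : LatticeData where
  facets :=
    [[0, 1, 0, 1, 0], [0, 1, 0, 0, 1], [0, 0, 0, 0, 1], [0, 0, 0, 1, 0], [1, 0, 1, 0, 1], [1, 0,
    1, 1, 0], [1, 1, 0, 0, 1], [1, 1, 0, 1, 0], [0, 0, 1, 0, 0]]
  rules :=
    [([1, 6], [0, 7]), ([3, 6], [2, 7]), ([0, 7], [4, 5]), ([4, 5], [1, 6]), ([2, 7], [3, 6]),
    ([1, 2], [0, 3]), ([0, 3], [1, 2])]

def modelSpecialQ1 : Model where
  k := 5
  rows :=
    [[1, 0, 0, 0, 0], [0, 1, 0, 0, 0], [0, 0, 1, 0, 0], [0, 0, 0, 1, 0], [0, -1, 1, 1, 0], [0, 0,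
    0, 0, 1], [2, -2, -1, 1, 1]]

def dataSpecialQ1 : LatticeData where
  facets :=
    [[0, 0, 0, 0, 1], [1, 0, 0, 0, 0], [0, 0, 0, 1, 0], [1, 0, 2, 0, 0], [0, 0, 1, 0, 1], [0, 0,
    1, 1, 0], [0, 1, 0, 2, 0], [1, 2, 0, 2, 0], [0, 1, 0, 1, 1], [3, 2, 2, 0, 0], [0, 1, 1, 0, 3]]
  rules :=
    [([2, 3], [1, 4]), ([1, 4], [2, 3]), ([1, 2, 2, 6], [0, 0, 4, 5]), ([0, 0, 3, 5], [1, 1, 2,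
    6]), ([0, 0, 4, 5], [1, 2, 2, 6])]

def modelSpecialQ2 : Model where
  k := 5
  rows :=
    [[1, 0, 0, 0, 0], [0, 1, 0, 0, 0], [0, 0, 1, 0, 0], [0, 0, 0, 1, 0], [0, -1, 1, 1, 0], [-1, 0,
    1, 1, 0], [0, 0, 0, 0, 1], [2, -2, -1, 1, 1]]

def dataSpecialQ2 : LatticeData where
  facets :=
    [[0, 0, 0, 0, 1], [1, 1, 0, 1, 0], [1, 0, 1, 0, 0], [1, 0, 0, 1, 0], [0, 0, 0, 1, 0], [0, 0,
    1, 0, 1], [0, 0, 1, 1, 0], [0, 1, 0, 2, 0], [0, 1, 0, 1, 1], [0, 1, 1, 0, 3], [1, 2, 0, 2, 0],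
    [1, 0, 2, 0, 0], [2, 1, 2, 0, 0], [2, 2, 1, 1, 0], [1, 1, 1, 0, 1]]
  rules :=
    [([0, 5], [2, 3]), ([2, 3], [1, 4]), ([2, 5, 5, 7], [3, 4, 4, 6]), ([1, 4], [0, 5]), ([1, 5,
    5, 7], [3, 3, 4, 6]), ([1, 2, 2, 7], [0, 0, 4, 6]), ([0, 3, 3, 6], [1, 1, 5, 7]), ([0, 0, 4,
    6], [1, 2, 2, 7]), ([3, 4, 4, 6], [2, 5, 5, 7])]

def modelTetrahedron : Model where
  k := 4
  rows :=
    [[1, 0, 0, 0], [0, 1, 0, 0], [0, 0, 1, 0], [0, 0, 0, 1]]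

def dataTetrahedron : LatticeData where
  facets :=
    [[0, 0, 0, 1], [0, 0, 1, 0], [0, 1, 0, 0], [1, 0, 0, 0]]
  rules :=
    []

def modelSquarePyramid : Model where
  k := 4
  rows :=
    [[1, 0, 0, 0], [0, 1, 0, 0], [0, 0, 1, 0], [-1, 1, 1, 0], [0, 0, 0, 1]]

def dataSquarePyramid : LatticeData where
  facets :=
    [[0, 0, 0, 1], [0, 0, 1, 0], [0, 1, 0, 0], [1, 0, 1, 0], [1, 1, 0, 0]]
  rules :=
    [([0, 3], [1, 2]), ([1, 2], [0, 3])]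

def modelTriangularPrism : Model where
  k := 4
  rows :=
    [[1, 0, 0, 0], [0, 1, 0, 0], [0, 0, 1, 0], [0, 0, 0, 1], [-1, 1, 0, 1], [-1, 0, 1, 1]]

def dataTriangularPrism : LatticeData where
  facets :=
    [[0, 0, 0, 1], [0, 0, 1, 0], [0, 1, 0, 0], [1, 0, 0, 1], [1, 1, 1, 0]]
  rules :=
    [([0, 4], [1, 3]), ([0, 5], [2, 3]), ([1, 3], [0, 4]), ([1, 5], [2, 4]), ([2, 3], [0, 5]),
    ([2, 4], [1, 5])]

def modelCube3 : Model where
  k := 4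
  rows :=
    [[1, 0, 0, 0], [0, 1, 0, 0], [0, 0, 1, 0], [-1, 1, 1, 0], [1, -1, 0, 1], [0, 0, 0, 1], [0, -1,
    1, 1], [-1, 0, 1, 1]]

def dataCube3 : LatticeData where
  facets :=
    [[0, 0, 0, 1], [0, 0, 1, 0], [0, 1, 0, 1], [1, 0, 1, 0], [1, 1, 0, 1], [1, 1, 1, 0]]
  rules :=
    [([0, 3], [1, 2]), ([0, 5], [1, 4]), ([0, 6], [2, 4]), ([0, 7], [1, 6]), ([2, 7], [3, 6]),
    ([3, 4], [2, 5]), ([1, 2], [0, 3]), ([1, 4], [0, 5]), ([1, 6], [2, 5]), ([2, 5], [0, 7]), ([1,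
    7], [3, 5]), ([2, 4], [0, 6]), ([3, 5], [1, 7]), ([3, 6], [2, 7]), ([4, 7], [5, 6]), ([5, 6],
    [4, 7])]

def modelOctahedron : Model where
  k := 4
  rows :=
    [[1, 0, 0, 0], [0, 1, 0, 0], [0, 0, 1, 0], [0, 0, 0, 1], [0, -1, 1, 1], [-1, 0, 1, 1]]

def dataOctahedron : LatticeData where
  facets :=
    [[0, 0, 0, 1], [0, 0, 1, 0], [0, 1, 0, 1], [0, 1, 1, 0], [1, 0, 0, 1], [1, 0, 1, 0], [1, 1, 0,
    1], [1, 1, 1, 0]]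
  rules :=
    [([1, 4], [0, 5]), ([0, 5], [2, 3]), ([2, 3], [1, 4])]

def modelTriangle : Model where
  k := 3
  rows :=
    [[1, 0, 0], [0, 1, 0], [0, 0, 1]]

def dataTriangle : LatticeData where
  facets :=
    [[0, 0, 1], [0, 1, 0], [1, 0, 0]]
  rules :=
    []

def modelSquare : Model where
  k := 3
  rows :=
    [[1, 0, 0], [0, 1, 0], [0, 0, 1], [-1, 1, 1]]

def dataSquare : LatticeData where
  facets :=
    [[0, 0, 1], [0, 1, 0], [1, 0, 1], [1, 1, 0]]
  rules :=
    [([0, 3], [1, 2]), ([1, 2], [0, 3])]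
theorem checkSimplex4 : modelSimplex4.Balanced && modelSimplex4.HasUnits &&
    modelSimplex4.latticeCheck dataSimplex4 = true := by decide +kernel

theorem checkPyramidSquarePyramid : modelPyramidSquarePyramid.Balanced && modelPyramidSquarePyramid.HasUnits &&
    modelPyramidSquarePyramid.latticeCheck dataPyramidSquarePyramid = true := by decide +kernel

theorem checkBirkhoff3 : modelBirkhoff3.Balanced && modelBirkhoff3.HasUnits &&
    modelBirkhoff3.latticeCheck dataBirkhoff3 = true := by decide +kernel

theorem checkFreeSumB : modelFreeSumB.Balanced && modelFreeSumB.HasUnits &&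
    modelFreeSumB.latticeCheck dataFreeSumB = true := by decide +kernel

theorem checkFreeSumC : modelFreeSumC.Balanced && modelFreeSumC.HasUnits &&
    modelFreeSumC.latticeCheck dataFreeSumC = true := by decide +kernel

theorem checkPyramidTriangularPrism : modelPyramidTriangularPrism.Balanced && modelPyramidTriangularPrism.HasUnits &&
    modelPyramidTriangularPrism.latticeCheck dataPyramidTriangularPrism = true := by decide +kernel

theorem checkWedgeW : modelWedgeW.Balanced && modelWedgeW.HasUnits &&
    modelWedgeW.latticeCheck dataWedgeW = true := by decide +kernel

theorem checkPyramidCube : modelPyramidCube.Balanced && modelPyramidCube.HasUnits &&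
    modelPyramidCube.latticeCheck dataPyramidCube = true := by decide +kernel

theorem checkPrismTetrahedron : modelPrismTetrahedron.Balanced && modelPrismTetrahedron.HasUnits &&
    modelPrismTetrahedron.latticeCheck dataPrismTetrahedron = true := by decide +kernel

theorem checkProductTriangles : modelProductTriangles.Balanced && modelProductTriangles.HasUnits &&
    modelProductTriangles.latticeCheck dataProductTriangles = true := by decide +kernel

theorem checkPrismSquarePyramid : modelPrismSquarePyramid.Balanced && modelPrismSquarePyramid.HasUnits &&
    modelPrismSquarePyramid.latticeCheck dataPrismSquarePyramid = true := by decide +kernel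

theorem checkProductTriangleSquare : modelProductTriangleSquare.Balanced && modelProductTriangleSquare.HasUnits &&
    modelProductTriangleSquare.latticeCheck dataProductTriangleSquare = true := by decide +kernel

theorem checkCube4 : modelCube4.Balanced && modelCube4.HasUnits &&
    modelCube4.latticeCheck dataCube4 = true := by decide +kernel

theorem checkCrossPolytope4 : modelCrossPolytope4.Balanced && modelCrossPolytope4.HasUnits &&
    modelCrossPolytope4.latticeCheck dataCrossPolytope4 = true := by decide +kernel

theorem checkPrismOctahedron : modelPrismOctahedron.Balanced && modelPrismOctahedron.HasUnits &&
    modelPrismOctahedron.latticeCheck dataPrismOctahedron = true := by decide +kernel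

theorem checkPyramidOctahedron : modelPyramidOctahedron.Balanced && modelPyramidOctahedron.HasUnits &&
    modelPyramidOctahedron.latticeCheck dataPyramidOctahedron = true := by decide +kernel

theorem checkBipyramidCube : modelBipyramidCube.Balanced && modelBipyramidCube.HasUnits &&
    modelBipyramidCube.latticeCheck dataBipyramidCube = true := by decide +kernel

theorem checkWedgeOctahedron : modelWedgeOctahedron.Balanced && modelWedgeOctahedron.HasUnits &&
    modelWedgeOctahedron.latticeCheck dataWedgeOctahedron = true := by decide +kernel

theorem checkDualW : modelDualW.Balanced && modelDualW.HasUnits &&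
    modelDualW.latticeCheck dataDualW = true := by decide +kernel

theorem checkHypersimplex : modelHypersimplex.Balanced && modelHypersimplex.HasUnits &&
    modelHypersimplex.latticeCheck dataHypersimplex = true := by decide +kernel

theorem checkSpecialP : modelSpecialP.Balanced && modelSpecialP.HasUnits &&
    modelSpecialP.latticeCheck dataSpecialP = true := by decide +kernel

theorem checkSpecialQ1 : modelSpecialQ1.Balanced && modelSpecialQ1.HasUnits &&
    modelSpecialQ1.latticeCheck dataSpecialQ1 = true := by decide +kernel

theorem checkSpecialQ2 : modelSpecialQ2.Balanced && modelSpecialQ2.HasUnits &&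
    modelSpecialQ2.latticeCheck dataSpecialQ2 = true := by decide +kernel

theorem checkTetrahedron : modelTetrahedron.Balanced && modelTetrahedron.HasUnits &&
    modelTetrahedron.latticeCheck dataTetrahedron = true := by decide +kernel

theorem checkSquarePyramid : modelSquarePyramid.Balanced && modelSquarePyramid.HasUnits &&
    modelSquarePyramid.latticeCheck dataSquarePyramid = true := by decide +kernel

theorem checkTriangularPrism : modelTriangularPrism.Balanced && modelTriangularPrism.HasUnits &&
    modelTriangularPrism.latticeCheck dataTriangularPrism = true := by decide +kernel

theorem checkCube3 : modelCube3.Balanced && modelCube3.HasUnits &&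
    modelCube3.latticeCheck dataCube3 = true := by decide +kernel

theorem checkOctahedron : modelOctahedron.Balanced && modelOctahedron.HasUnits &&
    modelOctahedron.latticeCheck dataOctahedron = true := by decide +kernel

theorem checkTriangle : modelTriangle.Balanced && modelTriangle.HasUnits &&
    modelTriangle.latticeCheck dataTriangle = true := by decide +kernel

theorem checkSquare : modelSquare.Balanced && modelSquare.HasUnits &&
    modelSquare.latticeCheck dataSquare = true := by decide +kernel

/-! ### Data of the enumerations in dimensions two, three and four -/

def idMat (r c : ℕ) : ℤ := if c = r + 1 then 1 else 0

/-- The reflection that replaces the coordinate `x_i` by `1 - x_i`. -/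
def flipMat (i r c : ℕ) : ℤ :=
  if r = i then (if c = 0 then 1 else if c = i + 1 then -1 else 0) else idMat r c

/-- The exchange of the coordinates `x_i` and `x_j`. -/
def swapMat (i j r c : ℕ) : ℤ :=
  if r = i then (if c = j + 1 then 1 else 0) else if r = j then (if c = i + 1 then 1 else 0)
  else idMat r c

/-- The shear that adds `e` times `x_j` to the coordinate `x_i`. -/
def shearMat (e : ℤ) (i j r c : ℕ) : ℤ := idMat r c + if r = i ∧ c = j + 1 then e else 0

def flipGen (i bad keep up s down : ℕ) : Gen := ⟨bad, keep, up, s, down, flipMat i, flipMat i⟩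

def swapGen (i j bad keep up s down : ℕ) : Gen :=
  ⟨bad, keep, up, s, down, swapMat i j, swapMat i j⟩

def addGen (i j bad keep up s down : ℕ) : Gen :=
  ⟨bad, keep, up, s, down, shearMat 1 i j, shearMat (-1) i j⟩

def subGen (i j bad keep up s down : ℕ) : Gen :=
  ⟨bad, keep, up, s, down, shearMat (-1) i j, shearMat 1 i j⟩

/-- Reflections and exchanges of coordinates preserve the cube. The shears `x_i ± x_j` preserve it
only in part; the excluded codes are those for which the new coordinate would be `2` or `-1`. -/
def coordGens : List Gen :=
  [flipGen 3 0 0 255 8 65280,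
   flipGen 2 0 0 3855 4 61680,
   flipGen 1 0 0 13107 2 52428,
   flipGen 0 0 0 21845 1 43690,
   swapGen 0 1 0 39321 8738 1 17476,
   swapGen 0 2 0 42405 2570 3 20560,
   swapGen 0 3 0 43605 170 7 21760,
   swapGen 1 2 0 50115 3084 2 12336,
   swapGen 1 3 0 52275 204 6 13056,
   swapGen 2 3 0 61455 240 4 3840,
   addGen 0 1 34952 13107 17476 1 0,
   subGen 0 1 17476 13107 0 1 34952,
   addGen 0 2 41120 3855 20560 1 0,
   subGen 0 2 20560 3855 0 1 41120,
   addGen 0 3 43520 255 21760 1 0,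
   subGen 0 3 21760 255 0 1 43520,
   addGen 1 0 34952 21845 8738 2 0,
   subGen 1 0 8738 21845 0 2 34952,
   addGen 1 2 49344 3855 12336 2 0,
   subGen 1 2 12336 3855 0 2 49344,
   addGen 1 3 52224 255 13056 2 0,
   subGen 1 3 13056 255 0 2 52224,
   addGen 2 0 41120 21845 2570 4 0,
   subGen 2 0 2570 21845 0 4 41120,
   addGen 2 1 49344 13107 3084 4 0,
   subGen 2 1 3084 13107 0 4 49344,
   addGen 2 3 61440 255 3840 4 0,
   subGen 2 3 3840 255 0 4 61440,
   addGen 3 0 43520 21845 170 8 0,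
   subGen 3 0 170 21845 0 8 43520,
   addGen 3 1 52224 13107 204 8 0,
   subGen 3 1 204 13107 0 8 52224,
   addGen 3 2 61440 3855 240 8 0,
   subGen 3 2 240 3855 0 8 61440]

/-- The first rule is typical: the neighbours `v ^^^ 1`, `v ^^^ 2`, `v ^^^ 4` add up to twice `v`
plus `v ^^^ 7`, so the five points force the three missing vertices of a 3-cube. -/
def starRules : List StarRule :=
  [⟨7, [1, 2, 4], 1⟩,
   ⟨15, [1, 2, 12], 1⟩,
   ⟨15, [7, 10, 13], 2⟩,
   ⟨15, [5, 11, 14], 2⟩,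
   ⟨15, [3, 4, 8], 1⟩,
   ⟨15, [2, 4, 9], 1⟩,
   ⟨14, [2, 4, 8], 1⟩,
   ⟨15, [3, 4, 4, 9, 10], 2⟩,
   ⟨15, [7, 9, 14], 2⟩,
   ⟨13, [1, 4, 8], 1⟩,
   ⟨15, [1, 6, 10, 13], 2⟩,
   ⟨15, [1, 2, 4, 8], 1⟩,
   ⟨15, [1, 1, 6, 10, 12], 2⟩,
   ⟨11, [3, 9, 10], 2⟩,
   ⟨15, [5, 6, 8, 11], 2⟩,
   ⟨15, [3, 5, 6, 8, 8], 2⟩,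
   ⟨15, [3, 4, 10, 13], 2⟩]

/-- A representative is only required to resist the listed tests. Affinely equivalent sets may
survive separately, and the same model is therefore listed several times. -/
def enumeration4 : Enumeration where
  d := 4
  gens := coordGens
  comps :=
    [(flipGen 2 0 0 3855 4 61680, subGen 2 3 3840 255 0 4 61440),
     (flipGen 1 0 0 13107 2 52428, flipGen 0 0 0 21845 1 43690),
     (flipGen 0 0 0 21845 1 43690, swapGen 1 2 0 50115 3084 2 12336),
     (flipGen 1 0 0 13107 2 52428, subGen 3 1 204 13107 0 8 52224),
     (flipGen 1 0 0 13107 2 52428, subGen 1 3 13056 255 0 2 52224),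
     (flipGen 1 0 0 13107 2 52428, subGen 1 0 8738 21845 0 2 34952),
     (flipGen 1 0 0 13107 2 52428, subGen 1 2 12336 3855 0 2 49344),
     (flipGen 2 0 0 3855 4 61680, flipGen 1 0 0 13107 2 52428),
     (flipGen 0 0 0 21845 1 43690, subGen 0 3 21760 255 0 1 43520),
     (flipGen 0 0 0 21845 1 43690, subGen 3 0 170 21845 0 8 43520),
     (flipGen 0 0 0 21845 1 43690, subGen 0 2 20560 3855 0 1 41120),
     (flipGen 3 0 0 255 8 65280, subGen 2 3 3840 255 0 4 61440)]
  rules := starRules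
  flats := [(255, [0, 0, 0, 0, 1]), (828, [-1, 0, 1, 1, 1]), (278, [-1, 1, 1, 1, 1]), (360, [-2, 1, 1, 1, 2]), (5736, [-2, 1, 1, 1, 1])]
  reps :=
    [(modelSimplex4, [0, 1, 2, 4, 8]),
     (modelSimplex4, [1, 2, 3, 4, 8]),
     (modelPyramidSquarePyramid, [0, 1, 2, 3, 4, 8]),
     (modelPyramidSquarePyramid, [2, 3, 4, 5, 0, 8]),
     (modelPyramidTriangularPrism, [0, 1, 2, 3, 4, 5, 8]),
     (modelSimplex4, [0, 3, 5, 6, 8]),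
     (modelSimplex4, [1, 3, 5, 6, 8]),
     (modelPyramidSquarePyramid, [1, 2, 5, 6, 3, 8]),
     (modelPyramidOctahedron, [1, 2, 3, 4, 5, 6, 8]),
     (modelPyramidCube, [0, 1, 2, 3, 4, 5, 6, 7, 8]),
     (modelPyramidTriangularPrism, [2, 3, 4, 5, 8, 9, 0]),
     (modelPrismTetrahedron, [0, 1, 2, 3, 4, 5, 8, 9]),
     (modelBirkhoff3, [1, 2, 4, 6, 8, 9]),
     (modelDualW, [0, 1, 2, 4, 6, 8, 9]),
     (modelWedgeW, [0, 1, 2, 3, 4, 6, 8, 9]),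
     (modelSimplex4, [3, 5, 6, 8, 9]),
     (modelFreeSumB, [0, 3, 5, 6, 9, 8]),
     (modelBirkhoff3, [1, 3, 5, 6, 9, 8]),
     (modelPyramidSquarePyramid, [2, 3, 8, 9, 5, 6]),
     (modelDualW, [2, 1, 3, 8, 9, 6, 5]),
     (modelPyramidTriangularPrism, [2, 3, 4, 5, 8, 9, 6]),
     (modelSpecialP, [2, 3, 8, 9, 1, 6, 4, 5]),
     (modelPrismSquarePyramid, [0, 1, 2, 3, 4, 5, 6, 7, 8, 9]),
     (modelPyramidSquarePyramid, [5, 6, 9, 10, 0, 3]),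
     (modelPyramidSquarePyramid, [5, 6, 9, 10, 3, 4]),
     (modelDualW, [6, 3, 5, 10, 9, 4, 1]),
     (modelSpecialP, [1, 2, 9, 10, 3, 4, 5, 6]),
     (modelPyramidSquarePyramid, [0, 3, 4, 7, 9, 10]),
     (modelProductTriangles, [0, 1, 2, 4, 5, 6, 8, 9, 10]),
     (modelPyramidTriangularPrism, [4, 8, 5, 9, 6, 10, 3]),
     (modelWedgeW, [4, 6, 8, 10, 5, 9, 1, 3]),
     (modelWedgeOctahedron, [1, 2, 3, 4, 5, 6, 8, 9, 10]),
     (modelWedgeOctahedron, [8, 9, 10, 1, 2, 3, 5, 6, 7]),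
     (modelProductTriangleSquare, [0, 1, 2, 3, 4, 5, 6, 7, 8, 9, 10, 11]),
     (modelPyramidOctahedron, [3, 5, 6, 9, 10, 12, 0]),
     (modelPyramidOctahedron, [3, 5, 6, 9, 10, 12, 1]),
     (modelSpecialP, [5, 6, 1, 2, 3, 12, 9, 10]),
     (modelWedgeOctahedron, [3, 5, 6, 1, 2, 4, 9, 10, 12]),
     (modelSimplex4, [0, 7, 9, 10, 12]),
     (modelFreeSumC, [0, 1, 10, 7, 9, 12]),
     (modelPyramidSquarePyramid, [1, 2, 9, 10, 7, 12]),
     (modelSpecialQ1, [0, 1, 2, 9, 10, 7, 12]),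
     (modelPyramidTriangularPrism, [1, 9, 2, 10, 4, 12, 7]),
     (modelPyramidOctahedron, [3, 5, 6, 9, 10, 12, 7]),
     (modelHypersimplex, [1, 2, 3, 4, 5, 6, 8, 9, 10, 12]),
     (modelCrossPolytope4, [3, 5, 6, 7, 8, 9, 10, 12]),
     (modelSpecialQ2, [0, 1, 2, 5, 6, 7, 11, 12]),
     (modelCrossPolytope4, [3, 4, 6, 7, 8, 9, 11, 12]),
     (modelSpecialP, [5, 9, 7, 11, 3, 12, 6, 10]),
     (modelBipyramidCube, [3, 4, 5, 6, 7, 8, 9, 10, 11, 12]),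
     (modelPrismTetrahedron, [0, 1, 6, 7, 10, 11, 12, 13]),
     (modelWedgeOctahedron, [2, 4, 8, 6, 10, 12, 7, 11, 13]),
     (modelPrismOctahedron, [2, 3, 4, 5, 6, 7, 8, 9, 10, 11, 12, 13]),
     (modelCrossPolytope4, [1, 2, 4, 7, 8, 11, 13, 14]),
     (modelHypersimplex, [3, 5, 9, 6, 10, 12, 7, 11, 13, 14]),
     (modelCube4, [0, 1, 2, 3, 4, 5, 6, 7, 8, 9, 10, 11, 12, 13, 14, 15])]

def enumeration3 : Enumeration where
  d := 3
  gens :=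
    [flipGen 2 0 0 15 4 240,
     flipGen 1 0 0 51 2 204,
     flipGen 0 0 0 85 1 170,
     swapGen 0 1 0 153 34 1 68,
     swapGen 0 2 0 165 10 3 80,
     swapGen 1 2 0 195 12 2 48,
     addGen 0 1 136 51 68 1 0,
     subGen 0 1 68 51 0 1 136,
     addGen 0 2 160 15 80 1 0,
     subGen 0 2 80 15 0 1 160,
     addGen 1 0 136 85 34 2 0,
     subGen 1 0 34 85 0 2 136,
     addGen 1 2 192 15 48 2 0,
     subGen 1 2 48 15 0 2 192,
     addGen 2 0 160 85 10 4 0,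
     subGen 2 0 10 85 0 4 160,
     addGen 2 1 192 51 12 4 0,
     subGen 2 1 12 51 0 4 192]
  comps := []
  rules := [⟨7, [1, 2, 4], 1⟩]
  flats := [(15, [0, 0, 0, -2]), (60, [-2, 0, 2, 2]), (104, [-2, 1, 1, 1]), (22, [-2, 2, 2, 2])]
  reps :=
    [(modelTetrahedron, [0, 1, 2, 4]),
     (modelTetrahedron, [1, 2, 3, 4]),
     (modelSquarePyramid, [0, 1, 2, 3, 4]),
     (modelSquarePyramid, [2, 3, 4, 5, 0]),
     (modelTriangularPrism, [0, 2, 4, 1, 3, 5]),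
     (modelTetrahedron, [0, 3, 5, 6]),
     (modelTetrahedron, [1, 3, 5, 6]),
     (modelSquarePyramid, [1, 2, 5, 6, 3]),
     (modelOctahedron, [1, 2, 3, 4, 5, 6]),
     (modelCube3, [0, 1, 2, 3, 4, 5, 6, 7])]

def enumeration2 : Enumeration where
  d := 2
  gens :=
    [flipGen 1 0 0 3 2 12,
     flipGen 0 0 0 5 1 10,
     swapGen 0 1 0 9 2 1 4,
     addGen 0 1 8 3 4 1 0,
     subGen 0 1 4 3 0 1 8,
     addGen 1 0 8 5 2 2 0,
     subGen 1 0 2 5 0 2 8]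
  comps := []
  rules := []
  flats := [(3, [0, 0, -2]), (6, [-2, 2, 2])]
  reps :=
    [(modelTriangle, [0, 1, 2]),
     (modelSquare, [0, 1, 2, 3])]

theorem enumeration2_valid : enumeration2.valid = true := by decide +kernel

theorem enumeration3_valid : enumeration3.valid = true := by decide +kernel

theorem enumeration4_valid : enumeration4.valid = true := by decide +kernel

theorem enumeration2_check : allBits 4 0 enumeration2.maskCheck = true := by decide +kernel

theorem enumeration3_check : allBits 8 0 enumeration3.maskCheck = true := by decide +kernel

theorem enumeration4_check : allBits 16 0 enumeration4.maskCheck = true := by decide +kernel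

/-! ### Wedges as convex hulls -/

section ConvexHulls

variable {E : Type*} [AddCommGroup E] [Module ℝ E]

theorem convexHull_union_convexHull (s t : Set E) :
    convexHull ℝ (convexHull ℝ s ∪ convexHull ℝ t) = convexHull ℝ (s ∪ t) := by
  rw [convexHull_convexHull_union_left, convexHull_convexHull_union_right]

/-- A point `(x, t)` of the wedge lies on the vertical segment from `(x, 0)` to `(x, a x)`. The ends
lie in the hulls of the bottom and top copies of `V`, because affine maps commute with convex hulls.
-/
theorem wedge_eq_convexHull (V : Set E) (a : E →ᵃ[ℝ] ℝ) (ha : ∀ v ∈ V, 0 ≤ a v) :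
    wedge (convexHull ℝ V) a =
      convexHull ℝ ((fun v => (v, (0 : ℝ))) '' V ∪ (fun v => (v, a v)) '' V) := by
  have haX : ∀ x ∈ convexHull ℝ V, 0 ≤ a x := fun x hx => by
    have : convexHull ℝ V ⊆ a ⁻¹' Set.Ici 0 :=
      convexHull_min ha ((convex_Ici 0).affine_preimage a)
    exact this hx
  have e1 : (fun v : E => (v, (0 : ℝ))) '' convexHull ℝ V =
      convexHull ℝ ((fun v : E => (v, (0 : ℝ))) '' V) :=
    AffineMap.image_convexHull ((AffineMap.id ℝ E).prod (AffineMap.const ℝ E (0 : ℝ))) V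
  have e2 : (fun v : E => (v, a v)) '' convexHull ℝ V =
      convexHull ℝ ((fun v : E => (v, a v)) '' V) :=
    AffineMap.image_convexHull ((AffineMap.id ℝ E).prod a) V
  apply Set.Subset.antisymm
  · rintro ⟨x, t⟩ ⟨hx, h0, h1⟩
    have m1 : ((x, (0 : ℝ)) : E × ℝ) ∈ convexHull ℝ ((fun v => (v, (0 : ℝ))) '' V ∪
        (fun v => (v, a v)) '' V) :=
      convexHull_mono Set.subset_union_left (e1 ▸ ⟨x, hx, rfl⟩)
    have m2 : ((x, a x) : E × ℝ) ∈ convexHull ℝ ((fun v => (v, (0 : ℝ))) '' V ∪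
        (fun v => (v, a v)) '' V) :=
      convexHull_mono Set.subset_union_right (e2 ▸ ⟨x, hx, rfl⟩)
    simp only at h0 h1
    rcases (haX x hx).eq_or_lt with h | h
    · have : t = 0 := le_antisymm (h ▸ h1) h0
      rw [this]; exact m1
    · have := (convex_convexHull ℝ _) m1 m2 (a := 1 - t / a x) (b := t / a x)
        (sub_nonneg.2 ((div_le_one h).2 h1)) (div_nonneg h0 h.le) (by ring)
      convert this using 1
      ext
      · simp [← add_smul]
      · simp [h.ne']
  · refine convexHull_min ?_ ?_
    · rintro _ (⟨v, hv, rfl⟩ | ⟨v, hv, rfl⟩)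
      · exact ⟨subset_convexHull ℝ V hv, le_rfl, ha v hv⟩
      · exact ⟨subset_convexHull ℝ V hv, ha v hv, le_rfl⟩
    · rintro ⟨x, s⟩ ⟨hx, h0, h1⟩ ⟨y, t⟩ ⟨hy, h0', h1'⟩ c d hc hd hcd
      refine ⟨(convex_convexHull ℝ V) hx hy hc hd hcd, ?_, ?_⟩
      · have := add_nonneg (mul_nonneg hc h0) (mul_nonneg hd h0')
        simpa using this
      · have := Convex.combo_affine_apply (f := a) (x := x) (y := y) hcd
        change c • s + d • t ≤ a (c • x + d • y)
        rw [this]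
        exact add_le_add (mul_le_mul_of_nonneg_left h1 hc) (mul_le_mul_of_nonneg_left h1' hd)

end ConvexHulls

/-! ### Polytopes given by lists of integral points -/

section IntegerCoordinates

/-- A coordinate system on a real vector space, used to read lists of integers as points. -/
class IntCoords (E : Type*) [AddCommGroup E] [Module ℝ E] where
  /-- the number of coordinates -/
  num : ℕ
  /-- the coordinate functionals -/
  co : ℕ → E →ₗ[ℝ] ℝ
  /-- the point with given coordinates -/
  dec : List ℤ → E
  co_dec : ∀ i < num, ∀ p : List ℤ, co i (dec p) = (p.getD i 0 : ℤ)
  ext : ∀ x y : E, (∀ i < num, co i x = co i y) → x = y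

open IntCoords

noncomputable instance (n : ℕ) : IntCoords (Fin n → ℝ) where
  num := n
  co i := if h : i < n then LinearMap.proj ⟨i, h⟩ else 0
  dec p := fun i => (p.getD i 0 : ℤ)
  co_dec i hi p := by simp [hi]
  ext x y h := by
    ext i
    have := h i i.2
    simpa using this

noncomputable instance : IntCoords ℝ where
  num := 1
  co _ := LinearMap.id
  dec p := (p.getD 0 0 : ℤ)
  co_dec i hi p := by
    obtain rfl : i = 0 := by omega
    simp
  ext x y h := by simpa using h 0 one_pos

noncomputable instance {E E' : Type*} [AddCommGroup E] [Module ℝ E] [AddCommGroup E']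
    [Module ℝ E'] [IntCoords E] [IntCoords E'] : IntCoords (E × E') where
  num := num E + num E'
  co i := if i < num E then (co i).comp (LinearMap.fst ℝ E E')
    else (co (i - num E)).comp (LinearMap.snd ℝ E E')
  dec p := (dec (p.take (num E)), dec (p.drop (num E)))
  co_dec i hi p := by
    split_ifs with h
    · rw [LinearMap.comp_apply, LinearMap.fst_apply, co_dec i h]
      simp [List.getD_eq_getElem?_getD, h]
    · rw [LinearMap.comp_apply, LinearMap.snd_apply, co_dec _ (by omega)]
      have : num E + (i - num E) = i := by omega
      simp [List.getD_eq_getElem?_getD, List.getElem?_drop, this]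
  ext x y h := by
    refine Prod.ext (ext _ _ fun i hi => ?_) (ext _ _ fun i hi => ?_)
    · simpa [hi] using h i (by omega)
    · simpa using h (num E + i) (by omega)

noncomputable instance (n : ℕ) : IntCoords (Matrix (Fin n) (Fin n) ℝ) where
  num := n * n
  co i := if h : i < n * n then
      Matrix.entryLinearMap ℝ ℝ (⟨i / n, Nat.div_lt_of_lt_mul h⟩ : Fin n)
        (⟨i % n, Nat.mod_lt _ (Nat.pos_of_ne_zero fun h0 => by simp [h0] at h)⟩ : Fin n)
    else 0
  dec p := Matrix.of fun i j => ((p.getD (i * n + j) 0 : ℤ) : ℝ)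
  co_dec i hi p := by
    simp only [hi, dif_pos, Matrix.entryLinearMap_apply, Matrix.of_apply]
    rw [mul_comm, Nat.div_add_mod]
  ext x y h := by
    ext i j
    have hlt : (i : ℕ) * n + j < n * n := by
      have := i.2; have := j.2
      nlinarith
    have hn : 0 < n := i.pos
    have h1 : ((i : ℕ) * n + j) / n = i := by
      rw [mul_comm, Nat.mul_add_div hn, Nat.div_eq_of_lt j.2, add_zero]
    have h2 : ((i : ℕ) * n + j) % n = j := by
      rw [mul_comm, Nat.mul_add_mod, Nat.mod_eq_of_lt j.2]
    have := h _ hlt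
    simpa [hlt, h1, h2] using this

variable {E E' : Type*} [AddCommGroup E] [Module ℝ E] [IntCoords E]
  [AddCommGroup E'] [Module ℝ E'] [IntCoords E']

variable (E) in
/-- The set of points with coordinates listed in `P`. -/
def decSet (P : List (List ℤ)) : Set E := {x | ∃ p ∈ P, dec p = x}

/-- The integral barycentric combination, coordinate by coordinate. -/
def combCoord (k : ℕ) (B : List (List ℤ)) (r : List ℤ) (i : ℕ) : ℤ :=
  ((List.range k).map fun j => r.getD j 0 * (B.getD j []).getD i 0).sum

theorem co_comb (k : ℕ) (B : List (List ℤ)) (r : List ℤ) {i : ℕ} (hi : i < num E) :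
    co i (comb k (fun j => (dec (B.getD j []) : E)) r) = (combCoord k B r i : ℤ) := by
  have : combCoord k B r i = ∑ j ∈ range k, r.getD j 0 * (B.getD j []).getD i 0 := rfl
  rw [comb, map_sum, this, Int.cast_sum]
  refine Finset.sum_congr rfl fun j _ => ?_
  rw [map_smul, co_dec i hi, Int.cast_mul, smul_eq_mul]

/-- The value of the affine functional with coefficients `A` (the last entry being the constant
term) at an integral point. -/
def evalAff (n : ℕ) (A p : List ℤ) : ℤ :=
  ((List.range n).map fun i => A.getD i 0 * p.getD i 0).sum + A.getD n 0

/-- Check that the listed points form a realization of the model, `B` being the base points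
and `A` the dual functionals, scaled by `N`. -/
def fitsCheck (n : ℕ) (M : Model) (P B A : List (List ℤ)) (N : ℤ) : Bool :=
  decide (N ≠ 0) &&
  ((List.range M.k).all fun i => (List.range M.k).all fun j =>
    evalAff n (A.getD i []) (B.getD j []) == if i = j then N else 0) &&
  (M.rows.all fun r => P.any fun p => (List.range n).all fun i =>
    combCoord M.k B r i == p.getD i 0) &&
  (P.all fun p => M.rows.any fun r => (List.range n).all fun i =>
    combCoord M.k B r i == p.getD i 0)

variable (E) in
-- The dual functionals have rational coefficients in general. The common factor `N` keeps the check
-- integral and is divided out here.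
theorem fits_of_fitsCheck {M : Model} {P B A : List (List ℤ)} {N : ℤ}
    (h : fitsCheck (num E) M P B A N = true) : M.Fits (decSet E P) := by
  simp only [fitsCheck, Bool.and_eq_true, decide_eq_true_eq, List.all_eq_true, List.mem_range,
    List.any_eq_true, beq_iff_eq] at h
  obtain ⟨⟨⟨hN, hd⟩, h1⟩, h2⟩ := h
  have hN' : (N : ℝ) ≠ 0 := by exact_mod_cast hN
  have key : ∀ r p, (∀ i < num E, combCoord M.k B r i = p.getD i 0) →
      comb M.k (fun j => (dec (B.getD j []) : E)) r = dec p := by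
    intro r p h
    refine ext _ _ fun i hi => ?_
    rw [co_comb _ _ _ hi, co_dec i hi, h i hi]
  refine ⟨fun j => dec (B.getD j []), fun i =>
    (N : ℝ)⁻¹ • ((∑ l ∈ range (num E), (((A.getD i []).getD l 0 : ℤ) : ℝ) •
      (co l : E →ₗ[ℝ] ℝ)).toAffineMap + AffineMap.const ℝ E (((A.getD i []).getD (num E) 0 : ℤ) : ℝ)),
    ?_, ?_⟩
  · intro i hi j hj
    have h3 : evalAff (num E) (A.getD i []) (B.getD j []) =
      ∑ l ∈ range (num E), (A.getD i []).getD l 0 * (B.getD j []).getD l 0 +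
        (A.getD i []).getD (num E) 0 := rfl
    have h4 := hd i hi j hj
    rw [h3] at h4
    have h5 := congrArg (Int.cast : ℤ → ℝ) h4
    push_cast at h5
    simp only [AffineMap.coe_smul, AffineMap.coe_add, LinearMap.coe_toAffineMap,
      AffineMap.coe_const, Pi.smul_apply, Pi.add_apply, Function.const_apply, LinearMap.sum_apply,
      LinearMap.smul_apply, smul_eq_mul]
    rw [Finset.sum_congr rfl fun l hl => by rw [co_dec l (Finset.mem_range.1 hl)], h5]
    split_ifs
    · exact inv_mul_cancel₀ hN'
    · simp
  · ext x
    constructor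
    · rintro ⟨p, hp, rfl⟩
      obtain ⟨r, hr, h⟩ := h2 p hp
      exact ⟨r, hr, key r p h⟩
    · rintro ⟨r, hr, rfl⟩
      obtain ⟨p, hp, h⟩ := h1 r hr
      exact ⟨p, hp, (key r p h).symm⟩

/-- `X` is the convex hull of the points with coordinates listed in `P`. -/
def HasPts (X : Set E) (P : List (List ℤ)) : Prop :=
  (∀ p ∈ P, p.length = num E) ∧ X = convexHull ℝ (decSet E P)

theorem dec_append {p q : List ℤ} (hp : p.length = num E) :
    (dec (p ++ q) : E × E') = (dec p, dec q) := by
  change ((dec ((p ++ q).take (num E)), dec ((p ++ q).drop (num E))) : E × E') = _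
  rw [← hp, List.take_left', List.drop_left'] <;> rfl

/-- All concatenations. -/
def prodLists (P Q : List (List ℤ)) : List (List ℤ) := P.flatMap fun p => Q.map fun q => p ++ q

theorem decSet_prod {P Q : List (List ℤ)} (hP : ∀ p ∈ P, p.length = num E) :
    decSet (E × E') (prodLists P Q) = decSet E P ×ˢ decSet E' Q := by
  ext ⟨x, y⟩
  simp only [decSet, prodLists, List.mem_flatMap, List.mem_map, Set.mem_ofPred_eq, Set.mem_prod]
  constructor
  · rintro ⟨_, ⟨p, hp, q, hq, rfl⟩, h⟩
    rw [dec_append (hP p hp)] at h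
    exact ⟨⟨p, hp, congrArg Prod.fst h⟩, ⟨q, hq, congrArg Prod.snd h⟩⟩
  · rintro ⟨⟨p, hp, rfl⟩, ⟨q, hq, rfl⟩⟩
    exact ⟨_, ⟨p, hp, q, hq, rfl⟩, dec_append (hP p hp)⟩

theorem length_prodLists {P Q : List (List ℤ)} {m n : ℕ} (hP : ∀ p ∈ P, p.length = m)
    (hQ : ∀ q ∈ Q, q.length = n) : ∀ p ∈ prodLists P Q, p.length = m + n := by
  intro _ h
  simp only [prodLists, List.mem_flatMap, List.mem_map] at h
  obtain ⟨p, hp, q, hq, rfl⟩ := h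
  rw [List.length_append, hP p hp, hQ q hq]

theorem HasPts.prod {X : Set E} {Y : Set E'} {P Q : List (List ℤ)} (hX : HasPts X P)
    (hY : HasPts Y Q) : HasPts (X ×ˢ Y) (prodLists P Q) := by
  refine ⟨length_prodLists hX.1 hY.1, ?_⟩
  rw [decSet_prod hX.1, convexHull_prod, ← hX.2, ← hY.2]

theorem decSet_cons (p : List ℤ) (P : List (List ℤ)) : decSet E (p :: P) = {dec p} ∪ decSet E P := by
  ext x
  simp [decSet, eq_comm]

theorem decSet_nil : decSet E [] = ∅ := by
  ext x
  simp [decSet]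

theorem decSet_append (P Q : List (List ℤ)) : decSet E (P ++ Q) = decSet E P ∪ decSet E Q := by
  ext x
  simp [decSet, or_and_right, exists_or]

theorem HasPts.union {X Y : Set E} {P Q : List (List ℤ)} (hX : HasPts X P) (hY : HasPts Y Q) :
    HasPts (convexHull ℝ (X ∪ Y)) (P ++ Q) := by
  refine ⟨fun p hp => (List.mem_append.1 hp).elim (hX.1 p) (hY.1 p), ?_⟩
  rw [decSet_append, hX.2, hY.2, convexHull_union_convexHull]

theorem HasPts.single {p : List ℤ} (hp : p.length = num E) : HasPts ({dec p} : Set E) [p] := by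
  refine ⟨by simpa using hp, ?_⟩
  rw [decSet_cons, decSet_nil, Set.union_empty, convexHull_singleton]

theorem hasPts_Icc : HasPts (Set.Icc (0 : ℝ) 1) [[0], [1]] := by
  refine ⟨by simp [num], ?_⟩
  rw [decSet_cons, decSet_cons, decSet_nil, Set.union_empty, Set.singleton_union, convexHull_pair,
    segment_eq_Icc]
  · simp [dec]
  · simp [dec]

theorem HasPts.prism {X : Set E} {P : List (List ℤ)} (hX : HasPts X P) :
    HasPts (prism X) (prodLists P [[0], [1]]) := hX.prod hasPts_Icc

theorem dec_real (z : ℤ) : (dec [z] : ℝ) = z := rfl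

theorem HasPts.zero {p : List ℤ} (hp : p.length = num E) (h : ∀ z ∈ p, z = 0) :
    HasPts ({0} : Set E) [p] := by
  have : (dec p : E) = 0 := by
    refine ext _ _ fun i hi => ?_
    rw [co_dec i hi, map_zero, List.getD_eq_getElem?_getD, List.getElem?_eq_getElem (hp ▸ hi)]
    simp [h _ (List.getElem_mem _)]
  rw [← this]
  exact HasPts.single hp

theorem hasPts_real (z : ℤ) : HasPts ({(z : ℝ)} : Set ℝ) [[z]] := HasPts.single rfl

variable (E) in
/-- The coordinates of the origin. -/
def zeros : List ℤ := List.replicate (num E) 0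

theorem HasPts.pyramid {X : Set E} {P : List (List ℤ)} (hX : HasPts X P) :
    HasPts (pyramid X) (prodLists P [[0]] ++ [zeros E ++ [1]]) := by
  have h0 : HasPts ({0} : Set E) [zeros E] := HasPts.zero (by simp [zeros]) (by simp [zeros])
  have h1 := h0.prod (hasPts_real 1)
  have h2 := hX.prod (hasPts_real 0)
  have := h2.union h1
  simpa [PermutationPolytope.pyramid, prodLists, Set.singleton_prod_singleton] using this

theorem HasPts.bipyramid {X : Set E} {P : List (List ℤ)} (hX : HasPts X P) :
    HasPts (bipyramid X) (prodLists P [[0]] ++ [zeros E ++ [1], zeros E ++ [-1]]) := by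
  have h0 : HasPts ({0} : Set E) [zeros E] := HasPts.zero (by simp [zeros]) (by simp [zeros])
  have h1 := h0.prod (hasPts_real 1)
  have h1' := h0.prod (hasPts_real (-1))
  have h2 := hX.prod (hasPts_real 0)
  have h3 := (h2.union (h1.union h1'))
  refine ⟨by simpa [prodLists] using h3.1, ?_⟩
  have := h3.2
  rw [convexHull_convexHull_union_right] at this
  rw [PermutationPolytope.bipyramid, Set.pair_comm]
  simpa [prodLists, Set.singleton_prod_singleton] using this

theorem HasPts.freeSum {X : Set E} {Y : Set E'} {P Q : List (List ℤ)} (hX : HasPts X P)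
    (hY : HasPts Y Q) : HasPts (freeSum X Y) (prodLists P [zeros E'] ++ prodLists [zeros E] Q) := by
  have h0 : HasPts ({0} : Set E) [zeros E] := HasPts.zero (by simp [zeros]) (by simp [zeros])
  have h0' : HasPts ({0} : Set E') [zeros E'] := HasPts.zero (by simp [zeros]) (by simp [zeros])
  exact (hX.prod h0').union (h0.prod hY)

/-- Points over the face `l = 0` appear twice in the list, which is harmless because only the set of
listed points matters. -/
theorem HasPts.wedge {X : Set E} {P : List (List ℤ)} (hX : HasPts X P) (a : E →ᵃ[ℝ] ℝ)
    (l : E → ℝ) (hl : ∀ x, l x = a x) (z : List ℤ → ℤ) (hz : ∀ p ∈ P, a (dec p) = z p ∧ 0 ≤ z p) :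
    HasPts (wedge X l) (prodLists P [[0]] ++ P.map fun p => p ++ [z p]) := by
  obtain rfl : l = a := funext hl
  refine ⟨?_, ?_⟩
  · intro p hp
    rcases List.mem_append.1 hp with hp | hp
    · exact length_prodLists hX.1 (n := 1) (by simp) p hp
    · obtain ⟨q, hq, rfl⟩ := List.mem_map.1 hp
      rw [List.length_append, hX.1 q hq]
      rfl
  · rw [hX.2, wedge_eq_convexHull, decSet_append]
    · congr 2
      · rw [decSet_prod hX.1]
        ext ⟨x, t⟩
        simp only [decSet_cons, decSet_nil, Set.union_empty, dec_real, Int.cast_zero]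
        constructor
        · rintro ⟨v, hv, h⟩
          simp only [Prod.mk.injEq] at h
          exact ⟨h.1 ▸ hv, h.2.symm⟩
        · rintro ⟨hv, h⟩
          exact ⟨x, hv, Prod.ext rfl (Set.mem_singleton_iff.1 h).symm⟩
      · ext x
        constructor
        · rintro ⟨_, ⟨p, hp, rfl⟩, rfl⟩
          refine ⟨_, List.mem_map.2 ⟨p, hp, rfl⟩, ?_⟩
          simp only [dec_append (hX.1 p hp), dec_real, (hz p hp).1]
        · rintro ⟨_, h, rfl⟩
          obtain ⟨p, hp, rfl⟩ := List.mem_map.1 h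
          refine ⟨dec p, ⟨p, hp, rfl⟩, ?_⟩
          simp only [dec_append (hX.1 p hp), dec_real, (hz p hp).1]
    · rintro _ ⟨p, hp, rfl⟩
      rw [(hz p hp).1]
      exact_mod_cast (hz p hp).2

end IntegerCoordinates

/-! ### Vertices of simplices, crosspolytopes, cubes, the hypersimplex and the wedges -/

section StandardPolytopes

open IntCoords

/-- The unit vectors with `n` coordinates, scaled by `c`. -/
def unitList (n : ℕ) (c : ℤ) : List (List ℤ) :=
  (List.range n).map fun i => (List.range n).map fun j => if j = i then c else 0

theorem decSet_unitList (n : ℕ) (c : ℤ) :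
    decSet (Fin n → ℝ) (unitList n c) = Set.range fun i : Fin n => Pi.single i (c : ℝ) := by
  have key : ∀ i : Fin n, (dec ((List.range n).map fun j => if j = (i : ℕ) then c else 0) :
      Fin n → ℝ) = Pi.single i (c : ℝ) := by
    intro i
    funext j
    change ((((List.range n).map fun j => if j = (i : ℕ) then c else 0).getD j 0 : ℤ) : ℝ) = _
    rw [List.getD_eq_getElem?_getD]
    simp [Pi.single_apply, Fin.ext_iff]
  ext x
  constructor
  · rintro ⟨p, hp, rfl⟩
    obtain ⟨i, hi, rfl⟩ := List.mem_map.1 hp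
    exact ⟨⟨i, List.mem_range.1 hi⟩, (key ⟨i, List.mem_range.1 hi⟩).symm⟩
  · rintro ⟨i, rfl⟩
    exact ⟨_, List.mem_map.2 ⟨i, List.mem_range.2 i.2, rfl⟩, key i⟩

theorem length_unitList (n : ℕ) (c : ℤ) : ∀ p ∈ unitList n c, p.length = n := by
  intro p hp
  obtain ⟨i, -, rfl⟩ := List.mem_map.1 hp
  simp

theorem hasPts_simplex (d : ℕ) : HasPts (simplex d) (unitList (d + 1) 1) := by
  refine ⟨length_unitList _ _, ?_⟩
  rw [decSet_unitList, simplex, Int.cast_one, convexHull_rangle_single_eq_stdSimplex]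

theorem hasPts_crossPolytope (d : ℕ) :
    HasPts (crossPolytope d) (unitList d 1 ++ unitList d (-1)) := by
  refine ⟨fun p hp => (List.mem_append.1 hp).elim (length_unitList _ _ p) (length_unitList _ _ p),
    ?_⟩
  rw [decSet_append, decSet_unitList, decSet_unitList, crossPolytope]
  congr 1
  ext x
  simp only [Set.mem_ofPred_eq, Set.mem_union, Set.mem_range, ← exists_or]
  refine exists_congr fun i => ?_
  rw [eq_comm, Int.cast_one, Int.cast_neg, Int.cast_one, Pi.single_neg, @eq_comm _ x (-_)]

/-- The lists of length `n` with entries `a` or `b`. -/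
def boxList (a b : ℤ) : ℕ → List (List ℤ)
  | 0 => [[]]
  | n + 1 => prodLists [[a], [b]] (boxList a b n)

theorem mem_boxList {a b : ℤ} {n : ℕ} {p : List ℤ} :
    p ∈ boxList a b n ↔ p.length = n ∧ ∀ z ∈ p, z = a ∨ z = b := by
  induction n generalizing p with
  | zero =>
    simp only [boxList, List.mem_singleton]
    constructor
    · rintro rfl; simp
    · rintro ⟨h, -⟩; exact List.length_eq_zero_iff.1 h
  | succ n ih =>
    cases p with
    | nil => simp [boxList, prodLists]
    | cons z p =>
      simp only [boxList, prodLists, List.flatMap_cons, List.flatMap_nil, List.append_nil,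
        List.mem_append, List.mem_map, List.singleton_append, List.cons.injEq, List.length_cons,
        Nat.add_right_cancel_iff, List.mem_cons, forall_eq_or_imp]
      constructor
      · rintro (⟨q, hq, rfl, rfl⟩ | ⟨q, hq, rfl, rfl⟩)
        · exact ⟨(ih.1 hq).1, Or.inl rfl, (ih.1 hq).2⟩
        · exact ⟨(ih.1 hq).1, Or.inr rfl, (ih.1 hq).2⟩
      · rintro ⟨h1, rfl | rfl, h3⟩
        · exact Or.inl ⟨p, ih.2 ⟨h1, h3⟩, rfl, rfl⟩
        · exact Or.inr ⟨p, ih.2 ⟨h1, h3⟩, rfl, rfl⟩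

theorem exists_boxList {a b : ℤ} {n : ℕ} {x : Fin n → ℝ} (hx : ∀ i, x i = a ∨ x i = b) :
    ∃ p ∈ boxList a b n, (dec p : Fin n → ℝ) = x := by
  classical
  refine ⟨List.ofFn fun i => if x i = a then a else b, mem_boxList.2 ⟨by simp, ?_⟩, ?_⟩
  · intro z hz
    obtain ⟨i, rfl⟩ := (List.mem_ofFn' _ _).1 hz
    dsimp only
    split_ifs
    · exact Or.inl rfl
    · exact Or.inr rfl
  · funext i
    change (((List.ofFn fun i => if x i = a then a else b).getD i 0 : ℤ) : ℝ) = x i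
    rw [List.getD_eq_getElem?_getD, List.getElem?_ofFn]
    simp only [i.2, dif_pos, Option.getD_some]
    split_ifs with h
    · exact h.symm
    · exact ((hx i).resolve_left h).symm

theorem dec_boxList {a b : ℤ} {n : ℕ} {p : List ℤ} (hp : p ∈ boxList a b n) (i : Fin n) :
    (dec p : Fin n → ℝ) i = a ∨ (dec p : Fin n → ℝ) i = b := by
  obtain ⟨h1, h2⟩ := mem_boxList.1 hp
  change (((p.getD i 0 : ℤ) : ℝ) = a ∨ ((p.getD i 0 : ℤ) : ℝ) = b)
  have hi : (i : ℕ) < p.length := h1 ▸ i.2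
  rw [List.getD_eq_getElem _ _ hi]
  exact (h2 _ (List.getElem_mem hi)).imp (congrArg _) (congrArg _)

theorem hasPts_box (a b : ℤ) (hab : a ≤ b) (n : ℕ) :
    HasPts (Set.Icc (fun _ => (a : ℝ)) (fun _ => (b : ℝ)) : Set (Fin n → ℝ)) (boxList a b n) := by
  refine ⟨fun p hp => (mem_boxList.1 hp).1, ?_⟩
  have : decSet (Fin n → ℝ) (boxList a b n) = Set.univ.pi fun _ => {(a : ℝ), (b : ℝ)} := by
    ext x
    simp only [Set.mem_pi, Set.mem_univ, true_imp_iff, Set.mem_insert_iff, Set.mem_singleton_iff]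
    constructor
    · rintro ⟨p, hp, rfl⟩ i
      exact dec_boxList hp i
    · exact exists_boxList
  rw [this, convexHull_pi, ← Set.pi_univ_Icc]
  congr 1
  funext _
  rw [convexHull_pair, segment_eq_Icc (Int.cast_le.2 hab)]

theorem hasPts_cube (n : ℕ) : HasPts (cube n) (boxList 0 1 n) := by
  have := hasPts_box 0 1 zero_le_one n
  simp only [Int.cast_zero, Int.cast_one] at this
  exact this

theorem hasPts_centeredCube : HasPts centeredCube (boxList (-1) 1 3) := by
  have := hasPts_box (-1) 1 (by norm_num) 3
  simp only [Int.cast_neg, Int.cast_one] at this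
  exact this

theorem hasPts_centeredTriangle : HasPts centeredTriangle [[1, 0], [0, 1], [-1, -1]] := by
  refine ⟨by simp [num], ?_⟩
  rw [centeredTriangle, decSet_cons, decSet_cons, decSet_cons, decSet_nil, Set.union_empty]
  have h1 : (dec [1, 0] : Fin 2 → ℝ) = ![1, 0] := by
    funext i; fin_cases i <;> simp [dec]
  have h2 : (dec [0, 1] : Fin 2 → ℝ) = ![0, 1] := by
    funext i; fin_cases i <;> simp [dec]
  have h3 : (dec [-1, -1] : Fin 2 → ℝ) = ![-1, -1] := by
    funext i; fin_cases i <;> simp [dec]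
  rw [h1, h2, h3]
  rfl

/-- If only one coordinate were fractional, then it would be the difference of two integers. -/
theorem exists_ne_fractional {n : ℕ} {x : Fin n → ℝ} {m : ℤ} (hsum : ∑ i, x i = m) {i : Fin n}
    (hi0 : 0 < x i) (hi1 : x i < 1) (hx : ∀ j, 0 ≤ x j ∧ x j ≤ 1) :
    ∃ j ≠ i, 0 < x j ∧ x j < 1 := by
  by_contra! h
  have h01 : ∀ j ≠ i, ∃ z : ℤ, x j = z := by
    intro j hj
    rcases (hx j).1.eq_or_lt with h0 | h0
    · exact ⟨0, by simpa using h0.symm⟩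
    · exact ⟨1, by simpa using le_antisymm (hx j).2 (h j hj h0)⟩
  choose! z hz using h01
  have h2 : x i = ((m - ∑ j ∈ univ.erase i, z j : ℤ) : ℝ) := by
    have := Finset.add_sum_erase univ x (Finset.mem_univ i)
    rw [hsum] at this
    push_cast
    rw [← Finset.sum_congr rfl fun j hj => hz j (Finset.ne_of_mem_erase hj)]
    linarith
  rw [h2] at hi0 hi1
  have : 0 < m - ∑ j ∈ univ.erase i, z j := by exact_mod_cast hi0
  have : m - ∑ j ∈ univ.erase i, z j < 1 := by exact_mod_cast hi1
  omega

/-- A fractional coordinate `i` is accompanied by another one, `j`. Moving by a small multiple of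
`e_i - e_j` in both directions preserves the sum and the bounds, so the point is the midpoint of a
proper segment. -/
theorem extremePoints_hypersimplex {x : Fin 5 → ℝ}
    (hx : x ∈ Set.extremePoints ℝ hypersimplex) (i : Fin 5) : x i = 0 ∨ x i = 1 := by
  obtain ⟨⟨h01, hsum⟩, hext⟩ := hx
  by_contra! hi
  have hi0 := lt_of_le_of_ne (h01 i).1 hi.1.symm
  have hi1 := lt_of_le_of_ne (h01 i).2 hi.2
  obtain ⟨j, hji, hj0, hj1⟩ := exists_ne_fractional (m := 2) (by simpa using hsum) hi0 hi1 h01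
  -- The smallest distance of the two fractional coordinates from `0` and `1`.
  obtain ⟨ε, hε, he⟩ : ∃ ε > 0, ε ≤ x i ∧ ε ≤ 1 - x i ∧ ε ≤ x j ∧ ε ≤ 1 - x j :=
    ⟨min (min (x i) (1 - x i)) (min (x j) (1 - x j)),
      lt_min (lt_min hi0 (by linarith)) (lt_min hj0 (by linarith)),
      by simp, by simp, by simp, by simp⟩
  let δ : Fin 5 → ℝ := Pi.single i ε - Pi.single j ε
  have hmem : ∀ c : ℝ, (c = 1 ∨ c = -1) → x + c • δ ∈ hypersimplex := by
    intro c hc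
    constructor
    · intro l
      simp only [δ, Pi.add_apply, Pi.smul_apply, Pi.sub_apply, Pi.single_apply, smul_eq_mul]
      have := h01 l
      rcases hc with rfl | rfl <;> split_ifs with h1 h2 h2 <;> subst_vars <;>
        constructor <;> linarith
    · simp [Finset.sum_add_distrib, ← Finset.mul_sum, δ, hsum]
  have hseg : x ∈ openSegment ℝ (x + (1 : ℝ) • δ) (x + (-1 : ℝ) • δ) := by
    refine ⟨1 / 2, 1 / 2, by norm_num, by norm_num, by norm_num, ?_⟩
    funext l
    simp only [Pi.add_apply, Pi.smul_apply, smul_eq_mul]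
    ring
  have := hext (hmem 1 (Or.inl rfl)) (hmem (-1) (Or.inr rfl)) hseg
  have := congrFun this i
  simp [δ, hji.symm] at this
  exact hε.ne' this

/-- The Krein-Milman theorem reduces the claim to extreme points, which are 0/1 vectors. The closure
is harmless because the hull of finitely many points is closed. -/
theorem hasPts_hypersimplex :
    HasPts hypersimplex ((boxList 0 1 5).filter fun p => p.sum = 2) := by
  refine ⟨fun p hp => (mem_boxList.1 (List.mem_filter.1 hp).1).1, ?_⟩
  have hsum : ∀ p : List ℤ, p.length = 5 → ∑ i, (dec p : Fin 5 → ℝ) i = (p.sum : ℤ) := by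
    intro p hp
    obtain ⟨a, b, c, d, e, rfl⟩ : ∃ a b c d e, p = [a, b, c, d, e] := by
      match p, hp with
      | [a, b, c, d, e], _ => exact ⟨a, b, c, d, e, rfl⟩
    simp [Fin.sum_univ_five, dec]
    ring
  have hconv : Convex ℝ hypersimplex := by
    rintro x ⟨hx, hx'⟩ y ⟨hy, hy'⟩ a b ha hb hab
    constructor
    · intro i
      simp only [Pi.add_apply, Pi.smul_apply, smul_eq_mul]
      have h1 := mul_le_mul_of_nonneg_left (hx i).2 ha
      have h2 := mul_le_mul_of_nonneg_left (hy i).2 hb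
      exact ⟨add_nonneg (mul_nonneg ha (hx i).1) (mul_nonneg hb (hy i).1), by linarith⟩
    · simp only [Pi.add_apply, Pi.smul_apply, smul_eq_mul, Finset.sum_add_distrib,
        ← Finset.mul_sum, hx', hy']
      linarith
  have hcomp : IsCompact hypersimplex := by
    have hcl : IsClosed {x : Fin 5 → ℝ | ∑ i, x i = 2} := isClosed_eq (by fun_prop) (by fun_prop)
    have : hypersimplex = Set.Icc 0 1 ∩ {x : Fin 5 → ℝ | ∑ i, x i = 2} := by
      ext x
      simp [hypersimplex, Pi.le_def, forall_and]
    rw [this]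
    exact isCompact_Icc.inter_right hcl
  apply Set.Subset.antisymm
  · rw [← closure_convexHull_extremePoints hcomp hconv]
    have hfin : (decSet (Fin 5 → ℝ) ((boxList 0 1 5).filter fun p => p.sum = 2)).Finite := by
      have : decSet (Fin 5 → ℝ) ((boxList 0 1 5).filter fun p => p.sum = 2) =
        dec '' {p | p ∈ (boxList 0 1 5).filter fun p => p.sum = 2} := rfl
      rw [this]
      exact (List.finite_toSet _).image _
    refine closure_minimal (convexHull_mono ?_) (hfin.isClosed_convexHull (𝕜 := ℝ))
    intro x hx
    obtain ⟨p, hp, rfl⟩ := exists_boxList (a := 0) (b := 1) (x := x)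
      (by simpa using extremePoints_hypersimplex hx)
    refine ⟨p, List.mem_filter.2 ⟨hp, ?_⟩, rfl⟩
    have := hsum p (mem_boxList.1 hp).1
    rw [hx.1.2] at this
    simpa using (by exact_mod_cast this.symm : p.sum = 2)
  · refine convexHull_min ?_ hconv
    rintro _ ⟨p, hp, rfl⟩
    obtain ⟨h1, h2⟩ := List.mem_filter.1 hp
    constructor
    · intro i
      have := dec_boxList h1 i
      simp only [Int.cast_zero, Int.cast_one] at this
      rcases this with h | h <;> rw [h] <;> norm_num
    · rw [hsum p (mem_boxList.1 h1).1, of_decide_eq_true h2]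
      norm_num

theorem hasPts_squarePyramid :
    HasPts squarePyramid (prodLists (boxList 0 1 2) [[0]] ++ [zeros (Fin 2 → ℝ) ++ [1]]) :=
  (hasPts_cube 2).pyramid

theorem hasPts_wedgeW : HasPts wedgeW
    (prodLists (prodLists (boxList 0 1 2) [[0]] ++ [zeros (Fin 2 → ℝ) ++ [1]]) [[0]] ++
      (prodLists (boxList 0 1 2) [[0]] ++ [zeros (Fin 2 → ℝ) ++ [1]]).map
        fun p : List ℤ => p ++ [p.getD 0 0 + p.getD 2 0]) := by
  refine hasPts_squarePyramid.wedge (((LinearMap.proj 0).comp (LinearMap.fst ℝ (Fin 2 → ℝ) ℝ) +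
    LinearMap.snd ℝ (Fin 2 → ℝ) ℝ).toAffineMap) _ (fun x => rfl) _ fun p hp => ⟨?_, ?_⟩
  · have h0 := co_dec (E := (Fin 2 → ℝ) × ℝ) 0 (by decide) p
    have h2 := co_dec (E := (Fin 2 → ℝ) × ℝ) 2 (by decide) p
    rw [Int.cast_add, ← h0, ← h2]
    rfl
  · have : ∀ p ∈ prodLists (boxList 0 1 2) [[0]] ++ [[0, 0] ++ [1]],
      0 ≤ p.getD 0 0 + p.getD 2 0 := by decide
    exact this p hp

theorem hasPts_wedgeOctahedron : HasPts wedgeOctahedron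
    (prodLists (unitList 3 1 ++ unitList 3 (-1)) [[0]] ++ (unitList 3 1 ++ unitList 3 (-1)).map
        fun p => p ++ [1 - (p.getD 0 0 + p.getD 1 0 + p.getD 2 0)]) := by
  refine (hasPts_crossPolytope 3).wedge (AffineMap.const ℝ (Fin 3 → ℝ) (1 : ℝ) -
    (∑ i, LinearMap.proj i : (Fin 3 → ℝ) →ₗ[ℝ] ℝ).toAffineMap) _ (fun x => ?_) _
    fun p hp => ⟨?_, ?_⟩
  · simp
  · simp [Fin.sum_univ_three, dec]
  · have : ∀ p ∈ unitList 3 1 ++ unitList 3 (-1),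
      0 ≤ 1 - (p.getD 0 0 + p.getD 1 0 + p.getD 2 0) := by decide
    exact this p hp

end StandardPolytopes

open IntCoords

/-- `X` is the convex hull of a point set fitting the model. -/
def Model.Realizes {E : Type*} [AddCommGroup E] [Module ℝ E] (M : Model) (X : Set E) : Prop :=
  ∃ W : Set E, M.Fits W ∧ X = convexHull ℝ W

theorem HasPts.realizes {E : Type*} [AddCommGroup E] [Module ℝ E] [IntCoords E] {X : Set E}
    {P : List (List ℤ)} (hX : HasPts X P) {M : Model} {B A : List (List ℤ)} {N : ℤ}
    (h : fitsCheck (num E) M P B A N = true) : M.Realizes X :=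
  ⟨_, fits_of_fitsCheck E h, hX.2⟩

/-- The list of length `n` with the given entries at the given positions, and zeros elsewhere. -/
def sparse (n : ℕ) (l : List (ℕ × ℤ)) : List ℤ := (List.range n).map fun t => (l.lookup t).getD 0

/-! ### Faces of Birkhoff polytopes with prescribed support -/

section Birkhoff

/-- The injective lists with entries chosen from the members of `S`. -/
def permsIn : List (List ℕ) → List (List ℕ)
  | [] => [[]]
  | R :: S => R.flatMap fun c => ((permsIn S).filter fun l => !l.contains c).map fun l => c :: l

theorem mem_permsIn {S : List (List ℕ)} {l : List ℕ} :
    l ∈ permsIn S ↔ List.Forall₂ (· ∈ ·) l S ∧ l.Nodup := by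
  induction S generalizing l with
  | nil =>
    simp only [permsIn, List.mem_singleton, List.forall₂_nil_right_iff]
    constructor
    · rintro rfl; simp
    · exact fun h => h.1
  | cons R S ih =>
    simp only [permsIn, List.mem_flatMap, List.mem_map, List.mem_filter, ih]
    constructor
    · rintro ⟨c, hc, l, ⟨⟨h1, h2⟩, h3⟩, rfl⟩
      refine ⟨List.Forall₂.cons hc h1, List.nodup_cons.2 ⟨?_, h2⟩⟩
      simpa using h3
    · rintro ⟨h1, h2⟩
      cases h1 with
      | cons hc h1 =>
        obtain ⟨h3, h4⟩ := List.nodup_cons.1 h2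
        exact ⟨_, hc, _, ⟨⟨h1, h4⟩, by simpa using h3⟩, rfl⟩

/-- The entries of the permutation matrix of the map given by a list of values. -/
def permRow (n : ℕ) (l : List ℕ) : List ℤ :=
  (List.range (n * n)).map fun t => if l.getD (t / n) 0 = t % n then 1 else 0

theorem dec_permRow {n : ℕ} (l : List ℕ) (i j : Fin n) :
    (dec (permRow n l) : Matrix (Fin n) (Fin n) ℝ) i j = if l.getD i 0 = j then 1 else 0 := by
  change (((permRow n l).getD (i * n + j) 0 : ℤ) : ℝ) = _
  have hlt : (i : ℕ) * n + j < n * n := by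
    have := i.2; have := j.2
    nlinarith
  have hn : 0 < n := i.pos
  have h1 : ((i : ℕ) * n + j) / n = i := by
    rw [mul_comm, Nat.mul_add_div hn, Nat.div_eq_of_lt j.2, add_zero]
  have h2 : ((i : ℕ) * n + j) % n = j := by
    rw [mul_comm, Nat.mul_add_mod, Nat.mod_eq_of_lt j.2]
  rw [List.getD_eq_getElem?_getD]
  simp [permRow, hlt, h1, h2]

theorem permMatrix_apply {n : ℕ} (σ : Equiv.Perm (Fin n)) (i j : Fin n) :
    σ.permMatrix ℝ i j = if σ i = j then 1 else 0 := by
  simp [Equiv.Perm.permMatrix, PEquiv.toMatrix_apply, Equiv.toPEquiv_apply, eq_comm]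

/-- The permutation matrices with prescribed support form the vertex set of a face. -/
theorem isExposed_support {n : ℕ} (G : Subgroup (Equiv.Perm (Fin n)))
    (R : Fin n → Fin n → Prop) :
    IsExposed ℝ (permPolytope G) (convexHull ℝ
      ((fun σ : Equiv.Perm (Fin n) => σ.permMatrix ℝ) '' {σ | σ ∈ G ∧ ∀ i, R i (σ i)})) := by
  classical
  -- At a permutation matrix this functional counts the rows in which the support condition holds.
  -- It is at most `n`, with equality exactly if the condition holds in every row.
  let l : Matrix (Fin n) (Fin n) ℝ →L[ℝ] ℝ := LinearMap.toContinuousLinearMap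
    (∑ i, ∑ j, (if R i j then (1 : ℝ) else 0) • Matrix.entryLinearMap ℝ ℝ i j)
  have hl : ∀ σ : Equiv.Perm (Fin n), l (σ.permMatrix ℝ) = ∑ i, if R i (σ i) then (1 : ℝ) else 0 := by
    intro σ
    simp only [l, LinearMap.coe_toContinuousLinearMap', LinearMap.sum_apply, LinearMap.smul_apply,
      Matrix.entryLinearMap_apply, permMatrix_apply, smul_eq_mul]
    refine Finset.sum_congr rfl fun i _ => ?_
    rw [Finset.sum_eq_single (σ i)]
    · simp
    · intro j _ hj
      rw [if_neg hj.symm, mul_zero]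
    · simp
  have hle : ∀ σ : Equiv.Perm (Fin n), l (σ.permMatrix ℝ) ≤ n := by
    intro σ
    rw [hl]
    refine (Finset.sum_le_sum (g := fun _ => (1 : ℝ)) fun i _ => ?_).trans ?_
    · split_ifs <;> norm_num
    · simp
  have heq : ∀ σ : Equiv.Perm (Fin n), l (σ.permMatrix ℝ) = n ↔ ∀ i, R i (σ i) := by
    intro σ
    rw [hl, Finset.sum_boole, Nat.cast_inj]
    constructor
    · intro h i
      have h2 : (Finset.univ.filter fun i => R i (σ i)) = Finset.univ :=
        Finset.eq_univ_of_card _ (by rw [h, Fintype.card_fin])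
      have := Finset.mem_univ i
      rw [← h2] at this
      exact (Finset.mem_filter.1 this).2
    · intro h
      rw [Finset.filter_true_of_mem fun i _ => h i]
      simp
  have := isExposed_level (W := (fun σ : Equiv.Perm (Fin n) => σ.permMatrix ℝ) ''
    (G : Set (Equiv.Perm (Fin n)))) l n (by rintro _ ⟨σ, -, rfl⟩; exact hle σ)
  have hset : (fun σ : Equiv.Perm (Fin n) => σ.permMatrix ℝ) '' {σ | σ ∈ G ∧ ∀ i, R i (σ i)} =
      {w | w ∈ (fun σ : Equiv.Perm (Fin n) => σ.permMatrix ℝ) '' (G : Set (Equiv.Perm (Fin n))) ∧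
        l w = n} := by
    ext x
    constructor
    · rintro ⟨σ, ⟨h1, h2⟩, rfl⟩
      exact ⟨⟨σ, h1, rfl⟩, (heq σ).2 h2⟩
    · rintro ⟨⟨σ, h1, rfl⟩, h2⟩
      exact ⟨σ, ⟨h1, (heq σ).1 h2⟩, rfl⟩
  rw [hset]
  exact this

theorem permMatrix_image_eq_decSet {n : ℕ} {S : List (List ℕ)} (hn : S.length = n)
    (hS : ∀ R ∈ S, ∀ c ∈ R, c < n) :
    (fun σ : Equiv.Perm (Fin n) => σ.permMatrix ℝ) ''
      {σ | ∀ i : Fin n, (σ i : ℕ) ∈ S.getD i []} = decSet _ ((permsIn S).map (permRow n)) := by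
  subst hn
  ext x
  constructor
  · rintro ⟨σ, hσ, rfl⟩
    refine ⟨_, List.mem_map.2 ⟨List.ofFn fun i => (σ i : ℕ), mem_permsIn.2 ⟨?_, ?_⟩, rfl⟩, ?_⟩
    · rw [List.forall₂_iff_get]
      refine ⟨by simp, fun i h1 h2 => ?_⟩
      have := hσ ⟨i, h2⟩
      rw [List.getD_eq_getElem _ _ h2] at this
      simpa using this
    · exact List.nodup_ofFn.2 fun i j h => σ.injective (Fin.ext h)
    · ext i j
      rw [dec_permRow]
      dsimp only
      rw [permMatrix_apply]
      simp [List.getD_eq_getElem?_getD, Fin.ext_iff]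
  · rintro ⟨_, hp, rfl⟩
    obtain ⟨l, hl, rfl⟩ := List.mem_map.1 hp
    obtain ⟨h1, h2⟩ := mem_permsIn.1 hl
    rw [List.forall₂_iff_get] at h1
    obtain ⟨hlen, h1⟩ := h1
    have hlt : ∀ i (hi : i < l.length), l[i] < S.length := fun i hi =>
      hS _ (List.getElem_mem (by omega)) _ (h1 i hi (by omega))
    let f : Fin S.length → Fin S.length := fun i => ⟨l[(i : ℕ)]'(by omega), hlt i (by omega)⟩
    have hf : Function.Injective f := by
      intro i j h
      exact Fin.ext ((List.Nodup.getElem_inj_iff h2).1 (congrArg Fin.val h))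
    refine ⟨Equiv.ofBijective f (Finite.injective_iff_bijective.1 hf), ?_, ?_⟩
    · intro i
      rw [List.getD_eq_getElem _ _ i.2]
      exact h1 i (by omega) i.2
    · ext i j
      rw [dec_permRow]
      dsimp only
      rw [permMatrix_apply, List.getD_eq_getElem _ _ (by omega)]
      simp [f, Fin.ext_iff]

/-- A face of a Birkhoff polytope with listed vertices. -/
theorem exists_birkhoff_face {M : Model} (n : ℕ) (S : List (List ℕ)) {B A : List (List ℤ)} {N : ℤ}
    (h : (S.length == n && (S.all fun R => R.all fun c => decide (c < n)) &&
      fitsCheck (n * n) M ((permsIn S).map (permRow n)) B A N) = true) :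
    ∃ F : Set (Matrix (Fin n) (Fin n) ℝ), IsExposed ℝ (birkhoff n) F ∧ M.Realizes F := by
  simp only [Bool.and_eq_true, beq_iff_eq, List.all_eq_true, decide_eq_true_eq] at h
  obtain ⟨⟨h1, h2⟩, h3⟩ := h
  refine ⟨_, isExposed_support ⊤ fun i j => (j : ℕ) ∈ S.getD i [], _,
    fits_of_fitsCheck (Matrix (Fin n) (Fin n) ℝ) h3, ?_⟩
  rw [← permMatrix_image_eq_decSet h1 h2]
  simp only [Subgroup.mem_top, true_and]

theorem hasPts_birkhoff (n : ℕ) : HasPts (birkhoff n)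
    ((permsIn (List.replicate n (List.range n))).map (permRow n)) := by
  constructor
  · intro p hp
    obtain ⟨l, -, rfl⟩ := List.mem_map.1 hp
    simp [permRow, num]
  · rw [← permMatrix_image_eq_decSet (by simp) fun R hR c hc => by
      rw [List.eq_of_mem_replicate hR] at hc
      exact List.mem_range.1 hc]
    rw [birkhoff, permPolytope]
    congr 2
    ext σ
    simp

end Birkhoff

/-! ### Faces of permutation polytopes of translation groups -/

section Cyclic

/-- The translation by the vector with coordinates `∑ j, c b j * t j` of a disjoint union of `m`
copies of `ZMod 4`. -/
def shift {m : ℕ} (c : Fin m → Fin 4 → ZMod 4) :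
    Multiplicative (Fin 4 → ZMod 4) →* Equiv.Perm (Fin m × ZMod 4) where
  toFun t := Equiv.sigmaEquivProd (Fin m) (ZMod 4) |>.permCongr
    (Equiv.sigmaCongrRight fun b => Equiv.addRight (∑ j, c b j * t.toAdd j))
  map_one' := by
    ext x <;> simp [Equiv.permCongr_apply]
  map_mul' s t := by
    ext x <;> simp [Equiv.permCongr_apply, mul_add, Finset.sum_add_distrib]
    ring

theorem shift_apply {m : ℕ} (c : Fin m → Fin 4 → ZMod 4) (t : Multiplicative (Fin 4 → ZMod 4))
    (b : Fin m) (x : ZMod 4) : shift c t (b, x) = (b, x + ∑ j, c b j * t.toAdd j) := rfl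

/-- The numbering of the disjoint union of `m` copies of `ZMod 4`. -/
def blockEquiv (m : ℕ) : Fin m × ZMod 4 ≃ Fin (m * 4) := finProdFinEquiv (m := m) (n := 4)

/-- The translations as permutations of the numbers below `m * 4`. -/
def shiftHom {m : ℕ} (c : Fin m → Fin 4 → ZMod 4) :
    Multiplicative (Fin 4 → ZMod 4) →* Equiv.Perm (Fin (m * 4)) :=
  (blockEquiv m).permCongrHom.toMonoidHom.comp (shift c)

/-- The successor within a block. -/
def blockSucc {m : ℕ} (x : Fin m × ZMod 4) : Fin m × ZMod 4 := (x.1, x.2 + 1)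

/-- If every block is moved by `0` or by `1`, then block `b` of the permutation matrix is `1 - y b`
times the identity plus `y b` times the cyclic shift, with `y b` in `{0, 1}`. The matrix is thus an
affine function of `y`, and the vertices of this face correspond to the 0/1 vectors in the image of
the linear map `c` over `ZMod 4`. -/
theorem affEq_shift {m : ℕ} (c : Fin m → Fin 4 → ZMod 4) :
    AffEq ((fun σ : Equiv.Perm (Fin (m * 4)) => σ.permMatrix ℝ) ''
      {σ | σ ∈ (shiftHom c).range ∧
        ∀ i, (blockEquiv m).symm (σ i) = (blockEquiv m).symm i ∨
          (blockEquiv m).symm (σ i) = blockSucc ((blockEquiv m).symm i)})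
      {y : Fin m → ℝ | ∃ t : Fin 4 → ZMod 4, (∀ b, ∑ j, c b j * t j = 0 ∨ ∑ j, c b j * t j = 1) ∧
        ∀ b, y b = if ∑ j, c b j * t j = 0 then 0 else 1} := by
  classical
  have hperm : ∀ (t : Fin 4 → ZMod 4) (b : Fin m) (x : ZMod 4),
      shiftHom c (Multiplicative.ofAdd t)
        (blockEquiv m (b, x)) = blockEquiv m (b, x + ∑ j, c b j * t j) := by
    intro t b x
    change blockEquiv m (shift c (Multiplicative.ofAdd t)
      ((blockEquiv m).symm (blockEquiv m (b, x)))) = _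
    rw [Equiv.symm_apply_apply, shift_apply]
    rfl
  have hcond : ∀ t : Fin 4 → ZMod 4, (∀ i, (blockEquiv m).symm
      (shiftHom c (Multiplicative.ofAdd t) i) =
        (blockEquiv m).symm i ∨ (blockEquiv m).symm
      (shiftHom c (Multiplicative.ofAdd t) i) =
        blockSucc ((blockEquiv m).symm i)) ↔ ∀ b, ∑ j, c b j * t j = 0 ∨ ∑ j, c b j * t j = 1 := by
    intro t
    constructor
    · intro h b
      have := h (blockEquiv m (b, 0))
      rw [hperm, Equiv.symm_apply_apply, Equiv.symm_apply_apply] at this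
      simpa [blockSucc] using this
    · intro h i
      obtain ⟨⟨b, x⟩, rfl⟩ := (blockEquiv m).surjective i
      rw [hperm, Equiv.symm_apply_apply, Equiv.symm_apply_apply]
      simpa [blockSucc] using h b
  let e := blockEquiv m
  -- The entry in row `(b, 0)` and column `(b, 1)` tells whether block `b` is moved.
  let f : Matrix (Fin (m * 4)) (Fin (m * 4)) ℝ →ₗ[ℝ] (Fin m → ℝ) :=
    LinearMap.pi fun b => Matrix.entryLinearMap ℝ ℝ (e (b, 0)) (e (b, 1))
  -- The inverse rebuilds each block from the identity and the cyclic shift.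
  let g : (Fin m → ℝ) →ᵃ[ℝ] Matrix (Fin (m * 4)) (Fin (m * 4)) ℝ :=
    { toFun := fun y => Matrix.of fun i j => (if i = j then 1 - y (e.symm i).1 else 0) +
        (if e.symm j = blockSucc (e.symm i) then y (e.symm i).1 else 0)
      linear :=
        { toFun := fun y => Matrix.of fun i j => (if i = j then - y (e.symm i).1 else 0) +
            (if e.symm j = blockSucc (e.symm i) then y (e.symm i).1 else 0)
          map_add' := fun y z => by
            ext i j
            simp only [Pi.add_apply, Matrix.add_apply, Matrix.of_apply]
            split_ifs <;> ring
          map_smul' := fun r y => by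
            ext i j
            simp only [Pi.smul_apply, Matrix.smul_apply, smul_eq_mul, RingHom.id_apply, Matrix.of_apply]
            split_ifs <;> ring }
      map_vadd' := fun y z => by
        ext i j
        simp only [vadd_eq_add, Pi.add_apply, LinearMap.coe_mk, AddHom.coe_mk, Matrix.add_apply,
          Matrix.of_apply]
        split_ifs <;> ring }
  have hval : ∀ t : Fin 4 → ZMod 4, (∀ b, ∑ j, c b j * t j = 0 ∨ ∑ j, c b j * t j = 1) →
      ∀ b, f ((shiftHom c
        (Multiplicative.ofAdd t)).permMatrix ℝ) b = if ∑ j, c b j * t j = 0 then 0 else 1 := by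
    intro t ht b
    change (Equiv.Perm.permMatrix ℝ _) (e (b, 0)) (e (b, 1)) = _
    rw [permMatrix_apply, hperm, zero_add]
    have h01 : (0 : ZMod 4) ≠ 1 := by decide
    rcases ht b with h | h
    · rw [h, if_neg (by simpa [e] using h01), if_pos rfl]
    · rw [h, if_pos rfl, if_neg h01.symm]
  refine ⟨f.toAffineMap, g, ?_, ?_⟩
  · ext y
    constructor
    · rintro ⟨_, ⟨_, ⟨⟨t, rfl⟩, h⟩, rfl⟩, rfl⟩
      exact ⟨t.toAdd, (hcond _).1 h, hval _ ((hcond _).1 h)⟩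
    · rintro ⟨t, ht, hy⟩
      refine ⟨_, ⟨_, ⟨⟨Multiplicative.ofAdd t, rfl⟩, (hcond t).2 ht⟩, rfl⟩, ?_⟩
      ext b
      rw [hy b, ← hval t ht b]
      rfl
  · rintro _ ⟨_, ⟨⟨t, rfl⟩, h⟩, rfl⟩
    obtain ⟨t, rfl⟩ := Multiplicative.ofAdd.surjective t
    have ht := (hcond _).1 h
    dsimp only
    ext i j
    obtain ⟨⟨b, x⟩, rfl⟩ := e.surjective i
    obtain ⟨⟨b', x'⟩, rfl⟩ := e.surjective j
    have hg : ∀ y i j, g y i j = (if i = j then 1 - y (e.symm i).1 else 0) +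
        (if e.symm j = blockSucc (e.symm i) then y (e.symm i).1 else 0) := fun _ _ _ => rfl
    rw [hg, LinearMap.coe_toAffineMap]
    have h01 : (0 : ZMod 4) ≠ 1 := by decide
    rw [Equiv.symm_apply_apply, Equiv.symm_apply_apply]
    have := hval _ ht b
    rw [this, permMatrix_apply, show e (b, x) = blockEquiv m (b, x) from rfl, hperm t b x]
    simp only [e, EmbeddingLike.apply_eq_iff_eq]
    rcases ht b with h | h
    · rw [h]
      simp [blockSucc, Prod.ext_iff, eq_comm]
    · rw [h]
      simp [blockSucc, Prod.ext_iff, h01.symm, eq_comm]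

/-- A face of the permutation polytope of a group of translations with listed vertices. -/
theorem exists_shift_face {M : Model} {D : LatticeData}
    (hM : M.Balanced && M.HasUnits && M.latticeCheck D = true) (m : ℕ)
    (c : Fin m → Fin 4 → ZMod 4) (P : List (List ℤ)) {B A : List (List ℤ)} {N : ℤ}
    (h1 : ∀ t0 t1 t2 t3 : ZMod 4,
      (∀ b, ∑ j, c b j * ![t0, t1, t2, t3] j = 0 ∨ ∑ j, c b j * ![t0, t1, t2, t3] j = 1) →
        ∃ p ∈ P, ∀ b : Fin m,
          p.getD b 0 = if ∑ j, c b j * ![t0, t1, t2, t3] j = 0 then 0 else 1)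
    (h2 : ∀ p ∈ P, ∃ t0 t1 t2 t3 : ZMod 4, ∀ b : Fin m, ∑ j, c b j * ![t0, t1, t2, t3] j =
      if p.getD b 0 = 0 then 0 else 1)
    (h2' : ∀ p ∈ P, ∀ b : Fin m, p.getD b 0 = 0 ∨ p.getD b 0 = 1)
    (h3 : fitsCheck m M P B A N = true) :
    ∃ (n : ℕ) (G : Subgroup (Equiv.Perm (Fin n))) (F : Set (Matrix (Fin n) (Fin n) ℝ)),
      IsExposed ℝ (permPolytope G) F ∧ M.Realizes F := by
  simp only [Bool.and_eq_true] at hM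
  obtain ⟨⟨hM, hu⟩, -⟩ := hM
  refine ⟨m * 4, _, _, isExposed_support
    (shiftHom c).range fun i j =>
      (blockEquiv m).symm j = (blockEquiv m).symm i ∨
          (blockEquiv m).symm j = blockSucc ((blockEquiv m).symm i), _, ?_, rfl⟩
  refine Model.Fits.congr hM (fits_of_fitsCheck (Fin m → ℝ) h3) (Model.exists_unit hu) ?_
  -- It remains to identify the listed points with the 0/1 vectors in the image of `c`: `h2` shows
  -- that each listed point occurs, and `h1` shows that none is missing.
  convert (affEq_shift c).symm using 1
  have hvec : ∀ t : Fin 4 → ZMod 4, t = ![t 0, t 1, t 2, t 3] := fun t => by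
    funext i; fin_cases i <;> rfl
  have h01 : (1 : ZMod 4) ≠ 0 := by decide
  ext y
  constructor
  · rintro ⟨p, hp, rfl⟩
    obtain ⟨t0, t1, t2, t3, h⟩ := h2 p hp
    refine ⟨![t0, t1, t2, t3], fun b => ?_, fun b => ?_⟩
    · rw [h b]
      split_ifs
      · exact Or.inl rfl
      · exact Or.inr rfl
    · rw [h b]
      change ((p.getD b 0 : ℤ) : ℝ) = _
      rcases h2' p hp b with h | h <;> rw [h] <;> simp [h01]
  · rintro ⟨t, ht, hy⟩
    rw [hvec t] at ht hy
    obtain ⟨p, hp, h⟩ := h1 _ _ _ _ ht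
    refine ⟨p, hp, ?_⟩
    funext b
    change ((p.getD b 0 : ℤ) : ℝ) = _
    rw [hy b, h b]
    split_ifs <;> simp

end Cyclic

/-! ### The standard polytopes realize their models -/

theorem realizes_simplex4 : modelSimplex4.Realizes (simplex 4) :=
  (hasPts_simplex 4).realizes
    (B := [[1, 0, 0, 0, 0], [0, 1, 0, 0, 0], [0, 0, 1, 0, 0], [0, 0, 0, 1, 0], [0, 0, 0, 0, 1]])
    (A := [[1, 0, 0, 0, 0, 0], [0, 1, 0, 0, 0, 0], [0, 0, 1, 0, 0, 0], [0, 0, 0, 1, 0, 0], [0, 0, 0,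
      0, 1, 0]])
    (N := 1) (by decide +kernel)

theorem realizes_pyramidSquarePyramid : modelPyramidSquarePyramid.Realizes (pyramid squarePyramid) :=
  hasPts_squarePyramid.pyramid.realizes
    (B := [[0, 0, 0, 0], [0, 1, 0, 0], [1, 0, 0, 0], [0, 0, 1, 0], [0, 0, 0, 1]])
    (A := [[-1, -1, -1, -1, 1], [0, 1, 0, 0, 0], [1, 0, 0, 0, 0], [0, 0, 1, 0, 0], [0, 0, 0, 1, 0]])
    (N := 1) (by decide +kernel)

theorem realizes_birkhoff3 : modelBirkhoff3.Realizes (birkhoff 3) :=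
  (hasPts_birkhoff 3).realizes
    (B := [[1, 0, 0, 0, 1, 0, 0, 0, 1], [1, 0, 0, 0, 0, 1, 0, 1, 0], [0, 1, 0, 1, 0, 0, 0, 0, 1], [0,
      1, 0, 0, 0, 1, 1, 0, 0], [0, 0, 1, 1, 0, 0, 0, 1, 0]])
    (A := [[0, 0, 0, 0, 1, 0, 0, 0, 0, 0], [1, 0, 0, 0, -1, 0, 0, 0, 0, 0], [0, 0, -1, 1, 0, 0, 0, 0,
      0, 0], [0, 1, 1, -1, 0, 0, 0, 0, 0, 0], [0, 0, 1, 0, 0, 0, 0, 0, 0, 0]])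
    (N := 1) (by decide +kernel)

theorem realizes_pyramidTriangularPrism : modelPyramidTriangularPrism.Realizes (pyramid (prism (simplex 2))) :=
  (hasPts_simplex 2).prism.pyramid.realizes
    (B := [[1, 0, 0, 0, 0], [1, 0, 0, 1, 0], [0, 1, 0, 0, 0], [0, 0, 1, 0, 0], [0, 0, 0, 0, 1]])
    (A := [[1, 0, 0, -1, 0, 0], [0, 0, 0, 1, 0, 0], [0, 1, 0, 0, 0, 0], [0, 0, 1, 0, 0, 0], [0, 0, 0,
      0, 1, 0]])
    (N := 1) (by decide +kernel)

theorem realizes_wedgeW : modelWedgeW.Realizes (wedgeW) :=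
  hasPts_wedgeW.realizes
    (B := [[1, 0, 0, 0], [1, 1, 0, 0], [1, 0, 0, 1], [0, 0, 1, 0], [0, 0, 0, 0]])
    (A := [[1, -1, 0, -1, 0], [0, 1, 0, 0, 0], [0, 0, 0, 1, 0], [0, 0, 1, 0, 0], [-1, 0, -1, 0, 1]])
    (N := 1) (by decide +kernel)

theorem realizes_pyramidCube : modelPyramidCube.Realizes (pyramid (cube 3)) :=
  (hasPts_cube 3).pyramid.realizes
    (B := [[0, 0, 0, 0], [0, 0, 1, 0], [0, 1, 0, 0], [1, 0, 1, 0], [0, 0, 0, 1]])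
    (A := [[0, -1, -1, -1, 1], [-1, 0, 1, 0, 0], [0, 1, 0, 0, 0], [1, 0, 0, 0, 0], [0, 0, 0, 1, 0]])
    (N := 1) (by decide +kernel)

theorem realizes_prismTetrahedron : modelPrismTetrahedron.Realizes (prism (simplex 3)) :=
  (hasPts_simplex 3).prism.realizes
    (B := [[1, 0, 0, 0, 0], [1, 0, 0, 0, 1], [0, 1, 0, 0, 0], [0, 0, 1, 0, 0], [0, 0, 0, 1, 0]])
    (A := [[1, 0, 0, 0, -1, 0], [0, 0, 0, 0, 1, 0], [0, 1, 0, 0, 0, 0], [0, 0, 1, 0, 0, 0], [0, 0, 0,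
      1, 0, 0]])
    (N := 1) (by decide +kernel)

theorem realizes_productTriangles : modelProductTriangles.Realizes (simplex 2 ×ˢ simplex 2) :=
  ((hasPts_simplex 2).prod (hasPts_simplex 2)).realizes
    (B := [[1, 0, 0, 1, 0, 0], [1, 0, 0, 0, 1, 0], [1, 0, 0, 0, 0, 1], [0, 1, 0, 1, 0, 0], [0, 0, 1,
      1, 0, 0]])
    (A := [[0, -1, -1, 1, 0, 0, 0], [0, 0, 0, 0, 1, 0, 0], [1, 1, 1, -1, -1, 0, 0], [0, 1, 0, 0, 0, 0,
      0], [0, 0, 1, 0, 0, 0, 0]])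
    (N := 1) (by decide +kernel)

theorem realizes_prismSquarePyramid : modelPrismSquarePyramid.Realizes (prism squarePyramid) :=
  hasPts_squarePyramid.prism.realizes
    (B := [[0, 0, 0, 0], [0, 0, 0, 1], [0, 1, 0, 0], [1, 0, 0, 1], [0, 0, 1, 0]])
    (A := [[0, -1, -1, -1, 1], [-1, 0, 0, 1, 0], [0, 1, 0, 0, 0], [1, 0, 0, 0, 0], [0, 0, 1, 0, 0]])
    (N := 1) (by decide +kernel)

theorem realizes_productTriangleSquare : modelProductTriangleSquare.Realizes (simplex 2 ×ˢ cube 2) :=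
  ((hasPts_simplex 2).prod (hasPts_cube 2)).realizes
    (B := [[1, 0, 0, 0, 0], [1, 0, 0, 0, 1], [1, 0, 0, 1, 0], [0, 1, 0, 0, 1], [0, 0, 1, 0, 1]])
    (A := [[1, 1, 1, -1, -1, 0], [0, -1, -1, 0, 1, 0], [0, 0, 0, 1, 0, 0], [0, 1, 0, 0, 0, 0], [0, 0,
      1, 0, 0, 0]])
    (N := 1) (by decide +kernel)

theorem realizes_cube4 : modelCube4.Realizes (cube 4) :=
  (hasPts_cube 4).realizes
    (B := [[0, 0, 0, 0], [0, 0, 0, 1], [0, 0, 1, 0], [0, 1, 0, 1], [1, 0, 1, 0]])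
    (A := [[0, 0, -1, -1, 1], [0, -1, 0, 1, 0], [-1, 0, 1, 0, 0], [0, 1, 0, 0, 0], [1, 0, 0, 0, 0]])
    (N := 1) (by decide +kernel)

theorem realizes_crossPolytope4 : modelCrossPolytope4.Realizes (crossPolytope 4) :=
  (hasPts_crossPolytope 4).realizes
    (B := [[1, 0, 0, 0], [0, 1, 0, 0], [0, 0, 1, 0], [0, 0, 0, 1], [0, 0, 0, -1]])
    (A := [[2, 0, 0, 0, 0], [0, 2, 0, 0, 0], [0, 0, 2, 0, 0], [-1, -1, -1, 1, 1], [-1, -1, -1, -1, 1]])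
    (N := 2) (by decide +kernel)

theorem realizes_prismOctahedron : modelPrismOctahedron.Realizes (prism (crossPolytope 3)) :=
  (hasPts_crossPolytope 3).prism.realizes
    (B := [[1, 0, 0, 0], [1, 0, 0, 1], [0, 1, 0, 0], [0, 0, 1, 0], [-1, 0, 0, 0]])
    (A := [[1, -1, -1, -2, 1], [0, 0, 0, 2, 0], [0, 2, 0, 0, 0], [0, 0, 2, 0, 0], [-1, -1, -1, 0, 1]])
    (N := 2) (by decide +kernel)

theorem realizes_pyramidOctahedron : modelPyramidOctahedron.Realizes (pyramid (crossPolytope 3)) :=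
  (hasPts_crossPolytope 3).pyramid.realizes
    (B := [[1, 0, 0, 0], [0, 1, 0, 0], [0, 0, 1, 0], [0, 0, -1, 0], [0, 0, 0, 1]])
    (A := [[2, 0, 0, 0, 0], [0, 2, 0, 0, 0], [-1, -1, 1, -1, 1], [-1, -1, -1, -1, 1], [0, 0, 0, 2, 0]])
    (N := 2) (by decide +kernel)

theorem realizes_bipyramidCube : modelBipyramidCube.Realizes (bipyramid centeredCube) :=
  hasPts_centeredCube.bipyramid.realizes
    (B := [[0, 0, 0, 1], [-1, -1, -1, 0], [-1, -1, 1, 0], [-1, 1, -1, 0], [1, -1, 1, 0]])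
    (A := [[0, 0, 0, 2, 0], [0, -1, -1, 0, 0], [-1, 0, 1, 0, 0], [0, 1, 0, -1, 1], [1, 0, 0, -1, 1]])
    (N := 2) (by decide +kernel)

theorem realizes_wedgeOctahedron : modelWedgeOctahedron.Realizes (wedgeOctahedron) :=
  hasPts_wedgeOctahedron.realizes
    (B := [[1, 0, 0, 0], [0, 1, 0, 0], [0, 0, 1, 0], [0, 0, -1, 0], [0, 0, -1, 2]])
    (A := [[2, 0, 0, 0, 0], [0, 2, 0, 0, 0], [-1, -1, 1, 0, 1], [-1, -1, -1, -1, 1], [0, 0, 0, 1, 0]])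
    (N := 2) (by decide +kernel)

theorem realizes_hypersimplex : modelHypersimplex.Realizes (hypersimplex) :=
  hasPts_hypersimplex.realizes
    (B := [[0, 0, 0, 1, 1], [0, 0, 1, 0, 1], [0, 0, 1, 1, 0], [0, 1, 0, 0, 1], [1, 0, 0, 1, 0]])
    (A := [[-1, -1, -1, 1, 1, 0], [1, -1, 1, -1, 1, 0], [-1, 1, 1, 1, -1, 0], [0, 2, 0, 0, 0, 0], [2,
      0, 0, 0, 0, 0]])
    (N := 2) (by decide +kernel)

theorem realizes_tetrahedron : modelTetrahedron.Realizes (simplex 3) :=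
  (hasPts_simplex 3).realizes
    (B := [[1, 0, 0, 0], [0, 1, 0, 0], [0, 0, 1, 0], [0, 0, 0, 1]])
    (A := [[1, 0, 0, 0, 0], [0, 1, 0, 0, 0], [0, 0, 1, 0, 0], [0, 0, 0, 1, 0]])
    (N := 1) (by decide +kernel)

theorem realizes_squarePyramid : modelSquarePyramid.Realizes (squarePyramid) :=
  hasPts_squarePyramid.realizes
    (B := [[0, 0, 0], [0, 1, 0], [1, 0, 0], [0, 0, 1]])
    (A := [[-1, -1, -1, 1], [0, 1, 0, 0], [1, 0, 0, 0], [0, 0, 1, 0]])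
    (N := 1) (by decide +kernel)

theorem realizes_triangularPrism : modelTriangularPrism.Realizes (prism (simplex 2)) :=
  (hasPts_simplex 2).prism.realizes
    (B := [[1, 0, 0, 0], [0, 1, 0, 0], [0, 0, 1, 0], [1, 0, 0, 1]])
    (A := [[1, 0, 0, -1, 0], [0, 1, 0, 0, 0], [0, 0, 1, 0, 0], [0, 0, 0, 1, 0]])
    (N := 1) (by decide +kernel)

theorem realizes_cube3 : modelCube3.Realizes (cube 3) :=
  (hasPts_cube 3).realizes
    (B := [[0, 0, 0], [0, 0, 1], [0, 1, 0], [1, 0, 1]])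
    (A := [[0, -1, -1, 1], [-1, 0, 1, 0], [0, 1, 0, 0], [1, 0, 0, 0]])
    (N := 1) (by decide +kernel)

theorem realizes_octahedron : modelOctahedron.Realizes (crossPolytope 3) :=
  (hasPts_crossPolytope 3).realizes
    (B := [[1, 0, 0], [0, 1, 0], [0, 0, 1], [0, 0, -1]])
    (A := [[2, 0, 0, 0], [0, 2, 0, 0], [-1, -1, 1, 1], [-1, -1, -1, 1]])
    (N := 2) (by decide +kernel)

theorem realizes_triangle : modelTriangle.Realizes (simplex 2) :=
  (hasPts_simplex 2).realizes
    (B := [[1, 0, 0], [0, 1, 0], [0, 0, 1]])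
    (A := [[1, 0, 0, 0], [0, 1, 0, 0], [0, 0, 1, 0]])
    (N := 1) (by decide +kernel)

theorem realizes_square : modelSquare.Realizes (cube 2) :=
  (hasPts_cube 2).realizes
    (B := [[0, 0], [0, 1], [1, 0]])
    (A := [[-1, -1, 1], [0, 1, 0], [1, 0, 0]])
    (N := 1) (by decide +kernel)

/-- Each centered triangle has vertex sum zero. Equating the two sums gives the relation between two
triples that defines the model of `B_3`. -/
theorem realizes_freeSum : modelBirkhoff3.Realizes (freeSum centeredTriangle centeredTriangle) :=
  (hasPts_centeredTriangle.freeSum hasPts_centeredTriangle).realizes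
    (B := [[1, 0, 0, 0], [0, 0, 1, 0], [0, 0, 0, 1], [0, 1, 0, 0], [-1, -1, 0, 0]])
    (A := [[2, -1, -1, -1, 1], [0, 0, 3, 0, 0], [0, 0, 0, 3, 0], [-1, 2, -1, -1, 1], [-1, -1, -1, -1,
      1]])
    (N := 3) (by decide +kernel)

/-! ### Faces of Birkhoff polytopes for the Birkhoff types -/

theorem exists_birkhoff_face_simplex4 : ∃ F : Set (Matrix (Fin 4) (Fin 4) ℝ),
    IsExposed ℝ (birkhoff 4) F ∧ modelSimplex4.Realizes F :=
  exists_birkhoff_face 4 [[0, 1, 3], [0, 1, 2, 3], [1, 2], [2, 3]]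
    (B := ([[0, 1, 2, 3], [0, 2, 1, 3], [0, 3, 1, 2], [1, 0, 2, 3], [3, 0, 1, 2]]).map (permRow 4))
    (A := ([[(5, 1)], [(6, 1)], [(0, 1), (5, -1), (6, -1)], [(1, 1)], [(3, 1)]]).map (sparse 17))
    (N := 1) (by decide +kernel)

theorem exists_birkhoff_face_pyramidSquarePyramid : ∃ F : Set (Matrix (Fin 4) (Fin 4) ℝ),
    IsExposed ℝ (birkhoff 4) F ∧ modelPyramidSquarePyramid.Realizes F :=
  exists_birkhoff_face 4 [[0, 1, 2], [0, 1, 2], [0, 2, 3], [2, 3]]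
    (B := ([[0, 1, 2, 3], [0, 1, 3, 2], [1, 0, 2, 3], [1, 2, 0, 3], [2, 1, 0, 3]]).map (permRow 4))
    (A := ([[(4, -1), (10, 1)], [(0, 1), (4, 1), (10, -1)], [(4, 1)], [(1, 1), (4, -1)], [(2, 1)]]).map (sparse 17))
    (N := 1) (by decide +kernel)

theorem exists_birkhoff_face_birkhoff3 : ∃ F : Set (Matrix (Fin 3) (Fin 3) ℝ),
    IsExposed ℝ (birkhoff 3) F ∧ modelBirkhoff3.Realizes F :=
  exists_birkhoff_face 3 [[0, 1, 2], [0, 1, 2], [0, 1, 2]]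
    (B := ([[0, 1, 2], [0, 2, 1], [1, 0, 2], [1, 2, 0], [2, 0, 1]]).map (permRow 3))
    (A := ([[(4, 1)], [(0, 1), (4, -1)], [(2, -1), (3, 1)], [(1, 1), (2, 1), (3, -1)], [(2, 1)]]).map (sparse 10))
    (N := 1) (by decide +kernel)

theorem exists_birkhoff_face_pyramidTriangularPrism : ∃ F : Set (Matrix (Fin 5) (Fin 5) ℝ),
    IsExposed ℝ (birkhoff 5) F ∧ modelPyramidTriangularPrism.Realizes F :=
  exists_birkhoff_face 5 [[0, 1, 4], [0, 1], [2, 3], [3, 4], [1, 2, 3, 4]]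
    (B := ([[0, 1, 2, 3, 4], [1, 0, 2, 3, 4], [0, 1, 2, 4, 3], [0, 1, 3, 4, 2], [4, 0, 2, 3, 1]]).map (permRow 5))
    (A := ([[(1, -1), (4, -1), (18, 1)], [(1, 1)], [(12, 1), (18, -1)], [(0, 1), (1, 1), (4, 1), (12,
      -1)], [(4, 1)]]).map (sparse 26))
    (N := 1) (by decide +kernel)

theorem exists_birkhoff_face_wedgeW : ∃ F : Set (Matrix (Fin 5) (Fin 5) ℝ),
    IsExposed ℝ (birkhoff 5) F ∧ modelWedgeW.Realizes F :=
  exists_birkhoff_face 5 [[0, 2], [1, 3, 4], [0, 2, 4], [1, 3], [0, 3, 4]]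
    (B := ([[0, 1, 2, 3, 4], [0, 3, 2, 1, 4], [2, 1, 0, 3, 4], [0, 4, 2, 1, 3], [2, 1, 4, 3, 0]]).map (permRow 5))
    (A := ([[(2, -1), (6, 1)], [(8, 1)], [(10, 1)], [(0, 1), (2, 1), (6, -1), (8, -1)], [(2, 1), (10,
      -1)]]).map (sparse 26))
    (N := 1) (by decide +kernel)

theorem exists_birkhoff_face_pyramidCube : ∃ F : Set (Matrix (Fin 6) (Fin 6) ℝ),
    IsExposed ℝ (birkhoff 6) F ∧ modelPyramidCube.Realizes F :=
  exists_birkhoff_face 6 [[0, 1], [0, 1, 2], [2, 3], [2, 3, 4], [4, 5], [4, 5, 0]]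
    (B := ([[0, 1, 2, 3, 4, 5], [0, 1, 2, 3, 5, 4], [0, 1, 3, 2, 4, 5], [1, 0, 2, 3, 5, 4], [1, 2, 3,
      4, 5, 0]]).map (permRow 6))
    (A := ([[(0, -1), (6, -1), (14, 1), (28, 1)], [(0, 1), (28, -1)], [(0, 1), (6, 1), (14, -1)], [(6,
      1)], [(1, 1), (6, -1)]]).map (sparse 37))
    (N := 1) (by decide +kernel)

theorem exists_birkhoff_face_prismTetrahedron : ∃ F : Set (Matrix (Fin 5) (Fin 5) ℝ),
    IsExposed ℝ (birkhoff 5) F ∧ modelPrismTetrahedron.Realizes F :=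
  exists_birkhoff_face 5 [[0, 4], [1, 2], [1, 2, 3], [1, 2, 3], [0, 4]]
    (B := ([[0, 1, 2, 3, 4], [4, 1, 2, 3, 0], [0, 1, 3, 2, 4], [0, 2, 1, 3, 4], [0, 2, 3, 1, 4]]).map (permRow 5))
    (A := ([[(4, -1), (12, 1)], [(4, 1)], [(6, 1), (12, -1)], [(11, 1)], [(0, 1), (4, 1), (6, -1), (11,
      -1)]]).map (sparse 26))
    (N := 1) (by decide +kernel)

theorem exists_birkhoff_face_productTriangles : ∃ F : Set (Matrix (Fin 6) (Fin 6) ℝ),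
    IsExposed ℝ (birkhoff 6) F ∧ modelProductTriangles.Realizes F :=
  exists_birkhoff_face 6 [[0, 1], [0, 1, 4], [2, 3], [2, 3, 5], [0, 4], [2, 5]]
    (B := ([[0, 1, 2, 3, 4, 5], [0, 1, 3, 2, 4, 5], [0, 1, 3, 5, 4, 2], [1, 0, 2, 3, 4, 5], [1, 4, 2,
      3, 0, 5]]).map (permRow 6))
    (A := ([[(1, -1), (14, 1)], [(20, 1)], [(0, 1), (1, 1), (14, -1), (20, -1)], [(6, 1)], [(1, 1), (6,
      -1)]]).map (sparse 37))
    (N := 1) (by decide +kernel)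

theorem exists_birkhoff_face_prismSquarePyramid : ∃ F : Set (Matrix (Fin 6) (Fin 6) ℝ),
    IsExposed ℝ (birkhoff 6) F ∧ modelPrismSquarePyramid.Realizes F :=
  exists_birkhoff_face 6 [[0, 1], [0, 1, 2], [2, 3], [0, 2, 3], [4, 5], [4, 5]]
    (B := ([[0, 1, 2, 3, 4, 5], [0, 1, 2, 3, 5, 4], [0, 1, 3, 2, 4, 5], [1, 0, 2, 3, 5, 4], [1, 2, 3,
      0, 4, 5]]).map (permRow 6))
    (A := ([[(0, -1), (1, -1), (14, 1), (28, 1)], [(0, 1), (1, 1), (6, -1), (28, -1)], [(0, 1), (6, 1),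
      (14, -1)], [(6, 1)], [(1, 1), (6, -1)]]).map (sparse 37))
    (N := 1) (by decide +kernel)

theorem exists_birkhoff_face_productTriangleSquare : ∃ F : Set (Matrix (Fin 7) (Fin 7) ℝ),
    IsExposed ℝ (birkhoff 7) F ∧ modelProductTriangleSquare.Realizes F :=
  exists_birkhoff_face 7 [[0, 1], [1, 2], [0, 1, 2], [3, 4], [3, 4], [5, 6], [5, 6]]
    (B := ([[0, 1, 2, 3, 4, 5, 6], [0, 1, 2, 3, 4, 6, 5], [0, 1, 2, 4, 3, 5, 6], [0, 2, 1, 3, 4, 6, 5],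
      [1, 2, 0, 3, 4, 6, 5]]).map (permRow 7))
    (A := ([[(0, -1), (1, -1), (24, 1), (40, 1)], [(8, 1), (40, -1)], [(0, 1), (1, 1), (24, -1)], [(0,
      1), (8, -1)], [(1, 1)]]).map (sparse 50))
    (N := 1) (by decide +kernel)

theorem exists_birkhoff_face_cube4 : ∃ F : Set (Matrix (Fin 8) (Fin 8) ℝ),
    IsExposed ℝ (birkhoff 8) F ∧ modelCube4.Realizes F :=
  exists_birkhoff_face 8 [[0, 1], [0, 1], [2, 3], [2, 3], [4, 5], [4, 5], [6, 7], [6, 7]]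
    (B := ([[0, 1, 2, 3, 4, 5, 6, 7], [0, 1, 2, 3, 4, 5, 7, 6], [0, 1, 2, 3, 5, 4, 6, 7], [0, 1, 3, 2,
      4, 5, 7, 6], [1, 0, 2, 3, 5, 4, 6, 7]]).map (permRow 8))
    (A := ([[(0, -1), (1, -1), (36, 1), (54, 1)], [(18, 1), (54, -1)], [(0, 1), (36, -1)], [(0, 1), (1,
      1), (18, -1)], [(1, 1)]]).map (sparse 65))
    (N := 1) (by decide +kernel)

theorem exists_birkhoff_face_tetrahedron : ∃ F : Set (Matrix (Fin 3) (Fin 3) ℝ),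
    IsExposed ℝ (birkhoff 3) F ∧ modelTetrahedron.Realizes F :=
  exists_birkhoff_face 3 [[0, 2], [0, 1, 2], [0, 1, 2]]
    (B := ([[0, 1, 2], [0, 2, 1], [2, 0, 1], [2, 1, 0]]).map (permRow 3))
    (A := ([[(2, -1), (3, 1), (4, 1)], [(0, 1), (2, 1), (3, -1), (4, -1)], [(3, 1)], [(2, 1), (3, -1)]]).map (sparse 10))
    (N := 1) (by decide +kernel)

theorem exists_birkhoff_face_squarePyramid : ∃ F : Set (Matrix (Fin 4) (Fin 4) ℝ),
    IsExposed ℝ (birkhoff 4) F ∧ modelSquarePyramid.Realizes F :=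
  exists_birkhoff_face 4 [[0, 1], [0, 1, 2], [2, 3], [0, 2, 3]]
    (B := ([[0, 1, 2, 3], [0, 1, 3, 2], [1, 0, 2, 3], [1, 2, 3, 0]]).map (permRow 4))
    (A := ([[(4, -1), (10, 1)], [(0, 1), (4, 1), (10, -1)], [(4, 1)], [(1, 1), (4, -1)]]).map (sparse 17))
    (N := 1) (by decide +kernel)

theorem exists_birkhoff_face_triangularPrism : ∃ F : Set (Matrix (Fin 5) (Fin 5) ℝ),
    IsExposed ℝ (birkhoff 5) F ∧ modelTriangularPrism.Realizes F :=
  exists_birkhoff_face 5 [[0, 2], [1, 3], [2, 4], [1, 3], [0, 2, 4]]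
    (B := ([[0, 1, 2, 3, 4], [0, 1, 4, 3, 2], [2, 1, 4, 3, 0], [0, 3, 2, 1, 4]]).map (permRow 5))
    (A := ([[(0, -1), (2, -1), (6, 1), (12, 1)], [(0, 1), (12, -1)], [(2, 1)], [(0, 1), (2, 1), (6,
      -1)]]).map (sparse 26))
    (N := 1) (by decide +kernel)

theorem exists_birkhoff_face_cube3 : ∃ F : Set (Matrix (Fin 6) (Fin 6) ℝ),
    IsExposed ℝ (birkhoff 6) F ∧ modelCube3.Realizes F :=
  exists_birkhoff_face 6 [[0, 1], [0, 1], [2, 3], [2, 3], [4, 5], [4, 5]]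
    (B := ([[0, 1, 2, 3, 4, 5], [0, 1, 2, 3, 5, 4], [0, 1, 3, 2, 4, 5], [1, 0, 2, 3, 5, 4]]).map (permRow 6))
    (A := ([[(0, -1), (1, -1), (14, 1), (28, 1)], [(0, 1), (28, -1)], [(0, 1), (1, 1), (14, -1)], [(1,
      1)]]).map (sparse 37))
    (N := 1) (by decide +kernel)

theorem exists_birkhoff_face_triangle : ∃ F : Set (Matrix (Fin 3) (Fin 3) ℝ),
    IsExposed ℝ (birkhoff 3) F ∧ modelTriangle.Realizes F :=
  exists_birkhoff_face 3 [[0, 1], [1, 2], [0, 1, 2]]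
    (B := ([[0, 1, 2], [0, 2, 1], [1, 2, 0]]).map (permRow 3))
    (A := ([[(4, 1)], [(0, 1), (4, -1)], [(1, 1)]]).map (sparse 10))
    (N := 1) (by decide +kernel)

theorem exists_birkhoff_face_square : ∃ F : Set (Matrix (Fin 4) (Fin 4) ℝ),
    IsExposed ℝ (birkhoff 4) F ∧ modelSquare.Realizes F :=
  exists_birkhoff_face 4 [[0, 1], [0, 1], [2, 3], [2, 3]]
    (B := ([[0, 1, 2, 3], [0, 1, 3, 2], [1, 0, 2, 3]]).map (permRow 4))
    (A := ([[(1, -1), (10, 1)], [(0, 1), (1, 1), (10, -1)], [(1, 1)]]).map (sparse 17))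
    (N := 1) (by decide +kernel)

/-! ### Faces of translation groups for the remaining realizable types -/

theorem exists_shift_face_crossPolytope4 : ∃ (n : ℕ) (G : Subgroup (Equiv.Perm (Fin n)))
    (F : Set (Matrix (Fin n) (Fin n) ℝ)),
    IsExposed ℝ (permPolytope G) F ∧ modelCrossPolytope4.Realizes F :=
  exists_shift_face checkCrossPolytope4 5
    ![![1, 0, 0, 0], ![1, 1, 0, 0], ![0, 1, 1, 0], ![0, 0, 1, 1], ![0, 1, 1, -1]]
    [[0, 0, 0, 0, 0], [0, 0, 1, 1, 1], [0, 1, 1, 0, 1], [0, 1, 1, 1, 0], [1, 0, 0, 0, 1], [1, 0,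
    0, 1, 0], [1, 1, 0, 0, 0], [1, 1, 1, 1, 1]]
    (B := [[0, 0, 0, 0, 0], [0, 0, 1, 1, 1], [0, 1, 1, 0, 1], [0, 1, 1, 1, 0], [1, 0, 0, 0, 1]])
    (A := [[-1, 0, -1, 0, 0, 1], [0, -1, 1, 0, 0, 0], [0, 0, 1, -1, 0, 0], [0, 1, -1, 1, 0, 0], [1, 0,
      0, 0, 0, 0]])
    (N := 1) (by decide +kernel) (by decide +kernel) (by decide +kernel) (by decide +kernel)

theorem exists_shift_face_prismOctahedron : ∃ (n : ℕ) (G : Subgroup (Equiv.Perm (Fin n)))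
    (F : Set (Matrix (Fin n) (Fin n) ℝ)),
    IsExposed ℝ (permPolytope G) F ∧ modelPrismOctahedron.Realizes F :=
  exists_shift_face checkPrismOctahedron 5
    ![![1, 0, 0, 0], ![0, 1, 0, 0], ![0, 0, 1, 0], ![1, 1, 0, -1], ![0, 0, 0, 1]]
    [[0, 0, 0, 0, 0], [0, 0, 1, 0, 0], [0, 1, 0, 0, 1], [0, 1, 0, 1, 0], [0, 1, 1, 0, 1], [0, 1,
    1, 1, 0], [1, 0, 0, 0, 1], [1, 0, 0, 1, 0], [1, 0, 1, 0, 1], [1, 0, 1, 1, 0], [1, 1, 0, 1, 1],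
    [1, 1, 1, 1, 1]]
    (B := [[0, 0, 0, 0, 0], [0, 0, 1, 0, 0], [0, 1, 0, 0, 1], [0, 1, 0, 1, 0], [1, 1, 0, 1, 1]])
    (A := [[0, -1, -1, 0, 0, 1], [0, 0, 1, 0, 0, 0], [0, 1, 0, -1, 0, 0], [-1, 0, 0, 1, 0, 0], [1, 0,
      0, 0, 0, 0]])
    (N := 1) (by decide +kernel) (by decide +kernel) (by decide +kernel) (by decide +kernel)

theorem exists_shift_face_pyramidOctahedron : ∃ (n : ℕ) (G : Subgroup (Equiv.Perm (Fin n)))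
    (F : Set (Matrix (Fin n) (Fin n) ℝ)),
    IsExposed ℝ (permPolytope G) F ∧ modelPyramidOctahedron.Realizes F :=
  exists_shift_face checkPyramidOctahedron 6
    ![![1, 0, 0, 0], ![1, -1, 0, 0], ![0, 1, 1, 0], ![0, 0, 0, 1], ![0, 0, 1, 1], ![1, 0, 0, 1]]
    [[0, 0, 0, 0, 0, 0], [0, 0, 0, 1, 1, 1], [0, 0, 1, 0, 1, 0], [0, 1, 0, 0, 1, 0], [1, 0, 1, 0,
    0, 1], [1, 1, 0, 0, 0, 1], [1, 1, 1, 0, 1, 1]]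
    (B := [[0, 0, 0, 0, 0, 0], [0, 0, 1, 0, 1, 0], [0, 1, 0, 0, 1, 0], [1, 0, 1, 0, 0, 1], [0, 0, 0,
      1, 1, 1]])
    (A := [[0, -1, -1, -1, 0, 0, 1], [-1, 0, 1, 0, 0, 0, 0], [0, 1, 0, 0, 0, 0, 0], [1, 0, 0, 0, 0, 0,
      0], [0, 0, 0, 1, 0, 0, 0]])
    (N := 1) (by decide +kernel) (by decide +kernel) (by decide +kernel) (by decide +kernel)

theorem exists_shift_face_bipyramidCube : ∃ (n : ℕ) (G : Subgroup (Equiv.Perm (Fin n)))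
    (F : Set (Matrix (Fin n) (Fin n) ℝ)),
    IsExposed ℝ (permPolytope G) F ∧ modelBipyramidCube.Realizes F :=
  exists_shift_face checkBipyramidCube 6
    ![![1, 0, 0, 0], ![0, 1, 0, 0], ![0, 0, 1, 0], ![0, 0, 0, 1], ![1, 1, -1, 0], ![1, 1, 0, -1]]
    [[0, 0, 0, 0, 0, 0], [0, 1, 0, 0, 1, 1], [0, 1, 0, 1, 1, 0], [0, 1, 1, 0, 0, 1], [0, 1, 1, 1,
    0, 0], [1, 0, 0, 0, 1, 1], [1, 0, 0, 1, 1, 0], [1, 0, 1, 0, 0, 1], [1, 0, 1, 1, 0, 0], [1, 1,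
    1, 1, 1, 1]]
    (B := [[0, 0, 0, 0, 0, 0], [0, 1, 0, 0, 1, 1], [0, 1, 0, 1, 1, 0], [0, 1, 1, 0, 0, 1], [1, 0, 0,
      1, 1, 0]])
    (A := [[-1, -1, 0, 0, 0, 0, 1], [1, 1, -1, -1, 0, 0, 0], [-1, 0, 0, 1, 0, 0, 0], [0, 0, 1, 0, 0,
      0, 0], [1, 0, 0, 0, 0, 0, 0]])
    (N := 1) (by decide +kernel) (by decide +kernel) (by decide +kernel) (by decide +kernel)

theorem exists_shift_face_wedgeOctahedron : ∃ (n : ℕ) (G : Subgroup (Equiv.Perm (Fin n)))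
    (F : Set (Matrix (Fin n) (Fin n) ℝ)),
    IsExposed ℝ (permPolytope G) F ∧ modelWedgeOctahedron.Realizes F :=
  exists_shift_face checkWedgeOctahedron 6
    ![![1, 0, 0, 0], ![1, -1, 0, 0], ![0, 0, 1, 0], ![0, 1, 1, 1], ![0, 0, 0, 1], ![0, 0, 1, 1]]
    [[0, 0, 0, 0, 0, 0], [0, 0, 0, 1, 1, 1], [0, 0, 1, 1, 0, 1], [0, 1, 0, 0, 1, 1], [0, 1, 1, 0,
    0, 1], [1, 0, 0, 1, 0, 0], [1, 1, 0, 0, 0, 0], [1, 1, 0, 1, 1, 1], [1, 1, 1, 1, 0, 1]]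
    (B := [[0, 0, 0, 0, 0, 0], [1, 0, 0, 1, 0, 0], [1, 1, 0, 0, 0, 0], [0, 0, 0, 1, 1, 1], [0, 0, 1,
      1, 0, 1]])
    (A := [[0, -1, 0, -1, 0, 0, 1], [1, -1, 0, 0, 0, 0, 0], [0, 1, 0, 0, 0, 0, 0], [-1, 1, -1, 1, 0,
      0, 0], [0, 0, 1, 0, 0, 0, 0]])
    (N := 1) (by decide +kernel) (by decide +kernel) (by decide +kernel) (by decide +kernel)

theorem exists_shift_face_dualW : ∃ (n : ℕ) (G : Subgroup (Equiv.Perm (Fin n)))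
    (F : Set (Matrix (Fin n) (Fin n) ℝ)),
    IsExposed ℝ (permPolytope G) F ∧ modelDualW.Realizes F :=
  exists_shift_face checkDualW 8
    ![![1, 0, 0, 0], ![0, 1, 0, 0], ![0, 0, 1, 0], ![0, 1, 1, -1], ![1, 0, 0, 1], ![0, 0, 0, 1],
    ![1, 0, 1, 0], ![0, 1, 0, -1]]
    [[0, 0, 0, 0, 0, 0, 0, 0], [0, 0, 1, 1, 0, 0, 1, 0], [0, 1, 0, 0, 1, 1, 0, 0], [0, 1, 0, 1, 0,
    0, 0, 1], [0, 1, 1, 1, 1, 1, 1, 0], [1, 0, 0, 0, 1, 0, 1, 0], [1, 1, 0, 1, 1, 0, 1, 1]]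
    (B := [[0, 0, 0, 0, 0, 0, 0, 0], [0, 0, 1, 1, 0, 0, 1, 0], [0, 1, 0, 1, 0, 0, 0, 1], [1, 0, 0, 0,
      1, 0, 1, 0], [0, 1, 0, 0, 1, 1, 0, 0]])
    (A := [[-1, -1, -1, 0, 0, 0, 0, 0, 1], [0, 0, 1, 0, 0, 0, 0, 0, 0], [0, 0, -1, 1, 0, 0, 0, 0, 0],
      [1, 0, 0, 0, 0, 0, 0, 0, 0], [0, 1, 1, -1, 0, 0, 0, 0, 0]])
    (N := 1) (by decide +kernel) (by decide +kernel) (by decide +kernel) (by decide +kernel)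

theorem exists_shift_face_hypersimplex : ∃ (n : ℕ) (G : Subgroup (Equiv.Perm (Fin n)))
    (F : Set (Matrix (Fin n) (Fin n) ℝ)),
    IsExposed ℝ (permPolytope G) F ∧ modelHypersimplex.Realizes F :=
  exists_shift_face checkHypersimplex 5
    ![![1, 0, 0, 0], ![0, 1, 0, 0], ![0, 0, 1, 0], ![0, 0, 0, 1], ![1, -1, 1, -1]]
    [[0, 0, 0, 0, 0], [0, 0, 1, 0, 1], [0, 0, 1, 1, 0], [0, 1, 1, 0, 0], [1, 0, 0, 0, 1], [1, 0,
    0, 1, 0], [1, 0, 1, 1, 1], [1, 1, 0, 0, 0], [1, 1, 1, 0, 1], [1, 1, 1, 1, 0]]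
    (B := [[0, 0, 0, 0, 0], [0, 0, 1, 0, 1], [1, 0, 0, 0, 1], [0, 0, 1, 1, 0], [1, 1, 0, 0, 0]])
    (A := [[-1, 0, -1, 0, 0, 1], [0, 0, 1, -1, 0, 0], [1, -1, 0, 0, 0, 0], [0, 0, 0, 1, 0, 0], [0, 1,
      0, 0, 0, 0]])
    (N := 1) (by decide +kernel) (by decide +kernel) (by decide +kernel) (by decide +kernel)

theorem exists_shift_face_specialP : ∃ (n : ℕ) (G : Subgroup (Equiv.Perm (Fin n)))
    (F : Set (Matrix (Fin n) (Fin n) ℝ)),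
    IsExposed ℝ (permPolytope G) F ∧ modelSpecialP.Realizes F :=
  exists_shift_face checkSpecialP 7
    ![![1, 0, 0, 0], ![0, 1, 0, 0], ![0, 0, 1, 0], ![0, 0, 0, 1], ![1, 0, 0, -1], ![0, 1, 0, 1],
    ![1, 1, -1, 0]]
    [[0, 0, 0, 0, 0, 0, 0], [0, 1, 0, 0, 0, 1, 1], [0, 1, 1, 0, 0, 1, 0], [1, 0, 0, 0, 1, 0, 1],
    [1, 0, 0, 1, 0, 1, 1], [1, 0, 1, 0, 1, 0, 0], [1, 0, 1, 1, 0, 1, 0], [1, 1, 1, 0, 1, 1, 1]]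
    (B := [[0, 1, 0, 0, 0, 1, 1], [0, 1, 1, 0, 0, 1, 0], [1, 0, 0, 1, 0, 1, 1], [0, 0, 0, 0, 0, 0, 0],
      [1, 1, 1, 0, 1, 1, 1]])
    (A := [[0, 1, -1, 0, 0, 0, 0, 0], [-1, 0, 1, 1, 0, 0, 0, 0], [0, 0, 0, 1, 0, 0, 0, 0], [0, -1, 0,
      -1, 0, 0, 0, 1], [1, 0, 0, -1, 0, 0, 0, 0]])
    (N := 1) (by decide +kernel) (by decide +kernel) (by decide +kernel) (by decide +kernel)

theorem exists_shift_face_octahedron : ∃ (n : ℕ) (G : Subgroup (Equiv.Perm (Fin n)))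
    (F : Set (Matrix (Fin n) (Fin n) ℝ)),
    IsExposed ℝ (permPolytope G) F ∧ modelOctahedron.Realizes F :=
  exists_shift_face checkOctahedron 4
    ![![1, 0, 0, 0], ![0, 1, 0, 0], ![0, 0, 1, 0], ![1, 1, -1, 0]]
    [[0, 0, 0, 0], [0, 1, 0, 1], [0, 1, 1, 0], [1, 0, 0, 1], [1, 0, 1, 0], [1, 1, 1, 1]]
    (B := [[0, 0, 0, 0], [0, 1, 0, 1], [0, 1, 1, 0], [1, 0, 0, 1]])
    (A := [[-1, -1, 0, 0, 1], [0, 1, -1, 0, 0], [0, 0, 1, 0, 0], [1, 0, 0, 0, 0]])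
    (N := 1) (by decide +kernel) (by decide +kernel) (by decide +kernel) (by decide +kernel)

section Certified

variable {E : Type*} [AddCommGroup E] [Module ℝ E] [TopologicalSpace E] [IsTopologicalAddGroup E]
  [ContinuousSMul ℝ E] [T2Space E] [FiniteDimensional ℝ E] {M : Model} {D : LatticeData}

theorem Model.Realizes.nonempty_faces
    (h : M.Balanced && M.HasUnits && M.latticeCheck D = true) {X : Set E} (hX : M.Realizes X) :
    Nonempty (Faces X ≃o MaskPoset (M.lattice D)) := by
  simp only [Bool.and_eq_true, decide_eq_true_eq] at h
  obtain ⟨W, hW, rfl⟩ := hX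
  exact hW.nonempty_faces h.1.1 h.2

theorem Model.Realizes.dim_eq {E : Type*} [AddCommGroup E] [Module ℝ E]
    (h : M.Balanced && M.HasUnits && M.latticeCheck D = true) {X : Set E} (hX : M.Realizes X) :
    dim X = M.k - 1 := by
  simp only [Bool.and_eq_true, decide_eq_true_eq] at h
  obtain ⟨W, hW, rfl⟩ := hX
  exact hW.dim_eq h.1.1 h.1.2

end Certified

/-! ### Isomorphisms, dualities and invariants of lattices of masks -/

section Lattices

theorem MaskPoset.le_iff_subMask {L : List ℕ} {s t : MaskPoset L} :
    s ≤ t ↔ subMask s.1 t.1 = true := MaskPoset.le_def.trans subMask_iff.symm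

theorem combEquiv_iff {E E' : Type*} [AddCommGroup E] [Module ℝ E] [TopologicalSpace E]
    [AddCommGroup E'] [Module ℝ E'] [TopologicalSpace E'] {X : Set E} {Y : Set E'} {L : List ℕ}
    (hY : Nonempty (Faces Y ≃o MaskPoset L)) :
    CombEquiv X Y ↔ Nonempty (Faces X ≃o MaskPoset L) := by
  obtain ⟨e⟩ := hY
  exact ⟨fun ⟨f⟩ => ⟨f.trans e⟩, fun ⟨f⟩ => ⟨f.trans e.symm⟩⟩

theorem combDual_iff {E E' : Type*} [AddCommGroup E] [Module ℝ E] [TopologicalSpace E]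
    [AddCommGroup E'] [Module ℝ E'] [TopologicalSpace E'] {X : Set E} {Y : Set E'} {L L' : List ℕ}
    (hY : Nonempty (Faces Y ≃o MaskPoset L)) (hL : Nonempty ((MaskPoset L)ᵒᵈ ≃o MaskPoset L')) :
    CombDual X Y ↔ Nonempty (Faces X ≃o MaskPoset L') := by
  obtain ⟨e⟩ := hY
  obtain ⟨g⟩ := hL
  exact ⟨fun ⟨f⟩ => ⟨(f.trans e.dual).trans g⟩, fun ⟨f⟩ => ⟨(f.trans g.symm).trans e.dual.symm⟩⟩

theorem hasIncidences_iff {E : Type*} [AddCommGroup E] [Module ℝ E] [TopologicalSpace E]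
    {X : Set E} {n : ℕ} {T : Finset (Finset (Fin n))} {L : List ℕ}
    (hL : Nonempty (IncidenceLattice T ≃o MaskPoset L)) :
    HasIncidences X T ↔ Nonempty (Faces X ≃o MaskPoset L) := by
  obtain ⟨e⟩ := hL
  exact ⟨fun ⟨f⟩ => ⟨f.trans e⟩, fun ⟨f⟩ => ⟨f.trans e.symm⟩⟩

/-- The set of the members of `T` that contain `s`. -/
def polarMask (T : List ℕ) (s : ℕ) : ℕ :=
  maskOf ((List.range T.length).filter fun i => subMask s (T.getD i 0))

theorem polarMask_antitone (T : List ℕ) {s t : ℕ} (h : subMask s t = true) :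
    subMask (polarMask T t) (polarMask T s) = true := by
  rw [subMask_iff] at *
  intro i hi
  rw [polarMask, testBit_maskOf, List.mem_filter, subMask_iff] at *
  exact ⟨hi.1, fun j hj => hi.2 j (h j hj)⟩

/-- Polarity with respect to `T` and `T'` exchanges the two lists of masks. -/
def polarCheck (L L' T T' : List ℕ) : Bool :=
  (L.all fun s => memMask (polarMask T s) L' && Nat.beq (polarMask T' (polarMask T s)) s) &&
  (L'.all fun s => memMask (polarMask T' s) L && Nat.beq (polarMask T (polarMask T' s)) s)

/-- The polar of `s` is the set of indices of the members of `T` containing `s`, which reverses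
inclusion. If the two polarities are mutually inverse on the lists, they form an anti-isomorphism.
-/
theorem nonempty_dual_orderIso {L L' T T' : List ℕ} (h : polarCheck L L' T T' = true) :
    Nonempty ((MaskPoset L)ᵒᵈ ≃o MaskPoset L') := by
  simp only [polarCheck, Bool.and_eq_true, List.all_eq_true, memMask_iff, Nat.beq_eq] at h
  obtain ⟨h1, h2⟩ := h
  exact ⟨{
    toFun := fun s => ⟨polarMask T (OrderDual.ofDual s).1, (h1 _ (OrderDual.ofDual s).2).1⟩
    invFun := fun s => OrderDual.toDual ⟨polarMask T' s.1, (h2 _ s.2).1⟩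
    left_inv := fun s => Subtype.ext (h1 _ (OrderDual.ofDual s).2).2
    right_inv := fun s => Subtype.ext (h2 _ s.2).2
    map_rel_iff' := by
      intro s t
      constructor
      · intro h
        have := polarMask_antitone T' (MaskPoset.le_iff_subMask.1 h)
        change subMask (polarMask T' (polarMask T _)) (polarMask T' (polarMask T _)) = true at this
        rw [(h1 _ (OrderDual.ofDual s).2).2, (h1 _ (OrderDual.ofDual t).2).2] at this
        exact MaskPoset.le_iff_subMask.2 this
      · intro h
        exact MaskPoset.le_iff_subMask.2
          (polarMask_antitone T (MaskPoset.le_iff_subMask (L := L).1 h)) }⟩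

/-- The elements of a finite set of numbers below `n` as a bit mask. -/
def finsetMask {n : ℕ} (S : Finset (Fin n)) : ℕ :=
  maskOf ((List.range n).filter fun i => decide (∃ h : i < n, ⟨i, h⟩ ∈ S))

theorem testBit_finsetMask {n : ℕ} (S : Finset (Fin n)) (i : ℕ) :
    (finsetMask S).testBit i = true ↔ ∃ h : i < n, ⟨i, h⟩ ∈ S := by
  rw [finsetMask, testBit_maskOf, List.mem_filter, decide_eq_true_iff, List.mem_range]
  exact ⟨fun h => h.2, fun h => ⟨h.1, h⟩⟩

/-- The finite set with given bit mask. -/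
def maskFinset (n : ℕ) (m : ℕ) : Finset (Fin n) := Finset.univ.filter fun i => m.testBit i = true

theorem maskFinset_finsetMask {n : ℕ} (S : Finset (Fin n)) : maskFinset n (finsetMask S) = S := by
  ext i
  simp [maskFinset, testBit_finsetMask]

theorem finsetMask_lt {n : ℕ} (S : Finset (Fin n)) : finsetMask S < 2 ^ n :=
  maskOf_lt fun _ hi => List.mem_range.1 (List.mem_filter.1 hi).1

theorem finsetMask_maskFinset {n m : ℕ} (hm : m < 2 ^ n) : finsetMask (maskFinset n m) = m := by
  refine Nat.eq_of_testBit_eq fun i => ?_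
  rw [Bool.eq_iff_iff, testBit_finsetMask]
  constructor
  · rintro ⟨h, h'⟩
    exact (Finset.mem_filter.1 h').2
  · intro h
    have hi : i < n := by
      by_contra hi
      rw [Nat.testBit_lt_two_pow (hm.trans_le (Nat.pow_le_pow_right two_pos (not_lt.1 hi)))] at h
      exact absurd h (by simp)
    exact ⟨hi, Finset.mem_filter.2 ⟨Finset.mem_univ _, h⟩⟩

theorem subMask_finsetMask {n : ℕ} {S S' : Finset (Fin n)} :
    subMask (finsetMask S) (finsetMask S') = true ↔ S ⊆ S' := by
  rw [subMask_iff]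
  simp only [testBit_finsetMask]
  constructor
  · intro h i hi
    exact (h i ⟨i.2, hi⟩).2
  · rintro h i ⟨hi, h'⟩
    exact ⟨hi, h h'⟩

/-- Among all families in `T` whose intersection is `S`, the family of all members containing `S` is
the largest one. Testing this single family makes the condition decidable. -/
theorem mem_incidence_iff {n : ℕ} {T : Finset (Finset (Fin n))} {S : Finset (Fin n)} :
    (∃ U ⊆ T, S = U.inf id) ↔ (T.filter fun t => S ⊆ t).inf id = S := by
  constructor
  · rintro ⟨U, hU, rfl⟩
    apply le_antisymm
    · refine Finset.le_inf fun t ht => Finset.inf_le (f := id) (Finset.mem_filter.2 ⟨hU ht, ?_⟩)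
      exact Finset.inf_le (f := id) ht
    · exact Finset.le_inf fun t ht => (Finset.mem_filter.1 ht).2
  · intro h
    exact ⟨_, Finset.filter_subset _ _, h.symm⟩

theorem nonempty_incidence_orderIso {n : ℕ} {T : Finset (Finset (Fin n))} {L : List ℕ}
    (hL : ∀ m ∈ L, m < 2 ^ n)
    (h : ∀ m < 2 ^ n, (T.filter fun t => maskFinset n m ⊆ t).inf id = maskFinset n m ↔ m ∈ L) :
    Nonempty (IncidenceLattice T ≃o MaskPoset L) := by
  refine ⟨{
    toFun := fun S => ⟨finsetMask S.1, (h _ (finsetMask_lt _)).1 ?_⟩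
    invFun := fun m => ⟨maskFinset n m.1, mem_incidence_iff.2 ((h _ (hL _ m.2)).2 m.2)⟩
    left_inv := fun S => Subtype.ext (maskFinset_finsetMask _)
    right_inv := fun m => Subtype.ext (finsetMask_maskFinset (hL _ m.2))
    map_rel_iff' := ?_ }⟩
  · rw [maskFinset_finsetMask]
    exact mem_incidence_iff.1 S.2
  · intro S S'
    exact MaskPoset.le_iff_subMask.trans subMask_finsetMask

/-- The numbers of atoms and of coatoms of a finite lattice. -/
noncomputable def posetSize (α : Type*) [PartialOrder α] : ℕ × ℕ :=
  (Nat.card {x : α // Nat.card {y : α // y ≤ x} = 2}, Nat.card {x : α // Nat.card {y : α // x ≤ y} = 2})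

/-- An atom has exactly two elements below it, the bottom and itself, and dually for coatoms. The
counts are therefore invariants of the order; in a face lattice they are the numbers of vertices and
of facets. -/
theorem posetSize_congr {α β : Type*} [PartialOrder α] [PartialOrder β] (e : α ≃o β) :
    posetSize α = posetSize β := by
  have h1 : ∀ x, Nat.card {y : α // y ≤ x} = Nat.card {y : β // y ≤ e x} := fun x =>
    Nat.card_congr (e.toEquiv.subtypeEquiv fun y => (e.le_iff_le).symm)
  have h2 : ∀ x, Nat.card {y : α // x ≤ y} = Nat.card {y : β // e x ≤ y} := fun x =>
    Nat.card_congr (e.toEquiv.subtypeEquiv fun y => (e.le_iff_le).symm)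
  exact Prod.ext (Nat.card_congr (e.toEquiv.subtypeEquiv fun x => by rw [h1]; rfl))
    (Nat.card_congr (e.toEquiv.subtypeEquiv fun x => by rw [h2]; rfl))

theorem card_maskPoset {L : List ℕ} (hL : L.Nodup) (p : ℕ → Bool) :
    Nat.card {s : MaskPoset L // p s.1 = true} = L.countP p := by
  rw [List.countP_eq_length_filter, ← List.toFinset_card_of_nodup (hL.filter p),
    ← Nat.card_eq_finsetCard]
  exact Nat.card_congr
    { toFun := fun s => ⟨s.1.1, List.mem_toFinset.2 (List.mem_filter.2 ⟨s.1.2, s.2⟩)⟩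
      invFun := fun s => ⟨⟨s.1, (List.mem_filter.1 (List.mem_toFinset.1 s.2)).1⟩,
        (List.mem_filter.1 (List.mem_toFinset.1 s.2)).2⟩
      left_inv := fun _ => rfl
      right_inv := fun _ => rfl }

/-- The numbers of atoms and of coatoms of a list of masks. -/
def maskSize (L : List ℕ) : ℕ × ℕ :=
  (L.countP fun s => Nat.beq (L.countP fun t => subMask t s) 2,
    L.countP fun s => Nat.beq (L.countP fun t => subMask s t) 2)

theorem posetSize_maskPoset {L : List ℕ} (hL : L.Nodup) :
    posetSize (MaskPoset L) = maskSize L := by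
  have h1 : ∀ s : MaskPoset L, Nat.card {t : MaskPoset L // t ≤ s} =
      L.countP fun t => subMask t s.1 := fun s => by
    simp only [MaskPoset.le_iff_subMask]
    exact card_maskPoset hL fun t => subMask t s.1
  have h2 : ∀ s : MaskPoset L, Nat.card {t : MaskPoset L // s ≤ t} =
      L.countP fun t => subMask s.1 t := fun s => by
    simp only [MaskPoset.le_iff_subMask]
    exact card_maskPoset hL fun t => subMask s.1 t
  simp only [posetSize, maskSize, h1, h2, ← card_maskPoset hL, Nat.beq_eq]

theorem Model.posetSize_lattice (M : Model) (D : LatticeData) :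
    posetSize (MaskPoset (M.lattice D)) = maskSize (M.lattice D) :=
  posetSize_maskPoset (nodup_interClosure _ _)

end Lattices

/-- `T` lists the seven facets of `W` in the order of the vertices of the dual model, and `T'` lists
the eight facets of the dual model in the order of the vertices of `W`. -/
theorem nonempty_dual_wedgeW : Nonempty
    ((MaskPoset (modelWedgeW.lattice dataWedgeW))ᵒᵈ ≃o MaskPoset (modelDualW.lattice dataDualW)) :=
  nonempty_dual_orderIso (T := [240, 117, 211, 236, 207, 186, 63])
    (T' := [86, 116, 90, 120, 103, 107, 31, 61]) (by decide +kernel)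

theorem nonempty_incidence_specialP : Nonempty (IncidenceLattice incidencesP ≃o
    MaskPoset (modelSpecialP.lattice dataSpecialP)) :=
  nonempty_incidence_orderIso (by decide +kernel) (by decide +kernel)

theorem nonempty_incidence_specialQ1 : Nonempty (IncidenceLattice incidencesQ1 ≃o
    MaskPoset (modelSpecialQ1.lattice dataSpecialQ1)) :=
  nonempty_incidence_orderIso (by decide +kernel) (by decide +kernel)

theorem nonempty_incidence_specialQ2 : Nonempty (IncidenceLattice incidencesQ2 ≃o
    MaskPoset (modelSpecialQ2.lattice dataSpecialQ2)) :=
  nonempty_incidence_orderIso (by decide +kernel) (by decide +kernel)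

/-! ### The types, told apart by their numbers of vertices and facets -/

/-- The model of the type with the given name. -/
def FaceType2.model : FaceType2 → Model
  | .triangle => modelTriangle
  | .square => modelSquare

/-- The facets of the model of the type with the given name. -/
def FaceType2.data : FaceType2 → LatticeData
  | .triangle => dataTriangle
  | .square => dataSquare

/-- The numbers of vertices and of facets. -/
def FaceType2.size : FaceType2 → ℕ × ℕ
  | .triangle => (3, 3)
  | .square => (4, 4)

theorem FaceType2.certified (τ : FaceType2) :
    τ.model.Balanced && τ.model.HasUnits && τ.model.latticeCheck τ.data = true := by
  cases τ
  · exact checkTriangle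
  · exact checkSquare

theorem FaceType2.maskSize_eq (τ : FaceType2) : maskSize (τ.model.lattice τ.data) = τ.size := by
  cases τ <;> decide +kernel

/-- The type with given numbers of vertices and facets. -/
def FaceType2.ofSize (s : ℕ × ℕ) : FaceType2 :=
  match s with
  | (3, 3) => .triangle
  | _ => .square

theorem FaceType2.size_injective : Function.Injective FaceType2.size :=
  Function.LeftInverse.injective (g := FaceType2.ofSize) fun τ => by cases τ <;> rfl

theorem FaceType2.isTypeOf_iff {E : Type*} [AddCommGroup E] [Module ℝ E] [TopologicalSpace E]
    (τ : FaceType2) (X : Set E) :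
    τ.IsTypeOf X ↔ Nonempty (Faces X ≃o MaskPoset (τ.model.lattice τ.data)) := by
  cases τ
  · exact combEquiv_iff (realizes_triangle.nonempty_faces checkTriangle)
  · exact combEquiv_iff (realizes_square.nonempty_faces checkSquare)

/-- Two types of the same set have isomorphic lattices, hence equal numbers of atoms and coatoms,
and these determine the name. -/
theorem FaceType2.isTypeOf_iff_eq {E : Type*} [AddCommGroup E] [Module ℝ E] [TopologicalSpace E]
    {X : Set E} {τ : FaceType2} (h : τ.IsTypeOf X) (σ : FaceType2) : σ.IsTypeOf X ↔ σ = τ := by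
  constructor
  · intro h'
    obtain ⟨e⟩ := (FaceType2.isTypeOf_iff _ _).1 h
    obtain ⟨e'⟩ := (FaceType2.isTypeOf_iff _ _).1 h'
    have := posetSize_congr (e'.symm.trans e)
    rw [Model.posetSize_lattice, Model.posetSize_lattice, FaceType2.maskSize_eq, FaceType2.maskSize_eq] at this
    exact FaceType2.size_injective this
  · rintro rfl
    exact h

theorem FaceType2.isTypeOf_of_realizes {E : Type*} [AddCommGroup E] [Module ℝ E] [TopologicalSpace E]
    [IsTopologicalAddGroup E] [ContinuousSMul ℝ E] [T2Space E] [FiniteDimensional ℝ E] {X : Set E}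
    (τ : FaceType2) (h : τ.model.Realizes X) : τ.IsTypeOf X :=
  (FaceType2.isTypeOf_iff τ X).2 (h.nonempty_faces τ.certified)

theorem FaceType2.existsUnique {E : Type*} [AddCommGroup E] [Module ℝ E] [TopologicalSpace E] {X : Set E}
    (h : ∃ τ : FaceType2, τ.IsTypeOf X) : ∃! τ : FaceType2, τ.IsTypeOf X := by
  obtain ⟨τ, hτ⟩ := h
  exact ⟨τ, hτ, fun σ hσ => (FaceType2.isTypeOf_iff_eq hτ σ).1 hσ⟩

/-- The numbering of the types. -/
def FaceType2.equivFin : FaceType2 ≃ Fin 2 where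
  toFun τ := ⟨τ.ctorIdx, by cases τ <;> decide⟩
  invFun i := [.triangle, .square].getD i .triangle
  left_inv τ := by cases τ <;> rfl
  right_inv i := by fin_cases i <;> rfl

theorem FaceType2.card_eq : Nat.card FaceType2 = 2 := by
  rw [Nat.card_congr FaceType2.equivFin, Nat.card_fin]

/-- The model of the type with the given name. -/
def FaceType3.model : FaceType3 → Model
  | .tetrahedron => modelTetrahedron
  | .squarePyramid => modelSquarePyramid
  | .triangularPrism => modelTriangularPrism
  | .cube => modelCube3
  | .octahedron => modelOctahedron

/-- The facets of the model of the type with the given name. -/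
def FaceType3.data : FaceType3 → LatticeData
  | .tetrahedron => dataTetrahedron
  | .squarePyramid => dataSquarePyramid
  | .triangularPrism => dataTriangularPrism
  | .cube => dataCube3
  | .octahedron => dataOctahedron

/-- The numbers of vertices and of facets. -/
def FaceType3.size : FaceType3 → ℕ × ℕ
  | .tetrahedron => (4, 4)
  | .squarePyramid => (5, 5)
  | .triangularPrism => (6, 5)
  | .cube => (8, 6)
  | .octahedron => (6, 8)

theorem FaceType3.certified (τ : FaceType3) :
    τ.model.Balanced && τ.model.HasUnits && τ.model.latticeCheck τ.data = true := by
  cases τ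
  · exact checkTetrahedron
  · exact checkSquarePyramid
  · exact checkTriangularPrism
  · exact checkCube3
  · exact checkOctahedron

theorem FaceType3.maskSize_eq (τ : FaceType3) : maskSize (τ.model.lattice τ.data) = τ.size := by
  cases τ <;> decide +kernel

/-- The type with given numbers of vertices and facets. -/
def FaceType3.ofSize (s : ℕ × ℕ) : FaceType3 :=
  match s with
  | (4, 4) => .tetrahedron
  | (5, 5) => .squarePyramid
  | (6, 5) => .triangularPrism
  | (8, 6) => .cube
  | _ => .octahedron

theorem FaceType3.size_injective : Function.Injective FaceType3.size :=
  Function.LeftInverse.injective (g := FaceType3.ofSize) fun τ => by cases τ <;> rfl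

theorem FaceType3.isTypeOf_iff {E : Type*} [AddCommGroup E] [Module ℝ E] [TopologicalSpace E]
    (τ : FaceType3) (X : Set E) :
    τ.IsTypeOf X ↔ Nonempty (Faces X ≃o MaskPoset (τ.model.lattice τ.data)) := by
  cases τ
  · exact combEquiv_iff (realizes_tetrahedron.nonempty_faces checkTetrahedron)
  · exact combEquiv_iff (realizes_squarePyramid.nonempty_faces checkSquarePyramid)
  · exact combEquiv_iff (realizes_triangularPrism.nonempty_faces checkTriangularPrism)
  · exact combEquiv_iff (realizes_cube3.nonempty_faces checkCube3)
  · exact combEquiv_iff (realizes_octahedron.nonempty_faces checkOctahedron)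

theorem FaceType3.isTypeOf_iff_eq {E : Type*} [AddCommGroup E] [Module ℝ E] [TopologicalSpace E]
    {X : Set E} {τ : FaceType3} (h : τ.IsTypeOf X) (σ : FaceType3) : σ.IsTypeOf X ↔ σ = τ := by
  constructor
  · intro h'
    obtain ⟨e⟩ := (FaceType3.isTypeOf_iff _ _).1 h
    obtain ⟨e'⟩ := (FaceType3.isTypeOf_iff _ _).1 h'
    have := posetSize_congr (e'.symm.trans e)
    rw [Model.posetSize_lattice, Model.posetSize_lattice, FaceType3.maskSize_eq, FaceType3.maskSize_eq] at this
    exact FaceType3.size_injective this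
  · rintro rfl
    exact h

theorem FaceType3.isTypeOf_of_realizes {E : Type*} [AddCommGroup E] [Module ℝ E] [TopologicalSpace E]
    [IsTopologicalAddGroup E] [ContinuousSMul ℝ E] [T2Space E] [FiniteDimensional ℝ E] {X : Set E}
    (τ : FaceType3) (h : τ.model.Realizes X) : τ.IsTypeOf X :=
  (FaceType3.isTypeOf_iff τ X).2 (h.nonempty_faces τ.certified)

theorem FaceType3.existsUnique {E : Type*} [AddCommGroup E] [Module ℝ E] [TopologicalSpace E] {X : Set E}
    (h : ∃ τ : FaceType3, τ.IsTypeOf X) : ∃! τ : FaceType3, τ.IsTypeOf X := by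
  obtain ⟨τ, hτ⟩ := h
  exact ⟨τ, hτ, fun σ hσ => (FaceType3.isTypeOf_iff_eq hτ σ).1 hσ⟩

instance : DecidableEq FaceType3 := fun σ τ =>
  decidable_of_iff _ (FaceType3.size_injective.eq_iff (a := σ) (b := τ))

/-- The numbering of the types. -/
def FaceType3.equivFin : FaceType3 ≃ Fin 5 where
  toFun τ := ⟨τ.ctorIdx, by cases τ <;> decide⟩
  invFun i := [.tetrahedron, .squarePyramid, .triangularPrism, .cube, .octahedron].getD i .tetrahedron
  left_inv τ := by cases τ <;> rfl
  right_inv i := by fin_cases i <;> rfl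

theorem FaceType3.card_eq : Nat.card FaceType3 = 5 := by
  rw [Nat.card_congr FaceType3.equivFin, Nat.card_fin]

/-- The model of the type with the given name. -/
def FaceType4.model : FaceType4 → Model
  | .simplex => modelSimplex4
  | .pyramidSquarePyramid => modelPyramidSquarePyramid
  | .birkhoff3 => modelBirkhoff3
  | .pyramidTriangularPrism => modelPyramidTriangularPrism
  | .wedgeW => modelWedgeW
  | .pyramidCube => modelPyramidCube
  | .prismTetrahedron => modelPrismTetrahedron
  | .productTriangles => modelProductTriangles
  | .prismSquarePyramid => modelPrismSquarePyramid
  | .productTriangleSquare => modelProductTriangleSquare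
  | .cube => modelCube4
  | .crossPolytope => modelCrossPolytope4
  | .prismOctahedron => modelPrismOctahedron
  | .pyramidOctahedron => modelPyramidOctahedron
  | .bipyramidCube => modelBipyramidCube
  | .wedgeOctahedron => modelWedgeOctahedron
  | .dualW => modelDualW
  | .hypersimplex => modelHypersimplex
  | .specialP => modelSpecialP
  | .specialQ1 => modelSpecialQ1
  | .specialQ2 => modelSpecialQ2

/-- The facets of the model of the type with the given name. -/
def FaceType4.data : FaceType4 → LatticeData
  | .simplex => dataSimplex4
  | .pyramidSquarePyramid => dataPyramidSquarePyramid
  | .birkhoff3 => dataBirkhoff3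
  | .pyramidTriangularPrism => dataPyramidTriangularPrism
  | .wedgeW => dataWedgeW
  | .pyramidCube => dataPyramidCube
  | .prismTetrahedron => dataPrismTetrahedron
  | .productTriangles => dataProductTriangles
  | .prismSquarePyramid => dataPrismSquarePyramid
  | .productTriangleSquare => dataProductTriangleSquare
  | .cube => dataCube4
  | .crossPolytope => dataCrossPolytope4
  | .prismOctahedron => dataPrismOctahedron
  | .pyramidOctahedron => dataPyramidOctahedron
  | .bipyramidCube => dataBipyramidCube
  | .wedgeOctahedron => dataWedgeOctahedron
  | .dualW => dataDualW
  | .hypersimplex => dataHypersimplex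
  | .specialP => dataSpecialP
  | .specialQ1 => dataSpecialQ1
  | .specialQ2 => dataSpecialQ2

/-- The numbers of vertices and of facets. -/
def FaceType4.size : FaceType4 → ℕ × ℕ
  | .simplex => (5, 5)
  | .pyramidSquarePyramid => (6, 6)
  | .birkhoff3 => (6, 9)
  | .pyramidTriangularPrism => (7, 6)
  | .wedgeW => (8, 7)
  | .pyramidCube => (9, 7)
  | .prismTetrahedron => (8, 6)
  | .productTriangles => (9, 6)
  | .prismSquarePyramid => (10, 7)
  | .productTriangleSquare => (12, 7)
  | .cube => (16, 8)
  | .crossPolytope => (8, 16)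
  | .prismOctahedron => (12, 10)
  | .pyramidOctahedron => (7, 9)
  | .bipyramidCube => (10, 12)
  | .wedgeOctahedron => (9, 9)
  | .dualW => (7, 8)
  | .hypersimplex => (10, 10)
  | .specialP => (8, 9)
  | .specialQ1 => (7, 11)
  | .specialQ2 => (8, 15)

theorem FaceType4.certified (τ : FaceType4) :
    τ.model.Balanced && τ.model.HasUnits && τ.model.latticeCheck τ.data = true := by
  cases τ
  · exact checkSimplex4
  · exact checkPyramidSquarePyramid
  · exact checkBirkhoff3
  · exact checkPyramidTriangularPrism
  · exact checkWedgeW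
  · exact checkPyramidCube
  · exact checkPrismTetrahedron
  · exact checkProductTriangles
  · exact checkPrismSquarePyramid
  · exact checkProductTriangleSquare
  · exact checkCube4
  · exact checkCrossPolytope4
  · exact checkPrismOctahedron
  · exact checkPyramidOctahedron
  · exact checkBipyramidCube
  · exact checkWedgeOctahedron
  · exact checkDualW
  · exact checkHypersimplex
  · exact checkSpecialP
  · exact checkSpecialQ1
  · exact checkSpecialQ2

theorem FaceType4.maskSize_eq (τ : FaceType4) : maskSize (τ.model.lattice τ.data) = τ.size := by
  cases τ <;> decide +kernel

/-- The type with given numbers of vertices and facets. -/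
def FaceType4.ofSize (s : ℕ × ℕ) : FaceType4 :=
  match s with
  | (5, 5) => .simplex
  | (6, 6) => .pyramidSquarePyramid
  | (6, 9) => .birkhoff3
  | (7, 6) => .pyramidTriangularPrism
  | (8, 7) => .wedgeW
  | (9, 7) => .pyramidCube
  | (8, 6) => .prismTetrahedron
  | (9, 6) => .productTriangles
  | (10, 7) => .prismSquarePyramid
  | (12, 7) => .productTriangleSquare
  | (16, 8) => .cube
  | (8, 16) => .crossPolytope
  | (12, 10) => .prismOctahedron
  | (7, 9) => .pyramidOctahedron
  | (10, 12) => .bipyramidCube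
  | (9, 9) => .wedgeOctahedron
  | (7, 8) => .dualW
  | (10, 10) => .hypersimplex
  | (8, 9) => .specialP
  | (7, 11) => .specialQ1
  | _ => .specialQ2

theorem FaceType4.size_injective : Function.Injective FaceType4.size :=
  Function.LeftInverse.injective (g := FaceType4.ofSize) fun τ => by cases τ <;> rfl

/-- Most types are compared with a standard polytope realizing the model. The dual of `W` is reached
through polarity, and `P`, `Q₁`, `Q₂` through their incidence lists, so that all definitions end in
the same form. -/
theorem FaceType4.isTypeOf_iff {E : Type*} [AddCommGroup E] [Module ℝ E] [TopologicalSpace E]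
    (τ : FaceType4) (X : Set E) :
    τ.IsTypeOf X ↔ Nonempty (Faces X ≃o MaskPoset (τ.model.lattice τ.data)) := by
  cases τ
  · exact combEquiv_iff (realizes_simplex4.nonempty_faces checkSimplex4)
  · exact combEquiv_iff (realizes_pyramidSquarePyramid.nonempty_faces checkPyramidSquarePyramid)
  · exact combEquiv_iff (realizes_birkhoff3.nonempty_faces checkBirkhoff3)
  · exact combEquiv_iff (realizes_pyramidTriangularPrism.nonempty_faces checkPyramidTriangularPrism)
  · exact combEquiv_iff (realizes_wedgeW.nonempty_faces checkWedgeW)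
  · exact combEquiv_iff (realizes_pyramidCube.nonempty_faces checkPyramidCube)
  · exact combEquiv_iff (realizes_prismTetrahedron.nonempty_faces checkPrismTetrahedron)
  · exact combEquiv_iff (realizes_productTriangles.nonempty_faces checkProductTriangles)
  · exact combEquiv_iff (realizes_prismSquarePyramid.nonempty_faces checkPrismSquarePyramid)
  · exact combEquiv_iff (realizes_productTriangleSquare.nonempty_faces checkProductTriangleSquare)
  · exact combEquiv_iff (realizes_cube4.nonempty_faces checkCube4)
  · exact combEquiv_iff (realizes_crossPolytope4.nonempty_faces checkCrossPolytope4)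
  · exact combEquiv_iff (realizes_prismOctahedron.nonempty_faces checkPrismOctahedron)
  · exact combEquiv_iff (realizes_pyramidOctahedron.nonempty_faces checkPyramidOctahedron)
  · exact combEquiv_iff (realizes_bipyramidCube.nonempty_faces checkBipyramidCube)
  · exact combEquiv_iff (realizes_wedgeOctahedron.nonempty_faces checkWedgeOctahedron)
  · exact combDual_iff (realizes_wedgeW.nonempty_faces checkWedgeW) nonempty_dual_wedgeW
  · exact combEquiv_iff (realizes_hypersimplex.nonempty_faces checkHypersimplex)
  · exact hasIncidences_iff nonempty_incidence_specialP
  · exact hasIncidences_iff nonempty_incidence_specialQ1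
  · exact hasIncidences_iff nonempty_incidence_specialQ2

theorem FaceType4.isTypeOf_iff_eq {E : Type*} [AddCommGroup E] [Module ℝ E] [TopologicalSpace E]
    {X : Set E} {τ : FaceType4} (h : τ.IsTypeOf X) (σ : FaceType4) : σ.IsTypeOf X ↔ σ = τ := by
  constructor
  · intro h'
    obtain ⟨e⟩ := (FaceType4.isTypeOf_iff _ _).1 h
    obtain ⟨e'⟩ := (FaceType4.isTypeOf_iff _ _).1 h'
    have := posetSize_congr (e'.symm.trans e)
    rw [Model.posetSize_lattice, Model.posetSize_lattice, FaceType4.maskSize_eq, FaceType4.maskSize_eq] at this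
    exact FaceType4.size_injective this
  · rintro rfl
    exact h

theorem FaceType4.isTypeOf_of_realizes {E : Type*} [AddCommGroup E] [Module ℝ E] [TopologicalSpace E]
    [IsTopologicalAddGroup E] [ContinuousSMul ℝ E] [T2Space E] [FiniteDimensional ℝ E] {X : Set E}
    (τ : FaceType4) (h : τ.model.Realizes X) : τ.IsTypeOf X :=
  (FaceType4.isTypeOf_iff τ X).2 (h.nonempty_faces τ.certified)

theorem FaceType4.existsUnique {E : Type*} [AddCommGroup E] [Module ℝ E] [TopologicalSpace E] {X : Set E}
    (h : ∃ τ : FaceType4, τ.IsTypeOf X) : ∃! τ : FaceType4, τ.IsTypeOf X := by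
  obtain ⟨τ, hτ⟩ := h
  exact ⟨τ, hτ, fun σ hσ => (FaceType4.isTypeOf_iff_eq hτ σ).1 hσ⟩

instance : DecidableEq FaceType4 := fun σ τ =>
  decidable_of_iff _ (FaceType4.size_injective.eq_iff (a := σ) (b := τ))

/-- The numbering of the types. -/
def FaceType4.equivFin : FaceType4 ≃ Fin 21 where
  toFun τ := ⟨τ.ctorIdx, by cases τ <;> decide⟩
  invFun i := [.simplex, .pyramidSquarePyramid, .birkhoff3, .pyramidTriangularPrism, .wedgeW, .pyramidCube,
    .prismTetrahedron, .productTriangles, .prismSquarePyramid, .productTriangleSquare, .cube,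
    .crossPolytope, .prismOctahedron, .pyramidOctahedron, .bipyramidCube, .wedgeOctahedron,
    .dualW, .hypersimplex, .specialP, .specialQ1, .specialQ2].getD i .simplex
  left_inv τ := by cases τ <;> rfl
  right_inv i := by fin_cases i <;> rfl

theorem FaceType4.card_eq : Nat.card FaceType4 = 21 := by
  rw [Nat.card_congr FaceType4.equivFin, Nat.card_fin]

theorem combEquiv_birkhoff_freeSum :
    CombEquiv (birkhoff 3) (freeSum centeredTriangle centeredTriangle) :=
  (combEquiv_iff (realizes_freeSum.nonempty_faces checkBirkhoff3)).2
    (realizes_birkhoff3.nonempty_faces checkBirkhoff3)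

theorem ncard_birkhoffTypes4 : birkhoffTypes4.ncard = 11 := by
  have : birkhoffTypes4 = (({.simplex, .pyramidSquarePyramid, .birkhoff3, .pyramidTriangularPrism,
    .wedgeW, .pyramidCube, .prismTetrahedron, .productTriangles, .prismSquarePyramid,
    .productTriangleSquare, .cube} : Finset FaceType4) : Set FaceType4) := by
    simp [birkhoffTypes4]
  rw [this, Set.ncard_coe_finset]
  decide

theorem ncard_furtherTypes4 : furtherTypes4.ncard = 8 := by
  have : furtherTypes4 = (({.crossPolytope, .prismOctahedron, .pyramidOctahedron, .bipyramidCube,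
    .wedgeOctahedron, .dualW, .hypersimplex, .specialP} : Finset FaceType4) : Set FaceType4) := by
    simp [furtherTypes4]
  rw [this, Set.ncard_coe_finset]
  decide

theorem ncard_openTypes4 : openTypes4.ncard = 2 := by
  have : openTypes4 = (({.specialQ1, .specialQ2} : Finset FaceType4) : Set FaceType4) := by
    simp [openTypes4]
  rw [this, Set.ncard_coe_finset]
  decide

theorem types4_union : birkhoffTypes4 ∪ furtherTypes4 ∪ openTypes4 = Set.univ := by
  ext τ
  cases τ <;> simp [birkhoffTypes4, furtherTypes4, openTypes4]

/-! ### Faces of permutation polytopes: reflection property, coordinates, classification -/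

section PermutationFaces

variable {n : ℕ}

/-- The permutation matrix. -/
noncomputable def permMat (σ : Equiv.Perm (Fin n)) : Matrix (Fin n) (Fin n) ℝ := σ.permMatrix ℝ

theorem permMat_apply (σ : Equiv.Perm (Fin n)) (i j : Fin n) :
    permMat σ i j = if σ i = j then 1 else 0 := permMatrix_apply σ i j

/-- `W` is the vertex set of a nonempty face of `P(G)`, or empty. -/
def IsFaceVertices (G : Subgroup (Equiv.Perm (Fin n))) (W : Set (Matrix (Fin n) (Fin n) ℝ)) :
    Prop :=
  ∃ (l : Matrix (Fin n) (Fin n) ℝ →ₗ[ℝ] ℝ) (c : ℝ), (∀ σ ∈ G, l (permMat σ) ≤ c) ∧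
    W = {x | ∃ σ ∈ G, l (permMat σ) = c ∧ permMat σ = x}

theorem exists_isFaceVertices {G : Subgroup (Equiv.Perm (Fin n))}
    {F : Set (Matrix (Fin n) (Fin n) ℝ)} (hF : IsExposed ℝ (permPolytope G) F)
    (hne : F.Nonempty) : ∃ W, IsFaceVertices G W ∧ F = convexHull ℝ W := by
  obtain ⟨l, c, hl, rfl⟩ := exists_level_of_isExposed hF hne
  refine ⟨_, ⟨l, c, fun σ hσ => hl _ ⟨σ, hσ, rfl⟩, rfl⟩, ?_⟩
  congr 1
  ext x
  constructor
  · rintro ⟨⟨σ, hσ, rfl⟩, h⟩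
    exact ⟨σ, hσ, h, rfl⟩
  · rintro ⟨σ, hσ, h, rfl⟩
    exact ⟨⟨σ, hσ, rfl⟩, h⟩

/-- If `τ` agrees everywhere with `σ` or `π`, then the complementary choice is a permutation. -/
theorem permMat_complement {σ π τ : Equiv.Perm (Fin n)} (h : ∀ i, τ i = σ i ∨ τ i = π i) :
    permMat (π * τ⁻¹ * σ) = permMat σ + permMat π - permMat τ := by
  have key : ∀ i, (τ i = σ i ∧ (π * τ⁻¹ * σ) i = π i) ∨ (τ i = π i ∧ (π * τ⁻¹ * σ) i = σ i) := by
    intro i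
    by_cases h1 : τ i = σ i
    · left
      refine ⟨h1, ?_⟩
      simp [Equiv.Perm.mul_apply, ← h1]
    · right
      refine ⟨(h i).resolve_left h1, ?_⟩
      -- Put `j = τ⁻¹ (σ i)`. If `τ j = σ j`, then `j = i` and `τ i = σ i`, which is excluded. So `τ
      -- j = π j`, that is, `π j = σ i`.
      have h2 : τ (τ⁻¹ (σ i)) = σ i := by simp
      rcases h (τ⁻¹ (σ i)) with h3 | h3
      · rw [h2] at h3
        have h4 := σ.injective h3
        rw [← h4] at h2
        exact absurd h2 h1
      · rw [h2] at h3
        simp only [Equiv.Perm.mul_apply]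
        exact h3.symm
  ext i j
  simp only [Matrix.add_apply, Matrix.sub_apply, permMat_apply]
  rcases key i with ⟨h1, h2⟩ | ⟨h1, h2⟩
  · rw [h1, h2]; ring
  · rw [h1, h2]; ring

theorem permMat_apply_nonneg (σ : Equiv.Perm (Fin n)) (i j : Fin n) : 0 ≤ permMat σ i j := by
  rw [permMat_apply]; split_ifs <;> norm_num

theorem permMat_apply_self (σ : Equiv.Perm (Fin n)) (i : Fin n) : permMat σ i (σ i) = 1 := by
  rw [permMat_apply, if_pos rfl]

theorem permMat_apply_eq_zero {σ : Equiv.Perm (Fin n)} {i j : Fin n} (h : σ i ≠ j) :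
    permMat σ i j = 0 := by
  rw [permMat_apply, if_neg h]

theorem le_list_sum_apply {l : List (Matrix (Fin n) (Fin n) ℝ)} (hl : ∀ u ∈ l, ∀ i j, 0 ≤ u i j)
    {u : Matrix (Fin n) (Fin n) ℝ} (hu : u ∈ l) (i j : Fin n) : u i j ≤ l.sum i j := by
  have hsum : l.sum i j = (l.map fun u => u i j).sum := by
    induction l with
    | nil => rfl
    | cons x l ih => 
      rw [List.sum_cons, Matrix.add_apply, List.map_cons, List.sum_cons]
      congr 1
      clear hu ih hl
      induction l with
      | nil => rfl
      | cons x l ih => rw [List.sum_cons, Matrix.add_apply, List.map_cons, List.sum_cons, ih]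
  rw [hsum]
  refine List.single_le_sum (fun x hx => ?_) _ (List.mem_map.2 ⟨u, hu, rfl⟩)
  obtain ⟨w, hw, rfl⟩ := List.mem_map.1 hx
  exact hl w hw i j

/-- The entry of the sum at `(i, τ i)` is at least one, because all summands are nonnegative. It
would be zero if neither `σ` nor `π` used this position. -/
theorem apply_eq_or_of_sum_eq {l : List (Matrix (Fin n) (Fin n) ℝ)}
    (hl : ∀ u ∈ l, ∃ τ, permMat τ = u) {σ π τ : Equiv.Perm (Fin n)} {a b : ℕ}
    (hsum : l.sum = a • permMat σ + b • permMat π) (hτ : permMat τ ∈ l) (i : Fin n) :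
    τ i = σ i ∨ τ i = π i := by
  by_contra! hcon
  have h1 := le_list_sum_apply (l := l) (fun u hu i j => by
    obtain ⟨τ, rfl⟩ := hl u hu
    exact permMat_apply_nonneg τ i j) hτ i (τ i)
  rw [hsum, permMat_apply_self] at h1
  simp only [Matrix.add_apply, Matrix.smul_apply, permMat_apply_eq_zero hcon.1.symm,
    permMat_apply_eq_zero hcon.2.symm] at h1
  norm_num at h1

/-- The complementary permutation `π τ⁻¹ σ` is in `G`, and the functional takes the value `c + c - c
= c` at its matrix. -/
theorem IsFaceVertices.star {G : Subgroup (Equiv.Perm (Fin n))}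
    {W : Set (Matrix (Fin n) (Fin n) ℝ)} (hW : IsFaceVertices G W) : Star W := by
  obtain ⟨f, c, hf, rfl⟩ := hW
  rintro _ ⟨σ, hσ, hσc, rfl⟩ _ ⟨π, hπ, hπc, rfl⟩ l hl a b hab hsum _ hu
  obtain ⟨τ, hτ, hτc, rfl⟩ := hl _ hu
  have h : ∀ i, τ i = σ i ∨ τ i = π i := apply_eq_or_of_sum_eq (fun u hu => by
    obtain ⟨τ, -, -, rfl⟩ := hl u hu
    exact ⟨τ, rfl⟩) hsum hu
  refine ⟨_, G.mul_mem (G.mul_mem hπ (G.inv_mem hτ)) hσ, ?_, permMat_complement h⟩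
  rw [permMat_complement h, map_sub, map_add, hσc, hπc, hτc]
  ring

/-- The entry functionals separate the points of the direction space, so they span its dual, and `d`
of them already do so. A vector on which these `d` entries vanish is zero. -/
theorem exists_coordinates {W : Set (Matrix (Fin n) (Fin n) ℝ)} {d : ℕ}
    (hd : Module.finrank ℝ (vectorSpan ℝ W) = d) :
    ∃ c : Fin d → Fin n × Fin n, ∀ x ∈ vectorSpan ℝ W, (∀ t, x (c t).1 (c t).2 = 0) → x = 0 := by
  let φ : Fin n × Fin n → Module.Dual ℝ (vectorSpan ℝ W) := fun p =>
    (Matrix.entryLinearMap ℝ ℝ p.1 p.2).comp (vectorSpan ℝ W).subtype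
  have hspan : Submodule.span ℝ (Set.range φ) = ⊤ := by
    have h1 : (Submodule.span ℝ (Set.range φ)).dualCoannihilator = ⊥ := by
      rw [eq_bot_iff]
      intro x hx
      rw [Submodule.mem_dualCoannihilator] at hx
      rw [Submodule.mem_bot]
      ext i j
      exact hx (φ (i, j)) (Submodule.subset_span ⟨(i, j), rfl⟩)
    have h2 := Subspace.dualCoannihilator_dualAnnihilator_eq
      (W := Submodule.span ℝ (Set.range φ))
    rw [h1, Submodule.dualAnnihilator_bot] at h2
    exact h2.symm
  obtain ⟨f, hf, hfspan, -⟩ := Submodule.exists_fun_fin_finrank_span_eq ℝ (Set.range φ)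
  have hfin : d = Module.finrank ℝ (Submodule.span ℝ (Set.range φ)) := by
    rw [hspan, finrank_top, Subspace.dual_finrank_eq, hd]
  choose c hc using hf
  refine ⟨fun t => c (Fin.cast hfin t), fun x hx h => ?_⟩
  have hzero : ∀ g ∈ Submodule.span ℝ (Set.range f), g ⟨x, hx⟩ = 0 := by
    intro g hg
    induction hg using Submodule.span_induction with
    | mem g hg =>
      obtain ⟨t, rfl⟩ := hg
      rw [← hc t]
      exact h (Fin.cast hfin.symm t)
    | zero => rfl
    | add g g' _ _ ih ih' => rw [LinearMap.add_apply, ih, ih', add_zero]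
    | smul r g _ ih => rw [LinearMap.smul_apply, ih, smul_zero]
  rw [hfspan, hspan] at hzero
  ext i j
  exact hzero (φ (i, j)) trivial

/-- The projection to suitable coordinates is an affine equivalence. -/
theorem affEq_coordinates {W : Set (Matrix (Fin n) (Fin n) ℝ)} {d : ℕ}
    (hd : Module.finrank ℝ (vectorSpan ℝ W) = d) :
    ∃ c : Fin d → Fin n × Fin n, AffEq W ((fun x t => x (c t).1 (c t).2) '' W) := by
  obtain ⟨c, hc⟩ := exists_coordinates hd
  refine ⟨c, ?_⟩
  let f : Matrix (Fin n) (Fin n) ℝ →ₗ[ℝ] (Fin d → ℝ) :=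
    LinearMap.pi fun t => Matrix.entryLinearMap ℝ ℝ (c t).1 (c t).2
  have hinj : LinearMap.ker (f.comp (vectorSpan ℝ W).subtype) = ⊥ := by
    rw [eq_bot_iff]
    intro x hx
    rw [Submodule.mem_bot]
    exact Subtype.ext (hc x.1 x.2 fun t => congrFun (LinearMap.mem_ker.1 hx) t)
  -- A linear left inverse on the direction space, translated by a point of `W`, inverts the
  -- projection on `W`.
  obtain ⟨g, hg⟩ := LinearMap.exists_leftInverse_of_injective _ hinj
  rcases W.eq_empty_or_nonempty with rfl | ⟨w, hw⟩
  · exact ⟨f.toAffineMap, AffineMap.const ℝ _ 0, by simp, fun x hx => absurd hx (by simp)⟩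
  refine ⟨f.toAffineMap, ((vectorSpan ℝ W).subtype.comp g).toAffineMap +
    AffineMap.const ℝ _ (w - g (f w)), rfl, fun x hx => ?_⟩
  have hxw : x - w ∈ vectorSpan ℝ W := vsub_mem_vectorSpan ℝ hx hw
  have h1 := congrArg Subtype.val (LinearMap.congr_fun hg ⟨x - w, hxw⟩)
  simp only [LinearMap.comp_apply, Submodule.subtype_apply, map_sub, LinearMap.id_apply,
    Submodule.coe_sub] at h1
  simp only [AffineMap.coe_add, Pi.add_apply, LinearMap.coe_toAffineMap, LinearMap.comp_apply,
    Submodule.subtype_apply, AffineMap.coe_const, Function.const_apply]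
  have : (g (f x) : Matrix (Fin n) (Fin n) ℝ) = (x - w) + g (f w) := by rw [← h1]; abel
  rw [this]
  abel

theorem exists_code {d : ℕ} {x : Fin d → ℝ} (hx : ∀ t, x t = 0 ∨ x t = 1) :
    ∃ v < 2 ^ d, pt d v = x := by
  classical
  refine ⟨maskOf ((List.range d).filter fun t => decide (∃ h : t < d, x ⟨t, h⟩ = 1)),
    maskOf_lt fun i hi => List.mem_range.1 (List.mem_filter.1 hi).1, ?_⟩
  funext t
  have h := testBit_maskOf ((List.range d).filter fun t => decide (∃ h : t < d, x ⟨t, h⟩ = 1)) t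
  simp only [List.mem_filter, List.mem_range, t.2, true_and, decide_eq_true_iff, exists_true_left]
    at h
  simp only [pt, bit]
  rcases hx t with h0 | h0
  · have : ¬ (x t = 1) := by rw [h0]; norm_num
    rw [Bool.eq_false_iff.2 fun h' => this (h.1 h'), h0]
    simp
  · rw [h.2 h0, h0]
    simp

theorem exists_mask {d : ℕ} {V : Set (Fin d → ℝ)} (hV : ∀ x ∈ V, ∀ t, x t = 0 ∨ x t = 1) :
    ∃ m < 2 ^ 2 ^ d, V = ptSet d m := by
  classical
  refine ⟨maskOf ((List.range (2 ^ d)).filter fun v => decide (pt d v ∈ V)),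
    maskOf_lt fun i hi => List.mem_range.1 (List.mem_filter.1 hi).1, ?_⟩
  ext x
  constructor
  · intro hx
    obtain ⟨v, hv, rfl⟩ := exists_code (hV x hx)
    exact ⟨v, (testBit_maskOf _ _).2 (List.mem_filter.2 ⟨List.mem_range.2 hv, by simpa using hx⟩),
      rfl⟩
  · rintro ⟨v, hv, rfl⟩
    have := (List.mem_filter.1 ((testBit_maskOf _ _).1 hv)).2
    simpa using this

/-- The entries of permutation matrices are `0` or `1`, so the projection of `W` to `d` entries is a
set of 0/1 points in dimension `d`. -/
theorem IsFaceVertices.exists_affEq {G : Subgroup (Equiv.Perm (Fin n))}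
    {W : Set (Matrix (Fin n) (Fin n) ℝ)} (hW : IsFaceVertices G W) {d : ℕ}
    (hd : Module.finrank ℝ (vectorSpan ℝ W) = d) : ∃ m < 2 ^ 2 ^ d, AffEq W (ptSet d m) := by
  obtain ⟨c, hc⟩ := affEq_coordinates hd
  obtain ⟨m, hm, h⟩ := exists_mask (V := (fun x t => x (c t).1 (c t).2) '' W) (by
    rintro _ ⟨x, hx, rfl⟩ t
    obtain ⟨l, b, -, rfl⟩ := hW
    obtain ⟨σ, -, -, rfl⟩ := hx
    simp only [permMat_apply]
    split_ifs
    · exact Or.inr rfl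
    · exact Or.inl rfl)
  exact ⟨m, hm, h ▸ hc⟩

theorem exists_fits {e : Enumeration} (hv : e.valid = true)
    (hall : allBits (2 ^ e.d) 0 e.maskCheck = true) (hd : 0 < e.d)
    {G : Subgroup (Equiv.Perm (Fin n))} {F : Set (Matrix (Fin n) (Fin n) ℝ)}
    (hF : IsExposed ℝ (permPolytope G) F) (hdim : dim F = e.d) :
    ∃ W, IsFaceVertices G W ∧ F = convexHull ℝ W ∧ ∃ r ∈ e.reps, r.1.Fits W := by
  -- The empty face has dimension zero by convention, hence the assumption `0 < e.d`.
  have hne : F.Nonempty := by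
    rw [Set.nonempty_iff_ne_empty]
    rintro rfl
    rw [dim, vectorSpan_empty, finrank_bot] at hdim
    omega
  obtain ⟨W, hW, rfl⟩ := exists_isFaceVertices hF hne
  rw [dim_convexHull] at hdim
  exact ⟨W, hW, rfl, Enumeration.classify hv hall (hW.exists_affEq hdim) hW.star hdim⟩

theorem exists_fits2 {G : Subgroup (Equiv.Perm (Fin n))} {F : Set (Matrix (Fin n) (Fin n) ℝ)}
    (hF : IsExposed ℝ (permPolytope G) F) (hdim : dim F = 2) :
    ∃ W, IsFaceVertices G W ∧ F = convexHull ℝ W ∧ ∃ τ : FaceType2, τ.model.Fits W := by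
  obtain ⟨W, hW, rfl, r, hr, h⟩ := exists_fits enumeration2_valid enumeration2_check
    (by decide) hF hdim
  have hreps : ∀ r ∈ enumeration2.reps, ∃ τ : FaceType2, r.1 = τ.model := by
    simp only [enumeration2, List.forall_mem_cons, List.not_mem_nil, false_imp_iff, implies_true,
      and_true]
    exact ⟨⟨.triangle, rfl⟩, ⟨.square, rfl⟩⟩
  obtain ⟨τ, hτ⟩ := hreps r hr
  exact ⟨W, hW, rfl, τ, hτ ▸ h⟩

theorem exists_isTypeOf2 {G : Subgroup (Equiv.Perm (Fin n))} {F : Set (Matrix (Fin n) (Fin n) ℝ)}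
    (hF : IsExposed ℝ (permPolytope G) F) (hdim : dim F = 2) :
    ∃ τ : FaceType2, τ.IsTypeOf F := by
  obtain ⟨W, -, hFW, τ, h⟩ := exists_fits2 hF hdim
  exact ⟨τ, τ.isTypeOf_of_realizes ⟨W, h, hFW⟩⟩

theorem exists_fits3 {G : Subgroup (Equiv.Perm (Fin n))} {F : Set (Matrix (Fin n) (Fin n) ℝ)}
    (hF : IsExposed ℝ (permPolytope G) F) (hdim : dim F = 3) :
    ∃ W, IsFaceVertices G W ∧ F = convexHull ℝ W ∧ ∃ τ : FaceType3, τ.model.Fits W := by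
  obtain ⟨W, hW, rfl, r, hr, h⟩ := exists_fits enumeration3_valid enumeration3_check
    (by decide) hF hdim
  have hreps : ∀ r ∈ enumeration3.reps, ∃ τ : FaceType3, r.1 = τ.model := by
    simp only [enumeration3, List.forall_mem_cons, List.not_mem_nil, false_imp_iff, implies_true,
      and_true]
    exact ⟨⟨.tetrahedron, rfl⟩, ⟨.tetrahedron, rfl⟩, ⟨.squarePyramid, rfl⟩, ⟨.squarePyramid, rfl⟩,
      ⟨.triangularPrism, rfl⟩, ⟨.tetrahedron, rfl⟩, ⟨.tetrahedron, rfl⟩, ⟨.squarePyramid,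
      rfl⟩, ⟨.octahedron, rfl⟩, ⟨.cube, rfl⟩⟩
  obtain ⟨τ, hτ⟩ := hreps r hr
  exact ⟨W, hW, rfl, τ, hτ ▸ h⟩

theorem exists_isTypeOf3 {G : Subgroup (Equiv.Perm (Fin n))} {F : Set (Matrix (Fin n) (Fin n) ℝ)}
    (hF : IsExposed ℝ (permPolytope G) F) (hdim : dim F = 3) :
    ∃ τ : FaceType3, τ.IsTypeOf F := by
  obtain ⟨W, -, hFW, τ, h⟩ := exists_fits3 hF hdim
  exact ⟨τ, τ.isTypeOf_of_realizes ⟨W, h, hFW⟩⟩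

/-- The second alternative accounts for the two models that share the face lattice of `B_3` without
being affinely equivalent to it. No further information is needed then, since `B_3` is among the
Birkhoff types. -/
theorem exists_fits4 {G : Subgroup (Equiv.Perm (Fin n))} {F : Set (Matrix (Fin n) (Fin n) ℝ)}
    (hF : IsExposed ℝ (permPolytope G) F) (hdim : dim F = 4) :
    ∃ W, IsFaceVertices G W ∧ F = convexHull ℝ W ∧
      ((∃ τ : FaceType4, τ.model.Fits W) ∨ FaceType4.birkhoff3.IsTypeOf F) := by
  obtain ⟨W, hW, rfl, r, hr, h⟩ := exists_fits enumeration4_valid enumeration4_check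
    (by decide) hF hdim
  have hreps : ∀ r ∈ enumeration4.reps, (∃ τ : FaceType4, r.1 = τ.model) ∨
      r.1 = modelFreeSumB ∨ r.1 = modelFreeSumC := by
    simp only [enumeration4, List.forall_mem_cons, List.not_mem_nil, false_imp_iff, implies_true,
      and_true]
    exact ⟨Or.inl ⟨.simplex, rfl⟩, Or.inl ⟨.simplex, rfl⟩, Or.inl ⟨.pyramidSquarePyramid, rfl⟩,
      Or.inl ⟨.pyramidSquarePyramid, rfl⟩, Or.inl ⟨.pyramidTriangularPrism, rfl⟩, Or.inl
      ⟨.simplex, rfl⟩, Or.inl ⟨.simplex, rfl⟩, Or.inl ⟨.pyramidSquarePyramid, rfl⟩, Or.inl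
      ⟨.pyramidOctahedron, rfl⟩, Or.inl ⟨.pyramidCube, rfl⟩, Or.inl ⟨.pyramidTriangularPrism,
      rfl⟩, Or.inl ⟨.prismTetrahedron, rfl⟩, Or.inl ⟨.birkhoff3, rfl⟩, Or.inl ⟨.dualW, rfl⟩,
      Or.inl ⟨.wedgeW, rfl⟩, Or.inl ⟨.simplex, rfl⟩, Or.inr (Or.inl trivial), Or.inl ⟨.birkhoff3,
      rfl⟩, Or.inl ⟨.pyramidSquarePyramid, rfl⟩, Or.inl ⟨.dualW, rfl⟩, Or.inl
      ⟨.pyramidTriangularPrism, rfl⟩, Or.inl ⟨.specialP, rfl⟩, Or.inl ⟨.prismSquarePyramid,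
      rfl⟩, Or.inl ⟨.pyramidSquarePyramid, rfl⟩, Or.inl ⟨.pyramidSquarePyramid, rfl⟩, Or.inl
      ⟨.dualW, rfl⟩, Or.inl ⟨.specialP, rfl⟩, Or.inl ⟨.pyramidSquarePyramid, rfl⟩, Or.inl
      ⟨.productTriangles, rfl⟩, Or.inl ⟨.pyramidTriangularPrism, rfl⟩, Or.inl ⟨.wedgeW, rfl⟩,
      Or.inl ⟨.wedgeOctahedron, rfl⟩, Or.inl ⟨.wedgeOctahedron, rfl⟩, Or.inl
      ⟨.productTriangleSquare, rfl⟩, Or.inl ⟨.pyramidOctahedron, rfl⟩, Or.inl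
      ⟨.pyramidOctahedron, rfl⟩, Or.inl ⟨.specialP, rfl⟩, Or.inl ⟨.wedgeOctahedron, rfl⟩,
      Or.inl ⟨.simplex, rfl⟩, Or.inr (Or.inr trivial), Or.inl ⟨.pyramidSquarePyramid, rfl⟩, Or.inl
      ⟨.specialQ1, rfl⟩, Or.inl ⟨.pyramidTriangularPrism, rfl⟩, Or.inl ⟨.pyramidOctahedron,
      rfl⟩, Or.inl ⟨.hypersimplex, rfl⟩, Or.inl ⟨.crossPolytope, rfl⟩, Or.inl ⟨.specialQ2,
      rfl⟩, Or.inl ⟨.crossPolytope, rfl⟩, Or.inl ⟨.specialP, rfl⟩, Or.inl ⟨.bipyramidCube,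
      rfl⟩, Or.inl ⟨.prismTetrahedron, rfl⟩, Or.inl ⟨.wedgeOctahedron, rfl⟩, Or.inl
      ⟨.prismOctahedron, rfl⟩, Or.inl ⟨.crossPolytope, rfl⟩, Or.inl ⟨.hypersimplex, rfl⟩,
      Or.inl ⟨.cube, rfl⟩⟩
  refine ⟨W, hW, rfl, ?_⟩
  rcases hreps r hr with ⟨τ, hτ⟩ | hτ | hτ
  · exact Or.inl ⟨τ, hτ ▸ h⟩
  · rw [hτ] at h
    -- The vertices and functionals are numbered so that the two computed lists are literally equal.
    have hl : modelFreeSumB.lattice dataFreeSumB = modelBirkhoff3.lattice dataBirkhoff3 := by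
      decide +kernel
    have := Model.Realizes.nonempty_faces checkFreeSumB ⟨W, h, rfl⟩
    rw [hl] at this
    exact Or.inr ((FaceType4.isTypeOf_iff _ _).2 this)
  · rw [hτ] at h
    have hl : modelFreeSumC.lattice dataFreeSumC = modelBirkhoff3.lattice dataBirkhoff3 := by
      decide +kernel
    have := Model.Realizes.nonempty_faces checkFreeSumC ⟨W, h, rfl⟩
    rw [hl] at this
    exact Or.inr ((FaceType4.isTypeOf_iff _ _).2 this)

theorem exists_isTypeOf4 {G : Subgroup (Equiv.Perm (Fin n))} {F : Set (Matrix (Fin n) (Fin n) ℝ)}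
    (hF : IsExposed ℝ (permPolytope G) F) (hdim : dim F = 4) :
    ∃ τ : FaceType4, τ.IsTypeOf F := by
  obtain ⟨W, -, hFW, ⟨τ, h⟩ | h⟩ := exists_fits4 hF hdim
  · exact ⟨τ, τ.isTypeOf_of_realizes ⟨W, h, hFW⟩⟩
  · exact ⟨_, h⟩

end PermutationFaces

/-! ### Affine relations and medians in models -/

section Relations

variable {E : Type*} [AddCommGroup E] [Module ℝ E]

/-- The sums of the rows with indices in `A` and in `B` agree. -/
def Model.rel (M : Model) (A B : List ℕ) : Bool :=
  (List.range M.k).all fun j => (A.map fun i => (M.row i).getD j 0).sum ==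
    (B.map fun i => (M.row i).getD j 0).sum

/-- The point with given index. -/
noncomputable def Model.point (M : Model) (b : ℕ → E) (i : ℕ) : E := comb M.k b (M.row i)

theorem Model.sum_point (M : Model) (b : ℕ → E) (A : List ℕ) :
    (A.map (M.point b)).sum =
      ∑ j ∈ range M.k, (((A.map fun i => (M.row i).getD j 0).sum : ℤ) : ℝ) • b j := by
  induction A with
  | nil => simp
  | cons i A ih =>
    rw [List.map_cons, List.sum_cons, ih, Model.point, comb, ← Finset.sum_add_distrib]
    refine Finset.sum_congr rfl fun j _ => ?_
    rw [List.map_cons, List.sum_cons, Int.cast_add, add_smul]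

theorem Model.sum_point_eq {M : Model} (b : ℕ → E) {A B : List ℕ} (h : M.rel A B = true) :
    (A.map (M.point b)).sum = (B.map (M.point b)).sum := by
  rw [M.sum_point, M.sum_point]
  refine Finset.sum_congr rfl fun j hj => ?_
  have := List.all_eq_true.1 h j (List.mem_range.2 (Finset.mem_range.1 hj))
  rw [beq_iff_eq.1 this]

/-- The dual functionals read off the barycentric coordinates from the points. Equal lengths are
needed for their constant terms to cancel. Relations between actual points can thus be refuted in
the model. -/
theorem Model.rel_of_sum_point_eq {M : Model} (hM : M.Balanced = true) {b : ℕ → E}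
    {a : ℕ → E →ᵃ[ℝ] ℝ} (hd : IsDual M.k b a) {A B : List ℕ} (hlen : A.length = B.length)
    (hA : ∀ i ∈ A, i < M.rows.length) (hB : ∀ i ∈ B, i < M.rows.length)
    (h : (A.map (M.point b)).sum = (B.map (M.point b)).sum) : M.rel A B = true := by
  refine List.all_eq_true.2 fun j hj => beq_iff_eq.2 ?_
  have key : ∀ A : List ℕ, (∀ i ∈ A, i < M.rows.length) →
      (((A.map fun i => (M.row i).getD j 0).sum : ℤ) : ℝ) =
        (a j).linear (A.map (M.point b)).sum + A.length • a j 0 := by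
    intro A hA
    have := affineMap_list_sum (a j) (A.map (M.point b))
    rw [List.length_map] at this
    rw [← this, List.map_map]
    clear this
    induction A with
    | nil => simp
    | cons i A ih =>
      rw [List.map_cons, List.sum_cons, List.map_cons, List.sum_cons, Int.cast_add,
        ih fun i hi => hA i (List.mem_cons_of_mem _ hi), Function.comp_apply, Model.point,
        hd.apply_comb (Model.rowSum_eq_one hM (M.row_mem (hA i (List.mem_cons_self ..))))
          (List.mem_range.1 hj)]
  have h1 := key A hA
  rw [h, hlen, ← key B hB] at h1
  exact_mod_cast h1

theorem Model.mem_points_iff {M : Model} {b : ℕ → E} {x : E} :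
    x ∈ M.points b ↔ ∃ i < M.rows.length, M.point b i = x := by
  constructor
  · rintro ⟨r, hr, rfl⟩
    obtain ⟨i, hi, rfl⟩ := M.exists_row hr
    exact ⟨i, hi, rfl⟩
  · rintro ⟨i, hi, rfl⟩
    exact ⟨_, M.row_mem hi, rfl⟩

/-- Three points `v`, `u₁`, `u₂` have a median in `W`. -/
def HasMedian (W : Set E) (v u₁ u₂ : E) : Prop :=
  ∃ x ∈ W, v + u₁ - x ∈ W ∧ v + u₂ - x ∈ W ∧ u₁ + u₂ - x ∈ W

/-- No point of the model is a median of the three given points. -/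
def Model.medianFree (M : Model) (v u₁ u₂ : ℕ) : Bool :=
  (List.range M.rows.length).all fun x =>
    !(((List.range M.rows.length).any fun y => M.rel [v, u₁] [x, y]) &&
      (((List.range M.rows.length).any fun y => M.rel [v, u₂] [x, y]) &&
        (List.range M.rows.length).any fun y => M.rel [u₁, u₂] [x, y]))

theorem Model.not_hasMedian {M : Model} (hM : M.Balanced = true) {b : ℕ → E}
    {a : ℕ → E →ᵃ[ℝ] ℝ} (hd : IsDual M.k b a) {v u₁ u₂ : ℕ} (hv : v < M.rows.length)
    (hu₁ : u₁ < M.rows.length) (hu₂ : u₂ < M.rows.length) (h : M.medianFree v u₁ u₂ = true) :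
    ¬ HasMedian (M.points b) (M.point b v) (M.point b u₁) (M.point b u₂) := by
  rintro ⟨_, hx, h1, h2, h3⟩
  obtain ⟨x, hxl, rfl⟩ := Model.mem_points_iff.1 hx
  have key : ∀ p < M.rows.length, ∀ q < M.rows.length,
      M.point b p + M.point b q - M.point b x ∈ M.points b →
        ((List.range M.rows.length).any fun y => M.rel [p, q] [x, y]) = true := by
    intro p hp q hq hy
    obtain ⟨y, hy, hxy⟩ := Model.mem_points_iff.1 hy
    refine List.any_eq_true.2 ⟨y, List.mem_range.2 hy, Model.rel_of_sum_point_eq hM hd rfl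
      (by simp [hp, hq]) (by simp [hxl, hy]) ?_⟩
    simp [hxy]
  have := List.all_eq_true.1 h x (List.mem_range.2 hxl)
  rw [key v hv u₁ hu₁ h1, key v hv u₂ hu₂ h2, key u₁ hu₁ u₂ hu₂ h3] at this
  exact absurd this (by simp)

end Relations

/-! ### Majorities and decompositions in faces of Birkhoff polytopes -/

section BirkhoffFaces

variable {n : ℕ} {W : Set (Matrix (Fin n) (Fin n) ℝ)}

/-- Where three permutations never take three different values, their majority is a permutation. -/
theorem IsFaceVertices.hasMedian (hW : IsFaceVertices (⊤ : Subgroup (Equiv.Perm (Fin n))) W)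
    {σ τ₁ τ₂ : Equiv.Perm (Fin n)} (hσ : permMat σ ∈ W) (h₁ : permMat τ₁ ∈ W)
    (h₂ : permMat τ₂ ∈ W) (h : ∀ i, τ₁ i = σ i ∨ τ₂ i = σ i ∨ τ₁ i = τ₂ i) :
    HasMedian W (permMat σ) (permMat τ₁) (permMat τ₂) := by
  let f : Fin n → Fin n := fun i => if τ₁ i = σ i ∨ τ₂ i = σ i then σ i else τ₁ i
  have hf : ∀ i, (f i = σ i ∧ f i = τ₁ i) ∨ (f i = σ i ∧ f i = τ₂ i) ∨ (f i = τ₁ i ∧ f i = τ₂ i) := by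
    intro i
    simp only [f]
    rcases h i with h1 | h1 | h1
    · left; simp [h1]
    · right; left; simp [h1]
    · by_cases h2 : τ₁ i = σ i ∨ τ₂ i = σ i
      · rcases h2 with h2 | h2
        · left; simp [h2]
        · right; left; simp [h2]
      · right; right; rw [if_neg h2]; exact ⟨rfl, h1⟩
  -- At each index `f` agrees with at least two of the three permutations. For any two indices some
  -- permutation is therefore common, and its injectivity applies.
  have hinj : Function.Injective f := by
    intro i j hij
    rcases hf i with ⟨h1, h2⟩ | ⟨h1, h2⟩ | ⟨h1, h2⟩ <;>
      rcases hf j with ⟨h3, h4⟩ | ⟨h3, h4⟩ | ⟨h3, h4⟩ <;>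
      first
      | exact σ.injective (h1.symm.trans (hij.trans h3))
      | exact τ₁.injective (h1.symm.trans (hij.trans h3))
      | exact τ₁.injective (h2.symm.trans (hij.trans h3))
      | exact τ₁.injective (h1.symm.trans (hij.trans h4))
      | exact τ₁.injective (h2.symm.trans (hij.trans h4))
      | exact τ₂.injective (h2.symm.trans (hij.trans h4))
  let ρ : Equiv.Perm (Fin n) := Equiv.ofBijective f (Finite.injective_iff_bijective.1 hinj)
  have hρ : ∀ i, ρ i = f i := fun i => rfl
  have e1 := permMat_complement (σ := σ) (π := τ₁) (τ := ρ) fun i => by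
    rw [hρ]; rcases hf i with h | h | h <;> simp [h.1]
  have e2 := permMat_complement (σ := σ) (π := τ₂) (τ := ρ) fun i => by
    rw [hρ]; rcases hf i with h | h | h
    · exact Or.inl h.1
    · exact Or.inl h.1
    · exact Or.inr h.2
  have e3 := permMat_complement (σ := τ₁) (π := τ₂) (τ := ρ) fun i => by
    rw [hρ]; rcases hf i with h | h | h
    · exact Or.inl h.2
    · exact Or.inr h.2
    · exact Or.inl h.1
  obtain ⟨l, c, hl, rfl⟩ := hW
  have hval : ∀ π, permMat π ∈ {x | ∃ σ ∈ (⊤ : Subgroup (Equiv.Perm (Fin n))),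
      l (permMat σ) = c ∧ permMat σ = x} ↔ l (permMat π) = c := by
    intro π
    constructor
    · rintro ⟨σ, -, h, h'⟩
      rwa [h'] at h
    · exact fun h => ⟨π, Subgroup.mem_top _, h, rfl⟩
  rw [hval] at hσ h₁ h₂
  have hle : ∀ π, l (permMat π) ≤ c := fun π => hl π (Subgroup.mem_top _)
  have l1 := congrArg l e1
  have l2 := congrArg l e2
  have l3 := congrArg l e3
  simp only [map_add, map_sub, hσ, h₁, h₂] at l1 l2 l3
  -- The values at `ρ` and at its complement with respect to `σ` and `τ₁` add up to `2 c`, and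
  -- neither exceeds `c`. The bound is available because every permutation belongs to the full
  -- symmetric group.
  have hρc : l (permMat ρ) = c := le_antisymm (hle ρ) (by
    have := hle (τ₁ * ρ⁻¹ * σ)
    linarith)
  exact ⟨permMat ρ, (hval _).2 hρc, e1 ▸ (hval _).2 (by linarith), e2 ▸ (hval _).2 (by linarith),
    e3 ▸ (hval _).2 (by linarith)⟩

theorem IsFaceVertices.exists_perm {G : Subgroup (Equiv.Perm (Fin n))} (hW : IsFaceVertices G W)
    {x : Matrix (Fin n) (Fin n) ℝ} (hx : x ∈ W) : ∃ σ, permMat σ = x := by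
  obtain ⟨l, c, -, rfl⟩ := hW
  obtain ⟨σ, -, -, rfl⟩ := hx
  exact ⟨σ, rfl⟩

/-- The members of `A` add up to `a` times the point `v` plus `b` times the point `w`, and two of
them have no median with `v`. -/
def Model.medianViolation (M : Model) (A : List ℕ) (v a w b u₁ u₂ : ℕ) : Bool :=
  M.rel A (List.replicate a v ++ List.replicate b w) && (A.contains u₁ && (A.contains u₂ &&
    (M.medianFree v u₁ u₂ && (v :: w :: A).all fun i => Nat.blt i M.rows.length)))

/-- By the relation, the members of `A` agree in each row with `v` or `w`. Hence `v`, `u₁`, `u₂`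
never take three different values, and their majority would be a median. -/
theorem IsFaceVertices.not_fits_of_medianViolation
    (hW : IsFaceVertices (⊤ : Subgroup (Equiv.Perm (Fin n))) W) {M : Model}
    (hM : M.Balanced = true) {A : List ℕ} {v a w b u₁ u₂ : ℕ}
    (h : M.medianViolation A v a w b u₁ u₂ = true) : ¬ M.Fits W := by
  rintro ⟨p, q, hd, rfl⟩
  simp only [Model.medianViolation, Bool.and_eq_true, List.contains_iff_mem, List.all_eq_true,
    List.mem_cons, Nat.blt_eq] at h
  obtain ⟨hrel, h1, h2, hmed, hlt⟩ := h
  have hmem : ∀ i, (i = v ∨ i = w ∨ i ∈ A) → M.point p i ∈ M.points p := fun i hi =>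
    Model.mem_points_iff.2 ⟨i, hlt i hi, rfl⟩
  have hperm := fun i hi => hW.exists_perm (hmem i hi)
  obtain ⟨σ, hσ⟩ := hperm v (Or.inl rfl)
  obtain ⟨π, hπ⟩ := hperm w (Or.inr (Or.inl rfl))
  obtain ⟨τ₁, hτ₁⟩ := hperm u₁ (Or.inr (Or.inr h1))
  obtain ⟨τ₂, hτ₂⟩ := hperm u₂ (Or.inr (Or.inr h2))
  have hsum := M.sum_point_eq p hrel
  rw [List.map_append, List.map_replicate, List.map_replicate, List.sum_append,
    List.sum_replicate, List.sum_replicate, ← hσ, ← hπ] at hsum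
  have hl : ∀ u ∈ A.map (M.point p), ∃ τ, permMat τ = u := by
    intro u hu
    obtain ⟨i, hi, rfl⟩ := List.mem_map.1 hu
    exact hperm i (Or.inr (Or.inr hi))
  have k1 := apply_eq_or_of_sum_eq hl hsum
    (by rw [hτ₁]; exact List.mem_map_of_mem h1)
  have k2 := apply_eq_or_of_sum_eq hl hsum
    (by rw [hτ₂]; exact List.mem_map_of_mem h2)
  refine M.not_hasMedian hM hd (hlt v (Or.inl rfl)) (hlt u₁ (Or.inr (Or.inr h1)))
    (hlt u₂ (Or.inr (Or.inr h2))) hmed ?_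
  rw [← hσ, ← hτ₁, ← hτ₂]
  refine hW.hasMedian (hσ ▸ hmem v (Or.inl rfl)) (hτ₁ ▸ hmem u₁ (Or.inr (Or.inr h1)))
    (hτ₂ ▸ hmem u₂ (Or.inr (Or.inr h2))) fun i => ?_
  rcases k1 i with h | h
  · exact Or.inl h
  · rcases k2 i with h' | h'
    · exact Or.inr (Or.inl h')
    · exact Or.inr (Or.inr (h.trans h'.symm))

/-- A nonnegative matrix with all line sums equal to one contains a permutation in its support. -/
theorem exists_perm_pos {A : Matrix (Fin n) (Fin n) ℝ} (hA : A ∈ doublyStochastic ℝ (Fin n)) :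
    ∃ σ : Equiv.Perm (Fin n), ∀ i, 0 < A i (σ i) := by
  -- The Birkhoff-von Neumann theorem writes the matrix as a convex combination; any permutation of
  -- positive weight will do.
  obtain ⟨w, hw0, hw1, hwA⟩ := exists_eq_sum_perm_of_mem_doublyStochastic hA
  obtain ⟨σ, -, hσ⟩ : ∃ σ ∈ Finset.univ, 0 < w σ := by
    by_contra! hcon
    have : ∑ σ, w σ ≤ 0 := Finset.sum_nonpos hcon
    rw [hw1] at this
    norm_num at this
  refine ⟨σ, fun i => hσ.trans_le ?_⟩
  rw [← hwA, Matrix.sum_apply]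
  refine le_trans ?_ (Finset.single_le_sum (f := fun π => (w π • Equiv.Perm.permMatrix ℝ π) i (σ i))
    (fun π _ => ?_) (Finset.mem_univ σ))
  · rw [Matrix.smul_apply, permMatrix_apply, if_pos rfl, smul_eq_mul, mul_one]
  · rw [Matrix.smul_apply, permMatrix_apply]
    exact smul_nonneg (hw0 π) (by split_ifs <;> norm_num)

theorem sum_row_permMat (σ : Equiv.Perm (Fin n)) (i : Fin n) : ∑ j, permMat σ i j = 1 := by
  simp [permMat_apply]

theorem sum_col_permMat (σ : Equiv.Perm (Fin n)) (j : Fin n) : ∑ i, permMat σ i j = 1 := by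
  simp [permMat_apply, ← Equiv.eq_symm_apply]

/-- If a permutation matrix is supported in the sum of three others, then the remainder is the sum
of two permutation matrices. -/
theorem exists_add_eq_add {α β γ δ : Equiv.Perm (Fin n)}
    (h : ∀ i, δ i = α i ∨ δ i = β i ∨ δ i = γ i) :
    ∃ ε φ, permMat α + permMat β + permMat γ = permMat δ + permMat ε + permMat φ := by
  -- The remainder is kept as an integral matrix, so that positive entries are at least one when a
  -- permutation matrix is subtracted.
  let Z : Fin n → Fin n → ℤ := fun i j => (if α i = j then 1 else 0) + (if β i = j then 1 else 0) +
    (if γ i = j then 1 else 0) - (if δ i = j then 1 else 0)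
  let A := permMat α + permMat β + permMat γ - permMat δ
  have hAZ : ∀ i j, A i j = Z i j := by
    intro i j
    simp only [A, Z, Matrix.add_apply, Matrix.sub_apply, permMat_apply]
    push_cast
    rfl
  have hZ : ∀ i j, 0 ≤ Z i j := by
    intro i j
    simp only [Z]
    by_cases hj : δ i = j
    · subst hj
      rcases h i with h | h | h <;> rw [if_pos rfl, h] <;> split_ifs <;> norm_num at *
    · rw [if_neg hj]
      split_ifs <;> norm_num
  have hrow : ∀ i, ∑ j, A i j = 2 := by
    intro i
    simp only [A, Matrix.add_apply, Matrix.sub_apply, Finset.sum_add_distrib,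
      Finset.sum_sub_distrib, sum_row_permMat]
    norm_num
  have hcol : ∀ j, ∑ i, A i j = 2 := by
    intro i
    simp only [A, Matrix.add_apply, Matrix.sub_apply, Finset.sum_add_distrib,
      Finset.sum_sub_distrib, sum_col_permMat]
    norm_num
  -- All line sums of the remainder are `3 - 1 = 2`, so half of it is doubly stochastic.
  obtain ⟨ε, hε⟩ := exists_perm_pos (A := (1 / 2 : ℝ) • A) (by
    rw [mem_doublyStochastic_iff_sum]
    refine ⟨fun i j => ?_, fun i => ?_, fun j => ?_⟩
    · rw [Matrix.smul_apply, hAZ]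
      exact smul_nonneg (by norm_num) (by exact_mod_cast hZ i j)
    · simp only [Matrix.smul_apply, ← Finset.smul_sum, hrow]; norm_num
    · simp only [Matrix.smul_apply, ← Finset.smul_sum, hcol]; norm_num)
  have hε1 : ∀ i, 1 ≤ Z i (ε i) := by
    intro i
    have := hε i
    rw [Matrix.smul_apply, hAZ, smul_eq_mul] at this
    have : (0 : ℝ) < Z i (ε i) := by linarith
    have : 0 < Z i (ε i) := by exact_mod_cast this
    omega
  let Z' : Fin n → Fin n → ℤ := fun i j => Z i j - if ε i = j then 1 else 0
  have hBZ : ∀ i j, (A - permMat ε) i j = Z' i j := by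
    intro i j
    simp only [Matrix.sub_apply, hAZ, permMat_apply, Z']
    push_cast
    rfl
  have hZ' : ∀ i j, 0 ≤ Z' i j := by
    intro i j
    simp only [Z']
    split_ifs with hj
    · subst hj
      have := hε1 i
      omega
    · have := hZ i j
      omega
  have hrow' : ∀ i, ∑ j, (A - permMat ε) i j = 1 := by
    intro i
    simp only [Matrix.sub_apply, Finset.sum_sub_distrib, hrow, sum_row_permMat]
    norm_num
  -- Now the line sums are one. The remainder dominates the matrix of `φ` and has the same row sums,
  -- so it equals this matrix.
  obtain ⟨φ, hφ⟩ := exists_perm_pos (A := A - permMat ε) (by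
    rw [mem_doublyStochastic_iff_sum]
    refine ⟨fun i j => ?_, hrow', fun j => ?_⟩
    · rw [hBZ]; exact_mod_cast hZ' i j
    · simp only [Matrix.sub_apply, Finset.sum_sub_distrib, hcol, sum_col_permMat]; norm_num)
  refine ⟨ε, φ, ?_⟩
  have hfin : A - permMat ε = permMat φ := by
    ext i j
    have hnn : ∀ j, 0 ≤ (A - permMat ε - permMat φ) i j := by
      intro j
      rw [Matrix.sub_apply, hBZ, permMat_apply]
      split_ifs with hj
      · subst hj
        have := hφ i
        rw [hBZ] at this
        have : 0 < Z' i (φ i) := by exact_mod_cast this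
        have : (1 : ℝ) ≤ Z' i (φ i) := by exact_mod_cast this
        linarith
      · rw [sub_zero]; exact_mod_cast hZ' i j
    have hs : ∑ j, (A - permMat ε - permMat φ) i j = 0 := by
      have := hrow' i
      simp only [Matrix.sub_apply _ (permMat φ), Finset.sum_sub_distrib (f := fun j =>
        (A - permMat ε) i j), this, sum_row_permMat]
      norm_num
    have := (Finset.sum_eq_zero_iff_of_nonneg fun j _ => hnn j).1 hs j (Finset.mem_univ j)
    rw [Matrix.sub_apply] at this
    linarith
  have : permMat α + permMat β + permMat γ = permMat δ + A := by simp only [A]; abel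
  rw [this, add_assoc, ← hfin]
  abel

end BirkhoffFaces

/-! ### Support, dimension and digraphs; exclusion of the dual of `W` -/

section BirkhoffFaces

variable {n : ℕ} {W : Set (Matrix (Fin n) (Fin n) ℝ)}

theorem apply_eq_or_of_sum_eq_three {l : List (Matrix (Fin n) (Fin n) ℝ)}
    (hl : ∀ u ∈ l, ∃ τ, permMat τ = u) {α β γ τ : Equiv.Perm (Fin n)} {a b c : ℕ}
    (hsum : l.sum = a • permMat α + b • permMat β + c • permMat γ) (hτ : permMat τ ∈ l)
    (i : Fin n) : τ i = α i ∨ τ i = β i ∨ τ i = γ i := by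
  by_contra! hcon
  have h1 := le_list_sum_apply (l := l) (fun u hu i j => by
    obtain ⟨τ, rfl⟩ := hl u hu
    exact permMat_apply_nonneg τ i j) hτ i (τ i)
  rw [hsum, permMat_apply_self] at h1
  simp only [Matrix.add_apply, Matrix.smul_apply, permMat_apply_eq_zero hcon.1.symm,
    permMat_apply_eq_zero hcon.2.1.symm, permMat_apply_eq_zero hcon.2.2.symm] at h1
  norm_num at h1

/-- The member `d` of `A` is supported in the sum of the points `a`, `b`, `c`, but the remainder
is not the sum of two points. -/
def Model.tripleViolation (M : Model) (A : List ℕ) (a x b y c z d : ℕ) : Bool :=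
  M.rel A (List.replicate x a ++ (List.replicate y b ++ List.replicate z c)) &&
  (A.contains d && ((a :: b :: c :: A).all (fun i => Nat.blt i M.rows.length) &&
    (List.range M.rows.length).all fun e => (List.range M.rows.length).all fun f =>
      !M.rel [a, b, c] [d, e, f]))

/-- The relation puts the support of `d` into that of `a`, `b`, `c`, so `a + b + c = d + ε + φ` for
two permutation matrices. The values of the functional at these two add up to `2 m` and are at most
`m` each, so both are vertices of the face, contrary to the check. -/
theorem IsFaceVertices.not_fits_of_tripleViolation
    (hW : IsFaceVertices (⊤ : Subgroup (Equiv.Perm (Fin n))) W) {M : Model}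
    (hM : M.Balanced = true) {A : List ℕ} {a x b y c z d : ℕ}
    (h : M.tripleViolation A a x b y c z d = true) : ¬ M.Fits W := by
  rintro ⟨p, q, hd, rfl⟩
  simp only [Model.tripleViolation, Bool.and_eq_true, List.contains_iff_mem, List.all_eq_true,
    List.mem_cons, Nat.blt_eq, List.mem_range, Bool.not_eq_true'] at h
  obtain ⟨hrel, hdA, hlt, hno⟩ := h
  have hmem : ∀ i, (i = a ∨ i = b ∨ i = c ∨ i ∈ A) → M.point p i ∈ M.points p := fun i hi =>
    Model.mem_points_iff.2 ⟨i, hlt i hi, rfl⟩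
  have hperm := fun i hi => hW.exists_perm (hmem i hi)
  obtain ⟨α, hα⟩ := hperm a (by simp)
  obtain ⟨β, hβ⟩ := hperm b (by simp)
  obtain ⟨γ, hγ⟩ := hperm c (by simp)
  obtain ⟨δ, hδ⟩ := hperm d (by simp [hdA])
  have hsum := M.sum_point_eq p hrel
  simp only [List.map_append, List.map_replicate, List.sum_append, List.sum_replicate, ← hα, ← hβ,
    ← hγ, ← add_assoc] at hsum
  have hl : ∀ u ∈ A.map (M.point p), ∃ τ, permMat τ = u := by
    intro u hu
    obtain ⟨i, hi, rfl⟩ := List.mem_map.1 hu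
    exact hperm i (by simp [hi])
  obtain ⟨ε, φ, hεφ⟩ := exists_add_eq_add (apply_eq_or_of_sum_eq_three hl hsum
    (by rw [hδ]; exact List.mem_map_of_mem hdA))
  have hW' := hW
  obtain ⟨l, m, hle, hWl⟩ := hW'
  have hval : ∀ π, permMat π ∈ M.points p ↔ l (permMat π) = m := by
    intro π
    rw [hWl]
    constructor
    · rintro ⟨σ, -, h, h'⟩
      rwa [h'] at h
    · exact fun h => ⟨π, Subgroup.mem_top _, h, rfl⟩
  have hs := congrArg l hεφ
  simp only [map_add, (hval α).1 (hα ▸ hmem a (by simp)), (hval β).1 (hβ ▸ hmem b (by simp)),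
    (hval γ).1 (hγ ▸ hmem c (by simp)), (hval δ).1 (hδ ▸ hmem d (by simp [hdA]))] at hs
  have l1 := hle ε (Subgroup.mem_top _)
  have l2 := hle φ (Subgroup.mem_top _)
  obtain ⟨e, he, hε⟩ := Model.mem_points_iff.1 ((hval ε).2 (by linarith))
  obtain ⟨f, hf, hφ⟩ := Model.mem_points_iff.1 ((hval φ).2 (by linarith))
  have := Model.rel_of_sum_point_eq hM hd (A := [a, b, c]) (B := [d, e, f]) rfl
    (by simp [hlt a, hlt b, hlt c]) (by simp [hlt d (by simp [hdA]), he, hf])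
    (by simp only [List.map_cons, List.map_nil, List.sum_cons, List.sum_nil, add_zero,
          ← add_assoc, ← hα, ← hβ, ← hγ, ← hδ, hε, hφ, hεφ])
  rw [hno e he f hf] at this
  exact absurd this (by simp)

/-- The directions of a face of a Birkhoff polytope: all matrices with vanishing line sums that are
supported in the face. -/
theorem IsFaceVertices.mem_vectorSpan
    (hW : IsFaceVertices (⊤ : Subgroup (Equiv.Perm (Fin n))) W) (hne : W.Nonempty)
    {D : Matrix (Fin n) (Fin n) ℝ} (hrow : ∀ i, ∑ j, D i j = 0) (hcol : ∀ j, ∑ i, D i j = 0)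
    (hsupp : ∀ i j, D i j ≠ 0 → ∃ w ∈ W, w i j ≠ 0) : D ∈ vectorSpan ℝ W := by
  classical
  have hW' := hW
  obtain ⟨l, c, hle, hWl⟩ := hW'
  let S : Finset (Equiv.Perm (Fin n)) := Finset.univ.filter fun σ => permMat σ ∈ W
  have hS : S.Nonempty := by
    obtain ⟨w, hw⟩ := hne
    obtain ⟨σ, rfl⟩ := hW.exists_perm hw
    exact ⟨σ, Finset.mem_filter.2 ⟨Finset.mem_univ _, hw⟩⟩
  have hN : (0 : ℝ) < S.card := by exact_mod_cast hS.card_pos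
  -- The barycenter of the vertices: each entry in the support of the face is at least the
  -- reciprocal of the number of vertices.
  let B : Matrix (Fin n) (Fin n) ℝ := ∑ σ ∈ S, (S.card : ℝ)⁻¹ • permMat σ
  have hBW : B ∈ convexHull ℝ W := by
    refine (convex_convexHull ℝ W).sum_mem (fun _ _ => (inv_pos.2 hN).le) ?_ fun σ hσ =>
      subset_convexHull ℝ W (Finset.mem_filter.1 hσ).2
    rw [Finset.sum_const, nsmul_eq_mul, mul_inv_cancel₀ hN.ne']
  have hBij : ∀ i j, B i j = ∑ σ ∈ S, (S.card : ℝ)⁻¹ * permMat σ i j := by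
    intro i j
    simp only [B, Matrix.sum_apply, Matrix.smul_apply, smul_eq_mul]
  have hB0 : ∀ i j, 0 ≤ B i j := fun i j => by
    rw [hBij]
    exact Finset.sum_nonneg fun σ _ => mul_nonneg (inv_pos.2 hN).le (permMat_apply_nonneg σ i j)
  have hBpos : ∀ i j, D i j ≠ 0 → (S.card : ℝ)⁻¹ ≤ B i j := by
    intro i j hD
    obtain ⟨w, hw, hwij⟩ := hsupp i j hD
    obtain ⟨σ, rfl⟩ := hW.exists_perm hw
    have hσj : σ i = j := by
      by_contra h
      exact hwij (permMat_apply_eq_zero h)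
    have hσS : σ ∈ S := Finset.mem_filter.2 ⟨Finset.mem_univ _, hw⟩
    rw [hBij]
    refine le_trans ?_ (Finset.single_le_sum (f := fun σ => (S.card : ℝ)⁻¹ * permMat σ i j)
      (fun τ _ => mul_nonneg (inv_pos.2 hN).le (permMat_apply_nonneg τ i j)) hσS)
    subst hσj
    simp [permMat_apply_self]
  have hBrow : ∀ i, ∑ j, B i j = 1 := by
    intro i
    simp only [hBij]
    rw [Finset.sum_comm]
    simp only [← Finset.mul_sum, sum_row_permMat]
    rw [Finset.sum_const, nsmul_eq_mul, mul_one, inv_mul_cancel₀ hN.ne']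
  have hBcol : ∀ j, ∑ i, B i j = 1 := by
    intro j
    simp only [hBij]
    rw [Finset.sum_comm]
    simp only [← Finset.mul_sum, sum_col_permMat]
    rw [Finset.sum_const, nsmul_eq_mul, mul_one, inv_mul_cancel₀ hN.ne']
  -- A bound for all entries of `D`; the summand one makes it positive even for `D = 0`.
  let R : ℝ := 1 + ∑ i, ∑ j, |D i j|
  have hR : ∀ i j, |D i j| ≤ R := by
    intro i j
    have h1 : |D i j| ≤ ∑ j, |D i j| :=
      Finset.single_le_sum (f := fun j => |D i j|) (fun _ _ => abs_nonneg _) (Finset.mem_univ j)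
    have h2 : ∑ j, |D i j| ≤ ∑ i, ∑ j, |D i j| :=
      Finset.single_le_sum (f := fun i => ∑ j, |D i j|)
        (fun _ _ => Finset.sum_nonneg fun _ _ => abs_nonneg _) (Finset.mem_univ i)
    simp only [R]
    linarith
  have hRpos : 0 < R := by
    have : 0 ≤ ∑ i, ∑ j, |D i j| :=
      Finset.sum_nonneg fun _ _ => Finset.sum_nonneg fun _ _ => abs_nonneg _
    simp only [R]
    linarith
  let t : ℝ := (S.card : ℝ)⁻¹ * R⁻¹
  have ht : 0 < t := mul_pos (inv_pos.2 hN) (inv_pos.2 hRpos)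
  have htD : ∀ i j, |t * D i j| ≤ (S.card : ℝ)⁻¹ := by
    intro i j
    rw [abs_mul, abs_of_pos ht]
    calc t * |D i j| ≤ t * R := mul_le_mul_of_nonneg_left (hR i j) ht.le
      _ = (S.card : ℝ)⁻¹ := by simp only [t]; rw [mul_assoc, inv_mul_cancel₀ hRpos.ne', mul_one]
  -- For this step size both `B + t D` and `B - t D` are nonnegative with line sums one, hence in
  -- the Birkhoff polytope.
  have hds : ∀ s : ℝ, (s = t ∨ s = -t) → B + s • D ∈
      convexHull ℝ {x : Matrix (Fin n) (Fin n) ℝ | ∃ σ : Equiv.Perm (Fin n), permMat σ = x} := by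
    intro s hs
    have hsabs : ∀ i j, |s * D i j| ≤ (S.card : ℝ)⁻¹ := by
      intro i j
      rcases hs with rfl | rfl
      · exact htD i j
      · rw [neg_mul, abs_neg]; exact htD i j
    have hmem : B + s • D ∈ (doublyStochastic ℝ (Fin n) : Set (Matrix (Fin n) (Fin n) ℝ)) := by
      refine mem_doublyStochastic_iff_sum.2 ⟨fun i j => ?_, fun i => ?_, fun j => ?_⟩
      · rw [Matrix.add_apply, Matrix.smul_apply, smul_eq_mul]
        by_cases hD : D i j = 0
        · rw [hD, mul_zero, add_zero]; exact hB0 i j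
        · have h1 := hBpos i j hD
          have h2 := (abs_le.1 (hsabs i j)).1
          linarith
      · simp only [Matrix.add_apply, Matrix.smul_apply, Finset.sum_add_distrib, ← Finset.smul_sum,
          hBrow, hrow, smul_zero, add_zero]
      · simp only [Matrix.add_apply, Matrix.smul_apply, Finset.sum_add_distrib, ← Finset.smul_sum,
          hBcol, hcol, smul_zero, add_zero]
    rw [doublyStochastic_eq_convexHull_permMatrix] at hmem
    exact hmem
  have hlB : l B = c := by
    have : convexHull ℝ W ⊆ {x | l x = c} := by
      refine convexHull_min ?_ (convex_hyperplane l.isLinear c)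
      rw [hWl]
      rintro _ ⟨σ, -, h, rfl⟩
      exact h
    exact this hBW
  have hlle : ∀ x ∈ convexHull ℝ {x | ∃ σ : Equiv.Perm (Fin n), permMat σ = x}, l x ≤ c := by
    intro x hx
    have : convexHull ℝ {x | ∃ σ : Equiv.Perm (Fin n), permMat σ = x} ⊆ {x | l x ≤ c} := by
      refine convexHull_min ?_ (convex_halfSpace_le l.isLinear c)
      rintro _ ⟨σ, rfl⟩
      exact hle σ (Subgroup.mem_top _)
    exact this hx
  -- The bound `l ≤ c` at both points forces `l D = 0`. Thus `B + t D` lies in the face, and `D` is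
  -- a multiple of a difference of two of its points.
  have h1 := hlle _ (hds t (Or.inl rfl))
  have h2 := hlle _ (hds (-t) (Or.inr rfl))
  rw [map_add, map_smul, hlB, smul_eq_mul] at h1 h2
  have hlc : l (B + t • D) = c := by
    rw [map_add, map_smul, hlB, smul_eq_mul]
    linarith
  have hin : B + t • D ∈ convexHull ℝ W := by
    rcases mem_convexHull_level (l := l) (M := c)
      (by rintro _ ⟨σ, rfl⟩; exact hle σ (Subgroup.mem_top _)) (hds t (Or.inl rfl)) with h | h
    · exact absurd h (by rw [hlc]; exact lt_irrefl c)
    · rw [hWl]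
      refine convexHull_mono ?_ h
      rintro _ ⟨⟨σ, rfl⟩, h⟩
      exact ⟨σ, Subgroup.mem_top _, h, rfl⟩
  have hspan : vectorSpan ℝ (convexHull ℝ W) = vectorSpan ℝ W := by
    rw [← direction_affineSpan, affineSpan_convexHull, direction_affineSpan]
  have h3 := vsub_mem_vectorSpan ℝ hin hBW
  rw [hspan, vsub_eq_sub, add_sub_cancel_left] at h3
  have h4 := (vectorSpan ℝ W).smul_mem t⁻¹ h3
  rwa [smul_smul, inv_mul_cancel₀ ht.ne', one_smul] at h4

/-- The dimension of a face of a Birkhoff polytope is at least the cyclomatic number of the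
associated digraph, taken with respect to the vertex `σ`. -/
theorem IsFaceVertices.card_arcs_le
    (hW : IsFaceVertices (⊤ : Subgroup (Equiv.Perm (Fin n))) W) {σ : Equiv.Perm (Fin n)}
    (hσ : permMat σ ∈ W) {A : Finset (Fin n × Fin n)} {V : Finset (Fin n)} (hV : V.Nonempty)
    (hA : ∀ a ∈ A, a.1 ≠ a.2 ∧ a.1 ∈ V ∧ a.2 ∈ V ∧ ∃ w ∈ W, w a.1 (σ a.2) ≠ 0) :
    A.card + 1 ≤ V.card + Module.finrank ℝ (vectorSpan ℝ W) := by
  classical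
  let ind : Fin n → Fin n → ℝ := fun i j => if i = j then 1 else 0
  -- Inflow minus outflow of a flow on the arcs. The total over all nodes is zero, so the rank is at
  -- most `V.card - 1`, and the circulations have dimension at least `A.card - V.card + 1`.
  let dv : (A → ℝ) →ₗ[ℝ] (V → ℝ) :=
    LinearMap.pi fun s => ∑ a : A, (ind a.1.2 s - ind a.1.1 s) • LinearMap.proj a
  have hdv : ∀ g s, dv g s = ∑ a : A, (ind a.1.2 s - ind a.1.1 s) * g a := by
    intro g s
    simp [dv]
  let tot : (V → ℝ) →ₗ[ℝ] ℝ := ∑ s : V, LinearMap.proj s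
  have htot : tot ≠ 0 := by
    obtain ⟨v, hv⟩ := hV
    intro h
    have := LinearMap.congr_fun h (Pi.single ⟨v, hv⟩ 1)
    simp [tot] at this
  have hrange : LinearMap.range dv ≤ LinearMap.ker tot := by
    rintro _ ⟨g, rfl⟩
    rw [LinearMap.mem_ker]
    simp only [tot, LinearMap.sum_apply, LinearMap.proj_apply, hdv]
    rw [Finset.sum_comm]
    refine Finset.sum_eq_zero fun a _ => ?_
    rw [← Finset.sum_mul, Finset.sum_sub_distrib]
    have key : ∀ v ∈ V, ∑ s : V, ind v s = 1 := by
      intro v hv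
      rw [Finset.sum_eq_single ⟨v, hv⟩]
      · simp [ind]
      · intro s _ hs
        simp only [ind]
        rw [if_neg fun h => hs (Subtype.ext h.symm)]
      · simp
    rw [key _ (hA _ a.2).2.2.1, key _ (hA _ a.2).2.1, sub_self, zero_mul]
  have h1 := LinearMap.finrank_range_add_finrank_ker dv
  have h2 := Module.Dual.finrank_ker_add_one_of_ne_zero htot
  have h3 := Submodule.finrank_mono hrange
  rw [Module.finrank_fintype_fun_eq_card, Fintype.card_coe] at h1 h2
  -- An arc `(r, s)` contributes `+1` at `(r, σ s)` and `-1` at `(r, σ r)`. Row sums then vanish,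
  -- and column sums vanish for circulations, so a circulation yields a direction of the face.
  let Φ : (A → ℝ) →ₗ[ℝ] Matrix (Fin n) (Fin n) ℝ :=
    ∑ a : A, (LinearMap.proj a).smulRight
      (Matrix.of fun i j => ind a.1.1 i * (ind (σ a.1.2) j - ind (σ a.1.1) j))
  have hΦ : ∀ g i j, Φ g i j =
      ∑ a : A, g a * (ind a.1.1 i * (ind (σ a.1.2) j - ind (σ a.1.1) j)) := by
    intro g i j
    simp only [Φ, LinearMap.sum_apply, Matrix.sum_apply, LinearMap.smulRight_apply,
      LinearMap.proj_apply, Matrix.smul_apply, Matrix.of_apply, smul_eq_mul]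
  have hone : ∀ v : Fin n, ∑ j, ind v j = 1 := fun v => by simp [ind]
  have hmem : ∀ g ∈ LinearMap.ker dv, Φ g ∈ vectorSpan ℝ W := by
    intro g hg
    refine hW.mem_vectorSpan ⟨_, hσ⟩ (fun i => ?_) (fun j => ?_) fun i j hij => ?_
    · simp only [hΦ]
      rw [Finset.sum_comm]
      refine Finset.sum_eq_zero fun a _ => ?_
      rw [← Finset.mul_sum, ← Finset.mul_sum, Finset.sum_sub_distrib, hone, hone, sub_self,
        mul_zero, mul_zero]
    · simp only [hΦ]
      rw [Finset.sum_comm]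
      have : ∀ a : A, ∑ i, g a * (ind a.1.1 i * (ind (σ a.1.2) j - ind (σ a.1.1) j)) =
          (ind a.1.2 (σ.symm j) - ind a.1.1 (σ.symm j)) * g a := by
        intro a
        rw [← Finset.mul_sum, ← Finset.sum_mul, hone, one_mul, mul_comm]
        simp only [ind, ← Equiv.eq_symm_apply]
      rw [Finset.sum_congr rfl fun a _ => this a]
      by_cases hj : σ.symm j ∈ V
      · rw [← hdv g ⟨σ.symm j, hj⟩, LinearMap.mem_ker.1 hg]
        rfl
      · refine Finset.sum_eq_zero fun a _ => ?_
        have h1 : a.1.2 ≠ σ.symm j := fun h => hj (h ▸ (hA _ a.2).2.2.1)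
        have h2 : a.1.1 ≠ σ.symm j := fun h => hj (h ▸ (hA _ a.2).2.1)
        simp [ind, h1, h2]
    · rw [hΦ] at hij
      obtain ⟨a, -, ha⟩ := Finset.exists_ne_zero_of_sum_ne_zero hij
      have hi : a.1.1 = i := by
        by_contra h
        simp [ind, h] at ha
      subst hi
      by_cases hj : σ a.1.2 = j
      · subst hj
        exact (hA _ a.2).2.2.2
      · have hj' : σ a.1.1 = j := by
          by_contra h
          simp [ind, h, hj] at ha
        subst hj'
        exact ⟨_, hσ, by rw [permMat_apply_self]; norm_num⟩
  -- There are no loops, so the entry at `(r, σ s)` involves only the arc `(r, s)` and recovers its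
  -- flow.
  have hinj : Function.Injective Φ := by
    rw [← LinearMap.ker_eq_bot, eq_bot_iff]
    intro g hg
    rw [Submodule.mem_bot]
    funext a
    have h : Φ g a.1.1 (σ a.1.2) = 0 := by rw [LinearMap.mem_ker.1 hg]; rfl
    rw [hΦ, Finset.sum_eq_single a] at h
    · have hne : σ a.1.1 ≠ σ a.1.2 := fun h => (hA _ a.2).1 (σ.injective h)
      simpa [ind, hne] using h
    · intro b _ hb
      by_cases h1 : b.1.1 = a.1.1
      · have h2 : b.1.2 ≠ a.1.2 := fun h => hb (Subtype.ext (Prod.ext h1 h))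
        have h3 : b.1.1 ≠ a.1.2 := fun h => (hA _ a.2).1 (h1.symm.trans h)
        simp [ind, h2, h3]
      · simp [ind, h1]
    · simp
  have h4 : Module.finrank ℝ (LinearMap.ker dv) ≤ Module.finrank ℝ (vectorSpan ℝ W) :=
    LinearMap.finrank_le_finrank_of_injective
      (f := (Φ.comp (LinearMap.ker dv).subtype).codRestrict (vectorSpan ℝ W)
        fun g => hmem g.1 g.2)
      (fun x y hxy => Subtype.ext (hinj (congrArg Subtype.val hxy)))
  omega

/-- Two permutations whose matrices add up to `σ` plus another permutation matrix do not both move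
away from `σ`. -/
theorem apply_eq_or_of_add_eq {σ τ π ρ : Equiv.Perm (Fin n)}
    (h : permMat τ + permMat π = permMat σ + permMat ρ) (i : Fin n) : τ i = σ i ∨ π i = σ i := by
  by_contra! hcon
  have := congrFun (congrFun h i) (σ i)
  simp only [Matrix.add_apply, permMat_apply_self, permMat_apply_eq_zero hcon.1,
    permMat_apply_eq_zero hcon.2] at this
  have h0 := permMat_apply_nonneg ρ i (σ i)
  linarith

/-- In the digraph taken at vertex `0`, every node moved by some vertex of the face has an outgoing
arc. The missing medians of `0` with the pairs `{1,2}`, `{1,3}`, `{2,5}`, `{3,5}` give rows with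
three different values, hence nodes with two outgoing arcs. Four such nodes make the number of arcs
at least the number of nodes plus four, whereas dimension four allows at most three more arcs than
nodes. -/
theorem IsFaceVertices.not_fits_dualW
    (hW : IsFaceVertices (⊤ : Subgroup (Equiv.Perm (Fin n))) W) : ¬ modelDualW.Fits W := by
  intro hfit
  have hM : modelDualW.Balanced = true := by decide +kernel
  have hu : modelDualW.HasUnits = true := by decide +kernel
  have hdim := hfit.dim_eq hM hu
  rw [dim_convexHull] at hdim
  obtain ⟨p, q, hd, rfl⟩ := hfit
  have hmem : ∀ i < 7, modelDualW.point p i ∈ modelDualW.points p := fun i hi =>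
    Model.mem_points_iff.2 ⟨i, hi, rfl⟩
  choose! π hπ using fun i (hi : i < 7) => hW.exists_perm (hmem i hi)
  have hπW : ∀ i < 7, permMat (π i) ∈ modelDualW.points p := fun i hi => by
    rw [hπ i hi]; exact hmem i hi
  have htriple : ∀ i j, i < 7 → j < 7 → modelDualW.medianFree 0 i j = true →
      ∃ r, π i r ≠ π 0 r ∧ π j r ≠ π 0 r ∧ π i r ≠ π j r := by
    intro i j hi hj h
    by_contra! hcon
    refine Model.not_hasMedian hM hd (by decide) hi hj h ?_
    rw [← hπ 0 (by norm_num), ← hπ i hi, ← hπ j hj]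
    refine hW.hasMedian (hπW 0 (by norm_num)) (hπW i hi) (hπW j hj) fun r => ?_
    by_contra! h'
    exact h'.2.2 (hcon r h'.1 h'.2.1)
  have hdisj : ∀ i j m, i < 7 → j < 7 → m < 7 → modelDualW.rel [i, j] [0, m] = true →
      ∀ r, π i r = π 0 r ∨ π j r = π 0 r := by
    intro i j m hi hj hm h
    refine apply_eq_or_of_add_eq (ρ := π m) ?_
    have := Model.sum_point_eq p h
    simpa [hπ i hi, hπ j hj, hπ m hm, hπ 0 (by norm_num : 0 < 7)] using this
  obtain ⟨r₁, a1, b1, c1⟩ := htriple 1 2 (by norm_num) (by norm_num) (by decide +kernel)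
  obtain ⟨r₂, a2, b2, c2⟩ := htriple 1 3 (by norm_num) (by norm_num) (by decide +kernel)
  obtain ⟨r₃, a3, b3, c3⟩ := htriple 2 5 (by norm_num) (by norm_num) (by decide +kernel)
  obtain ⟨r₄, a4, b4, c4⟩ := htriple 3 5 (by norm_num) (by norm_num) (by decide +kernel)
  -- The parallelograms `2 + 3 = 0 + 4` and `1 + 5 = 0 + 6` show that `2` and `3` never both depart
  -- from `0` in the same row, nor do `1` and `5`. Any two of the four pairs are separated in this
  -- way, so the four rows are different.
  have d1 := hdisj 2 3 4 (by norm_num) (by norm_num) (by norm_num) (by decide +kernel)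
  have d2 := hdisj 1 5 6 (by norm_num) (by norm_num) (by norm_num) (by decide +kernel)
  let R : Finset (Fin n) := {r₁, r₂, r₃, r₄}
  have hR : R.card = 4 := by
    have e12 : r₁ ≠ r₂ := by rintro rfl; exact (d1 r₁).elim b1 b2
    have e13 : r₁ ≠ r₃ := by rintro rfl; exact (d2 r₁).elim a1 b3
    have e14 : r₁ ≠ r₄ := by rintro rfl; exact (d2 r₁).elim a1 b4
    have e23 : r₂ ≠ r₃ := by rintro rfl; exact (d2 r₂).elim a2 b3
    have e24 : r₂ ≠ r₄ := by rintro rfl; exact (d2 r₂).elim a2 b4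
    have e34 : r₃ ≠ r₄ := by rintro rfl; exact (d1 r₃).elim a3 a4
    simp [R, e12, e13, e14, e23, e24, e34]
  have hR2 : ∀ r ∈ R, ∃ i < 7, ∃ j < 7, π i r ≠ π 0 r ∧ π j r ≠ π 0 r ∧ π i r ≠ π j r := by
    intro r hr
    simp only [R, Finset.mem_insert, Finset.mem_singleton] at hr
    rcases hr with rfl | rfl | rfl | rfl
    · exact ⟨1, by norm_num, 2, by norm_num, a1, b1, c1⟩
    · exact ⟨1, by norm_num, 3, by norm_num, a2, b2, c2⟩
    · exact ⟨2, by norm_num, 5, by norm_num, a3, b3, c3⟩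
    · exact ⟨3, by norm_num, 5, by norm_num, a4, b4, c4⟩
  obtain ⟨V, hV⟩ : ∃ V : Finset (Fin n), ∀ r, r ∈ V ↔ ∃ i < 7, π i r ≠ π 0 r :=
    ⟨(Set.toFinite {r | ∃ i < 7, π i r ≠ π 0 r}).toFinset, by simp⟩
  obtain ⟨A, hA⟩ : ∃ A : Finset (Fin n × Fin n), ∀ a, a ∈ A ↔
      a.1 ≠ a.2 ∧ ∃ i < 7, π i a.1 = π 0 a.2 :=
    ⟨(Set.toFinite {a : Fin n × Fin n | a.1 ≠ a.2 ∧ ∃ i < 7, π i a.1 = π 0 a.2}).toFinset,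
      by simp⟩
  have harc : ∀ i < 7, ∀ r, π i r ≠ π 0 r → (r, (π 0).symm (π i r)) ∈ A := by
    intro i hi r h
    refine (hA _).2 ⟨?_, i, hi, by simp⟩
    intro h'
    dsimp only at h'
    exact h (by rw [Equiv.eq_symm_apply] at h'; exact h'.symm)
  have hRV : R ⊆ V := by
    intro r hr
    obtain ⟨i, hi, -, -, h, -⟩ := hR2 r hr
    exact (hV r).2 ⟨i, hi, h⟩
  have hAV : ∀ a ∈ A, a.1 ≠ a.2 ∧ a.1 ∈ V ∧ a.2 ∈ V ∧
      ∃ w ∈ modelDualW.points p, w a.1 (π 0 a.2) ≠ 0 := by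
    intro a ha
    obtain ⟨hne, i, hi, h⟩ := (hA a).1 ha
    refine ⟨hne, (hV _).2 ⟨i, hi, ?_⟩,
      (hV _).2 ⟨i, hi, ?_⟩, _, hπW i hi, ?_⟩
    · rw [h]; exact fun h' => hne ((π 0).injective h').symm
    · rw [← h]; exact fun h' => hne ((π i).injective h').symm
    · rw [← h, permMat_apply_self]; norm_num
  have hmain := hW.card_arcs_le (hπW 0 (by norm_num))
    (V := V) ⟨r₁, hRV (by simp [R])⟩ hAV
  rw [hdim] at hmain
  -- Arcs are counted by their initial nodes: at least one for each node, at least two for the four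
  -- special ones.
  have hcard : V.card + 4 ≤ A.card := by
    rw [Finset.card_eq_sum_card_fiberwise (f := Prod.fst) (s := A) (t := V)
      fun a ha => (hAV a ha).2.1]
    have : V.card + 4 = ∑ r ∈ V, (1 + if r ∈ R then 1 else 0) := by
      rw [Finset.sum_add_distrib, Finset.sum_ite_mem, Finset.inter_eq_right.2 hRV]
      simp [hR]
    rw [this]
    refine Finset.sum_le_sum fun r hr => ?_
    split_ifs with h
    · obtain ⟨i, hi, j, hj, h1, h2, h3⟩ := hR2 r h
      refine Finset.one_lt_card.2 ⟨_, Finset.mem_filter.2 ⟨harc i hi r h1, rfl⟩, _,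
        Finset.mem_filter.2 ⟨harc j hj r h2, rfl⟩, fun h' => h3 ?_⟩
      exact (π 0).symm.injective (congrArg Prod.snd h')
    · obtain ⟨i, hi, h1⟩ := (hV r).1 hr
      exact Finset.card_pos.2 ⟨_, Finset.mem_filter.2 ⟨harc i hi r h1, rfl⟩⟩
  have : modelDualW.k - 1 = 4 := rfl
  omega

end BirkhoffFaces

/-! ### Exclusion of the types that are not Birkhoff faces -/

section BirkhoffFaces

variable {n : ℕ} {W : Set (Matrix (Fin n) (Fin n) ℝ)}

/-- The three diagonals share a midpoint, so the four vertices off the diagonal `{2, 3}` add up to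
twice its ends. The facet `{0, 1, 2}` has no median, as an edge midpoint is not the midpoint of
another pair of vertices. -/
theorem IsFaceVertices.ne_octahedron
    (hW : IsFaceVertices (⊤ : Subgroup (Equiv.Perm (Fin n))) W) {τ : FaceType3}
    (h : τ.model.Fits W) : τ ≠ .octahedron := by
  rintro rfl
  exact hW.not_fits_of_medianViolation (M := modelOctahedron) (A := [0, 1, 4, 5]) (v := 2) (a := 2)
    (w := 3) (b := 2) (u₁ := 0) (u₂ := 1) (by decide +kernel) (by decide +kernel) h

/-- Eight of the excluded types contain three pairs of vertices with a common midpoint and are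
excluded as the octahedron is. For `Q₁` the relation `2·1 + 2 + 6 = 2·0 + 5 + 3` between vertex
numbers puts vertex `1` into the support of `0`, `5`, `3`, but the remainder is not a sum of two
vertices. -/
theorem IsFaceVertices.mem_birkhoffTypes4
    (hW : IsFaceVertices (⊤ : Subgroup (Equiv.Perm (Fin n))) W) {τ : FaceType4}
    (h : τ.model.Fits W) : τ ∈ birkhoffTypes4 := by
  cases τ
  case crossPolytope =>
    exact absurd h (hW.not_fits_of_medianViolation (M := modelCrossPolytope4) (A := [0, 1, 6, 7])
      (v := 2) (a := 2) (w := 5) (b := 2) (u₁ := 0) (u₂ := 1) (by decide +kernel)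
      (by decide +kernel))
  case prismOctahedron =>
    exact absurd h (hW.not_fits_of_medianViolation (M := modelPrismOctahedron) (A := [0, 2, 8, 10])
      (v := 4) (a := 2) (w := 6) (b := 2) (u₁ := 0) (u₂ := 8) (by decide +kernel)
      (by decide +kernel))
  case pyramidOctahedron =>
    exact absurd h (hW.not_fits_of_medianViolation (M := modelPyramidOctahedron) (A := [0, 1, 4, 5])
      (v := 2) (a := 2) (w := 3) (b := 2) (u₁ := 0) (u₂ := 1) (by decide +kernel)
      (by decide +kernel))
  case bipyramidCube =>
    exact absurd h (hW.not_fits_of_medianViolation (M := modelBipyramidCube) (A := [0, 1, 8, 9])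
      (v := 2) (a := 2) (w := 7) (b := 2) (u₁ := 0) (u₂ := 1) (by decide +kernel)
      (by decide +kernel))
  case wedgeOctahedron =>
    exact absurd h (hW.not_fits_of_medianViolation (M := modelWedgeOctahedron) (A := [0, 1, 4, 5])
      (v := 2) (a := 2) (w := 3) (b := 2) (u₁ := 0) (u₂ := 1) (by decide +kernel)
      (by decide +kernel))
  case dualW => exact absurd h hW.not_fits_dualW
  case hypersimplex =>
    exact absurd h (hW.not_fits_of_medianViolation (M := modelHypersimplex) (A := [0, 1, 4, 5])
      (v := 2) (a := 2) (w := 3) (b := 2) (u₁ := 0) (u₂ := 1) (by decide +kernel)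
      (by decide +kernel))
  case specialP =>
    exact absurd h (hW.not_fits_of_medianViolation (M := modelSpecialP) (A := [0, 1, 6, 7])
      (v := 4) (a := 2) (w := 5) (b := 2) (u₁ := 0) (u₂ := 1) (by decide +kernel)
      (by decide +kernel))
  case specialQ1 =>
    exact absurd h (hW.not_fits_of_tripleViolation (M := modelSpecialQ1) (A := [1, 1, 2, 6])
      (a := 0) (x := 2) (b := 5) (y := 1) (c := 3) (z := 1) (d := 1) (by decide +kernel)
      (by decide +kernel))
  case specialQ2 =>
    exact absurd h (hW.not_fits_of_medianViolation (M := modelSpecialQ2) (A := [0, 1, 4, 5])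
      (v := 2) (a := 2) (w := 3) (b := 2) (u₁ := 0) (u₂ := 1) (by decide +kernel)
      (by decide +kernel))
  all_goals simp [birkhoffTypes4]

theorem ne_octahedron_of_isExposed {F : Set (Matrix (Fin n) (Fin n) ℝ)}
    (hF : IsExposed ℝ (birkhoff n) F) (hdim : dim F = 3) {τ : FaceType3} (hτ : τ.IsTypeOf F) :
    τ ≠ .octahedron := by
  obtain ⟨W, hW, rfl, σ, hσ⟩ := exists_fits3 hF hdim
  have h := σ.isTypeOf_of_realizes ⟨W, hσ, rfl⟩
  rw [(σ.isTypeOf_iff_eq h τ).1 hτ]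
  exact hW.ne_octahedron hσ

theorem mem_birkhoffTypes4_of_isExposed {F : Set (Matrix (Fin n) (Fin n) ℝ)}
    (hF : IsExposed ℝ (birkhoff n) F) (hdim : dim F = 4) {τ : FaceType4} (hτ : τ.IsTypeOf F) :
    τ ∈ birkhoffTypes4 := by
  obtain ⟨W, hW, rfl, ⟨σ, hσ⟩ | h⟩ := exists_fits4 hF hdim
  · have h := σ.isTypeOf_of_realizes ⟨W, hσ, rfl⟩
    rw [(σ.isTypeOf_iff_eq h τ).1 hτ]
    exact hW.mem_birkhoffTypes4 hσ
  · rw [(FaceType4.isTypeOf_iff_eq h τ).1 hτ]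
    simp [birkhoffTypes4]

end BirkhoffFaces

/-! ### Realization of all types by 0/1-polytopes, and the assembly of the theorem -/

/-- The binary digits of a number below `16`, as coordinates of a vertex of the `4`-cube. -/
def bits (c : ℕ) : List ℤ := (List.range 4).map fun i => if c.testBit i then 1 else 0

theorem FaceType4.exists_zeroOne_of_fitsCheck (τ : FaceType4) {C B : List ℕ} {A : List (List ℤ)}
    {N : ℤ} (h : fitsCheck 4 τ.model (C.map bits) (B.map bits) A N = true) :
    ∃ V : Set (Fin 4 → ℝ), (∀ v ∈ V, ∀ i, v i = 0 ∨ v i = 1) ∧ τ.model.Realizes (convexHull ℝ V) := by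
  refine ⟨decSet (Fin 4 → ℝ) (C.map bits), ?_, _, fits_of_fitsCheck (Fin 4 → ℝ) h, rfl⟩
  rintro _ ⟨p, hp, rfl⟩ i
  obtain ⟨c, -, rfl⟩ := List.mem_map.1 hp
  have h : (dec (bits c) : Fin 4 → ℝ) i = (((bits c).getD i 0 : ℤ) : ℝ) := rfl
  rw [h]
  have : (bits c).getD i 0 = if c.testBit i then 1 else 0 := by
    simp [bits, List.getD_eq_getElem?_getD, i.2]
  rw [this]
  split_ifs <;> simp

/-- Every type is the type of a `0/1`-polytope. -/
theorem FaceType4.exists_zeroOne (τ : FaceType4) :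
    ∃ V : Set (Fin 4 → ℝ), (∀ v ∈ V, ∀ i, v i = 0 ∨ v i = 1) ∧
      τ.model.Realizes (convexHull ℝ V) := by
  cases τ
  case simplex =>
    exact FaceType4.exists_zeroOne_of_fitsCheck .simplex
      (C := [0, 1, 2, 4, 8])
      (B := [0, 1, 2, 4, 8])
      (A := [[-1, -1, -1, -1, 1], [1, 0, 0, 0, 0], [0, 1, 0, 0, 0], [0, 0, 1, 0, 0], [0, 0, 0, 1, 0]])
      (N := 1) (by decide +kernel)
  case pyramidSquarePyramid =>
    exact FaceType4.exists_zeroOne_of_fitsCheck .pyramidSquarePyramid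
      (C := [0, 1, 2, 3, 4, 8])
      (B := [0, 1, 2, 4, 8])
      (A := [[-1, -1, -1, -1, 1], [1, 0, 0, 0, 0], [0, 1, 0, 0, 0], [0, 0, 1, 0, 0], [0, 0, 0, 1, 0]])
      (N := 1) (by decide +kernel)
  case birkhoff3 =>
    exact FaceType4.exists_zeroOne_of_fitsCheck .birkhoff3
      (C := [1, 2, 4, 6, 8, 9])
      (B := [1, 2, 4, 6, 8])
      (A := [[1, 0, 0, 0, 0], [-1, 0, -1, -1, 1], [-1, -1, 0, -1, 1], [1, 1, 1, 1, -1], [0, 0, 0, 1,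
        0]])
      (N := 1) (by decide +kernel)
  case pyramidTriangularPrism =>
    exact FaceType4.exists_zeroOne_of_fitsCheck .pyramidTriangularPrism
      (C := [0, 1, 2, 3, 4, 5, 8])
      (B := [0, 1, 2, 4, 8])
      (A := [[-1, -1, -1, -1, 1], [1, 0, 0, 0, 0], [0, 1, 0, 0, 0], [0, 0, 1, 0, 0], [0, 0, 0, 1, 0]])
      (N := 1) (by decide +kernel)
  case wedgeW =>
    exact FaceType4.exists_zeroOne_of_fitsCheck .wedgeW
      (C := [0, 1, 2, 3, 4, 6, 8, 9])
      (B := [0, 1, 2, 4, 8])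
      (A := [[-1, -1, -1, -1, 1], [1, 0, 0, 0, 0], [0, 1, 0, 0, 0], [0, 0, 1, 0, 0], [0, 0, 0, 1, 0]])
      (N := 1) (by decide +kernel)
  case pyramidCube =>
    exact FaceType4.exists_zeroOne_of_fitsCheck .pyramidCube
      (C := [0, 1, 2, 3, 4, 5, 6, 7, 8])
      (B := [0, 1, 2, 5, 8])
      (A := [[-1, -1, 0, -1, 1], [1, 0, -1, 0, 0], [0, 1, 0, 0, 0], [0, 0, 1, 0, 0], [0, 0, 0, 1, 0]])
      (N := 1) (by decide +kernel)
  case prismTetrahedron =>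
    exact FaceType4.exists_zeroOne_of_fitsCheck .prismTetrahedron
      (C := [0, 1, 2, 3, 4, 5, 8, 9])
      (B := [0, 1, 2, 4, 8])
      (A := [[-1, -1, -1, -1, 1], [1, 0, 0, 0, 0], [0, 1, 0, 0, 0], [0, 0, 1, 0, 0], [0, 0, 0, 1, 0]])
      (N := 1) (by decide +kernel)
  case productTriangles =>
    exact FaceType4.exists_zeroOne_of_fitsCheck .productTriangles
      (C := [0, 1, 2, 4, 5, 6, 8, 9, 10])
      (B := [0, 1, 2, 4, 8])
      (A := [[-1, -1, -1, -1, 1], [1, 0, 0, 0, 0], [0, 1, 0, 0, 0], [0, 0, 1, 0, 0], [0, 0, 0, 1, 0]])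
      (N := 1) (by decide +kernel)
  case prismSquarePyramid =>
    exact FaceType4.exists_zeroOne_of_fitsCheck .prismSquarePyramid
      (C := [0, 1, 2, 3, 4, 5, 6, 7, 8, 9])
      (B := [0, 1, 2, 5, 8])
      (A := [[-1, -1, 0, -1, 1], [1, 0, -1, 0, 0], [0, 1, 0, 0, 0], [0, 0, 1, 0, 0], [0, 0, 0, 1, 0]])
      (N := 1) (by decide +kernel)
  case productTriangleSquare =>
    exact FaceType4.exists_zeroOne_of_fitsCheck .productTriangleSquare
      (C := [0, 1, 2, 3, 4, 5, 6, 7, 8, 9, 10, 11])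
      (B := [0, 1, 2, 5, 9])
      (A := [[-1, -1, 0, 0, 1], [1, 0, -1, -1, 0], [0, 1, 0, 0, 0], [0, 0, 1, 0, 0], [0, 0, 0, 1, 0]])
      (N := 1) (by decide +kernel)
  case cube =>
    exact FaceType4.exists_zeroOne_of_fitsCheck .cube
      (C := [0, 1, 2, 3, 4, 5, 6, 7, 8, 9, 10, 11, 12, 13, 14, 15])
      (B := [0, 1, 2, 5, 10])
      (A := [[-1, -1, 0, 0, 1], [1, 0, -1, 0, 0], [0, 1, 0, -1, 0], [0, 0, 1, 0, 0], [0, 0, 0, 1, 0]])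
      (N := 1) (by decide +kernel)
  case crossPolytope =>
    exact FaceType4.exists_zeroOne_of_fitsCheck .crossPolytope
      (C := [3, 5, 6, 7, 8, 9, 10, 12])
      (B := [3, 5, 6, 7, 8])
      (A := [[0, 0, -1, -1, 1], [0, -1, 0, -1, 1], [-1, 0, 0, -1, 1], [1, 1, 1, 2, -2], [0, 0, 0, 1,
        0]])
      (N := 1) (by decide +kernel)
  case prismOctahedron =>
    exact FaceType4.exists_zeroOne_of_fitsCheck .prismOctahedron
      (C := [2, 3, 4, 5, 6, 7, 8, 9, 10, 11, 12, 13])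
      (B := [2, 3, 4, 6, 12])
      (A := [[-1, 0, -1, 0, 1], [1, 0, 0, 0, 0], [0, -1, 0, -1, 1], [0, 1, 1, 0, -1], [0, 0, 0, 1, 0]])
      (N := 1) (by decide +kernel)
  case pyramidOctahedron =>
    exact FaceType4.exists_zeroOne_of_fitsCheck .pyramidOctahedron
      (C := [1, 2, 3, 4, 5, 6, 8])
      (B := [1, 2, 3, 4, 8])
      (A := [[0, -1, -1, -1, 1], [-1, 0, -1, -1, 1], [1, 1, 1, 1, -1], [0, 0, 1, 0, 0], [0, 0, 0, 1,
        0]])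
      (N := 1) (by decide +kernel)
  case bipyramidCube =>
    exact FaceType4.exists_zeroOne_of_fitsCheck .bipyramidCube
      (C := [3, 4, 5, 6, 7, 8, 9, 10, 11, 12])
      (B := [3, 4, 5, 6, 9])
      (A := [[0, 0, -1, -1, 1], [-1, -1, -1, -1, 2], [1, 0, 1, 0, -1], [0, 1, 1, 1, -1], [0, 0, 0, 1,
        0]])
      (N := 1) (by decide +kernel)
  case wedgeOctahedron =>
    exact FaceType4.exists_zeroOne_of_fitsCheck .wedgeOctahedron
      (C := [1, 2, 3, 4, 5, 6, 8, 9, 10])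
      (B := [1, 2, 3, 4, 8])
      (A := [[0, -1, -1, -1, 1], [-1, 0, -1, -1, 1], [1, 1, 1, 1, -1], [0, 0, 1, 0, 0], [0, 0, 0, 1,
        0]])
      (N := 1) (by decide +kernel)
  case dualW =>
    exact FaceType4.exists_zeroOne_of_fitsCheck .dualW
      (C := [0, 1, 2, 4, 6, 8, 9])
      (B := [0, 1, 2, 4, 8])
      (A := [[-1, -1, -1, -1, 1], [1, 0, 0, 0, 0], [0, 1, 0, 0, 0], [0, 0, 1, 0, 0], [0, 0, 0, 1, 0]])
      (N := 1) (by decide +kernel)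
  case hypersimplex =>
    exact FaceType4.exists_zeroOne_of_fitsCheck .hypersimplex
      (C := [1, 2, 3, 4, 5, 6, 8, 9, 10, 12])
      (B := [1, 2, 3, 4, 9])
      (A := [[0, -1, -1, -1, 1], [-1, 0, -1, 0, 1], [1, 1, 1, 0, -1], [0, 0, 1, 0, 0], [0, 0, 0, 1,
        0]])
      (N := 1) (by decide +kernel)
  case specialP =>
    exact FaceType4.exists_zeroOne_of_fitsCheck .specialP
      (C := [2, 3, 8, 9, 1, 6, 4, 5])
      (B := [2, 3, 8, 1, 6])
      (A := [[-1, 0, -1, -1, 1], [1, 1, 0, 1, -1], [0, 0, 0, 1, 0], [0, -1, 0, -1, 1], [0, 0, 1, 0,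
        0]])
      (N := 1) (by decide +kernel)
  case specialQ1 =>
    exact FaceType4.exists_zeroOne_of_fitsCheck .specialQ1
      (C := [0, 1, 2, 9, 10, 7, 12])
      (B := [0, 1, 2, 9, 7])
      (A := [[-1, -1, 1, 0, 1], [1, 0, -1, -1, 0], [0, 1, -1, 0, 0], [0, 0, 0, 1, 0], [0, 0, 1, 0, 0]])
      (N := 1) (by decide +kernel)
  case specialQ2 =>
    exact FaceType4.exists_zeroOne_of_fitsCheck .specialQ2
      (C := [0, 1, 2, 5, 6, 7, 11, 12])
      (B := [0, 1, 2, 5, 11])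
      (A := [[-1, -1, 0, 1, 1], [1, 0, -1, -1, 0], [0, 1, 0, -1, 0], [0, 0, 1, 0, 0], [0, 0, 0, 1, 0]])
      (N := 1) (by decide +kernel)

theorem FaceType2.dim_eq {E : Type*} [AddCommGroup E] [Module ℝ E] {X : Set E} (τ : FaceType2)
    (h : τ.model.Realizes X) : dim X = 2 := by
  rw [h.dim_eq τ.certified]
  cases τ <;> rfl

theorem FaceType3.dim_eq {E : Type*} [AddCommGroup E] [Module ℝ E] {X : Set E} (τ : FaceType3)
    (h : τ.model.Realizes X) : dim X = 3 := by
  rw [h.dim_eq τ.certified]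
  cases τ <;> rfl

theorem FaceType4.dim_eq {E : Type*} [AddCommGroup E] [Module ℝ E] {X : Set E} (τ : FaceType4)
    (h : τ.model.Realizes X) : dim X = 4 := by
  rw [h.dim_eq τ.certified]
  cases τ <;> rfl

theorem FaceType2.exists_birkhoff (τ : FaceType2) : ∃ (n : ℕ) (F : Set (Matrix (Fin n) (Fin n) ℝ)),
    IsExposed ℝ (birkhoff n) F ∧ τ.model.Realizes F := by
  cases τ
  · exact ⟨_, exists_birkhoff_face_triangle⟩
  · exact ⟨_, exists_birkhoff_face_square⟩

theorem FaceType3.exists_birkhoff {τ : FaceType3} (h : τ ≠ .octahedron) :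
    ∃ (n : ℕ) (F : Set (Matrix (Fin n) (Fin n) ℝ)),
      IsExposed ℝ (birkhoff n) F ∧ τ.model.Realizes F := by
  cases τ
  · exact ⟨_, exists_birkhoff_face_tetrahedron⟩
  · exact ⟨_, exists_birkhoff_face_squarePyramid⟩
  · exact ⟨_, exists_birkhoff_face_triangularPrism⟩
  · exact ⟨_, exists_birkhoff_face_cube3⟩
  · exact absurd rfl h

theorem FaceType4.exists_birkhoff {τ : FaceType4} (h : τ ∈ birkhoffTypes4) :
    ∃ (n : ℕ) (F : Set (Matrix (Fin n) (Fin n) ℝ)),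
      IsExposed ℝ (birkhoff n) F ∧ τ.model.Realizes F := by
  simp only [birkhoffTypes4, Set.mem_insert_iff, Set.mem_singleton_iff] at h
  rcases h with rfl | rfl | rfl | rfl | rfl | rfl | rfl | rfl | rfl | rfl | rfl
  · exact ⟨_, exists_birkhoff_face_simplex4⟩
  · exact ⟨_, exists_birkhoff_face_pyramidSquarePyramid⟩
  · exact ⟨_, exists_birkhoff_face_birkhoff3⟩
  · exact ⟨_, exists_birkhoff_face_pyramidTriangularPrism⟩
  · exact ⟨_, exists_birkhoff_face_wedgeW⟩
  · exact ⟨_, exists_birkhoff_face_pyramidCube⟩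
  · exact ⟨_, exists_birkhoff_face_prismTetrahedron⟩
  · exact ⟨_, exists_birkhoff_face_productTriangles⟩
  · exact ⟨_, exists_birkhoff_face_prismSquarePyramid⟩
  · exact ⟨_, exists_birkhoff_face_productTriangleSquare⟩
  · exact ⟨_, exists_birkhoff_face_cube4⟩

theorem FaceType4.exists_permPolytope {τ : FaceType4} (h : τ ∈ furtherTypes4) :
    ∃ (n : ℕ) (G : Subgroup (Equiv.Perm (Fin n))) (F : Set (Matrix (Fin n) (Fin n) ℝ)),
      IsExposed ℝ (permPolytope G) F ∧ τ.model.Realizes F := by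
  simp only [furtherTypes4, Set.mem_insert_iff, Set.mem_singleton_iff] at h
  rcases h with rfl | rfl | rfl | rfl | rfl | rfl | rfl | rfl
  · exact exists_shift_face_crossPolytope4
  · exact exists_shift_face_prismOctahedron
  · exact exists_shift_face_pyramidOctahedron
  · exact exists_shift_face_bipyramidCube
  · exact exists_shift_face_wedgeOctahedron
  · exact exists_shift_face_dualW
  · exact exists_shift_face_hypersimplex
  · exact exists_shift_face_specialP

theorem FaceType3.exists_permPolytope (τ : FaceType3) :
    ∃ (n : ℕ) (G : Subgroup (Equiv.Perm (Fin n))) (F : Set (Matrix (Fin n) (Fin n) ℝ)),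
      IsExposed ℝ (permPolytope G) F ∧ τ.model.Realizes F := by
  by_cases h : τ = .octahedron
  · subst h
    exact exists_shift_face_octahedron
  · obtain ⟨n, h⟩ := FaceType3.exists_birkhoff h
    exact ⟨n, ⊤, h⟩

end PermutationPolytope

open PermutationPolytope in
theorem mainTheorem3 :
    -- dimension 2: the types of faces are exactly triangle and square, all Birkhoff faces
    ((∀ (n : ℕ) (G : Subgroup (Equiv.Perm (Fin n))) (F : Set (Matrix (Fin n) (Fin n) ℝ)),
        IsExposed ℝ (permPolytope G) F → dim F = 2 → ∃! τ : FaceType2, τ.IsTypeOf F) ∧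
      Nat.card FaceType2 = 2 ∧
      (∀ τ : FaceType2, ∃ (n : ℕ) (F : Set (Matrix (Fin n) (Fin n) ℝ)),
        IsExposed ℝ (birkhoff n) F ∧ dim F = 2 ∧ τ.IsTypeOf F)) ∧
    -- dimension 3: exactly five types of faces, exactly the first four being Birkhoff faces
    ((∀ (n : ℕ) (G : Subgroup (Equiv.Perm (Fin n))) (F : Set (Matrix (Fin n) (Fin n) ℝ)),
        IsExposed ℝ (permPolytope G) F → dim F = 3 → ∃! τ : FaceType3, τ.IsTypeOf F) ∧
      Nat.card FaceType3 = 5 ∧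
      (∀ τ : FaceType3, ∃ (n : ℕ) (G : Subgroup (Equiv.Perm (Fin n)))
        (F : Set (Matrix (Fin n) (Fin n) ℝ)),
        IsExposed ℝ (permPolytope G) F ∧ dim F = 3 ∧ τ.IsTypeOf F) ∧
      (∀ τ : FaceType3, (∃ (n : ℕ) (F : Set (Matrix (Fin n) (Fin n) ℝ)),
        IsExposed ℝ (birkhoff n) F ∧ dim F = 3 ∧ τ.IsTypeOf F) ↔ τ ≠ FaceType3.octahedron)) ∧
    -- dimension 4: every face has one of 21 pairwise different types of 0/1-polytopes;
    -- exactly 11 of them are Birkhoff faces, and 8 more are faces of permutation polytopes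
    ((∀ (n : ℕ) (G : Subgroup (Equiv.Perm (Fin n))) (F : Set (Matrix (Fin n) (Fin n) ℝ)),
        IsExposed ℝ (permPolytope G) F → dim F = 4 → ∃! τ : FaceType4, τ.IsTypeOf F) ∧
      Nat.card FaceType4 = 21 ∧
      (∀ τ : FaceType4, ∃ V : Set (Fin 4 → ℝ), (∀ v ∈ V, ∀ i, v i = 0 ∨ v i = 1) ∧
        dim (convexHull ℝ V) = 4 ∧ ∀ σ : FaceType4, σ.IsTypeOf (convexHull ℝ V) ↔ σ = τ) ∧
      (birkhoffTypes4.ncard = 11 ∧ furtherTypes4.ncard = 8 ∧ openTypes4.ncard = 2 ∧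
        birkhoffTypes4 ∪ furtherTypes4 ∪ openTypes4 = Set.univ) ∧
      (∀ τ : FaceType4, (∃ (n : ℕ) (F : Set (Matrix (Fin n) (Fin n) ℝ)),
        IsExposed ℝ (birkhoff n) F ∧ dim F = 4 ∧ τ.IsTypeOf F) ↔ τ ∈ birkhoffTypes4) ∧
      (∀ τ ∈ furtherTypes4, ∃ (n : ℕ) (G : Subgroup (Equiv.Perm (Fin n)))
        (F : Set (Matrix (Fin n) (Fin n) ℝ)),
        IsExposed ℝ (permPolytope G) F ∧ dim F = 4 ∧ τ.IsTypeOf F) ∧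
      CombEquiv (birkhoff 3) (freeSum centeredTriangle centeredTriangle)) := by
  refine ⟨⟨fun n G F hF hdim => FaceType2.existsUnique (exists_isTypeOf2 hF hdim),
      FaceType2.card_eq, fun τ => ?_⟩,
    ⟨fun n G F hF hdim => FaceType3.existsUnique (exists_isTypeOf3 hF hdim),
      FaceType3.card_eq, fun τ => ?_, fun τ => ⟨?_, fun hτ => ?_⟩⟩,
    ⟨fun n G F hF hdim => FaceType4.existsUnique (exists_isTypeOf4 hF hdim),
      FaceType4.card_eq, fun τ => ?_,
      ⟨ncard_birkhoffTypes4, ncard_furtherTypes4, ncard_openTypes4, types4_union⟩,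
      fun τ => ⟨?_, fun hτ => ?_⟩, fun τ hτ => ?_, combEquiv_birkhoff_freeSum⟩⟩
  · obtain ⟨n, F, hF, h⟩ := τ.exists_birkhoff
    exact ⟨n, F, hF, τ.dim_eq h, τ.isTypeOf_of_realizes h⟩
  · obtain ⟨n, G, F, hF, h⟩ := τ.exists_permPolytope
    exact ⟨n, G, F, hF, τ.dim_eq h, τ.isTypeOf_of_realizes h⟩
  · rintro ⟨n, F, hF, hdim, h⟩
    exact ne_octahedron_of_isExposed hF hdim h
  · obtain ⟨n, F, hF, h⟩ := FaceType3.exists_birkhoff hτ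
    exact ⟨n, F, hF, τ.dim_eq h, τ.isTypeOf_of_realizes h⟩
  · obtain ⟨V, hV, h⟩ := τ.exists_zeroOne
    exact ⟨V, hV, τ.dim_eq h, FaceType4.isTypeOf_iff_eq (τ.isTypeOf_of_realizes h)⟩
  · rintro ⟨n, F, hF, hdim, h⟩
    exact mem_birkhoffTypes4_of_isExposed hF hdim h
  · obtain ⟨n, F, hF, h⟩ := FaceType4.exists_birkhoff hτ
    exact ⟨n, F, hF, τ.dim_eq h, τ.isTypeOf_of_realizes h⟩
  · obtain ⟨n, G, F, hF, h⟩ := FaceType4.exists_permPolytope hτ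
    exact ⟨n, G, F, hF, τ.dim_eq h, τ.isTypeOf_of_realizes h⟩
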